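/- **Setting.** Logarithms are to base 2. Let $H$ be a finite directed graph with real edge weights and no negative cycle, $\eta=|V(H)|$, and let $G_0$ be its *well-behaved graph*: for every $a\in V(H)$ it has a *negative vertex* $r=r_a$ and a copy $\bar r=\bar r_a$ (so $n_0:=|V(G_0)|=2\eta$), and, with $m_a=\min(0,\min_{(a,c)\in E(H)}w_H(a,c))$, edges $r_a\to\bar r_a$ of weight $m_a$, $\bar r_a\to r_a$ of weight $-m_a$, and $\bar r_a\to r_c$ of weight $w_H(a,c)-m_a$ for $(a,c)\in E(H)$. $N$ is the set of negative vertices. Adding a parallel edge keeps the smaller weight. A *hop* of a walk is an edge of negative weight or an edge $(r,\bar r)$, $r\in N$; $d^k(x,y)$ is the least weight of a walk from $x$ to $y$ with at most $k$ hops. All vertices of $G_0$ are *level* $0$ and *heavy*. An "edge from $r\in N$ to $v$" may also be realised as the path $r\to\bar r\to v$. **Parameters.** Constants $c,c_L>0$ and $0<c_1\le c_2$; an integer $L\ge0$ with $L\le c_L\log n_0$; $h=L+1$; a real $\gamma$ with $c_1\log n_0\,2^{\sqrt{\log n_0}}\le\gamma\le c_2\log n_0\,2^{\sqrt{\log n_0}}$;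 $b=\eta/\gamma$; a number $K$. The *betweenness* of $(x,y)$ is the number of $r\in N$ with $d^h(x,r)+d^h(r,y)<0$. A potential $\varphi$ on the vertices is *valid* if after reweighting $w(x,y)\mapsto w(x,y)+\varphi(x)-\varphi(y)$ all edges that were nonnegative are nonnegative. A *betweenness-reduction subroutine* is a randomized map which, given the current graph on $n$ vertices, returns with probability at least $1-n^{-(c+1)}$ (provided that such a potential exists) a valid potential such that after reweighting and reinserting deferred edges (step 2 below) every pair has betweenness at most $\eta/b$. **Algorithm.** If $\eta\le100$ no iteration is made. Otherwise iterations $t=1,\dots,L$ are made; each performs the following on the current graph, with $n$ the number of its vertices at the start of the iteration and $\lambda=n/\sqrt b$. 1. Reweight the graph and the deferred edges by the potential returned by the subroutine. 2. Reinsert every deferred edge of nonnegative current weight with the procedure AddEdgeIn or AddEdgeOut below, and redirect edges from each $r\in N$ other than $(r,\bar r)$ through $\bar r$. Call the result the *base graph*. 3. For $r\in N$, compute a threshold $\Delta_r$. For each scale $l=1,\dots,\lfloor\log n\rfloor-2$, draw $\lceil K\log n\rceil$ independent random sets, each containing every vertex independently with probability $2^{-l}$ (the same sets for all $r$). Let $D^{in}_l$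 and $D^{out}_l$ be the medians over these sets $S$ of the extended distances from $S$ to $r$ and from $r$ to $S$ (minimum $h$-hop distance, ties broken by vertex index), made nondecreasing in $l$ by running maxima, and $d(\cdot)$ their distance parts. Let $\ell$ be the least scale with $d(D^{in}_\ell)+d(D^{out}_\ell)\ge0$. If there is none, $\Delta_r=d(D^{in}_m)$ for the last scale $m$. If $\ell=1$, $\Delta_r=d(D^{in}_1)$ (if this is infinite, $-d(D^{out}_1)$ if finite, and $0$ otherwise). If $\ell>1$ and $d(D^{in}_{\ell-1})<d(D^{in}_\ell)$, $\Delta_r=\min(-d(D^{out}_{\ell-1}),d(D^{in}_\ell))$; otherwise $\Delta_r=\max(-d(D^{out}_\ell),d(D^{in}_{\ell-1}))$. Put $U^{in}_r=\{v:d^0(v,r)<\Delta_r\}$, $U^{out}_r=\{v:d^1(r,v)<-\Delta_r\}$. For every $v$ let $A^{in}_v$ be the list of $u$ with a nonnegative edge $(u,v)$, sorted by nonincreasing weight, omitting the in-Steiner vertices whose in-parent is $v$ if $v$ is heavy, and omitting the out-parent of $v$; it is empty if $v$ is an in-Steiner vertex. $A^{out}_v$ is defined symmetrically. Membership and the lists'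 edge weights are those of the base graph. 4. For $r\in N$: for $\bar u\in U^{in}_r$ ($u\in N$) add $(u,\bar r)$ with weight $w(u,\bar u)+d^0(\bar u,r)+w(r,\bar r)$; for $v\in U^{out}_r\cap N$ add $(r,\bar v)$ with weight $d^1(r,v)+w(v,\bar v)$. 5. For each heavy $v$ with $A^{in}_v=(u_1,\dots,u_k)$ and each $0\le l<\lceil\log k\rceil$ create a level-$t$ *in-Steiner vertex* $v_l$ with in-parent $v$, an edge $(v_l,v)$ of weight $W=w(u_{k-2^l},v)$, edges $(u_i,v_l)$ of weight $w(u_i,v)-W$ for $i\le k-2^l$, and, if $u_i$ is an out-Steiner vertex with out-parent $p$, also $(p,v_l)$ of weight $w(p,u_i)+w(u_i,v)-W$; moreover, if $v=r\in N$, an edge $(r,v_l)$ of weight $-W$, and if $v$ is the N-Steiner vertex of $r$, an edge $(r,v_l)$ of weight $w(r,v)-W$. Symmetrically create *out-Steiner vertices* with out-parent $v$ from $A^{out}_v$ (where $\bar r$ takes the role of $r\in N$: an edge $(v_l,r)$ of weight $-w(r,\bar r)-W$, or $w(v,r)-W$ for an N-Steiner vertex $v$). 6. For each $r\in N$ create a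 heavy level-$t$ *N-Steiner vertex* $r^t$ with edges $(r^t,r)$ and $(r,r^t)$ of weights $\Delta_r$ and $-\Delta_r$. 7. For each $r\in N$ run ShortcutIn and ShortcutOut. ShortcutIn: put $d_v=d^0(v,r)$ for $v\in U^{in}_r$ and $d_v=\infty$ otherwise. For levels $t,t-1,\dots,0$ process the vertices $v$ of that level with $d_v<\infty$: if $v$ is an in-Steiner vertex with in-parent $p$, set $d_p\leftarrow\min(d_p,d_v-w(v,p))$. Otherwise: (i) if $v$ is an out-Steiner vertex with out-parent $p$ and $W=w(p,v)+d_v-\Delta_r\ge0$, call AddEdgeIn$(p,r^t,W)$; (ii) if $v$ is light, for each $u\in A^{in}_v$ with $W=w(u,v)+d_v-\Delta_r\ge0$ call AddEdgeIn$(u,r^t,W)$; (iii) if $v$ is heavy, $A^{in}_v=(u_1,\dots,u_k)$, let $i$ be the least index with $w(u_i,v)+d_v-\Delta_r<0$ ($i=k$ if there is none), $l=\lceil\log(k-i+1)\rceil$; if $l<\lceil\log k\rceil$ call AddEdgeIn$(v_l,r^t,w(v_l,v)+d_v-\Delta_r)$; and for each $u=u_j$, $j>k-2^l$: if $u$ is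 a light in-Steiner vertex with in-parent $p$ and $W=w(u,v)+d_v-w(u,p)<\Delta_r$, set $d_p\leftarrow\min(d_p,W)$; if $u$ is not a light in-Steiner vertex and $W=w(u,v)+d_v-\Delta_r\ge0$, call AddEdgeIn$(u,r^t,W)$. ShortcutOut is symmetric (reverse edges, exchange in and out, start from $d_v=d^1(r,v)$ on $U^{out}_r$, replace $\Delta_r$ by $-\Delta_r$, AddEdgeOut$(r^t,\cdot,\cdot)$). Finally, if $\Delta_r\le0$, for $v\in A^{in}_r$ call AddEdgeIn$(v,r^t,w(v,r)-\Delta_r)$, and if $\Delta_r\ge-w(r,\bar r)$, for $v\in A^{out}_{\bar r}$ call AddEdgeOut$(r^t,v,w(r,\bar r)+\Delta_r+w(\bar r,v))$. AddEdgeIn$(u,v,W)$ (with $v\in N$ or $v$ N-Steiner) adds the edge $(u,v)$ of weight $W$. Then, if $u$ is an out-Steiner vertex with out-parent $p$, it calls AddEdgeIn$(p,v,W+w(p,u))$. If $u$ is an in-Steiner vertex with in-parent $p$, put $W'=W-w(u,p)$; if $v\in N$ it calls AddEdgeIn$(p,v,W')$; if $v$ is an N-Steiner vertex of $r$ it records $(p,v,W')$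 as a deferred edge, calls AddEdgeIn$(p,v,W')$ if $W'\ge0$, and then AddEdgeIn$(p,r,W'-w(r,v))$. AddEdgeOut is symmetric. 8. For each $r\in N$ redirect its outgoing edges other than $(r,\bar r)$ to start in $\bar r$, preserving the weights of the resulting paths, and reweight by the potential with value $\min(0,\min_v w(v,r))$ at $r$ and $w(r,\bar r)-\min_v w(r,v)$ at $\bar r$ (weights before redirecting), $0$ elsewhere. 9. A level-$t$ in-Steiner (out-Steiner) vertex is declared heavy if its out-degree (in-degree) minus one is at least $\lambda$, and light otherwise. Loops over finite sets are executed in an arbitrary fixed order. Let $G_t$ be the graph after iteration $t$. **Claim.** For all $c,c_L>0$ and $0<c_1\le c_2$ there are $K_0$ and $C$ such that for all $H$, $L$, $\gamma$ as above, all $K\ge K_0$ and every betweenness-reduction subroutine, the following holds with probability at least $1-n_0^{-c}$: * in every iteration the number of heavy vertices grows by at most $C\,\eta\log n$, where $n$ is the number of vertices at the start of the iteration; * every graph $G_t$, from $G_0$ to the final one, has at most $C\,n_0\log^4n_0$ vertices. (Vertices are never deleted, so the bound holds throughout the algorithm.) -/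

import Mathlib

/-!
The shortcutting algorithm for negative-weight single-source shortest paths, written as a
probabilistic program (a `PMF`) on explicit graph states.  All loops "for every element of a finite
set" run in the order of `Finset.toList`, an unspecified enumeration; ties are broken by it too.
-/

namespace NegSSSP

noncomputable section

open scoped Classical

universe u

/-! ### Vertices -/

/-- Names of the vertices.  `neg a` is the negative vertex `a ∈ N` and `bar a` its copy in `N̄`, both
of level `0`; `inS v t l` (resp. `outS v t l`) is the `l`-th in-Steiner (resp. out-Steiner) vertex
`v_l` that iteration `t` creates for `v`, its in-parent (resp. out-parent); `hub a t` is the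
N-Steiner vertex that iteration `t` creates for its N-parent `neg a`. -/
inductive Vtx (α : Type u) : Type u
  | neg (a : α) : Vtx α
  | bar (a : α) : Vtx α
  | inS (parent : Vtx α) (t l : ℕ) : Vtx α
  | outS (parent : Vtx α) (t l : ℕ) : Vtx α
  | hub (a : α) (t : ℕ) : Vtx α

open Vtx

variable {α : Type u}

/-- The iteration in which a vertex is created. -/
def Vtx.level : Vtx α → ℕ
  | neg _ => 0
  | bar _ => 0
  | inS _ t _ => t
  | outS _ t _ => t
  | hub _ t => t

/-- The in-parent of an in-Steiner vertex. -/
def Vtx.inParent : Vtx α → Option (Vtx α)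
  | inS p _ _ => some p
  | _ => none

/-- The out-parent of an out-Steiner vertex. -/
def Vtx.outParent : Vtx α → Option (Vtx α)
  | outS p _ _ => some p
  | _ => none

/-! ### Graph states -/

/-- The current graph: vertices, edge weights (`⊤` when there is no edge), the vertices classified
as heavy (all other vertices are light), and the two sets of deferred weighted edges. -/
structure State (α : Type u) where
  verts : Finset (Vtx α)
  w : Vtx α → Vtx α → WithTop ℝ
  heavy : Finset (Vtx α)
  fIn : Finset (Vtx α × Vtx α × ℝ)
  fOut : Finset (Vtx α × Vtx α × ℝ)

namespace State

/-- The weight of an existing edge, as a real number. -/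
def wt (s : State α) (x y : Vtx α) : ℝ := (s.w x y).untopD 0

/-- The weight of the edge from the negative vertex `a` to `y`, where the length-two path
`a → ā → y` also counts as such an edge. -/
def wtNeg (s : State α) (a : α) (y : Vtx α) : ℝ :=
  (min (s.w (neg a) y) (s.w (neg a) (bar a) + s.w (bar a) y)).untopD 0

def addVertex (s : State α) (v : Vtx α) : State α :=
  { s with verts := insert v s.verts }

/-- Add the edge `(x, y)` of weight `W`; of two parallel edges the lighter one is kept. -/
def addEdge (s : State α) (x y : Vtx α) (W : ℝ) : State α :=
  { s with w := fun x' y' =>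
      if x' = x ∧ y' = y then min (s.w x' y') (W : WithTop ℝ) else s.w x' y' }

/-- Reweight all edges, and all deferred edges, by the vertex potential `φ`. -/
def reweight (s : State α) (φ : Vtx α → ℝ) : State α :=
  { s with
    w := fun x y => s.w x y + ((φ x - φ y : ℝ) : WithTop ℝ)
    fIn := s.fIn.image fun e => (e.1, e.2.1, e.2.2 + φ e.1 - φ e.2.1)
    fOut := s.fOut.image fun e => (e.1, e.2.1, e.2.2 + φ e.1 - φ e.2.1) }

/-- A vertex potential is valid if edges of nonnegative weight keep a nonnegative weight. -/
def Valid (s : State α) (φ : Vtx α → ℝ) : Prop :=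
  ∀ x y, 0 ≤ s.w x y → 0 ≤ (s.reweight φ).w x y

/-- Replace every edge `(r, y)`, `y ≠ r̄`, of the negative vertex `r = neg a` by the path
`r → r̄ → y` of the same weight. -/
def redirect (s : State α) (a : α) : State α :=
  { s with w := fun x y =>
      if x = neg a then (if y = bar a then s.w x y else ⊤)
      else if x = bar a ∧ y ≠ bar a then
        min (s.w x y) (s.w (neg a) y + ((-s.wt (neg a) (bar a) : ℝ) : WithTop ℝ))
      else s.w x y }

/-! ### Hop distances -/

/-- The edges that count as a hop: those of negative weight and the edges `(r, r̄)`. -/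
def IsHop (s : State α) (x y : Vtx α) : Prop :=
  s.w x y < 0 ∨ ∃ a, x = neg a ∧ y = bar a

/-- The weight of a walk, given by its list of vertices (`⊤` if some step is not an edge). -/
def walkWeight (s : State α) : List (Vtx α) → WithTop ℝ
  | x :: y :: l => s.w x y + walkWeight s (y :: l)
  | _ => 0

/-- The number of hops of a walk. -/
def walkHops (s : State α) : List (Vtx α) → ℕ
  | x :: y :: l => (if s.IsHop x y then 1 else 0) + walkHops s (y :: l)
  | _ => 0

/-- The inclusion of `ℝ ∪ {∞}` in the extended reals. -/
def toEReal : WithTop ℝ → EReal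
  | ⊤ => ⊤
  | (x : ℝ) => (x : EReal)

/-- The `h`-hop distance `d^h(x, y)`: the least weight of a walk from `x` to `y` with at most `h`
hops (`⊤` if there is none). -/
def hopDist (s : State α) (h : ℕ) (x y : Vtx α) : EReal :=
  ⨅ (l : List (Vtx α)) (_ : (x :: l).getLast? = some y ∧ s.walkHops (x :: l) ≤ h),
    toEReal (s.walkWeight (x :: l))

/-- `U^in_r = {v : d^0(v, r) < Δ}` for `r = neg a`. -/
def uIn (s : State α) (a : α) (Δ : ℝ) : Finset (Vtx α) :=
  s.verts.filter fun v => s.hopDist 0 v (neg a) < (Δ : EReal)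

/-- `U^out_r = {v : d^1(r, v) < -Δ}` for `r = neg a`. -/
def uOut (s : State α) (a : α) (Δ : ℝ) : Finset (Vtx α) :=
  s.verts.filter fun v => s.hopDist 1 (neg a) v < ((-Δ : ℝ) : EReal)

/-! ### Auxiliary adjacency lists -/

/-- The list `A^in_v`, sorted by non-increasing weight of the edge into `v`. -/
def aIn (s : State α) (v : Vtx α) : List (Vtx α) :=
  (s.verts.filter fun u => s.w u v ≠ ⊤ ∧ 0 ≤ s.w u v ∧
      (v ∈ s.heavy → u.inParent ≠ some v) ∧ v.inParent = none ∧
      v.outParent ≠ some u).toList.mergeSort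
    fun x y => decide (s.w y v ≤ s.w x v)

/-- The list `A^out_v`, sorted by non-increasing weight of the edge out of `v`. -/
def aOut (s : State α) (v : Vtx α) : List (Vtx α) :=
  (s.verts.filter fun u => s.w v u ≠ ⊤ ∧ 0 ≤ s.w v u ∧
      (v ∈ s.heavy → u.outParent ≠ some v) ∧ v.outParent = none ∧
      v.inParent ≠ some u).toList.mergeSort
    fun x y => decide (s.w v y ≤ s.w v x)

end State

/-! ### The procedures `AddEdgeIn` and `AddEdgeOut` -/

/-- `AddEdgeIn(u, v, W)`, where `v` is a negative vertex or an N-Steiner vertex. -/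
def addEdgeIn : Vtx α → Vtx α → ℝ → State α → State α
  | inS p t l, v, W, s =>
    let s := s.addEdge (inS p t l) v W
    let W' := W - s.wt (inS p t l) p
    match v with
    | neg a => addEdgeIn p (neg a) W' s
    | hub a t' =>
      let W'' := W' - s.wtNeg a (hub a t')
      let s := { s with fIn := insert (p, hub a t', W') s.fIn }
      let s := if 0 ≤ W' then addEdgeIn p (hub a t') W' s else s
      addEdgeIn p (neg a) W'' s
    | _ => s
  | outS p t l, v, W, s =>
    let s := s.addEdge (outS p t l) v W
    addEdgeIn p v (W + s.wt p (outS p t l)) s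
  | u, v, W, s => s.addEdge u v W

/-- `AddEdgeOut(u, v, W)`, where `u` is a negative vertex or an N-Steiner vertex.  The arguments
are in the order `v`, `u`, `W`. -/
def addEdgeOut : Vtx α → Vtx α → ℝ → State α → State α
  | inS p t l, u, W, s =>
    let s := s.addEdge u (inS p t l) W
    addEdgeOut p u (W + s.wt (inS p t l) p) s
  | outS p t l, u, W, s =>
    let s := s.addEdge u (outS p t l) W
    let W' := W - s.wt p (outS p t l)
    match u with
    | neg a => addEdgeOut p (neg a) W' s
    | hub a t' =>
      let W'' := W' - s.wt (hub a t') (neg a)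
      let s := { s with fOut := insert (hub a t', p, W') s.fOut }
      let s := if 0 ≤ W' then addEdgeOut p (hub a t') W' s else s
      addEdgeOut p (neg a) W'' s
    | _ => s
  | v, u, W, s => s.addEdge u v W

/-! ### Deferred edges -/

/-- Insert the deferred edges whose current weight is nonnegative.  The edges that this adds from a
negative vertex `r` are realised as paths through `r̄`. -/
def insertDeferred [Fintype α] (s : State α) : State α :=
  let s₁ := s.fIn.toList.foldl
    (fun x e => if 0 ≤ e.2.2 then addEdgeIn e.1 e.2.1 e.2.2 x else x) s
  let s₂ := s.fOut.toList.foldl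
    (fun x e => if 0 ≤ e.2.2 then addEdgeOut e.2.1 e.1 e.2.2 x else x) s₁
  (Finset.univ : Finset α).toList.foldl State.redirect s₂

/-! ### Betweenness reduction -/

/-- The `h`-hop betweenness of `(x, y)`: the number of negative vertices `r` with
`d^h(x, r) + d^h(r, y) < 0`. -/
def betweenness [Fintype α] (s : State α) (h : ℕ) (x y : Vtx α) : ℕ :=
  ((Finset.univ : Finset α).filter fun a =>
    s.hopDist h x (neg a) + s.hopDist h (neg a) y < 0).card

/-- `φ` is a successful output of the betweenness reduction with parameters `h` and `b`: a valid
potential such that, in the graph reweighted by `φ` (with the deferred edges that have become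
nonnegative put back), every pair has `h`-hop betweenness at most `η / b`. -/
def Reduces [Fintype α] (h : ℕ) (b : ℝ) (s : State α) (φ : Vtx α → ℝ) : Prop :=
  s.Valid φ ∧ ∀ x ∈ s.verts, ∀ y ∈ s.verts,
    (betweenness (insertDeferred (s.reweight φ)) h x y : ℝ) ≤ (Fintype.card α : ℝ) / b

/-- A randomized betweenness-reduction subroutine: called in iteration `t` on a graph with `n`
vertices that has a reducing potential, it returns one with probability at least `1 - n ^ (-κ)`. -/
def IsBetweennessReduction [Fintype α] (h : ℕ) (b κ : ℝ)
    (B : ℕ → State α → PMF (Vtx α → ℝ)) : Prop :=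
  ∀ t s, (∃ φ, Reduces h b s φ) →
    (B t s).toOuterMeasure {φ | ¬ Reduces h b s φ} ≤
      ENNReal.ofReal ((s.verts.card : ℝ) ^ (-κ))

/-- Such subroutines exist. -/
theorem exists_isBetweennessReduction [Fintype α] (h : ℕ) (b κ : ℝ) :
    ∃ B : ℕ → State α → PMF (Vtx α → ℝ), IsBetweennessReduction h b κ B := by
  refine ⟨fun _ s => PMF.pure (if hs : ∃ φ, Reduces h b s φ then hs.choose else 0), ?_⟩
  intro t s hs
  rw [PMF.toOuterMeasure_pure_apply, dif_pos hs, if_neg]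
  · exact zero_le
  · simpa using hs.choose_spec

/-! ### Threshold values -/

/-- Extended distances: pairs (distance, index of the moving endpoint) in lexicographic order; the
index of the other endpoint is constant in all comparisons.  `⊤` is the distance to an empty set. -/
abbrev ExtDist := WithTop (Lex (EReal × ℕ))

/-- The distance entry of an extended distance. -/
def ExtDist.dist : ExtDist → EReal
  | ⊤ => ⊤
  | (D : Lex (EReal × ℕ)) => (ofLex D).1

/-- The index of a vertex. -/
def State.index (s : State α) (v : Vtx α) : ℕ := s.verts.toList.idxOf v

/-- The extended distance `d̂(S, r)` from the set `S` to `r = neg a`. -/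
def extDistIn (s : State α) (h : ℕ) (a : α) (S : Finset (Vtx α)) : ExtDist :=
  S.inf fun u => ((toLex (s.hopDist h u (neg a), s.index u) : Lex (EReal × ℕ)) : ExtDist)

/-- The extended distance `d̂(r, S)` from `r = neg a` to the set `S`. -/
def extDistOut (s : State α) (h : ℕ) (a : α) (S : Finset (Vtx α)) : ExtDist :=
  S.inf fun u => ((toLex (s.hopDist h (neg a) u, s.index u) : Lex (EReal × ℕ)) : ExtDist)

/-- The median of a list of extended distances. -/
def median (l : List ExtDist) : ExtDist :=
  (l.mergeSort fun x y => decide (x ≤ y)).getD (l.length / 2) ⊤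

/-- The coin that shows `true` with probability `2 ^ (-l)`. -/
def coin (l : ℕ) : PMF Bool :=
  PMF.ofFintype (fun c => cond c ((2⁻¹ : ENNReal) ^ l) (1 - (2⁻¹ : ENNReal) ^ l)) (by
    rw [Fintype.sum_bool]
    exact add_tsub_cancel_of_le (pow_le_one₀ zero_le (by simp)))

/-- A random subset of a list, each element being kept independently with probability `2 ^ (-l)`. -/
def sampleSubset (l : ℕ) : List (Vtx α) → PMF (Finset (Vtx α))
  | [] => PMF.pure ∅
  | v :: vs => (coin l).bind fun c =>
      (sampleSubset l vs).map fun S => if c then insert v S else S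

/-- `k` independent random subsets. -/
def sampleTrials (l : ℕ) (vs : List (Vtx α)) : ℕ → PMF (List (Finset (Vtx α)))
  | 0 => PMF.pure []
  | k + 1 => (sampleSubset l vs).bind fun S => (sampleTrials l vs k).map fun Ss => S :: Ss

/-- The samples of `Estimate(2 ^ (-l))` for `l = 1, …, m`, each with `k` trials, all independent.
They are returned as a function of `l`. -/
def sampleLevels (vs : List (Vtx α)) (k : ℕ) : ℕ → PMF (ℕ → List (Finset (Vtx α)))
  | 0 => PMF.pure fun _ => []
  | m + 1 => (sampleLevels vs k m).bind fun f =>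
      (sampleTrials (m + 1) vs k).map fun Ss => Function.update f (m + 1) Ss

/-- The number `⌊log n⌋ - 2` of scales. -/
def numScales (s : State α) : ℕ := Nat.log 2 s.verts.card - 2

/-- The threshold as a function of the number `m` of scales and of the distances
`dI l = d(D^in_l)`, `dO l = d(D^out_l)`.  With `l` the least index at which their sum is nonnegative:
the first case is that there is none, the second is `l = 1` (where any finite value
between `- d(D^out_1)` and `d(D^in_1)` serves when `d(D^in_1) = ∞`), the others are `l > 1`. -/
def chooseThreshold (m : ℕ) (dI dO : ℕ → EReal) : ℝ :=
  match (List.range' 1 m).find? (fun l => decide (0 ≤ dI l + dO l)) with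
  | none => (dI m).toReal
  | some l =>
    if l = 1 then
      if dI 1 ≠ ⊤ then (dI 1).toReal else if dO 1 ≠ ⊤ then -(dO 1).toReal else 0
    else if dI (l - 1) < dI l then
      if -dO (l - 1) ≤ dI l then -(dO (l - 1)).toReal else (dI l).toReal
    else
      if -dO l ≤ dI (l - 1) then (dI (l - 1)).toReal else -(dO l).toReal

/-- The threshold `Δ_r` of `r = neg a`, computed from the samples `smp`.  The medians are first
made non-decreasing in the scale. -/
def threshold (s : State α) (h : ℕ) (smp : ℕ → List (Finset (Vtx α))) (a : α) : ℝ :=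
  chooseThreshold (numScales s)
    (fun l => ExtDist.dist
      ((Finset.Icc 1 l).sup fun i => (median ((smp i).map (extDistIn s h a)))))
    (fun l => ExtDist.dist
      ((Finset.Icc 1 l).sup fun i => (median ((smp i).map (extDistOut s h a)))))

/-! ### Simple shortcutting

From here on `base` is the graph in which the thresholds, the sets `U^in_r`, `U^out_r` and the lists
`A^in_v`, `A^out_v` are computed, and `Δ a` is the threshold of `neg a`. -/

/-- For each `ū ∈ U^in_r`, add the edge `(u, r̄)` of weight `w(u, ū) + d^0(ū, r) + w(r, r̄)`. -/
def simpleIn [Fintype α] (base : State α) (Δ : α → ℝ) (s : State α) : State α :=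
  (Finset.univ : Finset α).toList.foldl (fun s r =>
    ((Finset.univ : Finset α).filter fun c => bar c ∈ base.uIn r (Δ r)).toList.foldl
      (fun s c => s.addEdge (neg c) (bar r)
        (base.wt (neg c) (bar c) + (base.hopDist 0 (bar c) (neg r)).toReal
          + base.wt (neg r) (bar r))) s) s

/-- For each negative `v ∈ U^out_r`, add the edge `(r, v̄)` of weight `d^1(r, v) + w(v, v̄)`. -/
def simpleOut [Fintype α] (base : State α) (Δ : α → ℝ) (s : State α) : State α :=
  (Finset.univ : Finset α).toList.foldl (fun s r =>
    ((Finset.univ : Finset α).filter fun c => neg c ∈ base.uOut r (Δ r)).toList.foldl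
      (fun s c => s.addEdge (neg r) (bar c)
        ((base.hopDist 1 (neg r) (neg c)).toReal + base.wt (neg c) (bar c))) s) s

/-! ### Steiner gadgets -/

/-- The in-Steiner gadget of `v` in iteration `t`; `⌈log k⌉` vertices are created, where
`k = |A^in_v|`.  The list is indexed from `0`, so `u_i` is its entry number `i - 1`. -/
def inGadget (base : State α) (t : ℕ) (s : State α) (v : Vtx α) : State α :=
  let A := base.aIn v
  let k := A.length
  (List.range (Nat.clog 2 k)).foldl (fun s l =>
    let x := inS v t l
    let W := base.wt (A.getD (k - 2 ^ l - 1) v) v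
    let s := (s.addVertex x).addEdge x v W
    let s := (A.take (k - 2 ^ l)).foldl (fun s u =>
      let s := s.addEdge u x (base.wt u v - W)
      match u with
      | outS p t' l' => s.addEdge p x (s.wt p (outS p t' l') + base.wt (outS p t' l') v - W)
      | _ => s) s
    match v with
    | neg a => s.addEdge (neg a) x (-W)
    | hub a t' => s.addEdge (neg a) x (s.wtNeg a (hub a t') - W)
    | _ => s) s

/-- The out-Steiner gadget of `v` in iteration `t`. -/
def outGadget (base : State α) (t : ℕ) (s : State α) (v : Vtx α) : State α :=
  let A := base.aOut v
  let k := A.length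
  (List.range (Nat.clog 2 k)).foldl (fun s l =>
    let x := outS v t l
    let W := base.wt v (A.getD (k - 2 ^ l - 1) v)
    let s := (s.addVertex x).addEdge v x W
    let s := (A.take (k - 2 ^ l)).foldl (fun s u =>
      let s := s.addEdge x u (base.wt v u - W)
      match u with
      | inS p t' l' => s.addEdge x p (base.wt v (inS p t' l') + s.wt (inS p t' l') p - W)
      | _ => s) s
    match v with
    | bar a => s.addEdge x (neg a) (-s.wt (neg a) (bar a) - W)
    | hub a t' => s.addEdge x (neg a) (s.wt (hub a t') (neg a) - W)
    | _ => s) s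

/-- Create the N-Steiner vertex of `neg a` in iteration `t`. -/
def createHub (t : ℕ) (Δ : α → ℝ) (s : State α) (a : α) : State α :=
  let s := s.addVertex (hub a t)
  let s := { s with heavy := insert (hub a t) s.heavy }
  (s.addEdge (hub a t) (neg a) (Δ a)).addEdge (neg a) (hub a t) (-Δ a)

/-! ### The procedures `ShortcutIn` and `ShortcutOut`

The working state is a pair: the tentative distances `d` (`⊤` for `∞`) and the graph.  The set `S_l`
consists of the vertices of level `l` with a finite tentative distance. -/

/-- Lower the tentative distance of `p` to `x`, if it is larger. -/
def relax (d : Vtx α → WithTop ℝ) (p : Vtx α) (x : ℝ) : Vtx α → WithTop ℝ :=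
  Function.update d p (min (d p) (x : WithTop ℝ))

/-- Scan the list `A^in_v` of a heavy vertex `v` with tentative distance `dv`. -/
def scanHeavyIn (base : State α) (t : ℕ) (a : α) (Δ : ℝ) (v : Vtx α) (dv : ℝ)
    (z : (Vtx α → WithTop ℝ) × State α) : (Vtx α → WithTop ℝ) × State α :=
  let A := base.aIn v
  let k := A.length
  let i := A.findIdx fun u => decide (base.wt u v + dv - Δ < 0)
  let j := if i < k then i + 1 else k
  let l := Nat.clog 2 (k - j + 1)
  let z := if l < Nat.clog 2 k then
      (z.1, addEdgeIn (inS v t l) (hub a t) (z.2.wt (inS v t l) v + dv - Δ) z.2)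
    else z
  (A.drop (k - 2 ^ l)).foldl (fun z u =>
    match u.inParent, decide (u ∈ base.heavy) with
    | some p, false =>
      let W := base.wt u v + dv - z.2.wt u p
      if W < Δ then (relax z.1 p W, z.2) else z
    | _, _ =>
      let W := base.wt u v + dv - Δ
      if 0 ≤ W then (z.1, addEdgeIn u (hub a t) W z.2) else z) z

/-- Process one vertex `v` in `ShortcutIn`. -/
def processIn (base : State α) (t : ℕ) (a : α) (Δ : ℝ)
    (z : (Vtx α → WithTop ℝ) × State α) (v : Vtx α) : (Vtx α → WithTop ℝ) × State α :=
  let dv := (z.1 v).untopD 0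
  match v.inParent with
  | some p => (relax z.1 p (dv - z.2.wt v p), z.2)
  | none =>
    let z := match v.outParent with
      | some p =>
        let W := z.2.wt p v + dv - Δ
        if 0 ≤ W then (z.1, addEdgeIn p (hub a t) W z.2) else z
      | none => z
    if v ∈ base.heavy then scanHeavyIn base t a Δ v dv z
    else (base.aIn v).foldl (fun z u =>
      let W := base.wt u v + dv - Δ
      if 0 ≤ W then (z.1, addEdgeIn u (hub a t) W z.2) else z) z

/-- `ShortcutIn(r, t)` for `r = neg a`. -/
def shortcutIn (base : State α) (t : ℕ) (Δ : α → ℝ) (s : State α) (a : α) : State α :=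
  let d₀ : Vtx α → WithTop ℝ := fun v =>
    if v ∈ base.uIn a (Δ a) then ((base.hopDist 0 v (neg a)).toReal : WithTop ℝ) else ⊤
  ((List.range (t + 1)).reverse.foldl (fun z l =>
    (base.verts.filter fun v => z.1 v ≠ ⊤ ∧ v.level = l).toList.foldl
      (processIn base t a (Δ a)) z) (d₀, s)).2

/-- Scan the list `A^out_v` of a heavy vertex `v` with tentative distance `dv`. -/
def scanHeavyOut (base : State α) (t : ℕ) (a : α) (Δ : ℝ) (v : Vtx α) (dv : ℝ)
    (z : (Vtx α → WithTop ℝ) × State α) : (Vtx α → WithTop ℝ) × State α :=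
  let A := base.aOut v
  let k := A.length
  let i := A.findIdx fun u => decide (dv + base.wt v u + Δ < 0)
  let j := if i < k then i + 1 else k
  let l := Nat.clog 2 (k - j + 1)
  let z := if l < Nat.clog 2 k then
      (z.1, addEdgeOut (outS v t l) (hub a t) (dv + z.2.wt v (outS v t l) + Δ) z.2)
    else z
  (A.drop (k - 2 ^ l)).foldl (fun z u =>
    match u.outParent, decide (u ∈ base.heavy) with
    | some p, false =>
      let W := dv + base.wt v u - z.2.wt p u
      if W < -Δ then (relax z.1 p W, z.2) else z
    | _, _ =>
      let W := dv + base.wt v u + Δ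
      if 0 ≤ W then (z.1, addEdgeOut u (hub a t) W z.2) else z) z

/-- Process one vertex `v` in `ShortcutOut`. -/
def processOut (base : State α) (t : ℕ) (a : α) (Δ : ℝ)
    (z : (Vtx α → WithTop ℝ) × State α) (v : Vtx α) : (Vtx α → WithTop ℝ) × State α :=
  let dv := (z.1 v).untopD 0
  match v.outParent with
  | some p => (relax z.1 p (dv - z.2.wt p v), z.2)
  | none =>
    let z := match v.inParent with
      | some p =>
        let W := dv + z.2.wt v p + Δ
        if 0 ≤ W then (z.1, addEdgeOut p (hub a t) W z.2) else z
      | none => z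
    if v ∈ base.heavy then scanHeavyOut base t a Δ v dv z
    else (base.aOut v).foldl (fun z u =>
      let W := dv + base.wt v u + Δ
      if 0 ≤ W then (z.1, addEdgeOut u (hub a t) W z.2) else z) z

/-- `ShortcutOut(r, t)` for `r = neg a`. -/
def shortcutOut (base : State α) (t : ℕ) (Δ : α → ℝ) (s : State α) (a : α) : State α :=
  let d₀ : Vtx α → WithTop ℝ := fun v =>
    if v ∈ base.uOut a (Δ a) then ((base.hopDist 1 (neg a) v).toReal : WithTop ℝ) else ⊤
  ((List.range (t + 1)).reverse.foldl (fun z l =>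
    (base.verts.filter fun v => z.1 v ≠ ⊤ ∧ v.level = l).toList.foldl
      (processOut base t a (Δ a)) z) (d₀, s)).2

/-- The shortcut generation for one negative vertex, with the edge cases of extreme `Δ_r`. -/
def shortcutAt (base : State α) (t : ℕ) (Δ : α → ℝ) (s : State α) (a : α) : State α :=
  let s := shortcutOut base t Δ (shortcutIn base t Δ s a) a
  let s := if Δ a ≤ 0 then
      (base.aIn (neg a)).foldl
        (fun s v => addEdgeIn v (hub a t) (base.wt v (neg a) - Δ a) s) s
    else s
  if -base.wt (neg a) (bar a) ≤ Δ a then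
    (base.aOut (bar a)).foldl (fun s v =>
      addEdgeOut v (hub a t)
        (base.wt (neg a) (bar a) + Δ a + base.wt (bar a) v) s) s
  else s

/-! ### Postprocessing -/

/-- Restore `r = neg a` to be a vertex whose only outgoing edge is `(r, r̄)` and without incoming
negative edges: redirect its other outgoing edges to start in `r̄`, and apply the potential
with values `w^in_r` at `r` and `w(r, r̄) - w^out_r` at `r̄`. -/
def restore (s : State α) (a : α) : State α :=
  let W := s.wt (neg a) (bar a)
  let wOut := (s.verts.inf fun v => s.w (neg a) v).untopD 0
  let wIn := (min 0 (s.verts.inf fun v => s.w v (neg a))).untopD 0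
  (s.redirect a).reweight fun x =>
    if x = neg a then wIn else if x = bar a then W - wOut else 0

/-- Classify the in- and out-Steiner vertices of level `t`, with degree threshold `lam`. -/
def classify (t : ℕ) (lam : ℝ) (s : State α) : State α :=
  { s with heavy := s.heavy ∪ s.verts.filter fun v => v.level = t ∧
      ((v.inParent ≠ none ∧ lam ≤ ((s.verts.filter fun u => s.w v u ≠ ⊤).card : ℝ) - 1) ∨
       (v.outParent ≠ none ∧ lam ≤ ((s.verts.filter fun u => s.w u v ≠ ⊤).card : ℝ) - 1)) }

/-! ### One iteration and the whole algorithm -/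

/-- Everything in iteration `t` after the computation of the thresholds `Δ`. -/
def finish [Fintype α] (t : ℕ) (lam : ℝ) (Δ : α → ℝ) (base : State α) : State α :=
  let N := (Finset.univ : Finset α).toList
  let s := simpleOut base Δ (simpleIn base Δ base)
  let s := base.heavy.toList.foldl (inGadget base t) s
  let s := base.heavy.toList.foldl (outGadget base t) s
  let s := N.foldl (createHub t Δ) s
  let s := N.foldl (shortcutAt base t Δ) s
  let s := N.foldl restore s
  classify t lam s

/-- The procedure `Shortcut(G, t)` with the parameters `h` and `b`, with `⌈K log n⌉` trials in each
call of `Estimate`, and with the betweenness-reduction subroutine `B`; the degree threshold is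
`λ = n / √b`, where `n` is the number of vertices at the start of the iteration. -/
def shortcut [Fintype α] (h : ℕ) (b K : ℝ) (B : ℕ → State α → PMF (Vtx α → ℝ))
    (t : ℕ) (s : State α) : PMF (State α) :=
  (B t s).bind fun φ =>
    let base := insertDeferred (s.reweight φ)
    (sampleLevels base.verts.toList ⌈K * Real.logb 2 base.verts.card⌉₊ (numScales base)).map
      fun smp => finish t ((s.verts.card : ℝ) / √b) (threshold base h smp) base

/-- The input graph `H` (weight `⊤` for non-edges) has no negative cycle. -/
def NoNegCycle (H : α → α → WithTop ℝ) : Prop :=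
  ∀ (a : α) (l : List α), 0 ≤ (List.zipWith H (a :: l) (l ++ [a])).sum

/-- `w^min_v`, the least weight of an edge out of `v`, or `0` if that is smaller. -/
def wMin [Fintype α] (H : α → α → WithTop ℝ) (v : α) : ℝ :=
  (min 0 (Finset.univ.inf (H v))).untopD 0

/-- The well-behaved graph `G₀` of `H`.  All of its vertices are heavy. -/
def initState [Fintype α] (H : α → α → WithTop ℝ) : State α where
  verts := Finset.univ.image neg ∪ Finset.univ.image bar
  heavy := Finset.univ.image neg ∪ Finset.univ.image bar
  fIn := ∅
  fOut := ∅
  w := fun x y => match x, y with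
    | neg a, bar c => if a = c then ((wMin H a : ℝ) : WithTop ℝ) else ⊤
    | bar a, neg c => min (if a = c then ((-wMin H a : ℝ) : WithTop ℝ) else ⊤)
        (H a c + ((-wMin H a : ℝ) : WithTop ℝ))
    | _, _ => ⊤

/-- The law of the history of the first `t` iterations: the value of the history at `i ≤ t` is the
graph after `i` iterations. -/
def run [Fintype α] (H : α → α → WithTop ℝ) (h : ℕ) (b K : ℝ)
    (B : ℕ → State α → PMF (Vtx α → ℝ)) : ℕ → PMF (ℕ → State α)
  | 0 => PMF.pure fun _ => initState H
  | t + 1 => (run H h b K B t).bind fun G =>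
      (shortcut h b K B (t + 1) (G t)).map fun s => Function.update G (t + 1) s

/-- The number of iterations that the algorithm performs: none if there are at most `100` negative
vertices, and `L` otherwise. -/
def numIterations (η L : ℕ) : ℕ := if η ≤ 100 then 0 else L

end

end NegSSSP

/-! Everything rests on one estimate: except with small probability, an iteration on a graph with n
vertices adds at most 400η heavy vertices. The new N-Steiner vertices account for η of them. A new
in-Steiner vertex has, besides the edge into its parent, only edges into N-Steiner vertices of the
same iteration, so it is declared heavy only if there are at least λ of the latter. Such an edge
arises only when `ShortcutIn` of some r scans a heavy vertex, and every processed vertex yields at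
most one (`processIn_spec`). The same holds for out-Steiner vertices. Counting these edges twice, λ
times the number of new heavy Steiner vertices is at most the number of processed vertices, summed
over all r (`finish_spec`).

Processed vertices are close to r. A tentative distance handed from a Steiner vertex to its parent
is realised by a walk with at most one more hop, or two more if the parent has level 0
(`hopDist_inParent`, `hopDist_outParent`). Levels decrease from child to parent, so at most t + 1 ≤
h hops are ever used. Hence processed vertices have h-hop distance below Δ_r to r (below -Δ_r from
r), apart from some copies r̄ that are parents of such vertices; this gives `shortcutIn_spec` and
`shortcutOut_spec`.

The exchange of walks is what the invariant `Core` is made for. A graph without negative cycle has a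
feasible potential ψ, and all edges are measured by their weight reduced by ψ. Edges between Steiner
vertices and their parents are tight, that is, of reduced weight 0, and so are those between an
N-Steiner vertex and its negative vertex. If a Steiner vertex over p has an edge to some y other
than a parent or child, then p has a link of no larger reduced weight into a negative vertex from
which y is reached tightly. `AddEdgeIn` and `AddEdgeOut` maintain this because they pass an edge up
along tight edges, so that its reduced weight does not change. The signs recorded in `Stable`
determine which steps of the new walk are hops. The same ψ shows that the betweenness-reduction
subroutine always has a solution, since reweighting by ψ makes all weights nonnegative and all
betweenness zero (`Between.exists_reduces`).

The sampling bounds the number of vertices close to r. A median over random sets of density 2^(-l)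
is a distance within which there are about 2^l vertices (`sampleTrials_splits`). At the scale before
the chosen one the two distances have a negative sum, so if N vertices are close to r then, up to
constants, N² pairs (x, y) satisfy d(x, r) + d(r, y) < 0 (`near_sq_le`). Summed over r there are at
most n²η/b such pairs by the betweenness bound, and the Cauchy–Schwarz inequality bounds the total
number of close vertices, with the multiplicities needed, by 399η · n/√b = 399ηλ (`sum_near_le`).

Each iteration creates η N-Steiner vertices and at most 2⌈log n⌉ Steiner vertices per heavy vertex.
After O(log n₀) iterations there are O(n₀ log n₀) heavy vertices, hence O(n₀ log³ n₀) vertices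
(`card_step`), which is within the claimed bound. An iteration fails with probability at most
2n^(-(c+1)), and a union bound finishes the proof for large n₀ (`run_large`). For bounded n₀ the
number of iterations is bounded, and a deterministic estimate goes into the constant C
(`run_small`). -/

namespace NegSSSP

noncomputable section

open scoped Classical

universe u

open Vtx

variable {α : Type u}

/-! ### Reduced weights -/

/-- The edge `(x, y)` exists and its weight reduced by the potential `ψ` is at most `X`. -/
def State.Link (s : State α) (ψ : Vtx α → ℝ) (x y : Vtx α) (X : ℝ) : Prop :=
  s.w x y ≤ ((X - ψ x + ψ y : ℝ) : WithTop ℝ)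

/-- A link from `x` to `y`, where the outgoing edges of `r̄` also count as edges of `r`. -/
def State.Reach (s : State α) (ψ : Vtx α → ℝ) (x y : Vtx α) (X : ℝ) : Prop :=
  s.Link ψ x y X ∨ ∃ c, x = neg c ∧ s.Link ψ (bar c) y X

/-- `Anc q x`: the vertex `q` is `x` or one of its iterated parents. -/
inductive Anc : Vtx α → Vtx α → Prop
  | refl (x : Vtx α) : Anc x x
  | inS {q p : Vtx α} {t l : ℕ} : Anc q p → Anc q (inS p t l)
  | outS {q p : Vtx α} {t l : ℕ} : Anc q p → Anc q (outS p t l)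

/-- The negative vertex from which a vertex can be reached along a tight path. -/
def rootIn : Vtx α → Option α
  | neg a => some a
  | hub a _ => some a
  | inS (neg a) _ _ => some a
  | inS (hub a _) _ _ => some a
  | _ => none

/-- The negative vertex that can be reached from a vertex along a tight path. -/
def rootOut : Vtx α → Option α
  | neg a => some a
  | bar a => some a
  | hub a _ => some a
  | outS (bar a) _ _ => some a
  | outS (hub a _) _ _ => some a
  | _ => none

/-- `u` is an in-Steiner vertex of `p`, or an out-Steiner vertex of one. -/
def InBase (u p : Vtx α) : Prop :=
  u.inParent = some p ∨ ∃ v, u.outParent = some v ∧ v.inParent = some p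

/-- `u` is an out-Steiner vertex of `p`, or an in-Steiner vertex of one. -/
def OutBase (u p : Vtx α) : Prop :=
  u.outParent = some p ∨ ∃ v, u.inParent = some v ∧ v.outParent = some p

section Links

variable {s s' : State α} {ψ φ : Vtx α → ℝ} {x y : Vtx α} {X Y : ℝ}

theorem State.Link.mono (h : s.Link ψ x y X) (hXY : X ≤ Y) : s.Link ψ x y Y :=
  le_trans h (by exact_mod_cast by linarith)

theorem State.Reach.mono (h : s.Reach ψ x y X) (hXY : X ≤ Y) : s.Reach ψ x y Y := by
  rcases h with h | ⟨c, hc, h⟩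
  · exact Or.inl (h.mono hXY)
  · exact Or.inr ⟨c, hc, h.mono hXY⟩

theorem State.Link.ne_top (h : s.Link ψ x y X) : s.w x y ≠ ⊤ := by
  intro e
  rw [State.Link, e] at h
  exact absurd h (not_le.2 (WithTop.coe_lt_top _))

theorem State.link_wt (ψ : Vtx α → ℝ) (h : s.w x y ≠ ⊤) :
    s.Link ψ x y (s.wt x y + ψ x - ψ y) := by
  lift s.w x y to ℝ using h with c hc
  rw [State.Link, State.wt, ← hc]
  simp only [WithTop.untopD_coe]
  exact_mod_cast by linarith

theorem State.coe_wt (h : s.w x y ≠ ⊤) : ((s.wt x y : ℝ) : WithTop ℝ) = s.w x y := by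
  lift s.w x y to ℝ using h with c hc
  rw [State.wt, ← hc, WithTop.untopD_coe]

theorem State.link_iff : s.Link ψ x y X ↔ s.w x y ≠ ⊤ ∧ s.wt x y + ψ x - ψ y ≤ X := by
  constructor
  · intro h
    refine ⟨h.ne_top, ?_⟩
    have h' := h
    rw [State.Link, ← State.coe_wt h.ne_top] at h'
    have := WithTop.coe_le_coe.1 h'
    linarith
  · rintro ⟨h, h'⟩
    exact (State.link_wt ψ h).mono h'

/-- Turns the sign of a weight into a statement about links, so that sign conditions pass through
the same case distinctions on added edges as the rest of the invariant. -/
theorem State.nonneg_iff : 0 ≤ s.w x y ↔ ∀ X, s.Link ψ x y X → 0 ≤ X - ψ x + ψ y := by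
  constructor
  · intro h X hX
    exact_mod_cast h.trans hX
  · intro h
    by_cases ht : s.w x y = ⊤
    · rw [ht]; exact le_top
    · have := h _ (State.link_wt ψ ht)
      rw [← State.coe_wt ht]
      exact_mod_cast by linarith

/-- Of two parallel edges the minimum is kept, and an upper bound on a minimum is a disjunction.
This is why links bound the reduced weight instead of naming it. -/
theorem State.link_addEdge {a b : Vtx α} {W : ℝ} :
    (s.addEdge a b W).Link ψ x y X ↔
      s.Link ψ x y X ∨ (x = a ∧ y = b ∧ W + ψ a - ψ b ≤ X) := by
  unfold State.Link State.addEdge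
  dsimp only
  split_ifs with h
  · obtain ⟨rfl, rfl⟩ := h
    rw [min_le_iff]
    refine or_congr Iff.rfl ?_
    rw [WithTop.coe_le_coe]
    constructor
    · intro h; exact ⟨rfl, rfl, by linarith⟩
    · rintro ⟨-, -, h⟩; linarith
  · constructor
    · exact Or.inl
    · rintro (h' | ⟨rfl, rfl, -⟩)
      · exact h'
      · exact absurd ⟨rfl, rfl⟩ h

/-- Reweighting by `φ` and subtracting `φ` from the potential cancel, so reduced weights do not
change. -/
theorem State.link_reweight :
    (s.reweight φ).Link (fun v => ψ v - φ v) x y X ↔ s.Link ψ x y X := by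
  unfold State.Link State.reweight
  dsimp only
  induction s.w x y using WithTop.recTopCoe with
  | top => simp
  | coe c =>
    rw [← WithTop.coe_add, WithTop.coe_le_coe, WithTop.coe_le_coe]
    constructor <;> intro h <;> linarith

/-- Since the edge from r to r̄ is tight, an edge keeps its reduced weight when it is made to start
in r̄ instead of r. -/
theorem State.link_redirect {a : α} (ht : s.w (neg a) (bar a) = ((ψ (bar a) - ψ (neg a) : ℝ) : WithTop ℝ)) :
    (s.redirect a).Link ψ x y X ↔
      (x = neg a ∧ y = bar a ∧ s.Link ψ x y X) ∨ (x ≠ neg a ∧ s.Link ψ x y X) ∨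
        (x = bar a ∧ y ≠ bar a ∧ s.Link ψ (neg a) y X) := by
  have hwt : s.wt (neg a) (bar a) = ψ (bar a) - ψ (neg a) := by
    rw [State.wt, ht, WithTop.untopD_coe]
  unfold State.Link State.redirect
  dsimp only
  by_cases hx : x = neg a
  · subst hx
    by_cases hy : y = bar a
    · subst hy; simp
    · simp [hy]
  · by_cases hx' : x = bar a
    · subst hx'
      by_cases hy : y = bar a
      · subst hy; simp
      · simp only [hx, hy, if_false, ne_eq, not_false_eq_true, and_self, if_true, false_and,
          true_and, false_or, min_le_iff]
        refine or_congr Iff.rfl ?_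
        rw [hwt]
        induction s.w (neg a) y using WithTop.recTopCoe with
        | top => simp
        | coe c =>
          rw [← WithTop.coe_add, WithTop.coe_le_coe, WithTop.coe_le_coe]
          constructor <;> intro h <;> linarith
    · simp [hx, hx']

end Links

/-! ### The invariant -/

/-- The part of the invariant that any edge of nonnegative reduced weight preserves. -/
structure Frame (ψ : Vtx α → ℝ) (V : Finset (Vtx α)) (s : State α) : Prop where
  neg_mem : ∀ a, neg a ∈ V
  bar_mem : ∀ a, bar a ∈ V
  inS_mem : ∀ {p t l}, inS p t l ∈ V → p ∈ V ∧ p.level < t ∧ p.inParent = none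
  outS_mem : ∀ {p t l}, outS p t l ∈ V →
    p ∈ V ∧ p.level < t ∧ p.outParent = none ∧ ∀ a, p ≠ neg a
  hub_mem : ∀ {a t}, hub a t ∈ V → 1 ≤ t
  feas : ∀ {x y X}, s.Link ψ x y X → 0 ≤ X
  tight_inS : ∀ {p t l}, inS p t l ∈ V → s.Link ψ (inS p t l) p 0
  tight_outS : ∀ {p t l}, outS p t l ∈ V → s.Link ψ p (outS p t l) 0
  tight_bar : ∀ a, s.Link ψ (neg a) (bar a) 0
  tight_neg : ∀ a, s.Link ψ (bar a) (neg a) 0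
  rootIn_tight : ∀ {y a}, y ∈ V → rootIn y = some a → s.Reach ψ (neg a) y 0
  rootOut_tight : ∀ {y a}, y ∈ V → rootOut y = some a → y = neg a ∨ s.Link ψ y (neg a) 0

/-- The condition that the invariant puts on an edge `(x, y)` of reduced weight `X`. -/
structure EdgeOK (s : State α) (ψ : Vtx α → ℝ) (x y : Vtx α) (X : ℝ) : Prop where
  ein : ∀ p, InBase x p → x.inParent = some y ∨ y.outParent = some x ∨
    ∃ a, rootIn y = some a ∧ s.Reach ψ p (neg a) X
  eout : ∀ p, OutBase y p → y.outParent = some x ∨ x.inParent = some y ∨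
    ∃ a, rootOut x = some a ∧ s.Reach ψ (neg a) p X
  lvl_in : ∀ b t, y = hub b t → x.inParent ≠ none → x.inParent = some y ∨ x.level ≤ t
  lvl_out : ∀ b t, x = hub b t → y.outParent ≠ none → y.outParent = some x ∨ y.level ≤ t
  outNeg : ∀ a, y.outParent ≠ some (neg a)

/-- The condition on a deferred edge into an N-Steiner vertex. -/
def DeferIn (s : State α) (ψ : Vtx α → ℝ) (V : Finset (Vtx α)) (e : Vtx α × Vtx α × ℝ) : Prop :=
  ∃ a t, e.2.1 = hub a t ∧ e.1 ∈ V ∧ hub a t ∈ V ∧ e.1.level ≤ t ∧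
    0 ≤ e.2.2 + ψ e.1 - ψ (hub a t) ∧
    ∀ q, Anc q e.1 → s.Reach ψ q (neg a) (e.2.2 + ψ e.1 - ψ (hub a t))

/-- The condition on a deferred edge out of an N-Steiner vertex. -/
def DeferOut (s : State α) (ψ : Vtx α → ℝ) (V : Finset (Vtx α)) (e : Vtx α × Vtx α × ℝ) : Prop :=
  ∃ a t, e.1 = hub a t ∧ e.2.1 ∈ V ∧ hub a t ∈ V ∧ e.2.1.level ≤ t ∧
    0 ≤ e.2.2 + ψ (hub a t) - ψ e.2.1 ∧
    ∀ q, Anc q e.2.1 → s.Reach ψ (neg a) q (e.2.2 + ψ (hub a t) - ψ e.2.1)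

/-- The invariant of the algorithm: `ψ` is a feasible potential under which the edges between
Steiner vertices and their parents are tight, and every link of a Steiner vertex to or from a
negative vertex is accompanied by one of its parent. -/
structure Core (ψ : Vtx α → ℝ) (V : Finset (Vtx α)) (s : State α) : Prop
    extends Frame ψ V s where
  edge : ∀ {x y X}, s.Link ψ x y X → EdgeOK s ψ x y X
  deferIn : ∀ e ∈ s.fIn, DeferIn s ψ V e
  deferOut : ∀ e ∈ s.fOut, DeferOut s ψ V e

/-- All links of `s` are links of `s'`. -/
def Sub (ψ : Vtx α → ℝ) (s s' : State α) : Prop := ∀ x y X, s.Link ψ x y X → s'.Link ψ x y X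

/-! ### Passing the invariant to a changed graph -/

section Basic

variable {s s' s'' : State α} {ψ φ : Vtx α → ℝ} {V : Finset (Vtx α)} {x y p q : Vtx α} {X Y W : ℝ}

theorem Sub.refl (ψ : Vtx α → ℝ) (s : State α) : Sub ψ s s := fun _ _ _ h => h

theorem Sub.trans (h : Sub ψ s s') (h' : Sub ψ s' s'') : Sub ψ s s'' :=
  fun _ _ _ hl => h' _ _ _ (h _ _ _ hl)

theorem Sub.addEdge : Sub ψ s (s.addEdge x y W) := fun _ _ _ h => State.link_addEdge.2 (Or.inl h)

theorem Sub.reach (h : Sub ψ s s') (hr : s.Reach ψ x y X) : s'.Reach ψ x y X := by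
  rcases hr with hr | ⟨c, hc, hr⟩
  · exact Or.inl (h _ _ _ hr)
  · exact Or.inr ⟨c, hc, h _ _ _ hr⟩

/-- A change of the graph that keeps the values of `Reach`. -/
def ReachSub (ψ : Vtx α → ℝ) (s s' : State α) : Prop :=
  ∀ x y X, s.Reach ψ x y X → s'.Reach ψ x y X

theorem Sub.reachSub (h : Sub ψ s s') : ReachSub ψ s s' := fun _ _ _ => h.reach

theorem EdgeOK.of_reachSub (h : ReachSub ψ s s') (he : EdgeOK s ψ x y X) : EdgeOK s' ψ x y X where
  ein p hp := by
    rcases he.ein p hp with h1 | h1 | ⟨a, ha, hr⟩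
    · exact Or.inl h1
    · exact Or.inr (Or.inl h1)
    · exact Or.inr (Or.inr ⟨a, ha, h _ _ _ hr⟩)
  eout p hp := by
    rcases he.eout p hp with h1 | h1 | ⟨a, ha, hr⟩
    · exact Or.inl h1
    · exact Or.inr (Or.inl h1)
    · exact Or.inr (Or.inr ⟨a, ha, h _ _ _ hr⟩)
  lvl_in := he.lvl_in
  lvl_out := he.lvl_out
  outNeg := he.outNeg

theorem EdgeOK.mono (he : EdgeOK s ψ x y X) (hXY : X ≤ Y) : EdgeOK s ψ x y Y where
  ein p hp := by
    rcases he.ein p hp with h1 | h1 | ⟨a, ha, hr⟩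
    · exact Or.inl h1
    · exact Or.inr (Or.inl h1)
    · exact Or.inr (Or.inr ⟨a, ha, hr.mono hXY⟩)
  eout p hp := by
    rcases he.eout p hp with h1 | h1 | ⟨a, ha, hr⟩
    · exact Or.inl h1
    · exact Or.inr (Or.inl h1)
    · exact Or.inr (Or.inr ⟨a, ha, hr.mono hXY⟩)
  lvl_in := he.lvl_in
  lvl_out := he.lvl_out
  outNeg := he.outNeg

theorem DeferIn.of_reachSub {e : Vtx α × Vtx α × ℝ} {V' : Finset (Vtx α)} (h : ReachSub ψ s s')
    (hV : V ⊆ V') (he : DeferIn s ψ V e) : DeferIn s' ψ V' e := by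
  obtain ⟨a, t, h1, h2, h3, h4, h5, h6⟩ := he
  exact ⟨a, t, h1, hV h2, hV h3, h4, h5, fun q hq => h _ _ _ (h6 q hq)⟩

theorem DeferOut.of_reachSub {e : Vtx α × Vtx α × ℝ} {V' : Finset (Vtx α)} (h : ReachSub ψ s s')
    (hV : V ⊆ V') (he : DeferOut s ψ V e) : DeferOut s' ψ V' e := by
  obtain ⟨a, t, h1, h2, h3, h4, h5, h6⟩ := he
  exact ⟨a, t, h1, hV h2, hV h3, h4, h5, fun q hq => h _ _ _ (h6 q hq)⟩

/-- The frame survives any change that adds links of nonnegative reduced weight. -/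
theorem Frame.of_sub (hs : Frame ψ V s) (h : Sub ψ s s')
    (hf : ∀ {x y X}, s'.Link ψ x y X → 0 ≤ X) : Frame ψ V s' where
  neg_mem := hs.neg_mem
  bar_mem := hs.bar_mem
  inS_mem := hs.inS_mem
  outS_mem := hs.outS_mem
  hub_mem := hs.hub_mem
  feas := hf
  tight_inS hx := h _ _ _ (hs.tight_inS hx)
  tight_outS hx := h _ _ _ (hs.tight_outS hx)
  tight_bar a := h _ _ _ (hs.tight_bar a)
  tight_neg a := h _ _ _ (hs.tight_neg a)
  rootIn_tight hy ha := h.reach (hs.rootIn_tight hy ha)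
  rootOut_tight hy ha := (hs.rootOut_tight hy ha).imp id (h _ _ _)

theorem Frame.addEdge (hs : Frame ψ V s) (hW : 0 ≤ W + ψ x - ψ y) :
    Frame ψ V (s.addEdge x y W) :=
  hs.of_sub Sub.addEdge fun hl => by
    rcases State.link_addEdge.1 hl with h | ⟨-, -, h⟩
    · exact hs.feas h
    · linarith

/-- Feasibility bounds the reduced weight from below, the link from above. So a weight that the
algorithm reads off a tight edge is a difference of potentials, no matter which edges have been
added in the meantime. -/
theorem Frame.w_eq (hs : Frame ψ V s) (h : s.Link ψ x y 0) :
    s.w x y = ((ψ y - ψ x : ℝ) : WithTop ℝ) := by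
  have h1 := hs.feas (State.link_wt ψ h.ne_top)
  have h2 := (State.link_iff.1 h).2
  rw [← State.coe_wt h.ne_top]
  congr 1
  linarith

theorem Frame.wt_eq (hs : Frame ψ V s) (h : s.Link ψ x y 0) : s.wt x y = ψ y - ψ x := by
  rw [State.wt, hs.w_eq h, WithTop.untopD_coe]

/-- The same for an edge of r that may exist only as a path through r̄: neither realisation can be
cheaper than the potential difference, and one of them attains it. -/
theorem Frame.wtNeg_eq {a : α} (hs : Frame ψ V s) (h : s.Reach ψ (neg a) y 0) :
    s.wtNeg a y = ψ y - ψ (neg a) := by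
  have hb := hs.w_eq (hs.tight_bar a)
  have h1 : ∀ c : ℝ, s.w (neg a) y = c → ψ y - ψ (neg a) ≤ c := by
    intro c hc
    have := hs.feas (State.link_wt ψ (by rw [hc]; exact WithTop.coe_ne_top))
    rw [State.wt, hc, WithTop.untopD_coe] at this
    linarith
  have h2 : ∀ c : ℝ, s.w (bar a) y = c → ψ y - ψ (bar a) ≤ c := by
    intro c hc
    have := hs.feas (State.link_wt ψ (by rw [hc]; exact WithTop.coe_ne_top))
    rw [State.wt, hc, WithTop.untopD_coe] at this
    linarith
  have key : min (s.w (neg a) y) (s.w (neg a) (bar a) + s.w (bar a) y) =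
      ((ψ y - ψ (neg a) : ℝ) : WithTop ℝ) := by
    rw [hb]
    apply le_antisymm
    · rcases h with h | ⟨c, hc, h⟩
      · exact (min_le_left _ _).trans (by rw [hs.w_eq h])
      · cases hc
        refine (min_le_right _ _).trans ?_
        rw [hs.w_eq h, ← WithTop.coe_add, WithTop.coe_le_coe]
        linarith
    · refine le_min ?_ ?_
      · cases hc : s.w (neg a) y using WithTop.recTopCoe with
        | top => exact le_top
        | coe c => exact WithTop.coe_le_coe.2 (h1 c hc)
      · cases hc : s.w (bar a) y using WithTop.recTopCoe with
        | top => simp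
        | coe c =>
          rw [← WithTop.coe_add, WithTop.coe_le_coe]
          have := h2 c hc
          linarith
  rw [State.wtNeg, key, WithTop.untopD_coe]

/-- An edge of r may become one of r̄, so links are not preserved; `Reach` identifies the two, which
is why the invariant is phrased with it. -/
theorem Frame.reachSub_redirect (hs : Frame ψ V s) (a : α) : ReachSub ψ s (s.redirect a) := by
  have ht := hs.w_eq (hs.tight_bar a)
  intro x y X h
  rcases h with h | ⟨c, rfl, h⟩
  · by_cases hx : x = neg a
    · subst hx
      by_cases hy : y = bar a
      · exact Or.inl ((State.link_redirect ht).2 (Or.inl ⟨rfl, hy, h⟩))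
      · exact Or.inr ⟨a, rfl, (State.link_redirect ht).2 (Or.inr (Or.inr ⟨rfl, hy, h⟩))⟩
    · exact Or.inl ((State.link_redirect ht).2 (Or.inr (Or.inl ⟨hx, h⟩)))
  · exact Or.inr ⟨c, rfl, (State.link_redirect ht).2 (Or.inr (Or.inl ⟨by simp, h⟩))⟩

theorem Core.redirect (hs : Core ψ V s) (a : α) : Core ψ V (s.redirect a) := by
  have ht := hs.w_eq (hs.tight_bar a)
  have hR := hs.reachSub_redirect a
  have keep : ∀ {x y X}, x ≠ neg a → s.Link ψ x y X → (s.redirect a).Link ψ x y X :=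
    fun hx h => (State.link_redirect ht).2 (Or.inr (Or.inl ⟨hx, h⟩))
  refine ⟨⟨hs.neg_mem, hs.bar_mem, hs.inS_mem, hs.outS_mem, hs.hub_mem, ?_, ?_, ?_, ?_, ?_, ?_,
    ?_⟩, ?_, ?_, ?_⟩
  · intro x y X h
    rcases (State.link_redirect ht).1 h with ⟨-, -, h⟩ | ⟨-, h⟩ | ⟨-, -, h⟩ <;> exact hs.feas h
  · intro p t l h
    exact keep (by simp) (hs.tight_inS h)
  · intro p t l h
    exact keep ((hs.outS_mem h).2.2.2 a) (hs.tight_outS h)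
  · intro c
    by_cases hc : c = a
    · subst hc; exact (State.link_redirect ht).2 (Or.inl ⟨rfl, rfl, hs.tight_bar c⟩)
    · exact keep (by simpa using hc) (hs.tight_bar c)
  · intro c
    exact keep (by simp) (hs.tight_neg c)
  · intro y c hy hc
    exact hR _ _ _ (hs.rootIn_tight hy hc)
  · intro y c hy hc
    rcases hs.rootOut_tight hy hc with h | h
    · exact Or.inl h
    · by_cases hya : y = neg a
      · left; subst hya; simp [rootOut] at hc; rw [hc]
      · exact Or.inr (keep hya h)
  · intro x y X h
    rcases (State.link_redirect ht).1 h with ⟨-, -, h⟩ | ⟨-, h⟩ | ⟨rfl, -, h⟩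
    · exact (hs.edge h).of_reachSub hR
    · exact (hs.edge h).of_reachSub hR
    -- A redirected edge starts in r̄, which lies over no vertex and has the same `rootOut` as r. By
    -- `outNeg` it is never the tight edge of an out-Steiner vertex of r.
    · have he := (hs.edge h).of_reachSub hR
      refine ⟨?_, ?_, ?_, ?_, he.outNeg⟩
      · rintro p (hp | ⟨v, hv, -⟩)
        · simp [inParent] at hp
        · simp [outParent] at hv
      · intro p hp
        rcases he.eout p hp with h1 | h1 | ⟨b, hb, hr⟩
        · exact absurd h1 (he.outNeg a)
        · simp [inParent] at h1
        · exact Or.inr (Or.inr ⟨b, by simpa [rootOut] using hb, hr⟩)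
      · intro b t _ hx; simp [inParent] at hx
      · intro b t hx; simp at hx
  · intro e he
    exact (hs.deferIn e he).of_reachSub hR subset_rfl
  · intro e he
    exact (hs.deferOut e he).of_reachSub hR subset_rfl

end Basic

/-! ### The effect of `addEdgeIn` and `addEdgeOut` -/

section AddEdge

theorem addEdgeIn_verts (u v : Vtx α) (W : ℝ) (s : State α) :
    (addEdgeIn u v W s).verts = s.verts := by
  induction u generalizing v W s with
  | neg c => rfl
  | bar c => rfl
  | hub c t => rfl
  | inS p t l ih =>
    cases v <;> simp only [addEdgeIn] <;> (try rw [ih]) <;> (try rfl)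
    split_ifs <;> simp [ih, State.addEdge]
  | outS p t l ih => simp only [addEdgeIn]; rw [ih]; rfl

theorem addEdgeIn_heavy (u v : Vtx α) (W : ℝ) (s : State α) :
    (addEdgeIn u v W s).heavy = s.heavy := by
  induction u generalizing v W s with
  | neg c => rfl
  | bar c => rfl
  | hub c t => rfl
  | inS p t l ih =>
    cases v <;> simp only [addEdgeIn] <;> (try rw [ih]) <;> (try rfl)
    split_ifs <;> simp [ih, State.addEdge]
  | outS p t l ih => simp only [addEdgeIn]; rw [ih]; rfl

theorem addEdgeIn_fOut (u v : Vtx α) (W : ℝ) (s : State α) :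
    (addEdgeIn u v W s).fOut = s.fOut := by
  induction u generalizing v W s with
  | neg c => rfl
  | bar c => rfl
  | hub c t => rfl
  | inS p t l ih =>
    cases v <;> simp only [addEdgeIn] <;> (try rw [ih]) <;> (try rfl)
    split_ifs <;> simp [ih, State.addEdge]
  | outS p t l ih => simp only [addEdgeIn]; rw [ih]; rfl

theorem addEdgeIn_neg_fIn (u : Vtx α) (a : α) (W : ℝ) (s : State α) :
    (addEdgeIn u (neg a) W s).fIn = s.fIn := by
  induction u generalizing W s with
  | neg c => rfl
  | bar c => rfl
  | hub c t => rfl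
  | inS p t l ih => simp only [addEdgeIn]; rw [ih]; rfl
  | outS p t l ih => simp only [addEdgeIn]; rw [ih]; rfl

theorem addEdgeOut_verts (u v : Vtx α) (W : ℝ) (s : State α) :
    (addEdgeOut u v W s).verts = s.verts := by
  induction u generalizing v W s with
  | neg c => rfl
  | bar c => rfl
  | hub c t => rfl
  | outS p t l ih =>
    cases v <;> simp only [addEdgeOut] <;> (try rw [ih]) <;> (try rfl)
    split_ifs <;> simp [ih, State.addEdge]
  | inS p t l ih => simp only [addEdgeOut]; rw [ih]; rfl

theorem addEdgeOut_heavy (u v : Vtx α) (W : ℝ) (s : State α) :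
    (addEdgeOut u v W s).heavy = s.heavy := by
  induction u generalizing v W s with
  | neg c => rfl
  | bar c => rfl
  | hub c t => rfl
  | outS p t l ih =>
    cases v <;> simp only [addEdgeOut] <;> (try rw [ih]) <;> (try rfl)
    split_ifs <;> simp [ih, State.addEdge]
  | inS p t l ih => simp only [addEdgeOut]; rw [ih]; rfl

theorem addEdgeOut_fIn (u v : Vtx α) (W : ℝ) (s : State α) :
    (addEdgeOut u v W s).fIn = s.fIn := by
  induction u generalizing v W s with
  | neg c => rfl
  | bar c => rfl
  | hub c t => rfl
  | outS p t l ih =>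
    cases v <;> simp only [addEdgeOut] <;> (try rw [ih]) <;> (try rfl)
    split_ifs <;> simp [ih, State.addEdge]
  | inS p t l ih => simp only [addEdgeOut]; rw [ih]; rfl

theorem addEdgeOut_neg_fOut (u : Vtx α) (a : α) (W : ℝ) (s : State α) :
    (addEdgeOut u (neg a) W s).fOut = s.fOut := by
  induction u generalizing W s with
  | neg c => rfl
  | bar c => rfl
  | hub c t => rfl
  | inS p t l ih => simp only [addEdgeOut]; rw [ih]; rfl
  | outS p t l ih => simp only [addEdgeOut]; rw [ih]; rfl

variable {s : State α} {ψ : Vtx α → ℝ} {V : Finset (Vtx α)}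

theorem anc_inS_iff {q p : Vtx α} {t l : ℕ} : Anc q (inS p t l) ↔ q = inS p t l ∨ Anc q p := by
  constructor
  · intro h; cases h with
    | refl => exact Or.inl rfl
    | inS h => exact Or.inr h
  · rintro (rfl | h)
    · exact Anc.refl _
    · exact Anc.inS h

theorem anc_outS_iff {q p : Vtx α} {t l : ℕ} : Anc q (outS p t l) ↔ q = outS p t l ∨ Anc q p := by
  constructor
  · intro h; cases h with
    | refl => exact Or.inl rfl
    | outS h => exact Or.inr h
  · rintro (rfl | h)
    · exact Anc.refl _
    · exact Anc.outS h

theorem Anc.trans {x y z : Vtx α} (h : Anc x y) (h' : Anc y z) : Anc x z := by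
  induction h' with
  | refl => exact h
  | inS _ ih => exact Anc.inS ih
  | outS _ ih => exact Anc.outS ih

theorem Frame.anc {q u : Vtx α} (hs : Frame ψ V s) (h : Anc q u) (hu : u ∈ V) :
    q ∈ V ∧ q.level ≤ u.level := by
  induction h with
  | refl => exact ⟨hu, le_rfl⟩
  | inS _ ih =>
    obtain ⟨h1, h2, -⟩ := hs.inS_mem hu
    exact ⟨(ih h1).1, (ih h1).2.trans h2.le⟩
  | outS _ ih =>
    obtain ⟨h1, h2, -⟩ := hs.outS_mem hu
    exact ⟨(ih h1).1, (ih h1).2.trans h2.le⟩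

/-- Each recursive call moves to the parent along a tight edge. Hence one link is added from every
ancestor of `u`, and all of them have the same reduced weight. -/
theorem addEdgeIn_neg_spec (u : Vtx α) (a : α) (W : ℝ) (s : State α) (hs : Frame ψ V s)
    (hu : u ∈ V) (hW : 0 ≤ W + ψ u - ψ (neg a)) :
    Frame ψ V (addEdgeIn u (neg a) W s) ∧
      ∀ x y X, (addEdgeIn u (neg a) W s).Link ψ x y X ↔
        s.Link ψ x y X ∨ (Anc x u ∧ y = neg a ∧ W + ψ u - ψ (neg a) ≤ X) := by
  have base : ∀ (u : Vtx α), 0 ≤ W + ψ u - ψ (neg a) → (∀ x, Anc x u ↔ x = u) →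
      Frame ψ V (s.addEdge u (neg a) W) ∧
      ∀ x y X, (s.addEdge u (neg a) W).Link ψ x y X ↔
        s.Link ψ x y X ∨ (Anc x u ∧ y = neg a ∧ W + ψ u - ψ (neg a) ≤ X) := by
    intro u hW hA
    refine ⟨hs.addEdge hW, fun x y X => ?_⟩
    rw [State.link_addEdge, hA]
  induction u generalizing W s with
  | neg c => exact base _ hW fun x => ⟨fun h => by cases h; rfl, fun h => h ▸ Anc.refl _⟩
  | bar c => exact base _ hW fun x => ⟨fun h => by cases h; rfl, fun h => h ▸ Anc.refl _⟩
  | hub c t => exact base _ hW fun x => ⟨fun h => by cases h; rfl, fun h => h ▸ Anc.refl _⟩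
  | inS p t l ih =>
    simp only [addEdgeIn]
    have hs1 := hs.addEdge (x := inS p t l) (y := neg a) (W := W) hW
    have hwt : (s.addEdge (inS p t l) (neg a) W).wt (inS p t l) p = ψ p - ψ (inS p t l) :=
      hs1.wt_eq (hs1.tight_inS hu)
    rw [hwt]
    have e : W - (ψ p - ψ (inS p t l)) + ψ p - ψ (neg a) = W + ψ (inS p t l) - ψ (neg a) := by ring
    obtain ⟨h1, h2⟩ := ih (W - (ψ p - ψ (inS p t l))) (s.addEdge (inS p t l) (neg a) W) hs1
      (hs.inS_mem hu).1 (by rw [e]; exact hW) (by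
        intro u hW' hA
        refine ⟨hs1.addEdge hW', fun x y X => ?_⟩
        rw [State.link_addEdge, hA])
    refine ⟨h1, fun x y X => ?_⟩
    rw [h2, State.link_addEdge, e, anc_inS_iff]
    tauto
  | outS p t l ih =>
    simp only [addEdgeIn]
    have hs1 := hs.addEdge (x := outS p t l) (y := neg a) (W := W) hW
    have hwt : (s.addEdge (outS p t l) (neg a) W).wt p (outS p t l) = ψ (outS p t l) - ψ p :=
      hs1.wt_eq (hs1.tight_outS hu)
    rw [hwt]
    have e : W + (ψ (outS p t l) - ψ p) + ψ p - ψ (neg a) = W + ψ (outS p t l) - ψ (neg a) := by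
      ring
    obtain ⟨h1, h2⟩ := ih (W + (ψ (outS p t l) - ψ p)) (s.addEdge (outS p t l) (neg a) W) hs1
      (hs.outS_mem hu).1 (by rw [e]; exact hW) (by
        intro u hW' hA
        refine ⟨hs1.addEdge hW', fun x y X => ?_⟩
        rw [State.link_addEdge, hA])
    refine ⟨h1, fun x y X => ?_⟩
    rw [h2, State.link_addEdge, e, anc_outS_iff]
    tauto

theorem addEdgeOut_neg_spec (u : Vtx α) (a : α) (W : ℝ) (s : State α) (hs : Frame ψ V s)
    (hu : u ∈ V) (hW : 0 ≤ W + ψ (neg a) - ψ u) :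
    Frame ψ V (addEdgeOut u (neg a) W s) ∧
      ∀ x y X, (addEdgeOut u (neg a) W s).Link ψ x y X ↔
        s.Link ψ x y X ∨ (Anc y u ∧ x = neg a ∧ W + ψ (neg a) - ψ u ≤ X) := by
  have base : ∀ (s : State α) (W : ℝ) (u : Vtx α), Frame ψ V s → 0 ≤ W + ψ (neg a) - ψ u →
      (∀ x, Anc x u ↔ x = u) →
      Frame ψ V (s.addEdge (neg a) u W) ∧
      ∀ x y X, (s.addEdge (neg a) u W).Link ψ x y X ↔
        s.Link ψ x y X ∨ (Anc y u ∧ x = neg a ∧ W + ψ (neg a) - ψ u ≤ X) := by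
    intro s W u hs hW hA
    refine ⟨hs.addEdge hW, fun x y X => ?_⟩
    rw [State.link_addEdge, hA]
    tauto
  induction u generalizing W s with
  | neg c => exact base _ _ _ hs hW fun x => ⟨fun h => by cases h; rfl, fun h => h ▸ Anc.refl _⟩
  | bar c => exact base _ _ _ hs hW fun x => ⟨fun h => by cases h; rfl, fun h => h ▸ Anc.refl _⟩
  | hub c t => exact base _ _ _ hs hW fun x => ⟨fun h => by cases h; rfl, fun h => h ▸ Anc.refl _⟩
  | inS p t l ih =>
    simp only [addEdgeOut]
    have hs1 := hs.addEdge (y := inS p t l) (x := neg a) (W := W) hW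
    have hwt : (s.addEdge (neg a) (inS p t l) W).wt (inS p t l) p = ψ p - ψ (inS p t l) :=
      hs1.wt_eq (hs1.tight_inS hu)
    rw [hwt]
    have e : W + (ψ p - ψ (inS p t l)) + ψ (neg a) - ψ p = W + ψ (neg a) - ψ (inS p t l) := by ring
    obtain ⟨h1, h2⟩ := ih (W + (ψ p - ψ (inS p t l))) (s.addEdge (neg a) (inS p t l) W) hs1
      (hs.inS_mem hu).1 (by rw [e]; exact hW)
    refine ⟨h1, fun x y X => ?_⟩
    rw [h2, State.link_addEdge, e, anc_inS_iff]
    tauto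
  | outS p t l ih =>
    simp only [addEdgeOut]
    have hs1 := hs.addEdge (y := outS p t l) (x := neg a) (W := W) hW
    have hwt : (s.addEdge (neg a) (outS p t l) W).wt p (outS p t l) = ψ (outS p t l) - ψ p :=
      hs1.wt_eq (hs1.tight_outS hu)
    rw [hwt]
    have e : W - (ψ (outS p t l) - ψ p) + ψ (neg a) - ψ p = W + ψ (neg a) - ψ (outS p t l) := by
      ring
    obtain ⟨h1, h2⟩ := ih (W - (ψ (outS p t l) - ψ p)) (s.addEdge (neg a) (outS p t l) W) hs1
      (hs.outS_mem hu).1 (by rw [e]; exact hW)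
    refine ⟨h1, fun x y X => ?_⟩
    rw [h2, State.link_addEdge, e, anc_outS_iff]
    tauto

/-- The effect of `AddEdgeIn` with an N-Steiner vertex as target. -/
structure InHubSpec (ψ : Vtx α → ℝ) (V : Finset (Vtx α)) (u : Vtx α) (a : α) (t : ℕ) (W : ℝ)
    (s s' : State α) : Prop where
  frame : Frame ψ V s'
  sub : Sub ψ s s'
  new : ∀ x y X, s'.Link ψ x y X → s.Link ψ x y X ∨
    (Anc x u ∧ (y = neg a ∨ y = hub a t) ∧ W + ψ u - ψ (hub a t) ≤ X)
  close : ∀ q p t' l, Anc (inS p t' l) u → Anc q p →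
    s'.Link ψ q (neg a) (W + ψ u - ψ (hub a t))
  defer : ∀ e ∈ s'.fIn, e ∈ s.fIn ∨ ∃ p t' l, Anc (inS p t' l) u ∧
    e = (p, hub a t, W + ψ u - ψ (hub a t) - ψ p + ψ (hub a t))
  neg_or : ∀ x X, s'.Link ψ x (neg a) X → s.Link ψ x (neg a) X ∨
    ∃ p t' l, Anc (inS p t' l) u ∧ Anc x p ∧ W + ψ u - ψ (hub a t) ≤ X
  sign : (∀ p t' l, outS p t' l ∈ V → 0 ≤ ψ (outS p t' l) - ψ p) → (0 ≤ W ∨ u.inParent ≠ none) →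
    ∀ x X, s'.Link ψ x (hub a t) X → s.Link ψ x (hub a t) X ∨ x = u ∨
      0 ≤ X - ψ x + ψ (hub a t)
  self : s'.Link ψ u (hub a t) (W + ψ u - ψ (hub a t))

theorem InHubSpec.base (hs : Frame ψ V s) {u : Vtx α} {a : α} {t : ℕ} {W : ℝ}
    (hW : 0 ≤ W + ψ u - ψ (hub a t)) (hA : ∀ x, Anc x u ↔ x = u) (hu : u.inParent = none) :
    InHubSpec ψ V u a t W s (s.addEdge u (hub a t) W) where
  frame := hs.addEdge hW
  sub := Sub.addEdge
  new x y X h := by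
    rw [State.link_addEdge] at h
    rw [hA]; tauto
  close q p t' l h1 h2 := by
    rw [hA] at h1; rw [← h1] at hu; simp [inParent] at hu
  defer e he := Or.inl he
  neg_or x X h := by
    rw [State.link_addEdge] at h
    simp at h
    exact Or.inl h
  sign _ _ x X h := by
    rw [State.link_addEdge] at h; tauto
  self := State.link_addEdge.2 (Or.inr ⟨rfl, rfl, le_rfl⟩)

/-- Again all added links have the reduced weight of the first, because the parent edges and those
between the N-Steiner vertex and its negative vertex are tight. The recursion towards the N-Steiner
vertex may stop at an in-parent, but the accompanying call towards the negative vertex never does,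
which gives `close`. For `sign`: passing to an out-parent adds a nonnegative weight, and passing to
an in-parent happens only if the new weight is nonnegative. -/
theorem addEdgeIn_hub_spec (u : Vtx α) (a : α) (t : ℕ) (W : ℝ) (s : State α) (hs : Frame ψ V s)
    (hu : u ∈ V) (ha : hub a t ∈ V) (hW : 0 ≤ W + ψ u - ψ (hub a t)) :
    InHubSpec ψ V u a t W s (addEdgeIn u (hub a t) W s) := by
  induction u generalizing W s with
  | neg c =>
    exact InHubSpec.base hs hW (fun x => ⟨fun h => by cases h; rfl, fun h => h ▸ Anc.refl _⟩) rfl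
  | bar c =>
    exact InHubSpec.base hs hW (fun x => ⟨fun h => by cases h; rfl, fun h => h ▸ Anc.refl _⟩) rfl
  | hub c t =>
    exact InHubSpec.base hs hW (fun x => ⟨fun h => by cases h; rfl, fun h => h ▸ Anc.refl _⟩) rfl
  | outS p t' l ih =>
    simp only [addEdgeIn]
    have hs1 := hs.addEdge (x := outS p t' l) (y := hub a t) (W := W) hW
    have hwt : (s.addEdge (outS p t' l) (hub a t) W).wt p (outS p t' l) = ψ (outS p t' l) - ψ p :=
      hs1.wt_eq (hs1.tight_outS hu)
    rw [hwt]
    have e : W + (ψ (outS p t' l) - ψ p) + ψ p - ψ (hub a t) =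
      W + ψ (outS p t' l) - ψ (hub a t) := by ring
    have h := ih (W + (ψ (outS p t' l) - ψ p)) _ hs1 (hs.outS_mem hu).1 (by rw [e]; exact hW)
    have hclose := h.close
    have hdefer := h.defer
    have hneg := h.neg_or
    have hself := h.self
    rw [e] at hclose hdefer hneg hself
    refine ⟨h.frame, Sub.addEdge.trans h.sub, ?_, ?_, ?_, ?_, ?_, ?_⟩
    · intro x y X hl
      rcases h.new x y X hl with h1 | ⟨h1, h2, h3⟩
      · rw [State.link_addEdge] at h1
        rcases h1 with h1 | ⟨rfl, rfl, h3⟩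
        · exact Or.inl h1
        · exact Or.inr ⟨Anc.refl _, Or.inr rfl, h3⟩
      · rw [e] at h3
        exact Or.inr ⟨Anc.outS h1, h2, h3⟩
    · intro q p' t'' l' h1 h2
      rw [anc_outS_iff] at h1
      simp only [reduceCtorEq, false_or] at h1
      exact hclose q p' t'' l' h1 h2
    · intro f hf
      rcases hdefer f hf with h1 | ⟨p', t'', l', h1, h2⟩
      · exact Or.inl h1
      · exact Or.inr ⟨p', t'', l', Anc.outS h1, h2⟩
    · intro x X hl
      rcases hneg x X hl with h1 | ⟨p', t'', l', h1, h2⟩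
      · rw [State.link_addEdge] at h1
        simp at h1
        exact Or.inl h1
      · exact Or.inr ⟨p', t'', l', Anc.outS h1, h2⟩
    · intro hsg hW0 x X hl
      have hW0' : 0 ≤ W := by simpa [inParent] using hW0
      have hp := hsg p t' l hu
      rcases h.sign hsg (Or.inl (by linarith)) x X hl with h1 | rfl | h1
      · rw [State.link_addEdge] at h1; tauto
      · rcases h.new _ _ X hl with h1 | ⟨-, -, h3⟩
        · rw [State.link_addEdge] at h1; tauto
        · right; right; linarith
      · exact Or.inr (Or.inr h1)
    · exact h.sub _ _ _ (State.link_addEdge.2 (Or.inr ⟨rfl, rfl, le_rfl⟩))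
  | inS p t' l ih =>
    simp only [addEdgeIn]
    have hs1 := hs.addEdge (x := inS p t' l) (y := hub a t) (W := W) hW
    obtain ⟨hpV, -, hpn⟩ := hs.inS_mem hu
    have hwt : (s.addEdge (inS p t' l) (hub a t) W).wt (inS p t' l) p = ψ p - ψ (inS p t' l) :=
      hs1.wt_eq (hs1.tight_inS hu)
    have hwn : (s.addEdge (inS p t' l) (hub a t) W).wtNeg a (hub a t) = ψ (hub a t) - ψ (neg a) :=
      hs1.wtNeg_eq (hs1.rootIn_tight ha rfl)
    rw [hwt, hwn]
    set W' := W - (ψ p - ψ (inS p t' l)) with hW'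
    have e : W' + ψ p - ψ (hub a t) = W + ψ (inS p t' l) - ψ (hub a t) := by rw [hW']; ring
    have e2 : W' - (ψ (hub a t) - ψ (neg a)) + ψ p - ψ (neg a) =
      W + ψ (inS p t' l) - ψ (hub a t) := by rw [hW']; ring
    set s1 : State α := { s.addEdge (inS p t' l) (hub a t) W with
      fIn := insert (p, hub a t, W') (s.addEdge (inS p t' l) (hub a t) W).fIn } with hs1d
    have hF1 : Frame ψ V s1 := hs1.of_sub (fun _ _ _ h => h) (fun h => hs1.feas h)
    have hl1 : ∀ x y X, s1.Link ψ x y X ↔ s.Link ψ x y X ∨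
        (x = inS p t' l ∧ y = hub a t ∧ W + ψ (inS p t' l) - ψ (hub a t) ≤ X) :=
      fun x y X => State.link_addEdge
    -- Of the guarded call only an upper bound on the new links is kept; the links demanded by
    -- `close` come from the unconditional call that follows.
    set s2 : State α := if 0 ≤ W' then addEdgeIn p (hub a t) W' s1 else s1 with hs2d
    have hs2 : Frame ψ V s2 ∧ Sub ψ s1 s2 ∧
        (∀ x y X, s2.Link ψ x y X → s1.Link ψ x y X ∨
          (Anc x p ∧ (y = neg a ∨ y = hub a t) ∧ W + ψ (inS p t' l) - ψ (hub a t) ≤ X)) ∧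
        (∀ e ∈ s2.fIn, e ∈ s1.fIn ∨ ∃ p' t'' l', Anc (inS p' t'' l') p ∧
          e = (p', hub a t, W + ψ (inS p t' l) - ψ (hub a t) - ψ p' + ψ (hub a t))) ∧
        (∀ x X, s2.Link ψ x (neg a) X → s1.Link ψ x (neg a) X ∨
          (Anc x p ∧ W + ψ (inS p t' l) - ψ (hub a t) ≤ X)) ∧
        ((∀ p t' l, outS p t' l ∈ V → 0 ≤ ψ (outS p t' l) - ψ p) →
          ∀ x X, s2.Link ψ x (hub a t) X → s1.Link ψ x (hub a t) X ∨
            0 ≤ X - ψ x + ψ (hub a t)) := by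
      by_cases hc : 0 ≤ W'
      · have h := ih W' s1 hF1 hpV (by rw [e]; exact hW)
        have hdefer := h.defer
        have hneg := h.neg_or
        have hnew := h.new
        rw [e] at hdefer hneg hnew
        rw [if_pos hc] at hs2d
        rw [hs2d]
        refine ⟨h.frame, h.sub, hnew, hdefer, ?_, ?_⟩
        · intro x X hl
          rcases hneg x X hl with h1 | ⟨p', t'', l', h1, h2, h3⟩
          · exact Or.inl h1
          · exact Or.inr ⟨(h2.trans (Anc.inS (Anc.refl _))).trans h1, h3⟩
        · intro hsg x X hl
          rcases h.sign hsg (Or.inl hc) x X hl with h1 | rfl | h1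
          · exact Or.inl h1
          · rcases hnew _ _ X hl with h1 | ⟨-, -, h3⟩
            · exact Or.inl h1
            · right; linarith
          · exact Or.inr h1
      · rw [if_neg hc] at hs2d
        rw [hs2d]
        exact ⟨hF1, Sub.refl _ _, fun _ _ _ h => Or.inl h, fun _ h => Or.inl h,
          fun _ _ h => Or.inl h, fun _ _ _ h => Or.inl h⟩
    obtain ⟨hF2, hsub2, hnew2, hdef2, hneg2, hsign2⟩ := hs2
    obtain ⟨hF3, hl3⟩ := addEdgeIn_neg_spec p a (W' - (ψ (hub a t) - ψ (neg a))) s2 hF2 hpV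
      (by rw [e2]; exact hW)
    rw [e2] at hl3
    have hsub : Sub ψ s1 (addEdgeIn p (neg a) (W' - (ψ (hub a t) - ψ (neg a))) s2) :=
      hsub2.trans fun x y X h => (hl3 x y X).2 (Or.inl h)
    refine ⟨hF3, Sub.trans (fun x y X h => (hl1 x y X).2 (Or.inl h)) hsub, ?_, ?_, ?_, ?_, ?_, ?_⟩
    · intro x y X hl
      rcases (hl3 x y X).1 hl with h1 | ⟨h1, h2, h3⟩
      · rcases hnew2 x y X h1 with h1 | ⟨h1, h2, h3⟩
        · rcases (hl1 x y X).1 h1 with h1 | ⟨rfl, rfl, h3⟩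
          · exact Or.inl h1
          · exact Or.inr ⟨Anc.refl _, Or.inr rfl, h3⟩
        · exact Or.inr ⟨Anc.inS h1, h2, h3⟩
      · exact Or.inr ⟨Anc.inS h1, Or.inl h2, h3⟩
    · intro q p' t'' l' h1 h2
      refine (hl3 _ _ _).2 (Or.inr ⟨?_, rfl, le_rfl⟩)
      rw [anc_inS_iff] at h1
      rcases h1 with h1 | h1
      · cases h1; exact h2
      · exact (h2.trans (Anc.inS (Anc.refl _))).trans h1
    · intro f hf
      rw [addEdgeIn_neg_fIn] at hf
      rcases hdef2 f hf with h1 | ⟨p', t'', l', h1, h2⟩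
      · rcases Finset.mem_insert.1 h1 with h1 | h1
        · refine Or.inr ⟨p, t', l, Anc.refl _, ?_⟩
          rw [h1, ← e]
          congr 2; ring
        · exact Or.inl h1
      · exact Or.inr ⟨p', t'', l', Anc.inS h1, h2⟩
    · intro x X hl
      rcases (hl3 x _ X).1 hl with h1 | ⟨h1, h2, h3⟩
      · rcases hneg2 x X h1 with h1 | ⟨h1, h3⟩
        · rcases (hl1 x _ X).1 h1 with h1 | ⟨rfl, h, h3⟩
          · exact Or.inl h1
          · simp at h
        · exact Or.inr ⟨p, t', l, Anc.refl _, h1, h3⟩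
      · exact Or.inr ⟨p, t', l, Anc.refl _, h1, h3⟩
    · intro hsg _ x X hl
      rcases (hl3 x _ X).1 hl with h1 | ⟨h1, h2, h3⟩
      · rcases hsign2 hsg x X h1 with h1 | h1
        · rcases (hl1 x _ X).1 h1 with h1 | ⟨rfl, h, h3⟩
          · exact Or.inl h1
          · exact Or.inr (Or.inl rfl)
        · exact Or.inr (Or.inr h1)
      · simp at h2
    · exact hsub _ _ _ ((hl1 _ _ _).2 (Or.inr ⟨rfl, rfl, le_rfl⟩))

/-- The effect of `AddEdgeOut` with an N-Steiner vertex as source. -/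
structure OutHubSpec (ψ : Vtx α → ℝ) (V : Finset (Vtx α)) (u : Vtx α) (a : α) (t : ℕ) (W : ℝ)
    (s s' : State α) : Prop where
  frame : Frame ψ V s'
  sub : Sub ψ s s'
  new : ∀ x y X, s'.Link ψ x y X → s.Link ψ x y X ∨
    (Anc y u ∧ (x = neg a ∨ x = hub a t) ∧ W + ψ (hub a t) - ψ u ≤ X)
  close : ∀ q p t' l, Anc (outS p t' l) u → Anc q p →
    s'.Link ψ (neg a) q (W + ψ (hub a t) - ψ u)
  defer : ∀ e ∈ s'.fOut, e ∈ s.fOut ∨ ∃ p t' l, Anc (outS p t' l) u ∧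
    e = (hub a t, p, W + ψ (hub a t) - ψ u - ψ (hub a t) + ψ p)
  neg_or : ∀ x X, s'.Link ψ (neg a) x X → s.Link ψ (neg a) x X ∨
    ∃ p t' l, Anc (outS p t' l) u ∧ Anc x p ∧ W + ψ (hub a t) - ψ u ≤ X
  sign : (∀ p t' l, inS p t' l ∈ V → (∀ c, p ≠ bar c) → 0 ≤ ψ p - ψ (inS p t' l)) → 0 ≤ W →
    ∀ x X, s'.Link ψ (hub a t) x X → (∀ c, x ≠ bar c) → s.Link ψ (hub a t) x X ∨
      0 ≤ X - ψ (hub a t) + ψ x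
  self : s'.Link ψ (hub a t) u (W + ψ (hub a t) - ψ u)

theorem OutHubSpec.base (hs : Frame ψ V s) {u : Vtx α} {a : α} {t : ℕ} {W : ℝ}
    (hW : 0 ≤ W + ψ (hub a t) - ψ u) (hA : ∀ x, Anc x u ↔ x = u) (hu : u.outParent = none) :
    OutHubSpec ψ V u a t W s (s.addEdge (hub a t) u W) where
  frame := hs.addEdge hW
  sub := Sub.addEdge
  new x y X h := by
    rw [State.link_addEdge] at h
    rw [hA]; tauto
  close q p t' l h1 h2 := by
    rw [hA] at h1; rw [← h1] at hu; simp [outParent] at hu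
  defer e he := Or.inl he
  neg_or x X h := by
    rw [State.link_addEdge] at h
    simp at h
    exact Or.inl h
  sign _ hW0 x X h _ := by
    rw [State.link_addEdge] at h
    rcases h with h | ⟨-, rfl, h⟩
    · exact Or.inl h
    · right; linarith
  self := State.link_addEdge.2 (Or.inr ⟨rfl, rfl, le_rfl⟩)

/-- Mirror image of `addEdgeIn_hub_spec`, except that an edge from an in-Steiner vertex into a
parent r̄ may be negative; therefore `sign` says nothing about targets r̄. -/
theorem addEdgeOut_hub_spec (u : Vtx α) (a : α) (t : ℕ) (W : ℝ) (s : State α) (hs : Frame ψ V s)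
    (hu : u ∈ V) (ha : hub a t ∈ V) (hW : 0 ≤ W + ψ (hub a t) - ψ u) :
    OutHubSpec ψ V u a t W s (addEdgeOut u (hub a t) W s) := by
  induction u generalizing W s with
  | neg c =>
    exact OutHubSpec.base hs hW (fun x => ⟨fun h => by cases h; rfl, fun h => h ▸ Anc.refl _⟩) rfl
  | bar c =>
    exact OutHubSpec.base hs hW (fun x => ⟨fun h => by cases h; rfl, fun h => h ▸ Anc.refl _⟩) rfl
  | hub c t =>
    exact OutHubSpec.base hs hW (fun x => ⟨fun h => by cases h; rfl, fun h => h ▸ Anc.refl _⟩) rfl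
  | inS p t' l ih =>
    simp only [addEdgeOut]
    have hs1 := hs.addEdge (y := inS p t' l) (x := hub a t) (W := W) hW
    have hwt : (s.addEdge (hub a t) (inS p t' l) W).wt (inS p t' l) p = ψ p - ψ (inS p t' l) :=
      hs1.wt_eq (hs1.tight_inS hu)
    rw [hwt]
    have e : W + (ψ p - ψ (inS p t' l)) + ψ (hub a t) - ψ p =
      W + ψ (hub a t) - ψ (inS p t' l) := by ring
    have h := ih (W + (ψ p - ψ (inS p t' l))) _ hs1 (hs.inS_mem hu).1 (by rw [e]; exact hW)
    have hclose := h.close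
    have hdefer := h.defer
    have hneg := h.neg_or
    have hself := h.self
    rw [e] at hclose hdefer hneg hself
    refine ⟨h.frame, Sub.addEdge.trans h.sub, ?_, ?_, ?_, ?_, ?_, ?_⟩
    · intro x y X hl
      rcases h.new x y X hl with h1 | ⟨h1, h2, h3⟩
      · rw [State.link_addEdge] at h1
        rcases h1 with h1 | ⟨rfl, rfl, h3⟩
        · exact Or.inl h1
        · exact Or.inr ⟨Anc.refl _, Or.inr rfl, h3⟩
      · rw [e] at h3
        exact Or.inr ⟨Anc.inS h1, h2, h3⟩
    · intro q p' t'' l' h1 h2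
      rw [anc_inS_iff] at h1
      simp only [reduceCtorEq, false_or] at h1
      exact hclose q p' t'' l' h1 h2
    · intro f hf
      rcases hdefer f hf with h1 | ⟨p', t'', l', h1, h2⟩
      · exact Or.inl h1
      · exact Or.inr ⟨p', t'', l', Anc.inS h1, h2⟩
    · intro x X hl
      rcases hneg x X hl with h1 | ⟨p', t'', l', h1, h2⟩
      · rw [State.link_addEdge] at h1
        simp at h1
        exact Or.inl h1
      · exact Or.inr ⟨p', t'', l', Anc.inS h1, h2⟩
    · intro hsg hW0 x X hl hx
      -- At a parent r̄ the weight may become negative, but there the recursion ends and its last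
      -- edge is exempt. At any other parent the weight only grows.
      by_cases hpb : ∃ c, p = bar c
      · obtain ⟨c, rfl⟩ := hpb
        rcases h.new _ _ X hl with h1 | ⟨h1, -, h3⟩
        · rw [State.link_addEdge] at h1
          rcases h1 with h1 | ⟨-, rfl, h3⟩
          · exact Or.inl h1
          · right; linarith
        · cases h1; exact absurd rfl (hx c)
      · push Not at hpb
        have hp := hsg p t' l hu hpb
        rcases h.sign hsg (by linarith) x X hl hx with h1 | h1
        · rw [State.link_addEdge] at h1
          rcases h1 with h1 | ⟨-, rfl, h3⟩
          · exact Or.inl h1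
          · right; linarith
        · exact Or.inr h1
    · exact h.sub _ _ _ (State.link_addEdge.2 (Or.inr ⟨rfl, rfl, le_rfl⟩))
  | outS p t' l ih =>
    simp only [addEdgeOut]
    have hs1 := hs.addEdge (y := outS p t' l) (x := hub a t) (W := W) hW
    obtain ⟨hpV, -, hpn, -⟩ := hs.outS_mem hu
    have hwt : (s.addEdge (hub a t) (outS p t' l) W).wt p (outS p t' l) = ψ (outS p t' l) - ψ p :=
      hs1.wt_eq (hs1.tight_outS hu)
    have hwn : (s.addEdge (hub a t) (outS p t' l) W).wt (hub a t) (neg a) =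
        ψ (neg a) - ψ (hub a t) :=
      hs1.wt_eq ((hs1.rootOut_tight ha rfl).resolve_left (by simp))
    rw [hwt, hwn]
    set W' := W - (ψ (outS p t' l) - ψ p) with hW'
    have e : W' + ψ (hub a t) - ψ p = W + ψ (hub a t) - ψ (outS p t' l) := by rw [hW']; ring
    have e2 : W' - (ψ (neg a) - ψ (hub a t)) + ψ (neg a) - ψ p =
      W + ψ (hub a t) - ψ (outS p t' l) := by rw [hW']; ring
    set s1 : State α := { s.addEdge (hub a t) (outS p t' l) W with
      fOut := insert (hub a t, p, W') (s.addEdge (hub a t) (outS p t' l) W).fOut } with hs1d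
    have hF1 : Frame ψ V s1 := hs1.of_sub (fun _ _ _ h => h) (fun h => hs1.feas h)
    have hl1 : ∀ x y X, s1.Link ψ x y X ↔ s.Link ψ x y X ∨
        (x = hub a t ∧ y = outS p t' l ∧ W + ψ (hub a t) - ψ (outS p t' l) ≤ X) :=
      fun x y X => State.link_addEdge
    set s2 : State α := if 0 ≤ W' then addEdgeOut p (hub a t) W' s1 else s1 with hs2d
    have hs2 : Frame ψ V s2 ∧ Sub ψ s1 s2 ∧
        (∀ x y X, s2.Link ψ x y X → s1.Link ψ x y X ∨
          (Anc y p ∧ (x = neg a ∨ x = hub a t) ∧ W + ψ (hub a t) - ψ (outS p t' l) ≤ X)) ∧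
        (∀ e ∈ s2.fOut, e ∈ s1.fOut ∨ ∃ p' t'' l', Anc (outS p' t'' l') p ∧
          e = (hub a t, p', W + ψ (hub a t) - ψ (outS p t' l) - ψ (hub a t) + ψ p')) ∧
        (∀ x X, s2.Link ψ (neg a) x X → s1.Link ψ (neg a) x X ∨
          (Anc x p ∧ W + ψ (hub a t) - ψ (outS p t' l) ≤ X)) ∧
        ((∀ p t' l, inS p t' l ∈ V → (∀ c, p ≠ bar c) → 0 ≤ ψ p - ψ (inS p t' l)) →
          ∀ x X, s2.Link ψ (hub a t) x X → (∀ c, x ≠ bar c) → s1.Link ψ (hub a t) x X ∨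
            0 ≤ X - ψ (hub a t) + ψ x) := by
      by_cases hc : 0 ≤ W'
      · have h := ih W' s1 hF1 hpV (by rw [e]; exact hW)
        have hdefer := h.defer
        have hneg := h.neg_or
        have hnew := h.new
        rw [e] at hdefer hneg hnew
        rw [if_pos hc] at hs2d
        rw [hs2d]
        refine ⟨h.frame, h.sub, hnew, hdefer, ?_, ?_⟩
        · intro x X hl
          rcases hneg x X hl with h1 | ⟨p', t'', l', h1, h2, h3⟩
          · exact Or.inl h1
          · exact Or.inr ⟨(h2.trans (Anc.outS (Anc.refl _))).trans h1, h3⟩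
        · intro hsg x X hl hx
          exact h.sign hsg hc x X hl hx
      · rw [if_neg hc] at hs2d
        rw [hs2d]
        exact ⟨hF1, Sub.refl _ _, fun _ _ _ h => Or.inl h, fun _ h => Or.inl h,
          fun _ _ h => Or.inl h, fun _ _ _ h _ => Or.inl h⟩
    obtain ⟨hF2, hsub2, hnew2, hdef2, hneg2, hsign2⟩ := hs2
    obtain ⟨hF3, hl3⟩ := addEdgeOut_neg_spec p a (W' - (ψ (neg a) - ψ (hub a t))) s2 hF2 hpV
      (by rw [e2]; exact hW)
    rw [e2] at hl3
    have hsub : Sub ψ s1 (addEdgeOut p (neg a) (W' - (ψ (neg a) - ψ (hub a t))) s2) :=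
      hsub2.trans fun x y X h => (hl3 x y X).2 (Or.inl h)
    refine ⟨hF3, Sub.trans (fun x y X h => (hl1 x y X).2 (Or.inl h)) hsub, ?_, ?_, ?_, ?_, ?_, ?_⟩
    · intro x y X hl
      rcases (hl3 x y X).1 hl with h1 | ⟨h1, h2, h3⟩
      · rcases hnew2 x y X h1 with h1 | ⟨h1, h2, h3⟩
        · rcases (hl1 x y X).1 h1 with h1 | ⟨rfl, rfl, h3⟩
          · exact Or.inl h1
          · exact Or.inr ⟨Anc.refl _, Or.inr rfl, h3⟩
        · exact Or.inr ⟨Anc.outS h1, h2, h3⟩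
      · exact Or.inr ⟨Anc.outS h1, Or.inl h2, h3⟩
    · intro q p' t'' l' h1 h2
      refine (hl3 _ _ _).2 (Or.inr ⟨?_, rfl, le_rfl⟩)
      rw [anc_outS_iff] at h1
      rcases h1 with h1 | h1
      · cases h1; exact h2
      · exact (h2.trans (Anc.outS (Anc.refl _))).trans h1
    · intro f hf
      rw [addEdgeOut_neg_fOut] at hf
      rcases hdef2 f hf with h1 | ⟨p', t'', l', h1, h2⟩
      · rcases Finset.mem_insert.1 h1 with h1 | h1
        · refine Or.inr ⟨p, t', l, Anc.refl _, ?_⟩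
          rw [h1, ← e]
          congr 2; ring
        · exact Or.inl h1
      · exact Or.inr ⟨p', t'', l', Anc.outS h1, h2⟩
    · intro x X hl
      rcases (hl3 _ x X).1 hl with h1 | ⟨h1, h2, h3⟩
      · rcases hneg2 x X h1 with h1 | ⟨h1, h3⟩
        · rcases (hl1 _ x X).1 h1 with h1 | ⟨h, rfl, h3⟩
          · exact Or.inl h1
          · simp at h
        · exact Or.inr ⟨p, t', l, Anc.refl _, h1, h3⟩
      · exact Or.inr ⟨p, t', l, Anc.refl _, h1, h3⟩
    · intro hsg hW0 x X hl hx
      rcases (hl3 _ x X).1 hl with h1 | ⟨h1, h2, h3⟩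
      · rcases hsign2 hsg x X h1 hx with h1 | h1
        · rcases (hl1 _ x X).1 h1 with h1 | ⟨h, rfl, h3⟩
          · exact Or.inl h1
          · right; linarith
        · exact Or.inr h1
      · simp at h2
    · exact hsub _ _ _ ((hl1 _ _ _).2 (Or.inr ⟨rfl, rfl, le_rfl⟩))

end AddEdge

/-! ### Reinsertion of the deferred edges -/

theorem foldl_inv {β γ : Type*} {f : β → γ → β} {P : β → Prop} (l : List γ)
    (h : ∀ b, P b → ∀ x ∈ l, P (f b x)) (b : β) (hb : P b) : P (l.foldl f b) := by
  induction l generalizing b with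
  | nil => exact hb
  | cons x l ih =>
    exact ih (fun b hb y hy => h b hb y (List.mem_cons_of_mem _ hy)) _
      (h b hb x List.mem_cons_self)

/-- Edges join vertices of `V`. -/
def Ends (ψ : Vtx α → ℝ) (V : Finset (Vtx α)) (s : State α) : Prop :=
  ∀ x y X, s.Link ψ x y X → x ∈ V ∧ y ∈ V

/-- Signs of the weights of tight edges. -/
structure Sgn (ψ : Vtx α → ℝ) (V : Finset (Vtx α)) : Prop where
  outS : ∀ p t l, outS p t l ∈ V → 0 ≤ ψ (outS p t l) - ψ p
  inS : ∀ p t l, inS p t l ∈ V → (∀ c, p ≠ bar c) → 0 ≤ ψ p - ψ (inS p t l)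
  neg : ∀ a, 0 ≤ ψ (neg a) - ψ (bar a)

/-- `r̄` in place of `r`. -/
def outv : Vtx α → Vtx α
  | neg a => bar a
  | x => x

/-- The edges into negative vertices, and those from `r` or `r̄` to vertices outside of `N̄`, have a
nonnegative weight when they are made to start in `r̄`. -/
def SignOK (ψ : Vtx α → ℝ) (s : State α) : Prop :=
  ∀ x y X, s.Link ψ x y X → (∀ a, y = neg a → 0 ≤ X - ψ (outv x) + ψ y) ∧
    (∀ c, outv x = bar c → (∀ d, y ≠ bar d) → 0 ≤ X - ψ (outv x) + ψ y)

/-- The properties of the weights of the graph between two iterations. -/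
structure Stable (V : Finset (Vtx α)) (s : State α) : Prop where
  neg_out : ∀ a y, s.w (neg a) y ≠ ⊤ → y = bar a
  nn_neg : ∀ x a, 0 ≤ s.w x (neg a)
  nn_bar : ∀ c y, (∀ d, y ≠ bar d) → 0 ≤ s.w (bar c) y
  nn_inS : ∀ p t l, inS p t l ∈ V → (∀ c, p ≠ bar c) → 0 ≤ s.w (inS p t l) p
  nn_outS : ∀ p t l, outS p t l ∈ V → 0 ≤ s.w p (outS p t l)

section

variable {s s' : State α} {ψ φ : Vtx α → ℝ} {V : Finset (Vtx α)} {u : Vtx α} {a : α} {t : ℕ} {W : ℝ}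

theorem eq_of_inParent {x p : Vtx α} (h : x.inParent = some p) : ∃ t l, x = inS p t l := by
  cases x <;> simp [inParent] at h
  subst h; exact ⟨_, _, rfl⟩

theorem eq_of_outParent {x p : Vtx α} (h : x.outParent = some p) : ∃ t l, x = outS p t l := by
  cases x <;> simp [outParent] at h
  subst h; exact ⟨_, _, rfl⟩

theorem InBase.anc {x p : Vtx α} (h : InBase x p) : ∃ t l, Anc (inS p t l) x := by
  rcases h with h | ⟨v, h, h'⟩
  · obtain ⟨t, l, rfl⟩ := eq_of_inParent h
    exact ⟨t, l, Anc.refl _⟩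
  · obtain ⟨t, l, rfl⟩ := eq_of_outParent h
    obtain ⟨t', l', rfl⟩ := eq_of_inParent h'
    exact ⟨t', l', Anc.outS (Anc.refl _)⟩

theorem OutBase.anc {x p : Vtx α} (h : OutBase x p) : ∃ t l, Anc (outS p t l) x := by
  rcases h with h | ⟨v, h, h'⟩
  · obtain ⟨t, l, rfl⟩ := eq_of_outParent h
    exact ⟨t, l, Anc.refl _⟩
  · obtain ⟨t, l, rfl⟩ := eq_of_inParent h
    obtain ⟨t', l', rfl⟩ := eq_of_outParent h'
    exact ⟨t', l', Anc.inS (Anc.refl _)⟩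

/-- A new link starts in an ancestor of `u`. If that ancestor lies over `p`, then some in-Steiner
vertex of `p` is an ancestor of `u`, and `close` has given `p` precisely the link into the negative
vertex that `EdgeOK` requires. -/
theorem Core.addEdgeIn (hs : Core ψ V s) (hu : u ∈ V) (ha : hub a t ∈ V) (hl : u.level ≤ t)
    (hW : 0 ≤ W + ψ u - ψ (hub a t)) : Core ψ V (addEdgeIn u (hub a t) W s) := by
  have h := addEdgeIn_hub_spec u a t W s hs.toFrame hu ha hW
  refine ⟨h.frame, ?_, ?_, ?_⟩
  · intro x y X hX
    rcases h.new x y X hX with h1 | ⟨h1, h2, h3⟩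
    · exact (hs.edge h1).of_reachSub h.sub.reachSub
    · refine ⟨?_, ?_, ?_, ?_, ?_⟩
      · intro p hp
        obtain ⟨t', l', hp⟩ := hp.anc
        refine Or.inr (Or.inr ⟨a, by rcases h2 with rfl | rfl <;> rfl, Or.inl ?_⟩)
        exact (h.close p p t' l' (hp.trans h1) (Anc.refl _)).mono h3
      · rintro p (hp | ⟨v, hp, -⟩) <;> rcases h2 with rfl | rfl <;>
          simp [inParent, outParent] at hp
      · intro b t' hb hx
        rcases h2 with rfl | rfl
        · simp at hb
        · simp only [hub.injEq] at hb
          rw [← hb.2]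
          exact Or.inr ((hs.toFrame.anc h1 hu).2.trans hl)
      · intro b t' _ hy
        rcases h2 with rfl | rfl <;> simp [outParent] at hy
      · intro b hy
        rcases h2 with rfl | rfl <;> simp [outParent] at hy
  · intro e he
    rcases h.defer e he with h1 | ⟨p, t', l', h1, rfl⟩
    · exact (hs.deferIn e h1).of_reachSub h.sub.reachSub subset_rfl
    · have hp : Anc p u := (Anc.inS (Anc.refl p)).trans h1
      have e : W + ψ u - ψ (hub a t) - ψ p + ψ (hub a t) + ψ p - ψ (hub a t) =
        W + ψ u - ψ (hub a t) := by ring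
      refine ⟨a, t, rfl, (hs.toFrame.anc hp hu).1, ha, (hs.toFrame.anc hp hu).2.trans hl, ?_, ?_⟩
      · simpa only [e] using hW
      · intro q hq
        simp only [e]
        exact Or.inl (h.close q p t' l' h1 hq)
  · intro e he
    rw [addEdgeIn_fOut] at he
    exact (hs.deferOut e he).of_reachSub h.sub.reachSub subset_rfl

theorem Core.addEdgeOut (hs : Core ψ V s) (hu : u ∈ V) (ha : hub a t ∈ V) (hl : u.level ≤ t)
    (hW : 0 ≤ W + ψ (hub a t) - ψ u) : Core ψ V (addEdgeOut u (hub a t) W s) := by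
  have h := addEdgeOut_hub_spec u a t W s hs.toFrame hu ha hW
  refine ⟨h.frame, ?_, ?_, ?_⟩
  · intro x y X hX
    rcases h.new x y X hX with h1 | ⟨h1, h2, h3⟩
    · exact (hs.edge h1).of_reachSub h.sub.reachSub
    · refine ⟨?_, ?_, ?_, ?_, ?_⟩
      · rintro p (hp | ⟨v, hp, -⟩) <;> rcases h2 with rfl | rfl <;>
          simp [inParent, outParent] at hp
      · intro p hp
        obtain ⟨t', l', hp⟩ := hp.anc
        refine Or.inr (Or.inr ⟨a, by rcases h2 with rfl | rfl <;> rfl, Or.inl ?_⟩)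
        exact (h.close p p t' l' (hp.trans h1) (Anc.refl _)).mono h3
      · intro b t' _ hy
        rcases h2 with rfl | rfl <;> simp [inParent] at hy
      · intro b t' hb hx
        rcases h2 with rfl | rfl
        · simp at hb
        · simp only [hub.injEq] at hb
          rw [← hb.2]
          exact Or.inr ((hs.toFrame.anc h1 hu).2.trans hl)
      · intro b hy
        obtain ⟨t', l', rfl⟩ := eq_of_outParent hy
        exact (hs.outS_mem (hs.toFrame.anc h1 hu).1).2.2.2 b rfl
  · intro e he
    rw [addEdgeOut_fIn] at he
    exact (hs.deferIn e he).of_reachSub h.sub.reachSub subset_rfl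
  · intro e he
    rcases h.defer e he with h1 | ⟨p, t', l', h1, rfl⟩
    · exact (hs.deferOut e h1).of_reachSub h.sub.reachSub subset_rfl
    · have hp : Anc p u := (Anc.outS (Anc.refl p)).trans h1
      have e : W + ψ (hub a t) - ψ u - ψ (hub a t) + ψ p + ψ (hub a t) - ψ p =
        W + ψ (hub a t) - ψ u := by ring
      refine ⟨a, t, rfl, (hs.toFrame.anc hp hu).1, ha, (hs.toFrame.anc hp hu).2.trans hl, ?_, ?_⟩
      · simpa only [e] using hW
      · intro q hq
        simp only [e]
        exact Or.inl (h.close q p t' l' h1 hq)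

theorem SignOK.reach (hs : SignOK ψ s) {x y : Vtx α} {X : ℝ} (h : s.Reach ψ x y X) :
    (∀ a, y = neg a → 0 ≤ X - ψ (outv x) + ψ y) ∧
      (∀ c, outv x = bar c → (∀ d, y ≠ bar d) → 0 ≤ X - ψ (outv x) + ψ y) := by
  rcases h with h | ⟨c, rfl, h⟩
  · exact hs _ _ _ h
  · exact hs (bar c) _ _ h

/-- By `hR` the links into the negative vertex are dominated by existing ones, so only the links
into the N-Steiner vertex can violate a sign condition; these are covered by `sign`. -/
theorem SignOK.addEdgeIn (hs : SignOK ψ s) (hF : Frame ψ V s) (hg : Sgn ψ V) (hu : u ∈ V)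
    (ha : hub a t ∈ V) (hW : 0 ≤ W + ψ u - ψ (hub a t)) (hW0 : 0 ≤ W)
    (hR : ∀ q, Anc q u → s.Reach ψ q (neg a) (W + ψ u - ψ (hub a t))) :
    SignOK ψ (addEdgeIn u (hub a t) W s) := by
  have h := addEdgeIn_hub_spec u a t W s hF hu ha hW
  intro x y X hX
  rcases h.new x y X hX with h1 | ⟨h1, rfl | rfl, h3⟩
  · exact hs x y X h1
  · exact hs.reach ((hR x h1).mono h3)
  · refine ⟨fun a h => by simp at h, fun c hc hy => ?_⟩
    have key : 0 ≤ X - ψ x + ψ (hub a t) ∨ s.Link ψ x (hub a t) X := by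
      rcases h.sign hg.outS (Or.inl hW0) x X hX with h4 | rfl | h4
      · exact Or.inr h4
      · left; linarith
      · exact Or.inl h4
    rcases key with h4 | h4
    · cases x <;> simp only [outv, reduceCtorEq] at hc
      · have := hg.neg ‹_›
        simp only [outv]; linarith
      · exact h4
    · exact (hs _ _ _ h4).2 c hc hy

theorem SignOK.addEdgeOut (hs : SignOK ψ s) (hF : Frame ψ V s) (hg : Sgn ψ V) (hu : u ∈ V)
    (ha : hub a t ∈ V) (hW : 0 ≤ W + ψ (hub a t) - ψ u) (hW0 : 0 ≤ W)
    (hR : ∀ q, Anc q u → s.Reach ψ (neg a) q (W + ψ (hub a t) - ψ u)) :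
    SignOK ψ (addEdgeOut u (hub a t) W s) := by
  have h := addEdgeOut_hub_spec u a t W s hF hu ha hW
  intro x y X hX
  rcases h.new x y X hX with h1 | ⟨h1, rfl | rfl, h3⟩
  · exact hs x y X h1
  · exact hs.reach ((hR y h1).mono h3)
  · refine ⟨?_, fun c hc => by simp [outv] at hc⟩
    rintro b rfl
    rcases h.sign hg.inS hW0 _ X hX (by simp) with h4 | h4
    · exact (hs _ _ _ h4).1 b rfl
    · exact h4

theorem SignOK.redirect (hs : SignOK ψ s) (hF : Frame ψ V s) (a : α) :
    SignOK ψ (s.redirect a) := by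
  have ht := hF.w_eq (hF.tight_bar a)
  intro x y X h
  rcases (State.link_redirect ht).1 h with ⟨-, -, h⟩ | ⟨-, h⟩ | ⟨rfl, -, h⟩
  · exact hs _ _ _ h
  · exact hs _ _ _ h
  · exact hs (neg a) _ _ h

theorem Ends.redirect (hs : Ends ψ V s) (hF : Frame ψ V s) (a : α) :
    Ends ψ V (s.redirect a) := by
  have ht := hF.w_eq (hF.tight_bar a)
  intro x y X h
  rcases (State.link_redirect ht).1 h with ⟨-, -, h⟩ | ⟨-, h⟩ | ⟨rfl, -, h⟩
  · exact hs _ _ _ h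
  · exact hs _ _ _ h
  · exact ⟨hF.bar_mem a, (hs _ _ _ h).2⟩

theorem Ends.addEdgeIn (hs : Ends ψ V s) (hF : Frame ψ V s) (hu : u ∈ V)
    (ha : hub a t ∈ V) (hW : 0 ≤ W + ψ u - ψ (hub a t)) :
    Ends ψ V (addEdgeIn u (hub a t) W s) := by
  have h := addEdgeIn_hub_spec u a t W s hF hu ha hW
  intro x y X hX
  rcases h.new x y X hX with h1 | ⟨h1, rfl | rfl, -⟩
  · exact hs x y X h1
  · exact ⟨(hF.anc h1 hu).1, hF.neg_mem a⟩
  · exact ⟨(hF.anc h1 hu).1, ha⟩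

theorem Ends.addEdgeOut (hs : Ends ψ V s) (hF : Frame ψ V s) (hu : u ∈ V)
    (ha : hub a t ∈ V) (hW : 0 ≤ W + ψ (hub a t) - ψ u) :
    Ends ψ V (addEdgeOut u (hub a t) W s) := by
  have h := addEdgeOut_hub_spec u a t W s hF hu ha hW
  intro x y X hX
  rcases h.new x y X hX with h1 | ⟨h1, rfl | rfl, -⟩
  · exact hs x y X h1
  · exact ⟨hF.neg_mem a, (hF.anc h1 hu).1⟩
  · exact ⟨ha, (hF.anc h1 hu).1⟩

theorem insertDeferred_verts [Fintype α] (s : State α) : (insertDeferred s).verts = s.verts := by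
  unfold insertDeferred
  refine foldl_inv (P := fun x : State α => x.verts = s.verts)
    (f := State.redirect) _ (fun b hb _ _ => hb) _ ?_
  refine foldl_inv (P := fun x : State α => x.verts = s.verts) _ (fun b hb e _ => ?_) _ ?_
  · split_ifs
    · rw [addEdgeOut_verts]; exact hb
    · exact hb
  refine foldl_inv (P := fun x : State α => x.verts = s.verts) _ (fun b hb e _ => ?_) _ rfl
  · split_ifs
    · rw [addEdgeIn_verts]; exact hb
    · exact hb

theorem insertDeferred_heavy [Fintype α] (s : State α) : (insertDeferred s).heavy = s.heavy := by
  unfold insertDeferred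
  refine foldl_inv (P := fun x : State α => x.heavy = s.heavy)
    (f := State.redirect) _ (fun b hb _ _ => hb) _ ?_
  refine foldl_inv (P := fun x : State α => x.heavy = s.heavy) _ (fun b hb e _ => ?_) _ ?_
  · split_ifs
    · rw [addEdgeOut_heavy]; exact hb
    · exact hb
  refine foldl_inv (P := fun x : State α => x.heavy = s.heavy) _ (fun b hb e _ => ?_) _ rfl
  · split_ifs
    · rw [addEdgeIn_heavy]; exact hb
    · exact hb

/-- Redirecting at `a` leaves only the edge into r̄, and later redirections at other vertices add no
edge to this negative vertex. -/
theorem redirect_neg_out (s : State α) (l : List α) :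
    ∀ a ∈ l, ∀ y, (l.foldl State.redirect s).w (neg a) y ≠ ⊤ → y = bar a := by
  induction l generalizing s with
  | nil => simp
  | cons c l ih =>
    intro a ha y hy
    rw [List.foldl_cons] at hy
    by_cases hal : a ∈ l
    · exact ih _ a hal y hy
    · have hac : a = c := by simpa [hal] using ha
      subst hac
      by_contra hne
      refine hy ?_
      have := foldl_inv (f := State.redirect) (P := fun x : State α => x.w (neg a) y = ⊤) l
        (fun b hb c _ => ?_) (s.redirect a) (by simp [State.redirect, hne])
      · exact this
      · simp only [State.redirect]
        split_ifs <;> simp_all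

theorem insertDeferred_neg_out [Fintype α] (s : State α) (a : α) (y : Vtx α)
    (h : (insertDeferred s).w (neg a) y ≠ ⊤) : y = bar a :=
  redirect_neg_out _ _ a (by simp) y h

/-- The record of a deferred edge contains all that reinsertion needs: feasibility, levels, and
links into or from the negative vertex that already dominate the ones to be added. -/
theorem insertDeferred_spec [Fintype α] (hs : Core ψ V s) (hE : Ends ψ V s) :
    Core ψ V (insertDeferred s) ∧ Ends ψ V (insertDeferred s) ∧
      (Sgn ψ V → SignOK ψ s → SignOK ψ (insertDeferred s)) := by
  -- The records refer to the initial graph; carrying `ReachSub` along makes them valid in every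
  -- later one.
  let P : State α → Prop := fun x => (Core ψ V x ∧ Ends ψ V x ∧ ReachSub ψ s x) ∧
    (Sgn ψ V → SignOK ψ s → SignOK ψ x)
  suffices h : P (insertDeferred s) from ⟨h.1.1, h.1.2.1, h.2⟩
  unfold insertDeferred
  refine foldl_inv (P := P) _ ?_ _ ?_
  · rintro x ⟨⟨hC, hX, hR⟩, hS⟩ a -
    exact ⟨⟨hC.redirect a, hX.redirect hC.toFrame a,
      fun _ _ _ h => hC.toFrame.reachSub_redirect a _ _ _ (hR _ _ _ h)⟩,
      fun h1 h2 => (hS h1 h2).redirect hC.toFrame a⟩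
  refine foldl_inv (P := P) _ ?_ _ ?_
  · rintro x ⟨⟨hC, hX, hR⟩, hS⟩ ⟨e1, e2, W⟩ he
    dsimp only
    split_ifs with hW0
    · obtain ⟨a, t, h1, h2, h3, h4, h5, h6⟩ := hs.deferOut _ (Finset.mem_toList.1 he)
      dsimp only at h1 h2 h4 h5 h6
      subst h1
      have hsp := addEdgeOut_hub_spec e2 a t W x hC.toFrame h2 h3 h5
      exact ⟨⟨hC.addEdgeOut h2 h3 h4 h5, hX.addEdgeOut hC.toFrame h2 h3 h5,
        fun _ _ _ h => hsp.sub.reach (hR _ _ _ h)⟩,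
        fun g1 g2 => (hS g1 g2).addEdgeOut hC.toFrame g1 h2 h3 h5 hW0
          fun q hq => hR _ _ _ (h6 q hq)⟩
    · exact ⟨⟨hC, hX, hR⟩, hS⟩
  refine foldl_inv (P := P) _ ?_ _ ?_
  · rintro x ⟨⟨hC, hX, hR⟩, hS⟩ ⟨e1, e2, W⟩ he
    dsimp only
    split_ifs with hW0
    · obtain ⟨a, t, h1, h2, h3, h4, h5, h6⟩ := hs.deferIn _ (Finset.mem_toList.1 he)
      dsimp only at h1 h2 h4 h5 h6
      subst h1
      have hsp := addEdgeIn_hub_spec e1 a t W x hC.toFrame h2 h3 h5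
      exact ⟨⟨hC.addEdgeIn h2 h3 h4 h5, hX.addEdgeIn hC.toFrame h2 h3 h5,
        fun _ _ _ h => hsp.sub.reach (hR _ _ _ h)⟩,
        fun g1 g2 => (hS g1 g2).addEdgeIn hC.toFrame g1 h2 h3 h5 hW0
          fun q hq => hR _ _ _ (h6 q hq)⟩
    · exact ⟨⟨hC, hX, hR⟩, hS⟩
  · exact ⟨⟨hs, hE, fun _ _ _ h => h⟩, fun _ h => h⟩

/-- `SignOK` measures edges of r as if they started in r̄. After redirection no negative vertex has
an edge other than that into its copy, and the condition becomes one on actual weights. -/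
theorem Stable.of_signOK (hs : Core ψ V s) (hn : ∀ a y, s.w (neg a) y ≠ ⊤ → y = bar a)
    (hg : Sgn ψ V) (hS : SignOK ψ s) : Stable V s where
  neg_out := hn
  nn_neg x a := by
    refine (State.nonneg_iff (ψ := ψ)).2 fun X hX => ?_
    cases x with
    | neg c => exact absurd (hn c _ hX.ne_top) (by simp)
    | _ => exact (hS _ _ _ hX).1 a rfl
  nn_bar c y hy := (State.nonneg_iff (ψ := ψ)).2 fun X hX => (hS _ _ _ hX).2 c rfl hy
  nn_inS p t l h hp := by
    rw [hs.toFrame.w_eq (hs.tight_inS h)]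
    exact_mod_cast hg.inS p t l h hp
  nn_outS p t l h := by
    rw [hs.toFrame.w_eq (hs.tight_outS h)]
    exact_mod_cast hg.outS p t l h

theorem Stable.sgn (h : Stable V s) (hs : Core ψ V s) : Sgn ψ V where
  outS p t l hx := by
    have := h.nn_outS p t l hx
    rw [hs.toFrame.w_eq (hs.tight_outS hx)] at this
    exact_mod_cast this
  inS p t l hx hp := by
    have := h.nn_inS p t l hx hp
    rw [hs.toFrame.w_eq (hs.tight_inS hx)] at this
    exact_mod_cast this
  neg a := by
    have := h.nn_neg (bar a) a
    rw [hs.toFrame.w_eq (hs.tight_neg a)] at this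
    exact_mod_cast this

theorem Stable.signOK (h : Stable V s) (ψ : Vtx α → ℝ) : SignOK ψ s := by
  intro x y X hX
  constructor
  · rintro a rfl
    cases x with
    | neg c => exact absurd (h.neg_out c _ hX.ne_top) (by simp)
    | _ => exact (State.nonneg_iff (ψ := ψ)).1 (h.nn_neg _ a) X hX
  · intro c hc hy
    cases x with
    | neg c => exact absurd (h.neg_out c _ hX.ne_top) (hy c)
    | bar c => exact (State.nonneg_iff (ψ := ψ)).1 (h.nn_bar c y hy) X hX
    | _ => simp [outv] at hc

theorem Core.reweight (hs : Core ψ V s) (φ : Vtx α → ℝ) :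
    Core (fun v => ψ v - φ v) V (s.reweight φ) := by
  have hl : ∀ {x y X}, (s.reweight φ).Link (fun v => ψ v - φ v) x y X ↔ s.Link ψ x y X :=
    State.link_reweight
  have hr : ∀ {x y X}, s.Reach ψ x y X → (s.reweight φ).Reach (fun v => ψ v - φ v) x y X := by
    rintro x y X (h | ⟨c, hc, h⟩)
    · exact Or.inl (hl.2 h)
    · exact Or.inr ⟨c, hc, hl.2 h⟩
  refine ⟨⟨hs.neg_mem, hs.bar_mem, hs.inS_mem, hs.outS_mem, hs.hub_mem,
    fun h => hs.feas (hl.1 h), fun h => hl.2 (hs.tight_inS h), fun h => hl.2 (hs.tight_outS h),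
    fun a => hl.2 (hs.tight_bar a), fun a => hl.2 (hs.tight_neg a),
    fun h1 h2 => hr (hs.rootIn_tight h1 h2),
    fun h1 h2 => (hs.rootOut_tight h1 h2).imp id hl.2⟩, ?_, ?_, ?_⟩
  · intro x y X h
    have he := hs.edge (hl.1 h)
    refine ⟨fun p hp => ?_, fun p hp => ?_, he.lvl_in, he.lvl_out, he.outNeg⟩
    · rcases he.ein p hp with h1 | h1 | ⟨a, ha, h1⟩
      · exact Or.inl h1
      · exact Or.inr (Or.inl h1)
      · exact Or.inr (Or.inr ⟨a, ha, hr h1⟩)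
    · rcases he.eout p hp with h1 | h1 | ⟨a, ha, h1⟩
      · exact Or.inl h1
      · exact Or.inr (Or.inl h1)
      · exact Or.inr (Or.inr ⟨a, ha, hr h1⟩)
  · intro e he
    obtain ⟨f, hf, rfl⟩ := Finset.mem_image.1 he
    obtain ⟨a, t, h1, h2, h3, h4, h5, h6⟩ := hs.deferIn f hf
    have e : f.2.2 + φ f.1 - φ f.2.1 + (ψ f.1 - φ f.1) - (ψ (hub a t) - φ (hub a t)) =
      f.2.2 + ψ f.1 - ψ (hub a t) := by rw [h1]; ring
    refine ⟨a, t, h1, h2, h3, h4, ?_, fun q hq => ?_⟩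
    · dsimp only; rw [e]; exact h5
    · dsimp only; rw [e]; exact hr (h6 q hq)
  · intro e he
    obtain ⟨f, hf, rfl⟩ := Finset.mem_image.1 he
    obtain ⟨a, t, h1, h2, h3, h4, h5, h6⟩ := hs.deferOut f hf
    have e : f.2.2 + φ f.1 - φ f.2.1 + (ψ (hub a t) - φ (hub a t)) - (ψ f.2.1 - φ f.2.1) =
      f.2.2 + ψ (hub a t) - ψ f.2.1 := by rw [h1]; ring
    refine ⟨a, t, h1, h2, h3, h4, ?_, fun q hq => ?_⟩
    · dsimp only; rw [e]; exact h5
    · dsimp only; rw [e]; exact hr (h6 q hq)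

theorem Ends.reweight (hs : Ends ψ V s) (φ : Vtx α → ℝ) :
    Ends (fun v => ψ v - φ v) V (s.reweight φ) :=
  fun x y X h => hs x y X (State.link_reweight.1 h)

theorem Stable.reweight (h : Stable V s) (hv : s.Valid φ) : Stable V (s.reweight φ) where
  neg_out a y hy := h.neg_out a y fun e => hy (by simp [State.reweight, e])
  nn_neg x a := hv _ _ (h.nn_neg x a)
  nn_bar c y hy := hv _ _ (h.nn_bar c y hy)
  nn_inS p t l h1 h2 := hv _ _ (h.nn_inS p t l h1 h2)
  nn_outS p t l h1 := hv _ _ (h.nn_outS p t l h1)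

/-- The base graph inherits the invariants. -/
theorem base_spec [Fintype α] (hs : Core ψ V s) (hE : Ends ψ V s) (hst : Stable V s)
    (hv : s.Valid φ) :
    Core (fun v => ψ v - φ v) V (insertDeferred (s.reweight φ)) ∧
      Ends (fun v => ψ v - φ v) V (insertDeferred (s.reweight φ)) ∧
      Stable V (insertDeferred (s.reweight φ)) := by
  have h1 := hs.reweight φ
  have h2 := hst.reweight hv
  obtain ⟨g1, g2, g3⟩ := insertDeferred_spec h1 (hE.reweight φ)
  exact ⟨g1, g2, Stable.of_signOK g1 (insertDeferred_neg_out _) (h2.sgn h1)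
    (g3 (h2.sgn h1) (h2.signOK _))⟩

end

/-! ### Walks and hop distances -/

/-- A walk with its number of hops and its weight. -/
inductive Walk (s : State α) : ℕ → Vtx α → Vtx α → ℝ → Prop
  | nil (x : Vtx α) : Walk s 0 x x 0
  | cons {x y z : Vtx α} {c W : ℝ} {k : ℕ} (h : s.w x y = c) (w : Walk s k y z W) :
      Walk s ((if s.IsHop x y then 1 else 0) + k) x z (c + W)

/-- There is a walk of reduced weight at most `X` with at most `k` hops. -/
def RWalk (ψ : Vtx α → ℝ) (s : State α) (k : ℕ) (x y : Vtx α) (X : ℝ) : Prop :=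
  ∃ k' ≤ k, ∃ W, Walk s k' x y W ∧ W + ψ x - ψ y ≤ X

section

variable {s : State α} {ψ : Vtx α → ℝ} {V : Finset (Vtx α)} {x y z p u : Vtx α} {X Y W c d : ℝ}
  {h k k' j : ℕ}

theorem Walk.append {k₁ k₂ : ℕ} {W₁ W₂ : ℝ} (h₁ : Walk s k₁ x y W₁) (h₂ : Walk s k₂ y z W₂) :
    Walk s (k₁ + k₂) x z (W₁ + W₂) := by
  induction h₁ with
  | nil => simpa using h₂
  | cons hw _ ih =>
    have := Walk.cons hw (ih h₂)
    rw [← add_assoc, ← add_assoc] at this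
    exact this

theorem Walk.single (hw : s.w x y = c) : Walk s (if s.IsHop x y then 1 else 0) x y c := by
  have := Walk.cons hw (Walk.nil y)
  simpa using this

theorem Walk.last (h : Walk s k x z W) : (x = z ∧ W = 0) ∨
    ∃ y k₁ W₁ c, Walk s k₁ x y W₁ ∧ s.w y z = (c : ℝ) ∧ k₁ ≤ k ∧ W = W₁ + c := by
  induction h with
  | nil x => exact Or.inl ⟨rfl, rfl⟩
  | @cons x y z c W k hw w ih =>
    right
    rcases ih with ⟨rfl, rfl⟩ | ⟨y', k₁, W₁, c', h1, h2, h3, h4⟩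
    · exact ⟨x, 0, 0, c, Walk.nil x, hw, Nat.zero_le _, by ring⟩
    · exact ⟨y', _, _, c', Walk.cons hw h1, h2, by omega, by rw [h4]; ring⟩

theorem Walk.of_list (l : List (Vtx α)) (hy : (x :: l).getLast? = some y)
    (hW : s.walkWeight (x :: l) = (W : ℝ)) : Walk s (s.walkHops (x :: l)) x y W := by
  induction l generalizing x W with
  | nil =>
    simp only [List.getLast?_singleton, Option.some.injEq] at hy
    subst hy
    simp only [State.walkWeight] at hW
    have : W = 0 := by exact_mod_cast hW.symm
    subst this
    exact Walk.nil _
  | cons v l ih =>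
    rw [List.getLast?_cons_cons] at hy
    simp only [State.walkWeight] at hW
    have h1 : s.w x v ≠ ⊤ := by
      intro e; rw [e] at hW; simp at hW
    have h2 : s.walkWeight (v :: l) ≠ ⊤ := by
      intro e; rw [e] at hW; simp at hW
    lift s.w x v to ℝ using h1 with c hc
    lift s.walkWeight (v :: l) to ℝ using h2 with W' hW'
    have : W = c + W' := by exact_mod_cast hW.symm
    subst this
    exact Walk.cons hc.symm (ih hy hW'.symm)

theorem Walk.exists_list (h : Walk s k x y W) : ∃ l : List (Vtx α),
    (x :: l).getLast? = some y ∧ s.walkWeight (x :: l) = (W : ℝ) ∧ s.walkHops (x :: l) = k := by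
  induction h with
  | nil x => exact ⟨[], by simp, by simp [State.walkWeight], rfl⟩
  | @cons x y z c W k hw w ih =>
    obtain ⟨l, h1, h2, h3⟩ := ih
    refine ⟨y :: l, ?_, ?_, ?_⟩
    · rw [List.getLast?_cons_cons]; exact h1
    · simp only [State.walkWeight]; rw [hw, h2]; rfl
    · simp only [State.walkHops]; rw [h3]

theorem Walk.hopDist_le (hw : Walk s k x y W) (hk : k ≤ h) : s.hopDist h x y ≤ (W : EReal) := by
  obtain ⟨l, h1, h2, h3⟩ := hw.exists_list
  refine (iInf₂_le l ⟨h1, h3 ▸ hk⟩).trans ?_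
  rw [h2]; exact le_rfl

theorem le_hopDist {e : EReal}
    (hw : ∀ k W, k ≤ h → Walk s k x y W → e ≤ (W : EReal)) : e ≤ s.hopDist h x y := by
  refine le_iInf₂ fun l hl => ?_
  cases hW : s.walkWeight (x :: l) using WithTop.recTopCoe with
  | top => exact le_top
  | coe W => exact hw _ W hl.2 (Walk.of_list l hl.1 hW)

theorem hopDist_anti (hh : h ≤ k) : s.hopDist k x y ≤ s.hopDist h x y :=
  le_hopDist fun _ _ hk w => w.hopDist_le (hk.trans hh)

theorem Frame.le_walk (hs : Frame ψ V s) (hw : Walk s k x y W) : ψ y - ψ x ≤ W := by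
  induction hw with
  | nil => simp
  | @cons x y z c W k hw w ih =>
    have := hs.feas (State.link_wt ψ (x := x) (y := y) (by rw [hw]; exact WithTop.coe_ne_top))
    rw [State.wt, hw, WithTop.untopD_coe] at this
    linarith

theorem Frame.le_hopDist (hs : Frame ψ V s) :
    ((ψ y - ψ x : ℝ) : EReal) ≤ s.hopDist h x y :=
  NegSSSP.le_hopDist fun _ _ _ w => EReal.coe_le_coe_iff.2 (hs.le_walk w)

theorem Frame.hopDist_ne_bot (hs : Frame ψ V s) : s.hopDist h x y ≠ ⊥ := by
  intro e
  have := hs.le_hopDist (x := x) (y := y) (h := h)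
  rw [e] at this
  exact absurd (le_bot_iff.1 this) (EReal.coe_ne_bot _)

theorem RWalk.mono (hw : RWalk ψ s k x y X) (hk : k ≤ k') (hX : X ≤ Y) : RWalk ψ s k' x y Y := by
  obtain ⟨j, hj, W, h1, h2⟩ := hw
  exact ⟨j, hj.trans hk, W, h1, h2.trans hX⟩

theorem RWalk.append (h₁ : RWalk ψ s k x y X) (h₂ : RWalk ψ s j y z Y) :
    RWalk ψ s (k + j) x z (X + Y) := by
  obtain ⟨k₁, hk₁, W₁, h1, h2⟩ := h₁
  obtain ⟨k₂, hk₂, W₂, h3, h4⟩ := h₂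
  exact ⟨_, add_le_add hk₁ hk₂, _, h1.append h3, by linarith⟩

theorem State.Link.rwalk (hl : s.Link ψ x y X) : RWalk ψ s 1 x y X := by
  refine ⟨_, ?_, _, Walk.single (State.coe_wt hl.ne_top).symm, (State.link_iff.1 hl).2⟩
  split_ifs <;> simp

theorem State.Link.rwalk_zero (hl : s.Link ψ x y X) (h0 : 0 ≤ s.w x y) (hx : ∀ a, x ≠ neg a) :
    RWalk ψ s 0 x y X := by
  refine ⟨_, ?_, _, Walk.single (State.coe_wt hl.ne_top).symm, (State.link_iff.1 hl).2⟩
  rw [if_neg]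
  rintro (h | ⟨a, rfl, -⟩)
  · exact absurd h0 (not_le.2 h)
  · exact hx a rfl

theorem RWalk.hopDist_le (hw : RWalk ψ s k x y X) (hd : s.hopDist j y z ≤ (d : EReal)) :
    s.hopDist (k + j) x z ≤ ((X - ψ x + ψ y + d : ℝ) : EReal) := by
  obtain ⟨k₁, hk₁, W₁, h1, h2⟩ := hw
  -- The distance is an infimum over infinitely many walks; shifting it by `W₁` and comparing with
  -- every walk avoids choosing a shortest one.
  have key : s.hopDist (k + j) x z + ((-W₁ : ℝ) : EReal) ≤ s.hopDist j y z := by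
    refine le_hopDist fun i W hi w => ?_
    have := (h1.append w).hopDist_le (h := k + j) (by omega)
    calc _ ≤ ((W₁ + W : ℝ) : EReal) + ((-W₁ : ℝ) : EReal) := by gcongr
      _ = (W : EReal) := by rw [← EReal.coe_add]; congr 1; ring
  have h3 := key.trans hd
  have h4 : s.hopDist (k + j) x z ≤ ((W₁ + d : ℝ) : EReal) := by
    calc s.hopDist (k + j) x z
        = s.hopDist (k + j) x z + ((-W₁ : ℝ) : EReal) + (W₁ : EReal) := by
          rw [add_assoc, ← EReal.coe_add]; simp
      _ ≤ (d : EReal) + (W₁ : EReal) := by gcongr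
      _ = ((W₁ + d : ℝ) : EReal) := by rw [← EReal.coe_add, add_comm]
  exact h4.trans (EReal.coe_le_coe_iff.2 (by linarith))

theorem RWalk.le_hopDist (hw : RWalk ψ s k y z X) (hd : s.hopDist j x y ≤ (d : EReal)) :
    s.hopDist (j + k) x z ≤ ((d + X - ψ y + ψ z : ℝ) : EReal) := by
  obtain ⟨k₁, hk₁, W₁, h1, h2⟩ := hw
  have key : s.hopDist (j + k) x z + ((-W₁ : ℝ) : EReal) ≤ s.hopDist j x y := by
    refine NegSSSP.le_hopDist fun i W hi w => ?_
    have := (w.append h1).hopDist_le (h := j + k) (by omega)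
    calc _ ≤ ((W + W₁ : ℝ) : EReal) + ((-W₁ : ℝ) : EReal) := by gcongr
      _ = (W : EReal) := by rw [← EReal.coe_add]; congr 1; ring
  have h3 := key.trans hd
  have h4 : s.hopDist (j + k) x z ≤ ((d + W₁ : ℝ) : EReal) := by
    calc s.hopDist (j + k) x z
        = s.hopDist (j + k) x z + ((-W₁ : ℝ) : EReal) + (W₁ : EReal) := by
          rw [add_assoc, ← EReal.coe_add]; simp
      _ ≤ (d : EReal) + (W₁ : EReal) := by gcongr
      _ = ((d + W₁ : ℝ) : EReal) := by rw [← EReal.coe_add]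
  exact h4.trans (EReal.coe_le_coe_iff.2 (by linarith))

/-- One additional hop for a vertex of level `0`. -/
def lvlCost (p : Vtx α) : ℕ := if p.level = 0 then 1 else 0

/-! ### Replacing a Steiner vertex by its parent in a walk -/

theorem rwalk_to_neg {a : α} (hst : Stable V s) (hr : s.Reach ψ p (neg a) X) (hs : Frame ψ V s) :
    RWalk ψ s (lvlCost p) p (neg a) X := by
  rcases hr with h | ⟨c, rfl, h⟩
  · refine (h.rwalk_zero (hst.nn_neg p a) ?_).mono (Nat.zero_le _) le_rfl
    rintro c rfl
    exact absurd (hst.neg_out c _ h.ne_top) (by simp)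
  · have h1 := (hs.tight_bar c).rwalk
    have h2 := h.rwalk_zero (hst.nn_neg _ a) (by simp)
    exact (h1.append h2).mono (by simp [lvlCost, level]) (by simp)

/-- Leaving r costs the hop into r̄. The next edge can be a further hop only if it leads to another
copy, and copies have level 0. -/
theorem rwalk_from_neg {a : α} (hst : Stable V s) (hr : s.Reach ψ (neg a) p X)
    (hs : Frame ψ V s) : RWalk ψ s (1 + lvlCost p) (neg a) p X := by
  have hX : 0 ≤ X := by
    rcases hr with h | ⟨c, -, h⟩ <;> exact hs.feas h
  rcases hr with h | ⟨c, hc, h⟩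
  · exact h.rwalk.mono (by omega) le_rfl
  · cases hc
    have h1 := (hs.tight_bar a).rwalk
    by_cases hp : ∃ d, p = bar d
    · obtain ⟨d, rfl⟩ := hp
      exact (h1.append h.rwalk).mono (by simp [lvlCost, level]) (by simp)
    · push Not at hp
      exact (h1.append (h.rwalk_zero (hst.nn_bar a p hp) (by simp))).mono (by omega) (by simp)

/-- If the tight link starts in r̄, the only hop is the step from r to r̄, since `y` is not a copy
and the link has nonnegative weight. -/
theorem rwalk_root_in {a : α} (hst : Stable V s) (hs : Frame ψ V s) (hy : y ∈ V)
    (ha : rootIn y = some a) : RWalk ψ s 1 (neg a) y 0 := by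
  have hyb : ∀ d, y ≠ bar d := by rintro d rfl; simp [rootIn] at ha
  rcases hs.rootIn_tight hy ha with h | ⟨c, hc, h⟩
  · exact h.rwalk
  · cases hc
    exact ((hs.tight_bar a).rwalk.append (h.rwalk_zero (hst.nn_bar a y hyb) (by simp))).mono
      (by omega) (by simp)

theorem rwalk_root_out {a : α} (hst : Stable V s) (hs : Frame ψ V s) (hy : y ∈ V)
    (ha : rootOut y = some a) (hn : ∀ c, y ≠ neg c) : RWalk ψ s 0 y (neg a) 0 :=
  ((hs.rootOut_tight hy ha).resolve_left (hn a)).rwalk_zero (hst.nn_neg y a) hn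

/-- Replacing the first edge of a walk from a vertex that lies over `p`. -/
theorem rwalk_of_inBase (hC : Core ψ V s) (hE : Ends ψ V s) (hst : Stable V s)
    (hp : InBase u p) (hl : s.Link ψ u y X) (h1 : u.inParent ≠ some y)
    (h2 : y.outParent ≠ some u) : RWalk ψ s (1 + lvlCost p) p y X := by
  rcases (hC.edge hl).ein p hp with h | h | ⟨a, ha, hr⟩
  · exact absurd h h1
  · exact absurd h h2
  · have := (rwalk_to_neg hst hr hC.toFrame).append
      (rwalk_root_in hst hC.toFrame (hE _ _ _ hl).2 ha)
    exact this.mono (by omega) (by simp)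

theorem rwalk_of_outBase (hC : Core ψ V s) (hE : Ends ψ V s) (hst : Stable V s)
    (hp : OutBase u p) (hl : s.Link ψ y u X) (h1 : u.outParent ≠ some y)
    (h2 : y.inParent ≠ some u) : RWalk ψ s (1 + lvlCost p) y p X := by
  have hn : ∀ c, y ≠ neg c := by
    rintro c rfl
    have := hst.neg_out c u hl.ne_top
    subst this
    rcases hp with h | ⟨v, h, -⟩ <;> simp [inParent, outParent] at h
  rcases (hC.edge hl).eout p hp with h | h | ⟨a, ha, hr⟩
  · exact absurd h h1
  · exact absurd h h2
  · have := (rwalk_root_out hst hC.toFrame (hE _ _ _ hl).1 ha hn).append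
      (rwalk_from_neg hst hr hC.toFrame)
    exact this.mono (by omega) (by simp)

/-- The first edge of the walk, to `y` say, is replaced by a link from `p` into a negative vertex
and a tight path from there to `y`. This costs at most `1 + lvlCost p` hops and no reduced weight.
If the first edge leads into `p`, it is just removed. -/
theorem rwalk_inS {t l : ℕ} {a : α} (hC : Core ψ V s) (hE : Ends ψ V s) (hst : Stable V s)
    (hw : Walk s k (inS p t l) (neg a) W) :
    RWalk ψ s (1 + lvlCost p + k) p (neg a) (W + ψ (inS p t l) - ψ (neg a)) := by
  have hb : InBase (inS p t l) p := Or.inl rfl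
  cases hw with
  | @cons _ y _ c W k hw w =>
    have hl : s.Link ψ (inS p t l) y (c + ψ (inS p t l) - ψ y) := by
      rw [State.Link, hw]; exact_mod_cast by linarith
    by_cases h1 : (inS p t l).inParent = some y
    · have : p = y := by simpa [inParent] using h1
      subst this
      have := hC.feas hl
      exact ⟨k, by omega, W, w, by linarith⟩
    -- The invariant says nothing on the tight edge into an out-Steiner vertex of the start. But
    -- that vertex also lies over `p`, so the second edge of the walk is replaced instead.
    by_cases h2 : y.outParent = some (inS p t l)
    · have hy := (hE _ _ _ hl).2
      have hf := hC.feas hl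
      have hb' : InBase y p := Or.inr ⟨_, h2, rfl⟩
      obtain ⟨t', l', rfl⟩ := eq_of_outParent h2
      cases w with
      | @cons _ y' _ c' W k hw' w =>
        have hl' : s.Link ψ (outS (inS p t l) t' l') y'
            (c' + ψ (outS (inS p t l) t' l') - ψ y') := by
          rw [State.Link, hw']; exact_mod_cast by linarith
        -- Out-Steiner vertices have no out-Steiner children, so the exception cannot occur a second
        -- time.
        have h3 : y'.outParent ≠ some (outS (inS p t l) t' l') := by
          intro h
          obtain ⟨t'', l'', rfl⟩ := eq_of_outParent h
          have := (hC.outS_mem (hE _ _ _ hl').2).2.2.1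
          simp [outParent] at this
        have h4 := rwalk_of_inBase hC hE hst hb' hl' (by simp [inParent]) h3
        have h5 : RWalk ψ s k y' (neg a) (W + ψ y' - ψ (neg a)) := ⟨k, le_rfl, W, w, le_rfl⟩
        exact (h4.append h5).mono (by omega) (by linarith)
    · have h4 := rwalk_of_inBase hC hE hst hb hl h1 h2
      have h5 : RWalk ψ s k y (neg a) (W + ψ y - ψ (neg a)) := ⟨k, le_rfl, W, w, le_rfl⟩
      exact (h4.append h5).mono (by omega) (by linarith)

/-- The mirror image: here the last edge of the walk, or the one before it, is replaced. -/
theorem rwalk_outS {t l : ℕ} {a : α} (hC : Core ψ V s) (hE : Ends ψ V s) (hst : Stable V s)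
    (hw : Walk s k (neg a) (outS p t l) W) :
    RWalk ψ s (k + (1 + lvlCost p)) (neg a) p (W + ψ (neg a) - ψ (outS p t l)) := by
  have hb : OutBase (outS p t l) p := Or.inl rfl
  rcases hw.last with ⟨h, -⟩ | ⟨y, k₁, W₁, c, w₁, hw₁, hk, rfl⟩
  · simp at h
  have hl : s.Link ψ y (outS p t l) (c + ψ y - ψ (outS p t l)) := by
    rw [State.Link, hw₁]; exact_mod_cast by linarith
  by_cases h1 : (outS p t l).outParent = some y
  · have : p = y := by simpa [outParent] using h1
    subst this
    have := hC.feas hl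
    exact ⟨k₁, by omega, W₁, w₁, by linarith⟩
  by_cases h2 : y.inParent = some (outS p t l)
  · have hf := hC.feas hl
    have hb' : OutBase y p := Or.inr ⟨_, h2, rfl⟩
    obtain ⟨t', l', rfl⟩ := eq_of_inParent h2
    rcases w₁.last with ⟨h, -⟩ | ⟨y', k₂, W₂, c', w₂, hw', hk', rfl⟩
    · simp at h
    have hl' : s.Link ψ y' (inS (outS p t l) t' l')
        (c' + ψ y' - ψ (inS (outS p t l) t' l')) := by
      rw [State.Link, hw']; exact_mod_cast by linarith
    have h3 : y'.inParent ≠ some (inS (outS p t l) t' l') := by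
      intro h
      obtain ⟨t'', l'', rfl⟩ := eq_of_inParent h
      have := (hC.inS_mem (hE _ _ _ hl').1).2.2
      simp [inParent] at this
    have h4 := rwalk_of_outBase hC hE hst hb' hl' (by simp [outParent]) h3
    have h5 : RWalk ψ s k₂ (neg a) y' (W₂ + ψ (neg a) - ψ y') := ⟨k₂, le_rfl, W₂, w₂, le_rfl⟩
    exact (h5.append h4).mono (by omega) (by linarith)
  · have h4 := rwalk_of_outBase hC hE hst hb hl h1 h2
    have h5 : RWalk ψ s k₁ (neg a) y (W₁ + ψ (neg a) - ψ y) := ⟨k₁, le_rfl, W₁, w₁, le_rfl⟩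
    exact (h5.append h4).mono (by omega) (by linarith)

/-- From `e + D ≤ E ≤ d` to `e ≤ d - D` in the extended reals. -/
theorem EReal_le_sub_of_add_le {e E : EReal} {D d : ℝ} (h : e + (D : EReal) ≤ E)
    (hd : E ≤ (d : EReal)) : e ≤ ((d - D : ℝ) : EReal) := by
  calc e = e + (D : EReal) + ((-D : ℝ) : EReal) := by
        rw [add_assoc, ← EReal.coe_add]; simp
    _ ≤ (d : EReal) + ((-D : ℝ) : EReal) := by gcongr; exact h.trans hd
    _ = ((d - D : ℝ) : EReal) := by rw [← EReal.coe_add, sub_eq_add_neg]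

/-- Shows that the tentative distance which `ShortcutIn` hands to the in-parent is still realised by
an actual walk, with few additional hops. The number subtracted is the weight of the tight edge. -/
theorem hopDist_inParent {t l : ℕ} {a : α} (hC : Core ψ V s) (hE : Ends ψ V s)
    (hst : Stable V s) (hd : s.hopDist j (inS p t l) (neg a) ≤ (d : EReal)) :
    s.hopDist (j + 1 + lvlCost p) p (neg a) ≤ ((d - (ψ p - ψ (inS p t l)) : ℝ) : EReal) := by
  refine EReal_le_sub_of_add_le (le_hopDist fun k W hk w => ?_) hd
  obtain ⟨k', hk', W', w', hW'⟩ := rwalk_inS hC hE hst w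
  calc _ ≤ (W' : EReal) + ((ψ p - ψ (inS p t l) : ℝ) : EReal) := by
        gcongr; exact w'.hopDist_le (by omega)
    _ ≤ (W : EReal) := by
        rw [← EReal.coe_add]; exact EReal.coe_le_coe_iff.2 (by linarith)

theorem hopDist_outParent {t l : ℕ} {a : α} (hC : Core ψ V s) (hE : Ends ψ V s)
    (hst : Stable V s) (hd : s.hopDist j (neg a) (outS p t l) ≤ (d : EReal)) :
    s.hopDist (j + 1 + lvlCost p) (neg a) p ≤ ((d - (ψ (outS p t l) - ψ p) : ℝ) : EReal) := by
  refine EReal_le_sub_of_add_le (le_hopDist fun k W hk w => ?_) hd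
  obtain ⟨k', hk', W', w', hW'⟩ := rwalk_outS hC hE hst w
  calc _ ≤ (W' : EReal) + ((ψ (outS p t l) - ψ p : ℝ) : EReal) := by
        gcongr; exact w'.hopDist_le (by omega)
    _ ≤ (W : EReal) := by
        rw [← EReal.coe_add]; exact EReal.coe_le_coe_iff.2 (by linarith)

end

/-! ### The graph during an iteration -/

/-- The invariant during iteration `t`: `V` are the vertices that are completely set up and `V'` all
vertices. -/
structure Mid (ψ : Vtx α → ℝ) (V V' : Finset (Vtx α)) (t : ℕ) (s : State α) : Prop where
  core : Core ψ V s
  ends : Ends ψ V' s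
  verts : s.verts = V'
  sgn : Sgn ψ V
  lvl : ∀ v ∈ V', v.level ≤ t
  bar_nn : ∀ c y X, s.Link ψ (bar c) y X → (∀ a, y ≠ neg a) → (∀ a, y ≠ bar a) →
    0 ≤ X - ψ (bar c) + ψ y
  new_in : ∀ p l y X, s.Link ψ (inS p t l) y X → y = p ∨ ∃ a, y = hub a t
  new_out : ∀ p l y X, s.Link ψ y (outS p t l) X → y = p ∨ ∃ a, y = hub a t

section

variable {s s' base : State α} {ψ φ : Vtx α → ℝ} {V V' V₀ : Finset (Vtx α)} {t : ℕ}
  {x y p q u v : Vtx α} {X Y W : ℝ}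

/-- Edges among negative vertices, their copies and N-Steiner vertices are unconstrained. -/
theorem EdgeOK.of_none (hx : x.inParent = none) (hx' : x.outParent = none) (hy : y.inParent = none)
    (hy' : y.outParent = none) : EdgeOK s ψ x y X where
  ein p hp := by
    rcases hp with h | ⟨v, h, -⟩
    · rw [hx] at h; simp at h
    · rw [hx'] at h; simp at h
  eout p hp := by
    rcases hp with h | ⟨v, h, -⟩
    · rw [hy'] at h; simp at h
    · rw [hy] at h; simp at h
  lvl_in _ _ _ h := absurd hx h
  lvl_out _ _ _ h := absurd hy' h
  outNeg a := by rw [hy']; simp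

theorem Core.addEdge (hs : Core ψ V s) (hW : 0 ≤ W + ψ x - ψ y)
    (he : EdgeOK s ψ x y (W + ψ x - ψ y)) : Core ψ V (s.addEdge x y W) := by
  refine ⟨hs.toFrame.addEdge hW, ?_, ?_, ?_⟩
  · intro x' y' X hX
    rcases State.link_addEdge.1 hX with h | ⟨rfl, rfl, h⟩
    · exact (hs.edge h).of_reachSub Sub.addEdge.reachSub
    · exact (he.mono h).of_reachSub Sub.addEdge.reachSub
  · exact fun e he => (hs.deferIn e he).of_reachSub Sub.addEdge.reachSub subset_rfl
  · exact fun e he => (hs.deferOut e he).of_reachSub Sub.addEdge.reachSub subset_rfl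

theorem Mid.addEdge (hs : Mid ψ V V' t s) (hW : 0 ≤ W + ψ x - ψ y)
    (he : EdgeOK s ψ x y (W + ψ x - ψ y)) (hx : x ∈ V') (hy : y ∈ V')
    (hb : ∀ c, x = bar c → (∀ a, y ≠ neg a) → (∀ a, y ≠ bar a) → 0 ≤ W)
    (hin : ∀ p l, x = inS p t l → y = p ∨ ∃ a, y = hub a t)
    (hout : ∀ p l, y = outS p t l → x = p ∨ ∃ a, x = hub a t) :
    Mid ψ V V' t (s.addEdge x y W) where
  core := hs.core.addEdge hW he
  ends x' y' X hX := by
    rcases State.link_addEdge.1 hX with h | ⟨rfl, rfl, -⟩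
    · exact hs.ends _ _ _ h
    · exact ⟨hx, hy⟩
  verts := hs.verts
  sgn := hs.sgn
  lvl := hs.lvl
  bar_nn c y' X hX h1 h2 := by
    rcases State.link_addEdge.1 hX with h | ⟨h, rfl, h'⟩
    · exact hs.bar_nn c y' X h h1 h2
    · have := hb c h.symm h1 h2
      subst h; linarith
  new_in p l y' X hX := by
    rcases State.link_addEdge.1 hX with h | ⟨h, rfl, h'⟩
    · exact hs.new_in p l y' X h
    · exact hin p l h.symm
  new_out p l y' X hX := by
    rcases State.link_addEdge.1 hX with h | ⟨rfl, h, h'⟩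
    · exact hs.new_out p l y' X h
    · exact hout p l h.symm

theorem Core.of_w_eq (hs : Core ψ V s) (hw : s'.w = s.w) (h1 : s'.fIn = s.fIn)
    (h2 : s'.fOut = s.fOut) : Core ψ V s' := by
  have hl : ∀ x y X, s'.Link ψ x y X ↔ s.Link ψ x y X := fun x y X => by
    unfold State.Link; rw [hw]
  have hsub : Sub ψ s s' := fun x y X h => (hl x y X).2 h
  refine ⟨hs.toFrame.of_sub hsub fun h => hs.feas ((hl _ _ _).1 h),
    fun h => (hs.edge ((hl _ _ _).1 h)).of_reachSub hsub.reachSub, ?_, ?_⟩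
  · exact fun e he => (hs.deferIn e (h1 ▸ he)).of_reachSub hsub.reachSub subset_rfl
  · exact fun e he => (hs.deferOut e (h2 ▸ he)).of_reachSub hsub.reachSub subset_rfl

theorem Mid.addVertex (hs : Mid ψ V V' t s) (hx : x.level ≤ t) :
    Mid ψ V (insert x V') t (s.addVertex x) where
  core := hs.core.of_w_eq rfl rfl rfl
  ends x y X h := ⟨Finset.mem_insert_of_mem (hs.ends x y X h).1,
    Finset.mem_insert_of_mem (hs.ends x y X h).2⟩
  verts := by simp [State.addVertex, hs.verts]
  sgn := hs.sgn
  lvl v hv := by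
    rcases Finset.mem_insert.1 hv with rfl | hv
    · exact hx
    · exact hs.lvl v hv
  bar_nn := hs.bar_nn
  new_in := hs.new_in
  new_out := hs.new_out

/-- The tight edges demanded of a Steiner vertex exist only once its gadget is complete. Hence the
vertex joins `V` in a separate step after its edges have been added. -/
theorem Core.insert_inS {v : Vtx α} {l : ℕ} (hs : Core ψ V s) (hv : v ∈ V) (hlv : v.level < t)
    (hp : v.inParent = none) (htight : s.Link ψ (inS v t l) v 0)
    (hroot : ∀ a, rootIn v = some a → s.Reach ψ (neg a) (inS v t l) 0) :
    Core ψ (insert (inS v t l) V) s := by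
  have hsub : V ⊆ insert (inS v t l) V := Finset.subset_insert _ _
  refine ⟨⟨fun a => hsub (hs.neg_mem a), fun a => hsub (hs.bar_mem a), ?_, ?_, ?_, hs.feas, ?_, ?_,
    hs.tight_bar, hs.tight_neg, ?_, ?_⟩, hs.edge,
    fun e he => (hs.deferIn e he).of_reachSub (fun _ _ _ h => h) hsub,
    fun e he => (hs.deferOut e he).of_reachSub (fun _ _ _ h => h) hsub⟩
  · intro p t' l' h
    rcases Finset.mem_insert.1 h with h | h
    · cases h; exact ⟨hsub hv, hlv, hp⟩
    · obtain ⟨h1, h2⟩ := hs.inS_mem h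
      exact ⟨hsub h1, h2⟩
  · intro p t' l' h
    obtain ⟨h1, h2⟩ := hs.outS_mem (by simpa using h)
    exact ⟨hsub h1, h2⟩
  · intro a t' h
    exact hs.hub_mem (by simpa using h)
  · intro p t' l' h
    rcases Finset.mem_insert.1 h with h | h
    · cases h; exact htight
    · exact hs.tight_inS h
  · intro p t' l' h
    exact hs.tight_outS (by simpa using h)
  · intro y a hy ha
    rcases Finset.mem_insert.1 hy with rfl | hy
    · refine hroot a ?_
      cases v <;> simp_all [rootIn]
    · exact hs.rootIn_tight hy ha
  · intro y a hy ha
    rcases Finset.mem_insert.1 hy with rfl | hy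
    · simp [rootOut] at ha
    · exact hs.rootOut_tight hy ha

theorem Core.insert_outS {v : Vtx α} {l : ℕ} (hs : Core ψ V s) (hv : v ∈ V) (hlv : v.level < t)
    (hp : v.outParent = none) (hn : ∀ a, v ≠ neg a) (htight : s.Link ψ v (outS v t l) 0)
    (hroot : ∀ a, rootOut v = some a → s.Link ψ (outS v t l) (neg a) 0) :
    Core ψ (insert (outS v t l) V) s := by
  have hsub : V ⊆ insert (outS v t l) V := Finset.subset_insert _ _
  refine ⟨⟨fun a => hsub (hs.neg_mem a), fun a => hsub (hs.bar_mem a), ?_, ?_, ?_, hs.feas, ?_, ?_,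
    hs.tight_bar, hs.tight_neg, ?_, ?_⟩, hs.edge,
    fun e he => (hs.deferIn e he).of_reachSub (fun _ _ _ h => h) hsub,
    fun e he => (hs.deferOut e he).of_reachSub (fun _ _ _ h => h) hsub⟩
  · intro p t' l' h
    obtain ⟨h1, h2⟩ := hs.inS_mem (by simpa using h)
    exact ⟨hsub h1, h2⟩
  · intro p t' l' h
    rcases Finset.mem_insert.1 h with h | h
    · cases h; exact ⟨hsub hv, hlv, hp, hn⟩
    · obtain ⟨h1, h2⟩ := hs.outS_mem h
      exact ⟨hsub h1, h2⟩
  · intro a t' h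
    exact hs.hub_mem (by simpa using h)
  · intro p t' l' h
    exact hs.tight_inS (by simpa using h)
  · intro p t' l' h
    rcases Finset.mem_insert.1 h with h | h
    · cases h; exact htight
    · exact hs.tight_outS h
  · intro y a hy ha
    rcases Finset.mem_insert.1 hy with rfl | hy
    · simp [rootIn] at ha
    · exact hs.rootIn_tight hy ha
  · intro y a hy ha
    rcases Finset.mem_insert.1 hy with rfl | hy
    · right
      refine hroot a ?_
      cases v <;> simp_all [rootOut]
    · exact hs.rootOut_tight hy ha

theorem Core.insert_hub {a : α} (hs : Core ψ V s) (ht : 1 ≤ t)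
    (h1 : s.Reach ψ (neg a) (hub a t) 0) (h2 : s.Link ψ (hub a t) (neg a) 0) :
    Core ψ (insert (hub a t) V) s := by
  have hsub : V ⊆ insert (hub a t) V := Finset.subset_insert _ _
  refine ⟨⟨fun a => hsub (hs.neg_mem a), fun a => hsub (hs.bar_mem a), ?_, ?_, ?_, hs.feas, ?_, ?_,
    hs.tight_bar, hs.tight_neg, ?_, ?_⟩, hs.edge,
    fun e he => (hs.deferIn e he).of_reachSub (fun _ _ _ h => h) hsub,
    fun e he => (hs.deferOut e he).of_reachSub (fun _ _ _ h => h) hsub⟩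
  · intro p t' l' h
    obtain ⟨h1, h2⟩ := hs.inS_mem (by simpa using h)
    exact ⟨hsub h1, h2⟩
  · intro p t' l' h
    obtain ⟨h1, h2⟩ := hs.outS_mem (by simpa using h)
    exact ⟨hsub h1, h2⟩
  · intro c t' h
    rcases Finset.mem_insert.1 h with h | h
    · cases h; exact ht
    · exact hs.hub_mem h
  · intro p t' l' h
    exact hs.tight_inS (by simpa using h)
  · intro p t' l' h
    exact hs.tight_outS (by simpa using h)
  · intro y c hy hc
    rcases Finset.mem_insert.1 hy with rfl | hy
    · simp only [rootIn, Option.some.injEq] at hc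
      subst hc; exact h1
    · exact hs.rootIn_tight hy hc
  · intro y c hy hc
    rcases Finset.mem_insert.1 hy with rfl | hy
    · simp only [rootOut, Option.some.injEq] at hc
      subst hc; exact Or.inr h2
    · exact hs.rootOut_tight hy hc

theorem Mid.of_core (hs : Mid ψ V V' t s) (hc : Core ψ V' s) (hg : Sgn ψ V') :
    Mid ψ V' V' t s := { hs with core := hc, sgn := hg }

theorem Sgn.insert_inS {l : ℕ} (hg : Sgn ψ V) (h : 0 ≤ ψ v - ψ (Vtx.inS v t l)) :
    Sgn ψ (insert (Vtx.inS v t l) V) where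
  outS p t' l' hp := hg.outS p t' l' (by simpa using hp)
  inS p t' l' hp hb := by
    rcases Finset.mem_insert.1 hp with hp | hp
    · cases hp; exact h
    · exact hg.inS p t' l' hp hb
  neg := hg.neg

theorem Sgn.insert_outS {l : ℕ} (hg : Sgn ψ V) (h : 0 ≤ ψ (Vtx.outS v t l) - ψ v) :
    Sgn ψ (insert (Vtx.outS v t l) V) where
  inS p t' l' hp := hg.inS p t' l' (by simpa using hp)
  outS p t' l' hp := by
    rcases Finset.mem_insert.1 hp with hp | hp
    · cases hp; exact h
    · exact hg.outS p t' l' hp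
  neg := hg.neg

theorem Sgn.insert_hub {a : α} (hg : Sgn ψ V) : Sgn ψ (insert (hub a t) V) where
  inS p t' l' hp := hg.inS p t' l' (by simpa using hp)
  outS p t' l' hp := hg.outS p t' l' (by simpa using hp)
  neg := hg.neg

/-! ### Adjacency lists -/

theorem mem_aIn : u ∈ base.aIn v ↔ u ∈ base.verts ∧ base.w u v ≠ ⊤ ∧ 0 ≤ base.w u v ∧
    (v ∈ base.heavy → u.inParent ≠ some v) ∧ v.inParent = none ∧ v.outParent ≠ some u := by
  rw [State.aIn, List.mem_mergeSort, Finset.mem_toList, Finset.mem_filter]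

theorem mem_aOut : u ∈ base.aOut v ↔ u ∈ base.verts ∧ base.w v u ≠ ⊤ ∧ 0 ≤ base.w v u ∧
    (v ∈ base.heavy → u.outParent ≠ some v) ∧ v.outParent = none ∧ v.inParent ≠ some u := by
  rw [State.aOut, List.mem_mergeSort, Finset.mem_toList, Finset.mem_filter]

/-- The last of the first `m` entries is the lightest. With `m = k - 2 ^ l` this says that the
weight shifted by a gadget leaves nonnegative weights on the remaining edges. -/
theorem take_ge_of_pairwise {β : Type*} {A : List β} {f : β → WithTop ℝ}
    (hA : A.Pairwise fun x y => f y ≤ f x) {m : ℕ} (hm : m - 1 < A.length) {u d : β}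
    (hu : u ∈ A.take m) : f (A.getD (m - 1) d) ≤ f u := by
  obtain ⟨i, hi, rfl⟩ := List.mem_iff_getElem.1 hu
  rw [List.length_take] at hi
  rw [List.getElem_take, List.getD_eq_getElem _ _ hm]
  rcases Nat.lt_or_ge i (m - 1) with h | h
  · exact List.pairwise_iff_getElem.1 hA i (m - 1) (by omega) hm h
  · have : i = m - 1 := by omega
    subst this; exact le_rfl

theorem aIn_pairwise : (base.aIn v).Pairwise fun x y => base.w y v ≤ base.w x v := by
  have := List.pairwise_mergeSort (le := fun x y => decide (base.w y v ≤ base.w x v))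
    (fun a b c h1 h2 => by
      simp only [decide_eq_true_eq] at *
      exact h2.trans h1)
    (fun a b => by simpa using le_total _ _)
    (base.verts.filter fun u => base.w u v ≠ ⊤ ∧ 0 ≤ base.w u v ∧
      (v ∈ base.heavy → u.inParent ≠ some v) ∧ v.inParent = none ∧
      v.outParent ≠ some u).toList
  unfold State.aIn
  simpa only [decide_eq_true_eq] using this

theorem aOut_pairwise : (base.aOut v).Pairwise fun x y => base.w v y ≤ base.w v x := by
  have := List.pairwise_mergeSort (le := fun x y => decide (base.w v y ≤ base.w v x))
    (fun a b c h1 h2 => by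
      simp only [decide_eq_true_eq] at *
      exact h2.trans h1)
    (fun a b => by simpa using le_total _ _)
    (base.verts.filter fun u => base.w v u ≠ ⊤ ∧ 0 ≤ base.w v u ∧
      (v ∈ base.heavy → u.outParent ≠ some v) ∧ v.outParent = none ∧
      v.inParent ≠ some u).toList
  unfold State.aOut
  simpa only [decide_eq_true_eq] using this

/-- The weight that an in-Steiner vertex shifts to its edge into the parent. -/
def shiftIn (base : State α) (v : Vtx α) (l : ℕ) : ℝ :=
  base.wt ((base.aIn v).getD ((base.aIn v).length - 2 ^ l - 1) v) v

/-- The weight that an out-Steiner vertex shifts to its edge from the parent. -/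
def shiftOut (base : State α) (v : Vtx α) (l : ℕ) : ℝ :=
  base.wt v ((base.aOut v).getD ((base.aOut v).length - 2 ^ l - 1) v)

/-- Guarantees that the index `k - 2 ^ l - 1` is not truncated and lies in the list, so the default
value of `getD` is never taken. -/
theorem two_pow_lt_of_lt_clog {k l : ℕ} (h : l < Nat.clog 2 k) : 2 ^ l < k := by
  by_contra hc
  have := Nat.clog_le_of_le_pow (b := 2) (not_lt.1 hc)
  omega

theorem wt_nonneg (h : 0 ≤ s.w x y) : 0 ≤ s.wt x y := by
  by_cases ht : s.w x y = ⊤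
  · simp [State.wt, ht]
  · rw [← State.coe_wt ht] at h
    exact_mod_cast h

theorem shiftIn_nonneg {l : ℕ} (h : l < Nat.clog 2 (base.aIn v).length) : 0 ≤ shiftIn base v l := by
  have h1 := two_pow_lt_of_lt_clog h
  have h0 := Nat.two_pow_pos l
  refine wt_nonneg (mem_aIn.1 ?_).2.2.1
  rw [List.getD_eq_getElem _ _ (by omega)]
  exact List.getElem_mem _

theorem shiftOut_nonneg {l : ℕ} (h : l < Nat.clog 2 (base.aOut v).length) :
    0 ≤ shiftOut base v l := by
  have h1 := two_pow_lt_of_lt_clog h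
  have h0 := Nat.two_pow_pos l
  refine wt_nonneg (mem_aOut.1 ?_).2.2.1
  rw [List.getD_eq_getElem _ _ (by omega)]
  exact List.getElem_mem _

theorem shiftIn_le {l : ℕ} (h : l < Nat.clog 2 (base.aIn v).length)
    (hu : u ∈ (base.aIn v).take ((base.aIn v).length - 2 ^ l)) :
    shiftIn base v l ≤ base.wt u v := by
  have h1 := two_pow_lt_of_lt_clog h
  have h0 := Nat.two_pow_pos l
  have h2 := take_ge_of_pairwise aIn_pairwise (d := v) (by omega) hu
  have h3 : (base.aIn v).getD ((base.aIn v).length - 2 ^ l - 1) v ∈ base.aIn v := by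
    rw [List.getD_eq_getElem _ _ (by omega)]
    exact List.getElem_mem _
  rw [← State.coe_wt (mem_aIn.1 h3).2.1, ← State.coe_wt (mem_aIn.1 (List.mem_of_mem_take hu)).2.1]
    at h2
  exact WithTop.coe_le_coe.1 h2

theorem shiftOut_le {l : ℕ} (h : l < Nat.clog 2 (base.aOut v).length)
    (hu : u ∈ (base.aOut v).take ((base.aOut v).length - 2 ^ l)) :
    shiftOut base v l ≤ base.wt v u := by
  have h1 := two_pow_lt_of_lt_clog h
  have h0 := Nat.two_pow_pos l
  have h2 := take_ge_of_pairwise (f := fun u => base.w v u) aOut_pairwise (d := v) (by omega) hu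
  have h3 : (base.aOut v).getD ((base.aOut v).length - 2 ^ l - 1) v ∈ base.aOut v := by
    rw [List.getD_eq_getElem _ _ (by omega)]
    exact List.getElem_mem _
  rw [← State.coe_wt (mem_aOut.1 h3).2.1,
    ← State.coe_wt (mem_aOut.1 (List.mem_of_mem_take hu)).2.1] at h2
  exact WithTop.coe_le_coe.1 h2

end

/-! ### Steiner gadgets -/

/-- The base graph of iteration `t`, with a potential that is already defined on the vertices to be
created. -/
structure Setup (ψ : Vtx α → ℝ) (V₀ : Finset (Vtx α)) (t : ℕ) (Δ : α → ℝ) (base : State α) :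
    Prop where
  core : Core ψ V₀ base
  ends : Ends ψ V₀ base
  stable : Stable V₀ base
  verts : base.verts = V₀
  heavy : base.heavy ⊆ V₀
  lvl : ∀ v ∈ V₀, v.level < t
  pot_in : ∀ v ∈ V₀, ∀ l, ψ (inS v t l) = ψ v - shiftIn base v l
  pot_out : ∀ v ∈ V₀, ∀ l, ψ (outS v t l) = ψ v + shiftOut base v l
  pot_hub : ∀ a, ψ (hub a t) = ψ (neg a) - Δ a

section

variable {s s' base : State α} {ψ φ : Vtx α → ℝ} {V V' V₀ : Finset (Vtx α)} {t : ℕ} {Δ : α → ℝ}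
  {x y p q u v : Vtx α} {X Y W : ℝ}

theorem Setup.not_new_in (S : Setup ψ V₀ t Δ base) (hx : x ∈ V₀) (p : Vtx α) (l : ℕ) :
    x ≠ inS p t l := by
  rintro rfl
  exact absurd (S.lvl _ hx) (by simp [level])

theorem Setup.not_new_out (S : Setup ψ V₀ t Δ base) (hx : x ∈ V₀) (p : Vtx α) (l : ℕ) :
    x ≠ outS p t l := by
  rintro rfl
  exact absurd (S.lvl _ hx) (by simp [level])

theorem Setup.mid (S : Setup ψ V₀ t Δ base) : Mid ψ V₀ V₀ t base where
  core := S.core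
  ends := S.ends
  verts := S.verts
  sgn := S.stable.sgn S.core
  lvl v hv := (S.lvl v hv).le
  bar_nn c y X h _ h2 := (State.nonneg_iff (ψ := ψ)).1 (S.stable.nn_bar c y h2) X h
  new_in p l _ _ h := absurd rfl (S.not_new_in (S.ends _ _ _ h).1 p l)
  new_out p l _ _ h := absurd rfl (S.not_new_out (S.ends _ _ _ h).2 p l)

/-- The edges of the lists of a heavy vertex into its in-Steiner vertices. -/
theorem edgeOK_inS (he : EdgeOK base ψ u v X) (hv : v ∈ base.heavy) (hu : u ∈ base.aIn v)
    (hsub : Sub ψ base s) (l : ℕ) : EdgeOK s ψ u (inS v t l) X := by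
  obtain ⟨-, -, -, h1, h2, h3⟩ := mem_aIn.1 hu
  refine ⟨fun p hp => ?_, fun p hp => ?_, fun b t hb => by simp at hb,
    fun b t _ h => by simp [outParent] at h, fun a => by simp [outParent]⟩
  · rcases he.ein p hp with h | h | ⟨a, ha, hr⟩
    · exact absurd h (h1 hv)
    · exact absurd h h3
    · refine Or.inr (Or.inr ⟨a, ?_, hsub.reach hr⟩)
      cases v <;> simp_all [rootIn, inParent]
  · rcases hp with hp | ⟨w, hp, hp'⟩
    · simp [outParent] at hp
    · have hw : v = w := by simpa [inParent] using hp
      subst hw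
      rcases he.eout p (Or.inl hp') with h | h | ⟨a, ha, hr⟩
      · exact absurd h h3
      · exact absurd h (h1 hv)
      · exact Or.inr (Or.inr ⟨a, ha, hsub.reach hr⟩)

/-- Whatever `p` lies over, its out-Steiner vertex lies over too, and `p` inherits the `rootOut` of
that vertex; so the condition on the base edge carries over. -/
theorem edgeOK_inS_parent {t' l' : ℕ} (he : EdgeOK base ψ (outS p t' l') v X)
    (hv : v ∈ base.heavy) (hu : outS p t' l' ∈ base.aIn v) (hp0 : p.outParent = none)
    (hsub : Sub ψ base s) (l : ℕ) : EdgeOK s ψ p (inS v t l) X := by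
  obtain ⟨-, -, -, h1, h2, h3⟩ := mem_aIn.1 hu
  refine ⟨fun q hq => ?_, fun q hq => ?_, fun b t hb => by simp at hb,
    fun b t _ h => by simp [outParent] at h, fun a => by simp [outParent]⟩
  · have hq' : InBase (outS p t' l') q := by
      rcases hq with hq | ⟨w, hq, -⟩
      · exact Or.inr ⟨p, rfl, hq⟩
      · rw [hp0] at hq; simp at hq
    rcases he.ein q hq' with h | h | ⟨a, ha, hr⟩
    · exact absurd h (h1 hv)
    · exact absurd h h3
    · refine Or.inr (Or.inr ⟨a, ?_, hsub.reach hr⟩)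
      cases v <;> simp_all [rootIn, inParent]
  · rcases hq with hq | ⟨w, hq, hq'⟩
    · simp [outParent] at hq
    · have hw : v = w := by simpa [inParent] using hq
      subst hw
      rcases he.eout q (Or.inl hq') with h | h | ⟨a, ha, hr⟩
      · exact absurd h h3
      · exact absurd h (h1 hv)
      · refine Or.inr (Or.inr ⟨a, ?_, hsub.reach hr⟩)
        cases p <;> simp_all [rootOut, outParent]

theorem edgeOK_outS (he : EdgeOK base ψ v u X) (hv : v ∈ base.heavy) (hu : u ∈ base.aOut v)
    (hvn : ∀ a, v ≠ neg a) (hsub : Sub ψ base s) (l : ℕ) : EdgeOK s ψ (outS v t l) u X := by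
  obtain ⟨-, -, -, h1, h2, h3⟩ := mem_aOut.1 hu
  refine ⟨fun p hp => ?_, fun p hp => ?_, fun b t _ h => by simp [inParent] at h,
    fun b t hb => by simp at hb, he.outNeg⟩
  · rcases hp with hp | ⟨w, hp, hp'⟩
    · simp [inParent] at hp
    · have hw : v = w := by simpa [outParent] using hp
      subst hw
      rcases he.ein p (Or.inl hp') with h | h | ⟨a, ha, hr⟩
      · exact absurd h h3
      · exact absurd h (h1 hv)
      · exact Or.inr (Or.inr ⟨a, ha, hsub.reach hr⟩)
  · rcases he.eout p hp with h | h | ⟨a, ha, hr⟩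
    · exact absurd h (h1 hv)
    · exact absurd h h3
    · refine Or.inr (Or.inr ⟨a, ?_, hsub.reach hr⟩)
      cases v <;> simp_all [rootOut, outParent]

theorem edgeOK_outS_parent {t' l' : ℕ} (he : EdgeOK base ψ v (inS p t' l') X)
    (hv : v ∈ base.heavy) (hu : inS p t' l' ∈ base.aOut v) (hp0 : p.inParent = none)
    (hp1 : ∀ a, p.outParent ≠ some (neg a))
    (hvn : ∀ a, v ≠ neg a) (hsub : Sub ψ base s) (l : ℕ) : EdgeOK s ψ (outS v t l) p X := by
  obtain ⟨-, -, -, h1, h2, h3⟩ := mem_aOut.1 hu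
  refine ⟨fun q hq => ?_, fun q hq => ?_, fun b t _ h => by simp [inParent] at h,
    fun b t hb => by simp at hb, hp1⟩
  · rcases hq with hq | ⟨w, hq, hq'⟩
    · simp [inParent] at hq
    · have hw : v = w := by simpa [outParent] using hq
      subst hw
      rcases he.ein q (Or.inl hq') with h | h | ⟨a, ha, hr⟩
      · exact absurd h h3
      · exact absurd h (h1 hv)
      · refine Or.inr (Or.inr ⟨a, ?_, hsub.reach hr⟩)
        cases p <;> simp_all [rootIn, inParent]
  · have hq' : OutBase (inS p t' l') q := by
      rcases hq with hq | ⟨w, hq, -⟩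
      · exact Or.inr ⟨p, rfl, hq⟩
      · rw [hp0] at hq; simp at hq
    rcases he.eout q hq' with h | h | ⟨a, ha, hr⟩
    · exact absurd h (h1 hv)
    · exact absurd h h3
    · refine Or.inr (Or.inr ⟨a, ?_, hsub.reach hr⟩)
      cases v <;> simp_all [rootOut, outParent]

/-- The invariant of the gadget construction. -/
def Grown (ψ : Vtx α → ℝ) (V₀ : Finset (Vtx α)) (t : ℕ) (base s : State α) : Prop :=
  ∃ V, Mid ψ V V t s ∧ V₀ ⊆ V ∧ Sub ψ base s

/-- With the potential `ψ v - W` at the new vertex its edge into `v` is tight, and the edge from `u`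
into it has the reduced weight of the base edge from `u` to `v`. So the gadget only copies edges
that already satisfy the invariant. -/
theorem inGadget_spec (S : Setup ψ V₀ t Δ base) (hv : v ∈ base.heavy)
    (hs : Grown ψ V₀ t base s) : Grown ψ V₀ t base (inGadget base t s v) := by
  refine foldl_inv (P := Grown ψ V₀ t base) _ ?_ _ hs
  rintro s ⟨V, M, hV, hsub⟩ l hl
  rw [List.mem_range] at hl
  have hvV := S.heavy hv
  have hlen := two_pow_lt_of_lt_clog hl
  have h2l := Nat.two_pow_pos l
  have hne : ∃ u, u ∈ base.aIn v := List.exists_mem_of_length_pos (by omega)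
  obtain ⟨u₀, hu₀⟩ := hne
  have hvin : v.inParent = none := (mem_aIn.1 hu₀).2.2.2.2.1
  have hpot := S.pot_in v hvV l
  have hW0 := shiftIn_nonneg hl
  have hlv := S.lvl v hvV
  set x : Vtx α := inS v t l with hx
  set W : ℝ := shiftIn base v l with hW
  have hxV : x ∈ insert x V := Finset.mem_insert_self _ _
  have hin : ∀ {z}, z ∈ V₀ → z ∈ insert x V := fun h => Finset.mem_insert_of_mem (hV h)
  have M1 : Mid ψ V (insert x V) t ((s.addVertex x).addEdge x v W) := by
    have e : W + ψ x - ψ v = 0 := by rw [hpot]; ring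
    refine (M.addVertex (x := x) (by simp [hx, level])).addEdge e.ge ?_ hxV (hin hvV)
      (by simp [hx]) ?_ ?_
    · refine ⟨fun p _ => Or.inl rfl, fun p _ => Or.inr (Or.inl rfl), fun b t _ _ => Or.inl rfl,
        fun b t hb => by simp [hx] at hb, fun a ha => ?_⟩
      obtain ⟨t', l', rfl⟩ := eq_of_outParent ha
      exact (S.core.outS_mem hvV).2.2.2 a rfl
    · intro p l' h
      rw [hx, inS.injEq] at h
      exact Or.inl h.1
    · intro p l' h
      exact absurd h (S.not_new_out hvV p l')
  set s1 : State α := (s.addVertex x).addEdge x v W with hs1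
  have hsub1 : Sub ψ base s1 := hsub.trans fun _ _ _ h => Sub.addEdge _ _ _ h
  have ht1 : s1.Link ψ x v 0 :=
    State.link_addEdge.2 (Or.inr ⟨rfl, rfl, by rw [hpot]; linarith⟩)
  set s2 : State α := ((base.aIn v).take ((base.aIn v).length - 2 ^ l)).foldl (fun s u =>
      let s := s.addEdge u x (base.wt u v - W)
      match u with
      | outS p t' l' => s.addEdge p x (s.wt p (outS p t' l') + base.wt (outS p t' l') v - W)
      | _ => s) s1 with hs2
  have M2 : Mid ψ V (insert x V) t s2 ∧ Sub ψ s1 s2 := by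
    refine foldl_inv (P := fun s => Mid ψ V (insert x V) t s ∧ Sub ψ s1 s) _ ?_ _
      ⟨M1, Sub.refl _ _⟩
    rintro s' ⟨M', hsub'⟩ u hu
    have huA := List.mem_of_mem_take hu
    obtain ⟨huV, hutop, -⟩ := mem_aIn.1 huA
    rw [S.verts] at huV
    have hle := shiftIn_le hl hu
    have hL := State.link_wt ψ hutop
    have hfe := S.core.feas hL
    have e : base.wt u v - W + ψ u - ψ x = base.wt u v + ψ u - ψ v := by rw [hpot]; ring
    have M3 : Mid ψ V (insert x V) t (s'.addEdge u x (base.wt u v - W)) := by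
      refine M'.addEdge (by rw [e]; exact hfe) ?_ (hin huV) hxV
        (fun _ _ _ _ => by linarith) (fun p l' h => absurd h (S.not_new_in huV p l'))
        (fun p l' h => by simp [hx] at h)
      rw [e]
      exact edgeOK_inS (S.core.edge hL) hv huA (hsub1.trans hsub') l
    have hsub3 : Sub ψ s1 (s'.addEdge u x (base.wt u v - W)) := hsub'.trans Sub.addEdge
    cases u with
    | outS p t' l' =>
      dsimp only
      obtain ⟨hpV, hplt, hp0, hpn⟩ := S.core.outS_mem huV
      have hwt : (s'.addEdge (outS p t' l') x (base.wt (outS p t' l') v - W)).wt p (outS p t' l') =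
          ψ (outS p t' l') - ψ p :=
        M3.core.toFrame.wt_eq (hsub3 _ _ _ (hsub1 _ _ _ (S.core.tight_outS huV)))
      rw [hwt]
      have e' : ψ (outS p t' l') - ψ p + base.wt (outS p t' l') v - W + ψ p - ψ x =
        base.wt (outS p t' l') v + ψ (outS p t' l') - ψ v := by rw [hpot]; ring
      have hsg := (S.stable.sgn S.core).outS p t' l' huV
      refine ⟨M3.addEdge (by rw [e']; exact hfe) ?_ (hin hpV) hxV
        (fun _ _ _ _ => by linarith) (fun p' l' h => absurd h (S.not_new_in hpV p' l'))
        (fun p l' h => by simp [hx] at h), hsub3.trans Sub.addEdge⟩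
      rw [e']
      exact edgeOK_inS_parent (S.core.edge hL) hv huA hp0 (hsub1.trans hsub3) l
    | _ => exact ⟨M3, hsub3⟩
  obtain ⟨M2, hsub2⟩ := M2
  have final : ∀ s3, Mid ψ V (insert x V) t s3 → Sub ψ s2 s3 →
      (∀ a, rootIn v = some a → s3.Reach ψ (neg a) x 0) → Grown ψ V₀ t base s3 := by
    intro s3 M3 hsub3 hroot
    refine ⟨insert x V, M3.of_core ?_ (M3.sgn.insert_inS (by rw [hpot]; linarith)),
      hV.trans (Finset.subset_insert _ _), (hsub1.trans hsub2).trans hsub3⟩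
    exact M3.core.insert_inS (hV hvV) hlv hvin (hsub3 _ _ _ (hsub2 _ _ _ ht1)) hroot
  -- The additional edge out of r exists for this purpose: it provides the tight link from the root
  -- that `rootIn_tight` asks of the new vertex.
  have fin2 : ∀ a W', W' + ψ (neg a) - ψ x = 0 → rootIn v = some a →
      Grown ψ V₀ t base (s2.addEdge (neg a) x W') := by
    intro a W' e ha
    refine final _ (M2.addEdge e.ge ?_ (hin (S.core.neg_mem a)) hxV (by simp) (by simp)
        (by simp [hx])) Sub.addEdge ?_
    · refine ⟨fun p hp => ?_, fun p hp => ?_, fun b t hb => by simp [hx] at hb,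
        fun b t hb => by simp at hb, fun a => by simp [hx, outParent]⟩
      · rcases hp with h | ⟨v, h, -⟩ <;> simp [inParent, outParent] at h
      · rcases hp with h | ⟨w, h, h'⟩
        · simp [hx, outParent] at h
        · have hw : v = w := by simpa [hx, inParent] using h
          subst hw
          cases v <;> simp_all [rootIn, outParent]
    · intro b hb
      rw [ha] at hb
      cases hb
      exact Or.inl (State.link_addEdge.2 (Or.inr ⟨rfl, rfl, e.le⟩))
  cases v with
  | neg a => exact fin2 a (-W) (by rw [hpot]; ring) rfl
  | hub a t' =>
    refine fin2 a (s2.wtNeg a (hub a t') - W) ?_ rfl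
    have : s2.Reach ψ (neg a) (hub a t') 0 := hsub2.reach (hsub1.reach
      (S.core.rootIn_tight hvV rfl))
    rw [M2.core.toFrame.wtNeg_eq this, hpot]; ring
  | bar a => exact final _ M2 (Sub.refl _ _) (by simp [rootIn])
  | outS p t' l' => exact final _ M2 (Sub.refl _ _) (by simp [rootIn])
  | inS p t' l' => simp [inParent] at hvin

/-- The only out-neighbour of r in the base graph is r̄, and lists of length at most one give rise
to no gadget. So r never becomes an out-parent, which is what `outNeg` records. -/
theorem aOut_neg_length (S : Setup ψ V₀ t Δ base) (a : α) : (base.aOut (neg a)).length ≤ 1 := by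
  have hnd : (base.aOut (neg a)).Nodup := by
    unfold State.aOut
    exact ((List.mergeSort_perm _ _).nodup_iff).2 (Finset.nodup_toList _)
  have h : ∀ u ∈ base.aOut (neg a), u = bar a := fun u hu =>
    S.stable.neg_out a u (mem_aOut.1 hu).2.1
  match hA : base.aOut (neg a), hnd, h with
  | [], _, _ => simp
  | [_], _, _ => simp
  | x :: y :: l, hnd, h =>
    have h1 := h x (by simp)
    have h2 := h y (by simp)
    rw [h1, h2] at hnd
    simp at hnd

/-- As for in-gadgets, with potential `ψ v + W`. The additional edge now goes from the new vertex to
the negative vertex that is its root. -/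
theorem outGadget_spec (S : Setup ψ V₀ t Δ base) (hv : v ∈ base.heavy)
    (hs : Grown ψ V₀ t base s) : Grown ψ V₀ t base (outGadget base t s v) := by
  refine foldl_inv (P := Grown ψ V₀ t base) _ ?_ _ hs
  rintro s ⟨V, M, hV, hsub⟩ l hl
  rw [List.mem_range] at hl
  have hvV := S.heavy hv
  have hlen := two_pow_lt_of_lt_clog hl
  have h2l := Nat.two_pow_pos l
  have hvn : ∀ a, v ≠ neg a := by
    rintro a rfl
    have := aOut_neg_length S a
    omega
  have hne : ∃ u, u ∈ base.aOut v := List.exists_mem_of_length_pos (by omega)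
  obtain ⟨u₀, hu₀⟩ := hne
  have hvin : v.outParent = none := (mem_aOut.1 hu₀).2.2.2.2.1
  have hpot := S.pot_out v hvV l
  have hW0 := shiftOut_nonneg hl
  have hlv := S.lvl v hvV
  set x : Vtx α := outS v t l with hx
  set W : ℝ := shiftOut base v l with hW
  have hxV : x ∈ insert x V := Finset.mem_insert_self _ _
  have hin : ∀ {z}, z ∈ V₀ → z ∈ insert x V := fun h => Finset.mem_insert_of_mem (hV h)
  have M1 : Mid ψ V (insert x V) t ((s.addVertex x).addEdge v x W) := by
    have e : W + ψ v - ψ x = 0 := by rw [hpot]; ring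
    refine (M.addVertex (x := x) (by simp [hx, level])).addEdge e.ge ?_ (hin hvV) hxV
      (fun _ _ _ _ => hW0) ?_ ?_
    · refine ⟨fun p _ => Or.inr (Or.inl rfl), fun p _ => Or.inl rfl,
        fun b t hb => by simp [hx] at hb, fun b t _ _ => Or.inl rfl, fun a ha => ?_⟩
      simp only [hx, outParent, Option.some.injEq] at ha
      exact hvn a ha
    · intro p l' h
      exact absurd h (S.not_new_in hvV p l')
    · intro p l' h
      rw [hx, outS.injEq] at h
      exact Or.inl h.1
  set s1 : State α := (s.addVertex x).addEdge v x W with hs1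
  have hsub1 : Sub ψ base s1 := hsub.trans fun _ _ _ h => Sub.addEdge _ _ _ h
  have ht1 : s1.Link ψ v x 0 :=
    State.link_addEdge.2 (Or.inr ⟨rfl, rfl, by rw [hpot]; linarith⟩)
  set s2 : State α := ((base.aOut v).take ((base.aOut v).length - 2 ^ l)).foldl (fun s u =>
      let s := s.addEdge x u (base.wt v u - W)
      match u with
      | inS p t' l' => s.addEdge x p (base.wt v (inS p t' l') + s.wt (inS p t' l') p - W)
      | _ => s) s1 with hs2
  have M2 : Mid ψ V (insert x V) t s2 ∧ Sub ψ s1 s2 := by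
    refine foldl_inv (P := fun s => Mid ψ V (insert x V) t s ∧ Sub ψ s1 s) _ ?_ _
      ⟨M1, Sub.refl _ _⟩
    rintro s' ⟨M', hsub'⟩ u hu
    have huA := List.mem_of_mem_take hu
    obtain ⟨huV, hutop, -⟩ := mem_aOut.1 huA
    rw [S.verts] at huV
    have hle := shiftOut_le hl hu
    have hL := State.link_wt ψ hutop
    have hfe := S.core.feas hL
    have e : base.wt v u - W + ψ x - ψ u = base.wt v u + ψ v - ψ u := by rw [hpot]; ring
    have M3 : Mid ψ V (insert x V) t (s'.addEdge x u (base.wt v u - W)) := by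
      refine M'.addEdge (by rw [e]; exact hfe) ?_ hxV (hin huV)
        (by simp [hx]) (fun p l' h => by simp [hx] at h)
        (fun p l' h => absurd h (S.not_new_out huV p l'))
      rw [e]
      exact edgeOK_outS (S.core.edge hL) hv huA hvn (hsub1.trans hsub') l
    have hsub3 : Sub ψ s1 (s'.addEdge x u (base.wt v u - W)) := hsub'.trans Sub.addEdge
    cases u with
    | inS p t' l' =>
      dsimp only
      obtain ⟨hpV, hplt, hp0⟩ := S.core.inS_mem huV
      have hwt : (s'.addEdge x (inS p t' l') (base.wt v (inS p t' l') - W)).wt (inS p t' l') p =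
          ψ p - ψ (inS p t' l') :=
        M3.core.toFrame.wt_eq (hsub3 _ _ _ (hsub1 _ _ _ (S.core.tight_inS huV)))
      rw [hwt]
      have e' : base.wt v (inS p t' l') + (ψ p - ψ (inS p t' l')) - W + ψ x - ψ p =
        base.wt v (inS p t' l') + ψ v - ψ (inS p t' l') := by rw [hpot]; ring
      refine ⟨M3.addEdge (by rw [e']; exact hfe) ?_ hxV (hin hpV)
        (by simp [hx]) (fun p l' h => by simp [hx] at h)
        (fun p' l' h => absurd h (S.not_new_out hpV p' l')), hsub3.trans Sub.addEdge⟩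
      rw [e']
      refine edgeOK_outS_parent (S.core.edge hL) hv huA hp0 (fun a ha => ?_) hvn
        (hsub1.trans hsub3) l
      obtain ⟨t', l', rfl⟩ := eq_of_outParent ha
      exact (S.core.outS_mem hpV).2.2.2 a rfl
    | _ => exact ⟨M3, hsub3⟩
  obtain ⟨M2, hsub2⟩ := M2
  have final : ∀ s3, Mid ψ V (insert x V) t s3 → Sub ψ s2 s3 →
      (∀ a, rootOut v = some a → s3.Link ψ x (neg a) 0) → Grown ψ V₀ t base s3 := by
    intro s3 M3 hsub3 hroot
    refine ⟨insert x V, M3.of_core ?_ (M3.sgn.insert_outS (by rw [hpot]; linarith)),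
      hV.trans (Finset.subset_insert _ _), (hsub1.trans hsub2).trans hsub3⟩
    exact M3.core.insert_outS (hV hvV) hlv hvin hvn (hsub3 _ _ _ (hsub2 _ _ _ ht1)) hroot
  have fin2 : ∀ a W', W' + ψ x - ψ (neg a) = 0 → rootOut v = some a →
      Grown ψ V₀ t base (s2.addEdge x (neg a) W') := by
    intro a W' e ha
    refine final _ (M2.addEdge e.ge ?_ hxV (hin (S.core.neg_mem a)) (by simp [hx])
        (by simp [hx]) (by simp)) Sub.addEdge ?_
    · refine ⟨fun p hp => ?_, fun p hp => ?_, fun b t hb => by simp at hb,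
        fun b t hb => by simp [hx] at hb, fun a => by simp [outParent]⟩
      · rcases hp with h | ⟨w, h, h'⟩
        · simp [hx, inParent] at h
        · have hw : v = w := by simpa [hx, outParent] using h
          subst hw
          cases v <;> simp_all [rootOut, inParent]
      · rcases hp with h | ⟨v, h, -⟩ <;> simp [inParent, outParent] at h
    · intro b hb
      rw [ha] at hb
      cases hb
      exact State.link_addEdge.2 (Or.inr ⟨rfl, rfl, e.le⟩)
  cases v with
  | bar a =>
    refine fin2 a (-s2.wt (neg a) (bar a) - W) ?_ rfl
    rw [M2.core.toFrame.wt_eq (hsub2 _ _ _ (hsub1 _ _ _ (S.core.tight_bar a))), hpot]; ring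
  | hub a t' =>
    refine fin2 a (s2.wt (hub a t') (neg a) - W) ?_ rfl
    have : s2.Link ψ (hub a t') (neg a) 0 := hsub2 _ _ _ (hsub1 _ _ _
      ((S.core.rootOut_tight hvV rfl).resolve_left (by simp)))
    rw [M2.core.toFrame.wt_eq this, hpot]; ring
  | neg a => exact absurd rfl (hvn a)
  | inS p t' l' => exact final _ M2 (Sub.refl _ _) (by simp [rootOut])
  | outS p t' l' => simp [outParent] at hvin

theorem createHub_spec (S : Setup ψ V₀ t Δ base) (ht : 1 ≤ t) (hs : Grown ψ V₀ t base s) (a : α) :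
    Grown ψ V₀ t base (createHub t Δ s a) ∧ hub a t ∈ (createHub t Δ s a).verts := by
  refine ⟨?_, by simp [createHub, State.addVertex, State.addEdge]⟩
  obtain ⟨V, M, hV, hsub⟩ := hs
  have hpot := S.pot_hub a
  have M0 : Mid ψ V (insert (hub a t) V) t
      { s.addVertex (hub a t) with heavy := insert (hub a t) (s.addVertex (hub a t)).heavy } := by
    have h := M.addVertex (x := hub a t) (by simp [level])
    exact ⟨h.core.of_w_eq rfl rfl rfl, h.ends, h.verts, h.sgn, h.lvl, h.bar_nn, h.new_in,
      h.new_out⟩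
  have hx : hub a t ∈ insert (hub a t) V := Finset.mem_insert_self _ _
  have hn : neg a ∈ insert (hub a t) V :=
    Finset.mem_insert_of_mem (hV (S.core.neg_mem a))
  have e1 : Δ a + ψ (hub a t) - ψ (neg a) = 0 := by rw [hpot]; ring
  have e2 : -Δ a + ψ (neg a) - ψ (hub a t) = 0 := by rw [hpot]; ring
  have M1 := M0.addEdge (x := hub a t) (y := neg a) (W := Δ a) e1.ge
    (EdgeOK.of_none rfl rfl rfl rfl) hx hn (by simp) (by simp) (by simp)
  have M2 := M1.addEdge (x := neg a) (y := hub a t) (W := -Δ a) e2.ge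
    (EdgeOK.of_none rfl rfl rfl rfl) hn hx (by simp) (by simp) (by simp)
  refine ⟨insert (hub a t) V, M2.of_core ?_ M2.sgn.insert_hub,
    hV.trans (Finset.subset_insert _ _), ?_⟩
  · refine M2.core.insert_hub ht (Or.inl ?_) ?_
    · exact State.link_addEdge.2 (Or.inr ⟨rfl, rfl, e2.le⟩)
    · exact State.link_addEdge.2 (Or.inl (State.link_addEdge.2 (Or.inr ⟨rfl, rfl, e1.le⟩)))
  · exact fun x y X h => Sub.addEdge _ _ _ (Sub.addEdge _ _ _ (hsub _ _ _ h))

end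

/-! ### Vertices and heavy vertices during an iteration -/

section

variable {s s' base : State α} {ψ φ : Vtx α → ℝ} {V V' V₀ : Finset (Vtx α)} {t : ℕ} {Δ : α → ℝ}
  {x y p q u v : Vtx α} {X Y W : ℝ}

theorem foldl_union {β γ δ : Type*} {F : γ → Finset δ} {f : γ → β → γ} {g : β → Finset δ}
    (h : ∀ s x, F (f s x) = F s ∪ g x) (l : List β) (s : γ) :
    F (l.foldl f s) = F s ∪ l.toFinset.biUnion g := by
  induction l generalizing s with
  | nil => simp
  | cons x l ih =>
    rw [List.foldl_cons, ih, h, List.toFinset_cons, Finset.biUnion_insert, Finset.union_assoc]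

theorem foldl_eq {β γ δ : Type*} {F : γ → δ} {f : γ → β → γ}
    (h : ∀ s x, F (f s x) = F s) (l : List β) (s : γ) : F (l.foldl f s) = F s :=
  foldl_inv (P := fun s' => F s' = F s) l (fun b hb x _ => (h b x).trans hb) s rfl

/-- The in-Steiner vertices that iteration `t` creates for `v`. -/
def newInS (base : State α) (t : ℕ) (v : Vtx α) : Finset (Vtx α) :=
  (Finset.range (Nat.clog 2 (base.aIn v).length)).image (inS v t)

/-- The out-Steiner vertices that iteration `t` creates for `v`. -/
def newOutS (base : State α) (t : ℕ) (v : Vtx α) : Finset (Vtx α) :=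
  (Finset.range (Nat.clog 2 (base.aOut v).length)).image (outS v t)

theorem inGadget_verts (base : State α) (t : ℕ) (s : State α) (v : Vtx α) :
    (inGadget base t s v).verts = s.verts ∪ newInS base t v := by
  unfold inGadget newInS
  dsimp only
  rw [foldl_union (F := State.verts) (g := fun l => {inS v t l})]
  · congr 1
    ext x; simp [eq_comm]
  · intro s l
    have key : ∀ (s : State α) (L : List (Vtx α)) (W : ℝ), (L.foldl (fun s u =>
        match u with
        | outS p t' l' => (s.addEdge u (inS v t l) (base.wt u v - W)).addEdge p (inS v t l)
            ((s.addEdge u (inS v t l) (base.wt u v - W)).wt p (outS p t' l') +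
              base.wt (outS p t' l') v - W)
        | _ => s.addEdge u (inS v t l) (base.wt u v - W)) s).verts = s.verts := by
      intro s L W
      refine foldl_eq (F := State.verts) (fun s u => ?_) L s
      cases u <;> rfl
    have e : s.verts ∪ {inS v t l} = insert (inS v t l) s.verts := by
      rw [Finset.union_comm]; rfl
    rw [e]
    cases v <;> exact key _ _ _

theorem outGadget_verts (base : State α) (t : ℕ) (s : State α) (v : Vtx α) :
    (outGadget base t s v).verts = s.verts ∪ newOutS base t v := by
  unfold outGadget newOutS
  dsimp only
  rw [foldl_union (F := State.verts) (g := fun l => {outS v t l})]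
  · congr 1
    ext x; simp [eq_comm]
  · intro s l
    have key : ∀ (s : State α) (L : List (Vtx α)) (W : ℝ), (L.foldl (fun s u =>
        match u with
        | inS p t' l' => (s.addEdge (outS v t l) u (base.wt v u - W)).addEdge (outS v t l) p
            (base.wt v (inS p t' l') +
              (s.addEdge (outS v t l) u (base.wt v u - W)).wt (inS p t' l') p - W)
        | _ => s.addEdge (outS v t l) u (base.wt v u - W)) s).verts = s.verts := by
      intro s L W
      refine foldl_eq (F := State.verts) (fun s u => ?_) L s
      cases u <;> rfl
    have e : s.verts ∪ {outS v t l} = insert (outS v t l) s.verts := by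
      rw [Finset.union_comm]; rfl
    rw [e]
    cases v <;> exact key _ _ _

theorem inGadget_heavy (base : State α) (t : ℕ) (s : State α) (v : Vtx α) :
    (inGadget base t s v).heavy = s.heavy := by
  unfold inGadget
  refine foldl_eq (F := State.heavy) (fun s l => ?_) _ s
  have key : ∀ (s : State α) (L : List (Vtx α)) (W : ℝ), (L.foldl (fun s u =>
      match u with
      | outS p t' l' => (s.addEdge u (inS v t l) (base.wt u v - W)).addEdge p (inS v t l)
          ((s.addEdge u (inS v t l) (base.wt u v - W)).wt p (outS p t' l') +
            base.wt (outS p t' l') v - W)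
      | _ => s.addEdge u (inS v t l) (base.wt u v - W)) s).heavy = s.heavy := by
    intro s L W
    refine foldl_eq (F := State.heavy) (fun s u => ?_) L s
    cases u <;> rfl
  cases v <;> exact key _ _ _

theorem outGadget_heavy (base : State α) (t : ℕ) (s : State α) (v : Vtx α) :
    (outGadget base t s v).heavy = s.heavy := by
  unfold outGadget
  refine foldl_eq (F := State.heavy) (fun s l => ?_) _ s
  have key : ∀ (s : State α) (L : List (Vtx α)) (W : ℝ), (L.foldl (fun s u =>
      match u with
      | inS p t' l' => (s.addEdge (outS v t l) u (base.wt v u - W)).addEdge (outS v t l) p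
          (base.wt v (inS p t' l') +
            (s.addEdge (outS v t l) u (base.wt v u - W)).wt (inS p t' l') p - W)
      | _ => s.addEdge (outS v t l) u (base.wt v u - W)) s).heavy = s.heavy := by
    intro s L W
    refine foldl_eq (F := State.heavy) (fun s u => ?_) L s
    cases u <;> rfl
  cases v <;> exact key _ _ _

/-- The graph of iteration `t` before the shortcuts of the negative vertices are generated. -/
def prepared [Fintype α] (t : ℕ) (Δ : α → ℝ) (base : State α) : State α :=
  (Finset.univ : Finset α).toList.foldl (createHub t Δ)
    (base.heavy.toList.foldl (outGadget base t)
      (base.heavy.toList.foldl (inGadget base t) (simpleOut base Δ (simpleIn base Δ base))))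

theorem finish_eq [Fintype α] (t : ℕ) (lam : ℝ) (Δ : α → ℝ) (base : State α) :
    finish t lam Δ base = classify t lam ((Finset.univ : Finset α).toList.foldl restore
      ((Finset.univ : Finset α).toList.foldl (shortcutAt base t Δ) (prepared t Δ base))) := rfl

theorem simple_eq [Fintype α] {γ : Type*} (F : State α → γ)
    (hF : ∀ s x y W, F (s.addEdge x y W) = F s) (base : State α) (Δ : α → ℝ) (s : State α) :
    F (simpleOut base Δ (simpleIn base Δ s)) = F s := by
  unfold simpleOut simpleIn
  rw [foldl_eq (F := F), foldl_eq (F := F)]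
  · exact fun s r => foldl_eq (F := F) (fun s c => hF _ _ _ _) _ _
  · exact fun s r => foldl_eq (F := F) (fun s c => hF _ _ _ _) _ _

/-- The vertices created in iteration `t` for the heavy vertices. -/
def newSteiner (base : State α) (t : ℕ) : Finset (Vtx α) :=
  base.heavy.biUnion (newInS base t) ∪ base.heavy.biUnion (newOutS base t)

theorem gadgets_verts [Fintype α] (t : ℕ) (Δ : α → ℝ) (base : State α) :
    (base.heavy.toList.foldl (outGadget base t) (base.heavy.toList.foldl (inGadget base t)
      (simpleOut base Δ (simpleIn base Δ base)))).verts = base.verts ∪ newSteiner base t := by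
  rw [foldl_union (F := State.verts) (outGadget_verts base t),
    foldl_union (F := State.verts) (inGadget_verts base t),
    simple_eq State.verts fun _ _ _ _ => rfl]
  simp only [Finset.toList_toFinset, newSteiner, Finset.union_assoc]

theorem prepared_verts [Fintype α] (t : ℕ) (Δ : α → ℝ) (base : State α) :
    (prepared t Δ base).verts =
      base.verts ∪ newSteiner base t ∪ Finset.univ.image fun a => hub a t := by
  unfold prepared
  rw [foldl_union (F := State.verts) (g := fun a => {hub a t}), gadgets_verts]
  · congr 1
    ext x; simp [eq_comm]
  · intro s a
    rw [Finset.union_comm]; rfl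

theorem prepared_heavy [Fintype α] (t : ℕ) (Δ : α → ℝ) (base : State α) :
    (prepared t Δ base).heavy = base.heavy ∪ Finset.univ.image fun a => hub a t := by
  unfold prepared
  rw [foldl_union (F := State.heavy) (g := fun a => {hub a t}),
    foldl_eq (F := State.heavy) (outGadget_heavy base t),
    foldl_eq (F := State.heavy) (inGadget_heavy base t),
    simple_eq State.heavy fun _ _ _ _ => rfl]
  · congr 1
    ext x; simp [eq_comm]
  · intro s a
    rw [Finset.union_comm]; rfl

theorem scanHeavyIn_eq {γ : Type*} (F : State α → γ)
    (hF : ∀ u v W s, F (addEdgeIn u v W s) = F s) (base : State α) (t : ℕ) (a : α) (D : ℝ)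
    (v : Vtx α) (dv : ℝ) (z : (Vtx α → WithTop ℝ) × State α) :
    F (scanHeavyIn base t a D v dv z).2 = F z.2 := by
  unfold scanHeavyIn
  dsimp only
  rw [foldl_eq (F := fun z : (Vtx α → WithTop ℝ) × State α => F z.2)]
  · split_ifs <;> simp [hF]
  · intro z u
    split <;> split_ifs <;> simp [hF]

theorem scanHeavyOut_eq {γ : Type*} (F : State α → γ)
    (hF : ∀ u v W s, F (addEdgeOut u v W s) = F s) (base : State α) (t : ℕ) (a : α) (D : ℝ)
    (v : Vtx α) (dv : ℝ) (z : (Vtx α → WithTop ℝ) × State α) :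
    F (scanHeavyOut base t a D v dv z).2 = F z.2 := by
  unfold scanHeavyOut
  dsimp only
  rw [foldl_eq (F := fun z : (Vtx α → WithTop ℝ) × State α => F z.2)]
  · split_ifs <;> simp [hF]
  · intro z u
    split <;> split_ifs <;> simp [hF]

theorem processIn_eq {γ : Type*} (F : State α → γ)
    (hF : ∀ u v W s, F (addEdgeIn u v W s) = F s) (base : State α) (t : ℕ) (a : α) (D : ℝ)
    (z : (Vtx α → WithTop ℝ) × State α) (v : Vtx α) :
    F (processIn base t a D z v).2 = F z.2 := by
  unfold processIn
  dsimp only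
  split
  · rfl
  · split_ifs with hv
    · rw [scanHeavyIn_eq F hF]
      split <;> [split_ifs; skip] <;> simp [hF]
    · rw [foldl_eq (F := fun z : (Vtx α → WithTop ℝ) × State α => F z.2)]
      · split <;> [split_ifs; skip] <;> simp [hF]
      · intro z u
        split_ifs <;> simp [hF]

theorem processOut_eq {γ : Type*} (F : State α → γ)
    (hF : ∀ u v W s, F (addEdgeOut u v W s) = F s) (base : State α) (t : ℕ) (a : α) (D : ℝ)
    (z : (Vtx α → WithTop ℝ) × State α) (v : Vtx α) :
    F (processOut base t a D z v).2 = F z.2 := by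
  unfold processOut
  dsimp only
  split
  · rfl
  · split_ifs with hv
    · rw [scanHeavyOut_eq F hF]
      split <;> [split_ifs; skip] <;> simp [hF]
    · rw [foldl_eq (F := fun z : (Vtx α → WithTop ℝ) × State α => F z.2)]
      · split <;> [split_ifs; skip] <;> simp [hF]
      · intro z u
        split_ifs <;> simp [hF]

/-- The quantity `F` is arbitrary because the fact is needed both for the vertices and for the heavy
vertices. -/
theorem shortcutAt_eq {γ : Type*} (F : State α → γ)
    (hF : ∀ u v W s, F (addEdgeIn u v W s) = F s) (hF' : ∀ u v W s, F (addEdgeOut u v W s) = F s)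
    (base : State α) (t : ℕ) (Δ : α → ℝ) (s : State α) (a : α) :
    F (shortcutAt base t Δ s a) = F s := by
  have h1 : F (shortcutOut base t Δ (shortcutIn base t Δ s a) a) = F s := by
    unfold shortcutOut shortcutIn
    dsimp only
    rw [foldl_eq (F := fun z : (Vtx α → WithTop ℝ) × State α => F z.2),
      foldl_eq (F := fun z : (Vtx α → WithTop ℝ) × State α => F z.2)]
    · exact fun z l => foldl_eq (F := fun z : (Vtx α → WithTop ℝ) × State α => F z.2)
        (fun z v => processIn_eq F hF _ _ _ _ _ _) _ _
    · exact fun z l => foldl_eq (F := fun z : (Vtx α → WithTop ℝ) × State α => F z.2)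
        (fun z v => processOut_eq F hF' _ _ _ _ _ _) _ _
  have h2 : ∀ s (L : List (Vtx α)) (W : Vtx α → ℝ),
      F (L.foldl (fun s v => addEdgeIn v (hub a t) (W v) s) s) = F s :=
    fun s L W => foldl_eq (F := F) (fun s v => hF _ _ _ _) _ _
  have h3 : ∀ s (L : List (Vtx α)) (W : Vtx α → ℝ),
      F (L.foldl (fun s v => addEdgeOut v (hub a t) (W v) s) s) = F s :=
    fun s L W => foldl_eq (F := F) (fun s v => hF' _ _ _ _) _ _
  unfold shortcutAt
  dsimp only
  split_ifs <;> simp only [h1, h2, h3]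

theorem restore_verts (s : State α) (a : α) : (restore s a).verts = s.verts := rfl

theorem restore_heavy (s : State α) (a : α) : (restore s a).heavy = s.heavy := rfl

theorem finish_verts [Fintype α] (t : ℕ) (lam : ℝ) (Δ : α → ℝ) (base : State α) :
    (finish t lam Δ base).verts =
      base.verts ∪ newSteiner base t ∪ Finset.univ.image fun a => hub a t := by
  rw [finish_eq, ← prepared_verts]
  show (List.foldl restore _ _).verts = _
  rw [foldl_eq (F := State.verts) restore_verts,
    foldl_eq (F := State.verts) (shortcutAt_eq State.verts addEdgeIn_verts addEdgeOut_verts _ _ _)]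

theorem aIn_length_le (base : State α) (v : Vtx α) : (base.aIn v).length ≤ base.verts.card := by
  rw [State.aIn, List.length_mergeSort, Finset.length_toList]
  exact Finset.card_filter_le _ _

theorem aOut_length_le (base : State α) (v : Vtx α) : (base.aOut v).length ≤ base.verts.card := by
  rw [State.aOut, List.length_mergeSort, Finset.length_toList]
  exact Finset.card_filter_le _ _

theorem newSteiner_card (base : State α) (t : ℕ) :
    (newSteiner base t).card ≤ 2 * base.heavy.card * Nat.clog 2 base.verts.card := by
  have h1 : (base.heavy.biUnion (newInS base t)).card ≤
      base.heavy.card * Nat.clog 2 base.verts.card := by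
    refine Finset.card_biUnion_le_card_mul _ _ _ fun v _ => Finset.card_image_le.trans ?_
    rw [Finset.card_range]
    exact Nat.clog_mono_right 2 (aIn_length_le base v)
  have h2 : (base.heavy.biUnion (newOutS base t)).card ≤
      base.heavy.card * Nat.clog 2 base.verts.card := by
    refine Finset.card_biUnion_le_card_mul _ _ _ fun v _ => Finset.card_image_le.trans ?_
    rw [Finset.card_range]
    exact Nat.clog_mono_right 2 (aOut_length_le base v)
  have h3 := Finset.card_union_le (base.heavy.biUnion (newInS base t))
    (base.heavy.biUnion (newOutS base t))
  unfold newSteiner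
  linarith

theorem finish_verts_card [Fintype α] (t : ℕ) (lam : ℝ) (Δ : α → ℝ) (base : State α) :
    (finish t lam Δ base).verts.card ≤ base.verts.card + Fintype.card α +
      2 * base.heavy.card * Nat.clog 2 base.verts.card := by
  rw [finish_verts]
  have h1 := Finset.card_union_le (base.verts ∪ newSteiner base t)
    (Finset.univ.image fun a : α => hub a t)
  have h2 := Finset.card_union_le base.verts (newSteiner base t)
  have h3 := newSteiner_card base t
  have h4 : (Finset.univ.image fun a : α => hub a t).card ≤ Fintype.card α :=
    Finset.card_image_le
  linarith

theorem finish_heavy_subset [Fintype α] (t : ℕ) (lam : ℝ) (Δ : α → ℝ) (base : State α)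
    (h : base.heavy ⊆ base.verts) :
    (finish t lam Δ base).heavy ⊆ (finish t lam Δ base).verts := by
  rw [finish_verts, finish_eq]
  have e1 : ∀ s : State α, ((Finset.univ : Finset α).toList.foldl restore
      ((Finset.univ : Finset α).toList.foldl (shortcutAt base t Δ) s)).heavy = s.heavy := by
    intro s
    rw [foldl_eq (F := State.heavy) restore_heavy, foldl_eq (F := State.heavy)
      (shortcutAt_eq State.heavy addEdgeIn_heavy addEdgeOut_heavy _ _ _)]
  have e2 : ∀ s : State α, ((Finset.univ : Finset α).toList.foldl restore
      ((Finset.univ : Finset α).toList.foldl (shortcutAt base t Δ) s)).verts = s.verts := by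
    intro s
    rw [foldl_eq (F := State.verts) restore_verts, foldl_eq (F := State.verts)
      (shortcutAt_eq State.verts addEdgeIn_verts addEdgeOut_verts _ _ _)]
  refine Finset.union_subset ?_ ?_
  · rw [e1, prepared_heavy]
    exact Finset.union_subset_union (h.trans Finset.subset_union_left) subset_rfl
  · refine (Finset.filter_subset _ _).trans ?_
    rw [e2, prepared_verts]

/-! ### The graph before the generation of shortcuts -/

/-- The extension of the potential to the vertices that iteration `t` creates. -/
def newPot (base : State α) (ψ : Vtx α → ℝ) (t : ℕ) (Δ : α → ℝ) : Vtx α → ℝ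
  | inS p t' l => if t' = t then ψ p - shiftIn base p l else ψ (inS p t' l)
  | outS p t' l => if t' = t then ψ p + shiftOut base p l else ψ (outS p t' l)
  | hub a t' => if t' = t then ψ (neg a) - Δ a else ψ (hub a t')
  | v => ψ v

theorem newPot_of_lt (hv : v.level < t) : newPot base ψ t Δ v = ψ v := by
  cases v <;> simp only [newPot, level] at * <;> rw [if_neg hv.ne]

/-- All links join vertices of `V`, so the potential may be changed at will elsewhere. This allows
it to be defined in advance on the vertices that an iteration is about to create. -/
theorem Core.congr_pot (hs : Core ψ V s) (hE : Ends ψ V s) (h : ∀ v ∈ V, φ v = ψ v) :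
    Core φ V s ∧ Ends φ V s := by
  have hl : ∀ {x y X}, s.Link φ x y X ↔ s.Link ψ x y X := by
    intro x y X
    rw [State.link_iff, State.link_iff]
    refine and_congr_right fun hne => ?_
    obtain ⟨hx, hy⟩ := hE _ _ _ (State.link_wt ψ hne)
    rw [h x hx, h y hy]
  have hr : ∀ {x y X}, s.Reach ψ x y X → s.Reach φ x y X := by
    rintro x y X (h | ⟨c, hc, h⟩)
    · exact Or.inl (hl.2 h)
    · exact Or.inr ⟨c, hc, hl.2 h⟩
  refine ⟨⟨⟨hs.neg_mem, hs.bar_mem, hs.inS_mem, hs.outS_mem, hs.hub_mem,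
    fun h => hs.feas (hl.1 h), fun h => hl.2 (hs.tight_inS h), fun h => hl.2 (hs.tight_outS h),
    fun a => hl.2 (hs.tight_bar a), fun a => hl.2 (hs.tight_neg a),
    fun h1 h2 => hr (hs.rootIn_tight h1 h2),
    fun h1 h2 => (hs.rootOut_tight h1 h2).imp id hl.2⟩, ?_, ?_, ?_⟩, fun x y X h => hE _ _ _ (hl.1 h)⟩
  · intro x y X h
    have he := hs.edge (hl.1 h)
    refine ⟨fun p hp => ?_, fun p hp => ?_, he.lvl_in, he.lvl_out, he.outNeg⟩
    · rcases he.ein p hp with h1 | h1 | ⟨a, ha, h1⟩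
      · exact Or.inl h1
      · exact Or.inr (Or.inl h1)
      · exact Or.inr (Or.inr ⟨a, ha, hr h1⟩)
    · rcases he.eout p hp with h1 | h1 | ⟨a, ha, h1⟩
      · exact Or.inl h1
      · exact Or.inr (Or.inl h1)
      · exact Or.inr (Or.inr ⟨a, ha, hr h1⟩)
  · intro e he
    obtain ⟨a, t, h1, h2, h3, h4, h5, h6⟩ := hs.deferIn e he
    refine ⟨a, t, h1, h2, h3, h4, ?_, fun q hq => ?_⟩
    · rw [h _ h2, h _ h3]; exact h5
    · rw [h _ h2, h _ h3]; exact hr (h6 q hq)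
  · intro e he
    obtain ⟨a, t, h1, h2, h3, h4, h5, h6⟩ := hs.deferOut e he
    refine ⟨a, t, h1, h2, h3, h4, ?_, fun q hq => ?_⟩
    · rw [h _ h2, h _ h3]; exact h5
    · rw [h _ h2, h _ h3]; exact hr (h6 q hq)

theorem Setup.of_core (hC : Core ψ V₀ base) (hE : Ends ψ V₀ base) (hst : Stable V₀ base)
    (hv : base.verts = V₀) (hh : base.heavy ⊆ V₀) (hl : ∀ v ∈ V₀, v.level < t) :
    Setup (newPot base ψ t Δ) V₀ t Δ base := by
  obtain ⟨h1, h2⟩ := hC.congr_pot (φ := newPot base ψ t Δ) hE fun v hv => newPot_of_lt (hl v hv)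
  refine ⟨h1, h2, hst, hv, hh, hl, fun v hv l => ?_, fun v hv l => ?_, fun a => ?_⟩
  · rw [newPot_of_lt (hl v hv)]; simp [newPot]
  · rw [newPot_of_lt (hl v hv)]; simp [newPot]
  · simp [newPot]

theorem Frame.le_toReal {e : EReal} {r d : ℝ} (h : (r : EReal) ≤ e) (h' : e < (d : EReal)) :
    r ≤ e.toReal ∧ e = (e.toReal : EReal) := by
  have h1 : e ≠ ⊤ := ne_top_of_lt h'
  have h2 : e ≠ ⊥ := by
    rintro rfl
    exact absurd (le_bot_iff.1 h) (EReal.coe_ne_bot _)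
  have h3 := (EReal.coe_toReal h1 h2).symm
  rw [h3] at h
  exact ⟨EReal.coe_le_coe_iff.1 h, h3⟩

/-- The weight of an added edge is the tight weights at both ends plus a hop distance, and a
feasible potential bounds each of these from below. -/
theorem simpleIn_spec [Fintype α] (S : Setup ψ V₀ t Δ base)
    (h : Mid ψ V₀ V₀ t s ∧ Sub ψ base s) :
    Mid ψ V₀ V₀ t (simpleIn base Δ s) ∧ Sub ψ base (simpleIn base Δ s) := by
  refine foldl_inv (P := fun s => Mid ψ V₀ V₀ t s ∧ Sub ψ base s) _ (fun s h r _ => ?_) _ h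
  refine foldl_inv (P := fun s => Mid ψ V₀ V₀ t s ∧ Sub ψ base s) _ (fun s h c hc => ?_) _ h
  have hu := (Finset.mem_filter.1 (Finset.mem_filter.1 (Finset.mem_toList.1 hc)).2).2
  have hle := (Frame.le_toReal (S.core.toFrame.le_hopDist (h := 0)) hu).1
  have e1 := S.core.toFrame.wt_eq (S.core.tight_bar c)
  have e2 := S.core.toFrame.wt_eq (S.core.tight_bar r)
  exact ⟨h.1.addEdge (by rw [e1, e2]; linarith) (EdgeOK.of_none rfl rfl rfl rfl)
    (S.core.neg_mem c) (S.core.bar_mem r) (by simp) (by simp) (by simp), h.2.trans Sub.addEdge⟩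

theorem simpleOut_spec [Fintype α] (S : Setup ψ V₀ t Δ base)
    (h : Mid ψ V₀ V₀ t s ∧ Sub ψ base s) :
    Mid ψ V₀ V₀ t (simpleOut base Δ s) ∧ Sub ψ base (simpleOut base Δ s) := by
  refine foldl_inv (P := fun s => Mid ψ V₀ V₀ t s ∧ Sub ψ base s) _ (fun s h r _ => ?_) _ h
  refine foldl_inv (P := fun s => Mid ψ V₀ V₀ t s ∧ Sub ψ base s) _ (fun s h c hc => ?_) _ h
  have hu := (Finset.mem_filter.1 (Finset.mem_filter.1 (Finset.mem_toList.1 hc)).2).2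
  have hle := (Frame.le_toReal (S.core.toFrame.le_hopDist (h := 1)) hu).1
  have e1 := S.core.toFrame.wt_eq (S.core.tight_bar c)
  exact ⟨h.1.addEdge (by rw [e1]; linarith) (EdgeOK.of_none rfl rfl rfl rfl)
    (S.core.neg_mem r) (S.core.bar_mem c) (by simp) (by simp) (by simp), h.2.trans Sub.addEdge⟩

/-- The last two statements make the counts of `hubIn` and `hubOut` start at zero. -/
theorem prepared_spec [Fintype α] (S : Setup ψ V₀ t Δ base) (ht : 1 ≤ t) :
    Grown ψ V₀ t base (prepared t Δ base) ∧
      (∀ x a, (prepared t Δ base).w x (hub a t) ≠ ⊤ → x = neg a) ∧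
      (∀ y a, (prepared t Δ base).w (hub a t) y ≠ ⊤ → y = neg a) := by
  have g0 : Grown ψ V₀ t base (simpleOut base Δ (simpleIn base Δ base)) := by
    obtain ⟨h1, h2⟩ := simpleOut_spec S (simpleIn_spec S ⟨S.mid, Sub.refl _ _⟩)
    exact ⟨V₀, h1, subset_rfl, h2⟩
  have g1 := foldl_inv (P := Grown ψ V₀ t base) base.heavy.toList
    (fun s hs v hv => inGadget_spec S (Finset.mem_toList.1 hv) hs) _ g0
  have g2 := foldl_inv (P := Grown ψ V₀ t base) base.heavy.toList
    (fun s hs v hv => outGadget_spec S (Finset.mem_toList.1 hv) hs) _ g1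
  have gv := gadgets_verts t Δ base
  unfold prepared
  set s₀ := base.heavy.toList.foldl (outGadget base t) (base.heavy.toList.foldl (inGadget base t)
      (simpleOut base Δ (simpleIn base Δ base))) with hs₀
  have hno : ∀ a, hub a t ∉ s₀.verts := by
    intro a ha
    rw [gv] at ha
    simp only [newSteiner, newInS, newOutS, Finset.mem_union, Finset.mem_biUnion, Finset.mem_image,
      reduceCtorEq, and_false, exists_false, or_false] at ha
    rw [S.verts] at ha
    exact absurd (S.lvl _ ha) (by simp [level])
  refine foldl_inv (P := fun s => Grown ψ V₀ t base s ∧ (∀ x a, s.w x (hub a t) ≠ ⊤ → x = neg a) ∧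
    (∀ y a, s.w (hub a t) y ≠ ⊤ → y = neg a)) _ ?_ _ ⟨g2, ?_, ?_⟩
  · rintro s ⟨h1, h2, h3⟩ a -
    refine ⟨(createHub_spec S ht h1 a).1, ?_, ?_⟩
    · intro x b hx
      simp only [createHub, State.addEdge, State.addVertex, reduceCtorEq, and_false, if_false] at hx
      split_ifs at hx with hc
      · rw [hc.1]
        have := hc.2
        simp only [hub.injEq, and_true] at this
        rw [this]
      · exact h2 x b hx
    · intro x b hx
      simp only [createHub, State.addEdge, State.addVertex, reduceCtorEq, false_and, if_false] at hx
      split_ifs at hx with hc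
      · rw [hc.2]
        have := hc.1
        simp only [hub.injEq, and_true] at this
        rw [this]
      · exact h3 x b hx
  · intro x a hx
    obtain ⟨V, M, -, -⟩ := g2
    have := (M.ends _ _ _ (State.link_wt ψ hx)).2
    rw [← M.verts] at this
    exact absurd this (hno a)
  · intro x a hx
    obtain ⟨V, M, -, -⟩ := g2
    have := (M.ends _ _ _ (State.link_wt ψ hx)).1
    rw [← M.verts] at this
    exact absurd this (hno a)

end

/-! ### Generation of shortcuts -/

section

variable {s s' s₀ base : State α} {ψ φ : Vtx α → ℝ} {V V' V₀ : Finset (Vtx α)} {t h k l : ℕ}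
  {Δ : α → ℝ} {a b : α} {x y p q u v : Vtx α} {X Y W dv : ℝ}

theorem Mid.addEdgeIn (M : Mid ψ V V t s) (hu : u ∈ V) (ha : hub a t ∈ V)
    (hW : 0 ≤ W + ψ u - ψ (hub a t)) (hW0 : 0 ≤ W ∨ u.inParent ≠ none) :
    Mid ψ V V t (addEdgeIn u (hub a t) W s) := by
  have hF := M.core.toFrame
  have h := addEdgeIn_hub_spec u a t W s hF hu ha hW
  refine ⟨M.core.addEdgeIn hu ha (M.lvl u hu) hW, M.ends.addEdgeIn hF hu ha hW, ?_, M.sgn, M.lvl,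
    ?_, ?_, ?_⟩
  · rw [addEdgeIn_verts]; exact M.verts
  · intro c y X hX h1 h2
    rcases h.new _ _ _ hX with h3 | ⟨-, rfl | rfl, h4⟩
    · exact M.bar_nn c y X h3 h1 h2
    · exact absurd rfl (h1 a)
    · rcases h.sign M.sgn.outS hW0 _ X hX with h5 | rfl | h5
      · exact M.bar_nn c _ X h5 h1 h2
      · rcases hW0 with h0 | h0
        · linarith
        · exact absurd rfl h0
      · exact h5
  · intro p l y X hX
    rcases h.new _ _ _ hX with h3 | ⟨-, rfl | rfl, -⟩
    · exact M.new_in p l y X h3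
    -- A new link into the negative vertex starts in an ancestor of some in-parent, thus at a level
    -- below `t`; it cannot start in a new in-Steiner vertex.
    · rcases h.neg_or _ _ hX with h5 | ⟨p', t', l', h5, h6, -⟩
      · exact M.new_in p l _ X h5
      · have h7 := hF.anc h5 hu
        have h8 := hF.inS_mem h7.1
        have h9 := (hF.anc h6 h8.1).2
        have := M.lvl _ h7.1
        simp only [level] at this
        have h10 : (inS p t l).level = t := rfl
        omega
    · exact Or.inr ⟨a, rfl⟩
  · intro p l y X hX
    rcases h.new _ _ _ hX with h3 | ⟨-, h4, -⟩
    · exact M.new_out p l y X h3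
    · rcases h4 with h4 | h4 <;> simp at h4

theorem Mid.addEdgeOut (M : Mid ψ V V t s) (hu : u ∈ V) (ha : hub a t ∈ V)
    (hW : 0 ≤ W + ψ (hub a t) - ψ u) : Mid ψ V V t (addEdgeOut u (hub a t) W s) := by
  have hF := M.core.toFrame
  have h := addEdgeOut_hub_spec u a t W s hF hu ha hW
  refine ⟨M.core.addEdgeOut hu ha (M.lvl u hu) hW, M.ends.addEdgeOut hF hu ha hW, ?_, M.sgn, M.lvl,
    ?_, ?_, ?_⟩
  · rw [addEdgeOut_verts]; exact M.verts
  · intro c y X hX h1 h2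
    rcases h.new _ _ _ hX with h3 | ⟨-, h4, -⟩
    · exact M.bar_nn c y X h3 h1 h2
    · rcases h4 with h4 | h4 <;> simp at h4
  · intro p l y X hX
    rcases h.new _ _ _ hX with h3 | ⟨-, h4, -⟩
    · exact M.new_in p l y X h3
    · rcases h4 with h4 | h4 <;> simp at h4
  · intro p l y X hX
    rcases h.new _ _ _ hX with h3 | ⟨-, rfl | rfl, -⟩
    · exact M.new_out p l y X h3
    · rcases h.neg_or _ _ hX with h5 | ⟨p', t', l', h5, h6, -⟩
      · exact M.new_out p l _ X h5
      · have h7 := hF.anc h5 hu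
        have h8 := hF.outS_mem h7.1
        have h9 := (hF.anc h6 h8.1).2
        have := M.lvl _ h7.1
        simp only [level] at this
        have h10 : (outS p t l).level = t := rfl
        omega
    · exact Or.inr ⟨a, rfl⟩

/-- The new in-Steiner vertices with an edge into the new N-Steiner vertex of `neg b`. -/
def hubIn (t : ℕ) (V : Finset (Vtx α)) (s : State α) (b : α) : Finset (Vtx α) :=
  V.filter fun x => x.level = t ∧ x.inParent ≠ none ∧ s.w x (hub b t) ≠ ⊤

/-- The new out-Steiner vertices with an edge from the new N-Steiner vertex of `neg b`. -/
def hubOut (t : ℕ) (V : Finset (Vtx α)) (s : State α) (b : α) : Finset (Vtx α) :=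
  V.filter fun x => x.level = t ∧ x.outParent ≠ none ∧ s.w (hub b t) x ≠ ⊤

/-- The vertices of the graph during the generation of shortcuts. -/
structure Site (ψ : Vtx α → ℝ) (V₀ V : Finset (Vtx α)) (t : ℕ) (Δ : α → ℝ) (base : State α) : Prop
    extends Setup ψ V₀ t Δ base where
  subset : V₀ ⊆ V
  hub_in : ∀ a, hub a t ∈ V
  inS_in : ∀ v ∈ base.heavy, ∀ l < Nat.clog 2 (base.aIn v).length, inS v t l ∈ V
  outS_in : ∀ v ∈ base.heavy, ∀ l < Nat.clog 2 (base.aOut v).length, outS v t l ∈ V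

/-- The invariant of `ShortcutIn(neg a)`: at most `k` edges into the N-Steiner vertex from new
in-Steiner vertices have been added to `s₀`. -/
structure LiveIn (ψ : Vtx α → ℝ) (V : Finset (Vtx α)) (t : ℕ) (a : α) (s₀ : State α) (k : ℕ)
    (s : State α) : Prop where
  mid : Mid ψ V V t s
  cIn : ∀ b, (hubIn t V s b).card ≤ (hubIn t V s₀ b).card + if b = a then k else 0
  cOut : ∀ b, (hubOut t V s b).card ≤ (hubOut t V s₀ b).card

/-- The invariant of `ShortcutOut(neg a)`. -/
structure LiveOut (ψ : Vtx α → ℝ) (V : Finset (Vtx α)) (t : ℕ) (a : α) (s₀ : State α) (k : ℕ)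
    (s : State α) : Prop where
  mid : Mid ψ V V t s
  cIn : ∀ b, (hubIn t V s b).card ≤ (hubIn t V s₀ b).card
  cOut : ∀ b, (hubOut t V s b).card ≤ (hubOut t V s₀ b).card + if b = a then k else 0

theorem LiveIn.mono {k' : ℕ} (h : LiveIn ψ V t a s₀ k s) (hk : k ≤ k') :
    LiveIn ψ V t a s₀ k' s := by
  refine ⟨h.mid, fun b => (h.cIn b).trans ?_, h.cOut⟩
  split_ifs <;> omega

theorem LiveOut.mono {k' : ℕ} (h : LiveOut ψ V t a s₀ k s) (hk : k ≤ k') :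
    LiveOut ψ V t a s₀ k' s := by
  refine ⟨h.mid, h.cIn, fun b => (h.cOut b).trans ?_⟩
  split_ifs <;> omega

theorem hub_not_anc (S : Site ψ V₀ V t Δ base) (hu : u ∈ V₀) : ¬ Anc (hub b t) u := fun h => by
  have := S.lvl _ (S.core.toFrame.anc h hu).1
  simp [level] at this

/-- All ancestors of an old vertex are old. So a call for an old vertex adds no edge between new
Steiner vertices and new N-Steiner vertices. -/
theorem hubIn_addEdgeIn (S : Site ψ V₀ V t Δ base) (M : Mid ψ V V t s) (hu : u ∈ V₀)
    (hW : 0 ≤ W + ψ u - ψ (hub a t)) (b : α) :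
    hubIn t V (addEdgeIn u (hub a t) W s) b ⊆ hubIn t V s b ∧
      hubOut t V (addEdgeIn u (hub a t) W s) b ⊆ hubOut t V s b := by
  have h := addEdgeIn_hub_spec u a t W s M.core.toFrame (S.subset hu) (S.hub_in a) hW
  constructor
  · intro x hx
    obtain ⟨h1, h2, h3, h4⟩ := Finset.mem_filter.1 hx
    rcases h.new _ _ _ (State.link_wt ψ h4) with h5 | ⟨h5, -, -⟩
    · exact Finset.mem_filter.2 ⟨h1, h2, h3, h5.ne_top⟩
    · have := S.lvl _ (S.core.toFrame.anc h5 hu).1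
      omega
  · intro x hx
    obtain ⟨h1, h2, h3, h4⟩ := Finset.mem_filter.1 hx
    rcases h.new _ _ _ (State.link_wt ψ h4) with h5 | ⟨h5, -, -⟩
    · exact Finset.mem_filter.2 ⟨h1, h2, h3, h5.ne_top⟩
    · exact absurd h5 (hub_not_anc S hu)

theorem hubOut_addEdgeOut (S : Site ψ V₀ V t Δ base) (M : Mid ψ V V t s) (hu : u ∈ V₀)
    (hW : 0 ≤ W + ψ (hub a t) - ψ u) (b : α) :
    hubIn t V (addEdgeOut u (hub a t) W s) b ⊆ hubIn t V s b ∧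
      hubOut t V (addEdgeOut u (hub a t) W s) b ⊆ hubOut t V s b := by
  have h := addEdgeOut_hub_spec u a t W s M.core.toFrame (S.subset hu) (S.hub_in a) hW
  constructor
  · intro x hx
    obtain ⟨h1, h2, h3, h4⟩ := Finset.mem_filter.1 hx
    rcases h.new _ _ _ (State.link_wt ψ h4) with h5 | ⟨h5, -, -⟩
    · exact Finset.mem_filter.2 ⟨h1, h2, h3, h5.ne_top⟩
    · exact absurd h5 (hub_not_anc S hu)
  · intro x hx
    obtain ⟨h1, h2, h3, h4⟩ := Finset.mem_filter.1 hx
    rcases h.new _ _ _ (State.link_wt ψ h4) with h5 | ⟨h5, -, -⟩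
    · exact Finset.mem_filter.2 ⟨h1, h2, h3, h5.ne_top⟩
    · have := S.lvl _ (S.core.toFrame.anc h5 hu).1
      omega

theorem LiveIn.old (S : Site ψ V₀ V t Δ base) (L : LiveIn ψ V t a s₀ k s) (hu : u ∈ V₀)
    (hW : 0 ≤ W + ψ u - ψ (hub a t)) (hW0 : 0 ≤ W) :
    LiveIn ψ V t a s₀ k (addEdgeIn u (hub a t) W s) where
  mid := L.mid.addEdgeIn (S.subset hu) (S.hub_in a) hW (Or.inl hW0)
  cIn b := (Finset.card_le_card (hubIn_addEdgeIn S L.mid hu hW b).1).trans (L.cIn b)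
  cOut b := (Finset.card_le_card (hubIn_addEdgeIn S L.mid hu hW b).2).trans (L.cOut b)

theorem LiveOut.old (S : Site ψ V₀ V t Δ base) (L : LiveOut ψ V t a s₀ k s) (hu : u ∈ V₀)
    (hW : 0 ≤ W + ψ (hub a t) - ψ u) :
    LiveOut ψ V t a s₀ k (addEdgeOut u (hub a t) W s) where
  mid := L.mid.addEdgeOut (S.subset hu) (S.hub_in a) hW
  cIn b := (Finset.card_le_card (hubOut_addEdgeOut S L.mid hu hW b).1).trans (L.cIn b)
  cOut b := (Finset.card_le_card (hubOut_addEdgeOut S L.mid hu hW b).2).trans (L.cOut b)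

/-- Among the ancestors of the new vertex only that vertex itself is new, so a single edge counts,
namely that into the N-Steiner vertex of `a`. -/
theorem LiveIn.new (S : Site ψ V₀ V t Δ base) (L : LiveIn ψ V t a s₀ k s) (hv : v ∈ V₀)
    (hx : inS v t l ∈ V) (hW : 0 ≤ W + ψ (inS v t l) - ψ (hub a t)) :
    LiveIn ψ V t a s₀ (k + 1) (addEdgeIn (inS v t l) (hub a t) W s) := by
  have h := addEdgeIn_hub_spec _ a t W s L.mid.core.toFrame hx (S.hub_in a) hW
  refine ⟨L.mid.addEdgeIn hx (S.hub_in a) hW (Or.inr (by simp [inParent])), fun b => ?_,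
    fun b => (Finset.card_le_card fun x hx => ?_).trans (L.cOut b)⟩
  · have hsub : hubIn t V (addEdgeIn (inS v t l) (hub a t) W s) b ⊆
        hubIn t V s b ∪ if b = a then {inS v t l} else ∅ := by
      intro x hx
      obtain ⟨h1, h2, h3, h4⟩ := Finset.mem_filter.1 hx
      rcases h.new _ _ _ (State.link_wt ψ h4) with h5 | ⟨h5, h6, -⟩
      · exact Finset.mem_union_left _ (Finset.mem_filter.2 ⟨h1, h2, h3, h5.ne_top⟩)
      · rcases anc_inS_iff.1 h5 with rfl | h5
        · simp only [reduceCtorEq, hub.injEq, and_true, false_or] at h6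
          rw [if_pos h6]
          exact Finset.mem_union_right _ (Finset.mem_singleton_self _)
        · have := S.lvl _ (S.core.toFrame.anc h5 hv).1
          omega
    have h1 := (Finset.card_le_card hsub).trans (Finset.card_union_le _ _)
    have h2 := L.cIn b
    split_ifs at h1 h2 ⊢
    · rw [Finset.card_singleton] at h1; omega
    · rw [Finset.card_empty] at h1; omega
  · obtain ⟨h1, h2, h3, h4⟩ := Finset.mem_filter.1 hx
    rcases h.new _ _ _ (State.link_wt ψ h4) with h5 | ⟨h5, -, -⟩
    · exact Finset.mem_filter.2 ⟨h1, h2, h3, h5.ne_top⟩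
    · rcases anc_inS_iff.1 h5 with h5 | h5
      · simp at h5
      · exact absurd h5 (hub_not_anc S hv)

theorem LiveOut.new (S : Site ψ V₀ V t Δ base) (L : LiveOut ψ V t a s₀ k s) (hv : v ∈ V₀)
    (hx : outS v t l ∈ V) (hW : 0 ≤ W + ψ (hub a t) - ψ (outS v t l)) :
    LiveOut ψ V t a s₀ (k + 1) (addEdgeOut (outS v t l) (hub a t) W s) := by
  have h := addEdgeOut_hub_spec _ a t W s L.mid.core.toFrame hx (S.hub_in a) hW
  refine ⟨L.mid.addEdgeOut hx (S.hub_in a) hW,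
    fun b => (Finset.card_le_card fun x hx => ?_).trans (L.cIn b), fun b => ?_⟩
  · obtain ⟨h1, h2, h3, h4⟩ := Finset.mem_filter.1 hx
    rcases h.new _ _ _ (State.link_wt ψ h4) with h5 | ⟨h5, -, -⟩
    · exact Finset.mem_filter.2 ⟨h1, h2, h3, h5.ne_top⟩
    · rcases anc_outS_iff.1 h5 with h5 | h5
      · simp at h5
      · exact absurd h5 (hub_not_anc S hv)
  · have hsub : hubOut t V (addEdgeOut (outS v t l) (hub a t) W s) b ⊆
        hubOut t V s b ∪ if b = a then {outS v t l} else ∅ := by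
      intro x hx
      obtain ⟨h1, h2, h3, h4⟩ := Finset.mem_filter.1 hx
      rcases h.new _ _ _ (State.link_wt ψ h4) with h5 | ⟨h5, h6, -⟩
      · exact Finset.mem_union_left _ (Finset.mem_filter.2 ⟨h1, h2, h3, h5.ne_top⟩)
      · rcases anc_outS_iff.1 h5 with rfl | h5
        · simp only [reduceCtorEq, hub.injEq, and_true, false_or] at h6
          rw [if_pos h6]
          exact Finset.mem_union_right _ (Finset.mem_singleton_self _)
        · have := S.lvl _ (S.core.toFrame.anc h5 hv).1
          omega
    have h1 := (Finset.card_le_card hsub).trans (Finset.card_union_le _ _)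
    have h2 := L.cOut b
    split_ifs at h1 h2 ⊢
    · rw [Finset.card_singleton] at h1; omega
    · rw [Finset.card_empty] at h1; omega

/-! ### Processing one vertex -/

/-- Finite tentative distances belong to `V₀` and are compatible with the potential. -/
def FeasIn (ψ : Vtx α → ℝ) (V₀ : Finset (Vtx α)) (a : α) (d : Vtx α → WithTop ℝ) : Prop :=
  ∀ v (c : ℝ), d v = c → v ∈ V₀ ∧ ψ (neg a) - ψ v ≤ c

def FeasOut (ψ : Vtx α → ℝ) (V₀ : Finset (Vtx α)) (a : α) (d : Vtx α → WithTop ℝ) : Prop :=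
  ∀ v (c : ℝ), d v = c → v ∈ V₀ ∧ ψ v - ψ (neg a) ≤ c

/-- The relaxations made when a vertex `v` with tentative distance `dv` is processed in
`ShortcutIn`. -/
def SrcIn (base : State α) (ψ : Vtx α → ℝ) (D : ℝ) (v : Vtx α) (dv : ℝ) (x : Vtx α) (c : ℝ) :
    Prop :=
  (v.inParent = some x ∧ c = dv - (ψ x - ψ v)) ∨
    (v ∈ base.heavy ∧ ∃ u ∈ base.aIn v, u.inParent = some x ∧
      c = base.wt u v + dv - (ψ x - ψ u) ∧ c < D)

def SrcOut (base : State α) (ψ : Vtx α → ℝ) (D : ℝ) (v : Vtx α) (dv : ℝ) (x : Vtx α) (c : ℝ) :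
    Prop :=
  (v.outParent = some x ∧ c = dv - (ψ v - ψ x)) ∨
    (v ∈ base.heavy ∧ ∃ u ∈ base.aOut v, u.outParent = some x ∧
      c = dv + base.wt v u - (ψ u - ψ x) ∧ c < -D)

/-- The change of the tentative distances by a step. -/
structure Relaxed (Q : Vtx α → ℝ → Prop) (d d' : Vtx α → WithTop ℝ) : Prop where
  ne_top : ∀ x, d x ≠ ⊤ → d' x ≠ ⊤
  src : ∀ x (c : ℝ), d' x = c → d x = c ∨ Q x c

theorem Relaxed.refl (Q : Vtx α → ℝ → Prop) (d : Vtx α → WithTop ℝ) : Relaxed Q d d :=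
  ⟨fun _ h => h, fun _ _ h => Or.inl h⟩

theorem Relaxed.relax {Q : Vtx α → ℝ → Prop} {d d' : Vtx α → WithTop ℝ} (h : Relaxed Q d d') {c : ℝ}
    (hc : Q p c) : Relaxed Q d (relax d' p c) where
  ne_top x hx := by
    unfold NegSSSP.relax
    by_cases hxp : x = p
    · subst hxp
      rw [Function.update_self]
      exact ne_top_of_le_ne_top WithTop.coe_ne_top (min_le_right _ _)
    · rw [Function.update_of_ne hxp]
      exact h.ne_top x hx
  src x c' hx := by
    unfold NegSSSP.relax at hx
    by_cases hxp : x = p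
    · subst hxp
      rw [Function.update_self] at hx
      rcases min_choice (d' x) (c : WithTop ℝ) with h1 | h1
      · rw [h1] at hx; exact h.src _ _ hx
      · rw [h1] at hx
        have : c = c' := by exact_mod_cast hx
        exact Or.inr (this ▸ hc)
    · rw [Function.update_of_ne hxp] at hx
      exact h.src _ _ hx

/-- Only the scan of a heavy vertex calls `addEdgeIn` for a new Steiner vertex, and it does so at
most once; this is the increment of `k`. All added edges are feasible because `dv` is at least the
potential difference to the negative vertex. -/
theorem processIn_spec (S : Site ψ V₀ V t Δ base) {z : (Vtx α → WithTop ℝ) × State α}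
    (L : LiveIn ψ V t a s₀ k z.2) (hv : v ∈ V₀) (hd : z.1 v = (dv : ℝ))
    (hf : ψ (neg a) - ψ v ≤ dv) :
    LiveIn ψ V t a s₀ (k + 1) (processIn base t a (Δ a) z v).2 ∧
      Relaxed (SrcIn base ψ (Δ a) v dv) z.1 (processIn base t a (Δ a) z v).1 := by
  have hhub := S.pot_hub a
  have hin : ∀ {u} , u ∈ base.aIn v → u ∈ V₀ ∧ ψ v - ψ u ≤ base.wt u v := by
    intro u hu
    obtain ⟨h1, h2, -⟩ := mem_aIn.1 hu
    rw [S.verts] at h1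
    have := S.core.feas (State.link_wt ψ h2)
    exact ⟨h1, by linarith⟩
  let P : ℕ → (Vtx α → WithTop ℝ) × State α → Prop := fun k z' =>
    LiveIn ψ V t a s₀ k z'.2 ∧ Relaxed (SrcIn base ψ (Δ a) v dv) z.1 z'.1
  have hold : ∀ {k z' u} (_ : u ∈ base.aIn v) (_ : P k z'),
      P k (if 0 ≤ base.wt u v + dv - Δ a then
        (z'.1, addEdgeIn u (hub a t) (base.wt u v + dv - Δ a) z'.2) else z') := by
    intro k z' u hu hP
    split_ifs with hW
    · exact ⟨hP.1.old S (hin hu).1 (by rw [hhub]; linarith [(hin hu).2]) hW, hP.2⟩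
    · exact hP
  have hscan : ∀ z₁, P k z₁ → P (k + 1) (if v ∈ base.heavy then scanHeavyIn base t a (Δ a) v dv z₁
      else (base.aIn v).foldl (fun z u => if 0 ≤ base.wt u v + dv - Δ a then
        (z.1, addEdgeIn u (hub a t) (base.wt u v + dv - Δ a) z.2) else z) z₁) := by
    intro z₁ h1
    split_ifs with hheavy
    · unfold scanHeavyIn
      dsimp only
      refine foldl_inv (P := P (k + 1)) _ ?_ _ ?_
      · intro z' hz' u hu
        have huA := List.mem_of_mem_drop hu
        split
        · next p hp _ =>
          split_ifs with hc
          · refine ⟨hz'.1, hz'.2.relax (Or.inr ⟨hheavy, u, huA, hp, ?_, hc⟩)⟩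
            obtain ⟨t', l', rfl⟩ := eq_of_inParent hp
            rw [hz'.1.mid.core.toFrame.wt_eq
              (hz'.1.mid.core.tight_inS (S.subset (hin huA).1))]
          · exact hz'
        · exact hold huA hz'
      -- The position found in the sorted list does not matter for the count, so every `l` is
      -- treated.
      · have hnew : ∀ l, P (k + 1) (if l < Nat.clog 2 (base.aIn v).length then
            (z₁.1, addEdgeIn (inS v t l) (hub a t) (z₁.2.wt (inS v t l) v + dv - Δ a) z₁.2) else z₁) := by
          intro l
          split_ifs with hl
          · have hx := S.inS_in v hheavy l hl
            refine ⟨h1.1.new S hv hx ?_, h1.2⟩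
            rw [hhub, h1.1.mid.core.toFrame.wt_eq (h1.1.mid.core.tight_inS hx)]
            linarith
          · exact ⟨h1.1.mono (Nat.le_succ _), h1.2⟩
        exact hnew _
    · refine foldl_inv (P := P (k + 1)) _ ?_ _ ⟨h1.1.mono (Nat.le_succ _), h1.2⟩
      intro z' hz' u hu
      exact hold hu hz'
  unfold processIn
  rw [hd]
  dsimp only [WithTop.untopD_coe]
  split
  · next p hp =>
    obtain ⟨t', l', rfl⟩ := eq_of_inParent hp
    have e : z.2.wt (inS p t' l') p = ψ p - ψ (inS p t' l') :=
      L.mid.core.toFrame.wt_eq (L.mid.core.tight_inS (S.subset hv))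
    refine ⟨L.mono (Nat.le_succ _), (Relaxed.refl _ _).relax (Or.inl ⟨hp, ?_⟩)⟩
    rw [e]
  · next hnone =>
    refine hscan _ ?_
    split
    · next p hp =>
      obtain ⟨t', l', rfl⟩ := eq_of_outParent hp
      have e : z.2.wt p (outS p t' l') = ψ (outS p t' l') - ψ p :=
        L.mid.core.toFrame.wt_eq (L.mid.core.tight_outS (S.subset hv))
      split_ifs with hW
      · refine ⟨L.old S (S.core.outS_mem hv).1 ?_ hW, Relaxed.refl _ _⟩
        rw [hhub, e]; linarith
      · exact ⟨L, Relaxed.refl _ _⟩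
    · exact ⟨L, Relaxed.refl _ _⟩

theorem processOut_spec (S : Site ψ V₀ V t Δ base) {z : (Vtx α → WithTop ℝ) × State α}
    (L : LiveOut ψ V t a s₀ k z.2) (hv : v ∈ V₀) (hd : z.1 v = (dv : ℝ))
    (hf : ψ v - ψ (neg a) ≤ dv) :
    LiveOut ψ V t a s₀ (k + 1) (processOut base t a (Δ a) z v).2 ∧
      Relaxed (SrcOut base ψ (Δ a) v dv) z.1 (processOut base t a (Δ a) z v).1 := by
  have hhub := S.pot_hub a
  have hin : ∀ {u} , u ∈ base.aOut v → u ∈ V₀ ∧ ψ u - ψ v ≤ base.wt v u := by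
    intro u hu
    obtain ⟨h1, h2, -⟩ := mem_aOut.1 hu
    rw [S.verts] at h1
    have := S.core.feas (State.link_wt ψ h2)
    exact ⟨h1, by linarith⟩
  let P : ℕ → (Vtx α → WithTop ℝ) × State α → Prop := fun k z' =>
    LiveOut ψ V t a s₀ k z'.2 ∧ Relaxed (SrcOut base ψ (Δ a) v dv) z.1 z'.1
  have hold : ∀ {k z' u} (_ : u ∈ base.aOut v) (_ : P k z'),
      P k (if 0 ≤ dv + base.wt v u + Δ a then
        (z'.1, addEdgeOut u (hub a t) (dv + base.wt v u + Δ a) z'.2) else z') := by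
    intro k z' u hu hP
    split_ifs with hW
    · exact ⟨hP.1.old S (hin hu).1 (by rw [hhub]; linarith [(hin hu).2]), hP.2⟩
    · exact hP
  have hscan : ∀ z₁, P k z₁ → P (k + 1) (if v ∈ base.heavy then scanHeavyOut base t a (Δ a) v dv z₁
      else (base.aOut v).foldl (fun z u => if 0 ≤ dv + base.wt v u + Δ a then
        (z.1, addEdgeOut u (hub a t) (dv + base.wt v u + Δ a) z.2) else z) z₁) := by
    intro z₁ h1
    split_ifs with hheavy
    · unfold scanHeavyOut
      dsimp only
      refine foldl_inv (P := P (k + 1)) _ ?_ _ ?_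
      · intro z' hz' u hu
        have huA := List.mem_of_mem_drop hu
        split
        · next p hp _ =>
          split_ifs with hc
          · refine ⟨hz'.1, hz'.2.relax (Or.inr ⟨hheavy, u, huA, hp, ?_, hc⟩)⟩
            obtain ⟨t', l', rfl⟩ := eq_of_outParent hp
            rw [hz'.1.mid.core.toFrame.wt_eq
              (hz'.1.mid.core.tight_outS (S.subset (hin huA).1))]
          · exact hz'
        · exact hold huA hz'
      · have hnew : ∀ l, P (k + 1) (if l < Nat.clog 2 (base.aOut v).length then
            (z₁.1, addEdgeOut (outS v t l) (hub a t) (dv + z₁.2.wt v (outS v t l) + Δ a) z₁.2) else z₁) := by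
          intro l
          split_ifs with hl
          · have hx := S.outS_in v hheavy l hl
            refine ⟨h1.1.new S hv hx ?_, h1.2⟩
            rw [hhub, h1.1.mid.core.toFrame.wt_eq (h1.1.mid.core.tight_outS hx)]
            linarith
          · exact ⟨h1.1.mono (Nat.le_succ _), h1.2⟩
        exact hnew _
    · refine foldl_inv (P := P (k + 1)) _ ?_ _ ⟨h1.1.mono (Nat.le_succ _), h1.2⟩
      intro z' hz' u hu
      exact hold hu hz'
  unfold processOut
  rw [hd]
  dsimp only [WithTop.untopD_coe]
  split
  · next p hp =>
    obtain ⟨t', l', rfl⟩ := eq_of_outParent hp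
    have e : z.2.wt p (outS p t' l') = ψ (outS p t' l') - ψ p :=
      L.mid.core.toFrame.wt_eq (L.mid.core.tight_outS (S.subset hv))
    refine ⟨L.mono (Nat.le_succ _), (Relaxed.refl _ _).relax (Or.inl ⟨hp, ?_⟩)⟩
    rw [e]
  · next hnone =>
    refine hscan _ ?_
    split
    · next p hp =>
      obtain ⟨t', l', rfl⟩ := eq_of_inParent hp
      have e : z.2.wt (inS p t' l') p = ψ p - ψ (inS p t' l') :=
        L.mid.core.toFrame.wt_eq (L.mid.core.tight_inS (S.subset hv))
      split_ifs with hW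
      · refine ⟨L.old S (S.core.inS_mem hv).1 ?_, Relaxed.refl _ _⟩
        rw [hhub, e]; linarith
      · exact ⟨L, Relaxed.refl _ _⟩
    · exact ⟨L, Relaxed.refl _ _⟩

end

/-! ### The number of processed vertices -/

/-- The vertices at `h`-hop distance less than `Δ_r` to `r = neg a`. -/
def nearIn (base : State α) (h : ℕ) (D : ℝ) (a : α) : Finset (Vtx α) :=
  base.verts.filter fun v => base.hopDist h v (neg a) < (D : EReal)

/-- The vertices at `h`-hop distance less than `-Δ_r` from `r = neg a`. -/
def nearOut (base : State α) (h : ℕ) (D : ℝ) (a : α) : Finset (Vtx α) :=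
  base.verts.filter fun v => base.hopDist h (neg a) v < ((-D : ℝ) : EReal)

/-- The number of hops that realise the tentative distances at a vertex. -/
def hopBound (t : ℕ) (v : Vtx α) : ℕ := if v.level = 0 then t + 1 else t - v.level

/-- The parent of a Steiner vertex. -/
def Vtx.par : Vtx α → Vtx α
  | inS p _ _ => p
  | outS p _ _ => p
  | v => v

section

variable {s s' s₀ base : State α} {ψ φ : Vtx α → ℝ} {V V' V₀ : Finset (Vtx α)} {t h k l : ℕ}
  {Δ : α → ℝ} {D : ℝ} {a b : α} {x y p q u v : Vtx α} {X Y W dv : ℝ} {d d' : Vtx α → WithTop ℝ}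

/-- The tentative distances in `ShortcutIn(neg a)` while vertices of positive level are processed. -/
def NearIn (base : State α) (t h : ℕ) (D : ℝ) (a : α) (d : Vtx α → WithTop ℝ) : Prop :=
  ∀ v (c : ℝ), d v = c → base.hopDist (hopBound t v) v (neg a) ≤ (c : EReal) ∧
    (c < D ∨ v.level = 0 ∧ ∃ u ∈ nearIn base h D a, u.par = v)

/-- The tentative distances in `ShortcutOut(neg a)` while vertices of positive level are
processed. -/
def NearOut (base : State α) (t : ℕ) (D : ℝ) (a : α) (d : Vtx α → WithTop ℝ) : Prop :=
  ∀ v (c : ℝ), d v = c → base.hopDist (hopBound t v) (neg a) v ≤ (c : EReal) ∧ c < -D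

theorem Setup.of_mem_aIn (S : Setup ψ V₀ t Δ base) (hu : u ∈ base.aIn v) :
    u ∈ V₀ ∧ base.Link ψ u v (base.wt u v + ψ u - ψ v) ∧ 0 ≤ base.wt u v + ψ u - ψ v := by
  obtain ⟨h1, h2, -⟩ := mem_aIn.1 hu
  rw [S.verts] at h1
  exact ⟨h1, State.link_wt ψ h2, S.core.feas (State.link_wt ψ h2)⟩

theorem Setup.of_mem_aOut (S : Setup ψ V₀ t Δ base) (hu : u ∈ base.aOut v) :
    u ∈ V₀ ∧ base.Link ψ v u (base.wt v u + ψ v - ψ u) ∧ 0 ≤ base.wt v u + ψ v - ψ u := by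
  obtain ⟨h1, h2, -⟩ := mem_aOut.1 hu
  rw [S.verts] at h1
  exact ⟨h1, State.link_wt ψ h2, S.core.feas (State.link_wt ψ h2)⟩

theorem FeasIn.relaxed (S : Setup ψ V₀ t Δ base) (hF : FeasIn ψ V₀ a d) (hd : d v = (dv : ℝ))
    (hr : Relaxed (SrcIn base ψ D v dv) d d') : FeasIn ψ V₀ a d' := by
  intro x c hc
  obtain ⟨hv, hf⟩ := hF v dv hd
  rcases hr.src x c hc with h1 | ⟨hp, rfl⟩ | ⟨-, u, hu, hp, rfl, -⟩
  · exact hF x c h1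
  · obtain ⟨t', l', rfl⟩ := eq_of_inParent hp
    exact ⟨(S.core.inS_mem hv).1, by linarith⟩
  · obtain ⟨t', l', rfl⟩ := eq_of_inParent hp
    obtain ⟨h1, -, h3⟩ := S.of_mem_aIn hu
    exact ⟨(S.core.inS_mem h1).1, by linarith⟩

theorem FeasOut.relaxed (S : Setup ψ V₀ t Δ base) (hF : FeasOut ψ V₀ a d) (hd : d v = (dv : ℝ))
    (hr : Relaxed (SrcOut base ψ D v dv) d d') : FeasOut ψ V₀ a d' := by
  intro x c hc
  obtain ⟨hv, hf⟩ := hF v dv hd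
  rcases hr.src x c hc with h1 | ⟨hp, rfl⟩ | ⟨-, u, hu, hp, rfl, -⟩
  · exact hF x c h1
  · obtain ⟨t', l', rfl⟩ := eq_of_outParent hp
    exact ⟨(S.core.outS_mem hv).1, by linarith⟩
  · obtain ⟨t', l', rfl⟩ := eq_of_outParent hp
    obtain ⟨h1, -, h3⟩ := S.of_mem_aOut hu
    exact ⟨(S.core.outS_mem h1).1, by linarith⟩

theorem hopBound_le (ht : t + 1 ≤ h) (v : Vtx α) : hopBound t v ≤ h := by
  unfold hopBound; split_ifs <;> omega

/-- One level down pays for one more hop. A parent of level 0 costs two hops, and for it `hopBound`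
is `t + 1`; as `l` is at least 1, this suffices. -/
theorem hopBound_parent (hpv : p.level < v.level) (hv : v.level ≤ l) (hl : l < t) :
    t - l + 1 + lvlCost p ≤ hopBound t p := by
  unfold hopBound lvlCost
  split_ifs <;> omega

/-- A relaxed value is realised by a walk from the parent, by `hopDist_inParent`; the decrease of
the level pays for the additional hops. -/
theorem NearIn.relaxed (S : Setup ψ V₀ t Δ base) (ht : t + 1 ≤ h) (hN : NearIn base t h D a d)
    (hF : FeasIn ψ V₀ a d) (hd : d v = (dv : ℝ)) (hlv : 1 ≤ v.level)
    (hr : Relaxed (SrcIn base ψ D v dv) d d') : NearIn base t h D a d' := by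
  intro x c hc
  obtain ⟨hv, hf⟩ := hF v dv hd
  obtain ⟨hhop, hdv⟩ := hN v dv hd
  have hdv' : dv < D := hdv.resolve_right fun h => by omega
  have hvt := S.lvl v hv
  have hB : hopBound t v = t - v.level := by
    unfold hopBound; rw [if_neg (by omega)]
  rw [hB] at hhop
  rcases hr.src x c hc with h1 | ⟨hp, rfl⟩ | ⟨hheavy, u, hu, hp, rfl, hcD⟩
  · exact hN x c h1
  · obtain ⟨t', l', rfl⟩ := eq_of_inParent hp
    have hlt := (S.core.inS_mem hv).2.1
    refine ⟨(hopDist_anti (hopBound_parent (v := inS x t' l') hlt le_rfl hvt)).trans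
      (hopDist_inParent S.core S.ends S.stable hhop), ?_⟩
    -- The weight of the edge into the parent is subtracted from `dv`. If it is nonnegative the
    -- value stays below `D`. It may be negative for a parent r̄, and then the child serves as a
    -- witness near `a`.
    by_cases hb : ∃ e, x = bar e
    · right
      refine ⟨by obtain ⟨e, rfl⟩ := hb; rfl, inS x t' l', Finset.mem_filter.2 ⟨?_, ?_⟩, rfl⟩
      · rw [S.verts]; exact hv
      · exact ((hopDist_anti (by omega)).trans hhop).trans_lt (EReal.coe_lt_coe_iff.2 hdv')
    · left
      have := (S.stable.sgn S.core).inS x t' l' hv (fun e he => hb ⟨e, he⟩)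
      linarith
  · refine ⟨?_, Or.inl hcD⟩
    obtain ⟨huV, hlink, -⟩ := S.of_mem_aIn hu
    obtain ⟨-, -, h0, g1, g2, g3⟩ := mem_aIn.1 hu
    obtain ⟨t', l', rfl⟩ := eq_of_inParent hp
    have hlt := (S.core.inS_mem huV).2.1
    -- By the invariant the target of an edge from an in-Steiner vertex that is not its child in the
    -- list has a `rootIn`. Among the vertices of positive level that are not in-Steiner vertices
    -- only N-Steiner vertices have one.
    have hhub : ∃ b τ, v = hub b τ := by
      rcases (S.core.edge hlink).ein x (Or.inl rfl) with h1 | h1 | ⟨b, hb, -⟩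
      · exact absurd h1 (g1 hheavy)
      · exact absurd h1 g3
      · cases v with
        | hub b τ => exact ⟨b, τ, rfl⟩
        | neg b => simp [level] at hlv
        | bar b => simp [level] at hlv
        | inS p t l => simp [inParent] at g2
        | outS p t l => simp [rootIn] at hb
    obtain ⟨b, τ, rfl⟩ := hhub
    -- Without this bound, which is the purpose of `lvl_in`, the parent might have a level at least
    -- that of `v`, and the hops could not be paid for.
    have hlevel : (inS x t' l').level ≤ τ :=
      ((S.core.edge hlink).lvl_in b τ rfl (by simp [inParent])).resolve_left (g1 hheavy)
    have h1 := (hlink.rwalk_zero h0 (by simp)).hopDist_le hhop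
    rw [zero_add] at h1
    have h2 := hopDist_inParent S.core S.ends S.stable
      (h1.trans_eq (congrArg _ (show _ = base.wt (inS x t' l') (hub b τ) + dv by ring)))
    exact (hopDist_anti (hopBound_parent (v := inS x t' l') hlt hlevel hvt)).trans h2

/-- Here no exception is needed: edges from an out-parent to its out-Steiner vertex always have
nonnegative weight. -/
theorem NearOut.relaxed (S : Setup ψ V₀ t Δ base) (hN : NearOut base t D a d)
    (hF : FeasOut ψ V₀ a d) (hd : d v = (dv : ℝ)) (hlv : 1 ≤ v.level)
    (hr : Relaxed (SrcOut base ψ D v dv) d d') : NearOut base t D a d' := by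
  intro x c hc
  obtain ⟨hv, hf⟩ := hF v dv hd
  obtain ⟨hhop, hdv'⟩ := hN v dv hd
  have hvt := S.lvl v hv
  have hB : hopBound t v = t - v.level := by
    unfold hopBound; rw [if_neg (by omega)]
  rw [hB] at hhop
  rcases hr.src x c hc with h1 | ⟨hp, rfl⟩ | ⟨hheavy, u, hu, hp, rfl, hcD⟩
  · exact hN x c h1
  · obtain ⟨t', l', rfl⟩ := eq_of_outParent hp
    have hlt := (S.core.outS_mem hv).2.1
    refine ⟨(hopDist_anti (hopBound_parent (v := outS x t' l') hlt le_rfl hvt)).trans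
      (hopDist_outParent S.core S.ends S.stable hhop), ?_⟩
    have := (S.stable.sgn S.core).outS x t' l' hv
    linarith
  · refine ⟨?_, hcD⟩
    obtain ⟨huV, hlink, -⟩ := S.of_mem_aOut hu
    obtain ⟨-, -, h0, g1, g2, g3⟩ := mem_aOut.1 hu
    obtain ⟨t', l', rfl⟩ := eq_of_outParent hp
    have hlt := (S.core.outS_mem huV).2.1
    have hhub : ∃ b τ, v = hub b τ := by
      rcases (S.core.edge hlink).eout x (Or.inl rfl) with h1 | h1 | ⟨b, hb, -⟩
      · exact absurd h1 (g1 hheavy)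
      · exact absurd h1 g3
      · cases v with
        | hub b τ => exact ⟨b, τ, rfl⟩
        | neg b => simp [level] at hlv
        | bar b => simp [level] at hlv
        | outS p t l => simp [outParent] at g2
        | inS p t l => simp [rootOut] at hb
    obtain ⟨b, τ, rfl⟩ := hhub
    have hlevel : (outS x t' l').level ≤ τ :=
      ((S.core.edge hlink).lvl_out b τ rfl (by simp [outParent])).resolve_left (g1 hheavy)
    have h1 := (hlink.rwalk_zero h0 (by simp)).le_hopDist hhop
    rw [add_zero] at h1
    have h2 := hopDist_outParent S.core S.ends S.stable
      (h1.trans_eq (congrArg _ (show _ = dv + base.wt (hub b τ) (outS x t' l') by ring)))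
    exact (hopDist_anti (hopBound_parent (v := outS x t' l') hlt hlevel hvt)).trans h2

theorem exists_coe_of_ne_top {e : WithTop ℝ} (h : e ≠ ⊤) : ∃ c : ℝ, e = c := by
  lift e to ℝ using h with c
  exact ⟨c, rfl⟩

/-- The property `R` of the tentative distances is a parameter because positive levels need
`NearIn`, while at level 0 nothing has to be remembered. -/
theorem foldl_processIn (S : Site ψ V₀ V t Δ base) (R : (Vtx α → WithTop ℝ) → Prop)
    (L : List (Vtx α)) (hR : ∀ d d' v dv, v ∈ L → R d → FeasIn ψ V₀ a d → d v = (dv : ℝ) →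
      Relaxed (SrcIn base ψ (Δ a) v dv) d d' → R d')
    (z : (Vtx α → WithTop ℝ) × State α) (k : ℕ) (hz : LiveIn ψ V t a s₀ k z.2)
    (hF : FeasIn ψ V₀ a z.1) (hz' : R z.1) (hL : ∀ v ∈ L, z.1 v ≠ ⊤) :
    LiveIn ψ V t a s₀ (k + L.length) (L.foldl (processIn base t a (Δ a)) z).2 ∧
      FeasIn ψ V₀ a (L.foldl (processIn base t a (Δ a)) z).1 ∧
      R (L.foldl (processIn base t a (Δ a)) z).1 := by
  induction L generalizing z k with
  | nil => exact ⟨hz, hF, hz'⟩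
  | cons v L ih =>
    obtain ⟨dv, hdv⟩ := exists_coe_of_ne_top (hL v List.mem_cons_self)
    obtain ⟨hv, hf⟩ := hF v dv hdv
    obtain ⟨h1, h2⟩ := processIn_spec S hz hv hdv hf
    have := ih (fun d d' v dv hv => hR d d' v dv (List.mem_cons_of_mem _ hv)) _ _ h1
      (hF.relaxed S.toSetup hdv h2) (hR _ _ v dv List.mem_cons_self hz' hF hdv h2)
      (fun w hw => h2.ne_top w (hL w (List.mem_cons_of_mem _ hw)))
    rw [List.foldl_cons, List.length_cons, add_comm L.length, ← add_assoc]
    exact this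

theorem foldl_processOut (S : Site ψ V₀ V t Δ base) (R : (Vtx α → WithTop ℝ) → Prop)
    (L : List (Vtx α)) (hR : ∀ d d' v dv, v ∈ L → R d → FeasOut ψ V₀ a d → d v = (dv : ℝ) →
      Relaxed (SrcOut base ψ (Δ a) v dv) d d' → R d')
    (z : (Vtx α → WithTop ℝ) × State α) (k : ℕ) (hz : LiveOut ψ V t a s₀ k z.2)
    (hF : FeasOut ψ V₀ a z.1) (hz' : R z.1) (hL : ∀ v ∈ L, z.1 v ≠ ⊤) :
    LiveOut ψ V t a s₀ (k + L.length) (L.foldl (processOut base t a (Δ a)) z).2 ∧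
      FeasOut ψ V₀ a (L.foldl (processOut base t a (Δ a)) z).1 ∧
      R (L.foldl (processOut base t a (Δ a)) z).1 := by
  induction L generalizing z k with
  | nil => exact ⟨hz, hF, hz'⟩
  | cons v L ih =>
    obtain ⟨dv, hdv⟩ := exists_coe_of_ne_top (hL v List.mem_cons_self)
    obtain ⟨hv, hf⟩ := hF v dv hdv
    obtain ⟨h1, h2⟩ := processOut_spec S hz hv hdv hf
    have := ih (fun d d' v dv hv => hR d d' v dv (List.mem_cons_of_mem _ hv)) _ _ h1
      (hF.relaxed S.toSetup hdv h2) (hR _ _ v dv List.mem_cons_self hz' hF hdv h2)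
      (fun w hw => h2.ne_top w (hL w (List.mem_cons_of_mem _ hw)))
    rw [List.foldl_cons, List.length_cons, add_comm L.length, ← add_assoc]
    exact this

theorem card_filter_level_succ (A : Finset (Vtx α)) (m : ℕ) :
    (A.filter fun v => m + 1 ≤ v.level).card + (A.filter fun v => v.level = m).card =
      (A.filter fun v => m ≤ v.level).card := by
  rw [← Finset.card_union_of_disjoint]
  · congr 1
    ext v
    simp only [Finset.mem_union, Finset.mem_filter]
    constructor
    · rintro (⟨h1, h2⟩ | ⟨h1, h2⟩) <;> exact ⟨h1, by omega⟩
    · rintro ⟨h1, h2⟩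
      rcases Nat.lt_or_ge m v.level with h | h
      · exact Or.inl ⟨h1, h⟩
      · exact Or.inr ⟨h1, by omega⟩
  · rw [Finset.disjoint_filter]
    intro v _ h1 h2
    omega

/-- Separates level 0, which is processed last and counted differently. -/
theorem range_reverse_foldl {β : Type*} (f : β → ℕ → β) (z : β) (t : ℕ) :
    (List.range (t + 1)).reverse.foldl f z =
      f ((List.range' 1 t).foldr (fun l z => f z l) z) 0 := by
  rw [List.foldl_reverse, List.range_eq_range', List.range'_succ, List.foldr_cons]

/-- At a positive level every processed vertex is near, since the exception in `NearIn` concerns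
level 0 only. Summing over the levels, no near vertex is counted twice. -/
theorem levelsIn (S : Site ψ V₀ V t Δ base) (ht : t + 1 ≤ h) (n : ℕ) :
    ∀ m, 1 ≤ m → ∀ (z : (Vtx α → WithTop ℝ) × State α), LiveIn ψ V t a s₀ 0 z.2 →
      FeasIn ψ V₀ a z.1 → NearIn base t h (Δ a) a z.1 →
      let z' := (List.range' m n).foldr (fun l z =>
        (base.verts.filter fun v => z.1 v ≠ ⊤ ∧ v.level = l).toList.foldl
          (processIn base t a (Δ a)) z) z
      LiveIn ψ V t a s₀ ((nearIn base h (Δ a) a).filter fun v => m ≤ v.level).card z'.2 ∧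
        FeasIn ψ V₀ a z'.1 ∧ NearIn base t h (Δ a) a z'.1 := by
  induction n with
  | zero => exact fun m _ z h1 h2 h3 => ⟨h1.mono (Nat.zero_le _), h2, h3⟩
  | succ n ih =>
    intro m hm z h1 h2 h3
    obtain ⟨g1, g2, g3⟩ := ih (m + 1) (by omega) z h1 h2 h3
    rw [List.range'_succ]
    dsimp only [List.foldr_cons] at g1 g2 g3 ⊢
    set z₁ := (List.range' (m + 1) n).foldr (fun l z =>
        (base.verts.filter fun v => z.1 v ≠ ⊤ ∧ v.level = l).toList.foldl
          (processIn base t a (Δ a)) z) z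
    have hmem : ∀ v ∈ (base.verts.filter fun v => z₁.1 v ≠ ⊤ ∧ v.level = m).toList,
        v ∈ base.verts ∧ z₁.1 v ≠ ⊤ ∧ v.level = m := fun v hv =>
      Finset.mem_filter.1 (Finset.mem_toList.1 hv)
    obtain ⟨f1, f2, f3⟩ := foldl_processIn S (NearIn base t h (Δ a) a)
      (base.verts.filter fun v => z₁.1 v ≠ ⊤ ∧ v.level = m).toList
      (fun d d' v dv hv hd hF hdv hr => hd.relaxed S.toSetup ht hF hdv
        (by rw [(hmem v hv).2.2]; exact hm) hr) z₁ _ g1 g2 g3 (fun v hv => (hmem v hv).2.1)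
    refine ⟨f1.mono ?_, f2, f3⟩
    rw [← card_filter_level_succ (nearIn base h (Δ a) a) m, Finset.length_toList]
    refine Nat.add_le_add_left (Finset.card_le_card fun v hv => ?_) _
    obtain ⟨e1, e2, e3⟩ := Finset.mem_filter.1 hv
    obtain ⟨c, hc⟩ := exists_coe_of_ne_top e2
    obtain ⟨e4, e5⟩ := g3 v c hc
    have e6 : c < Δ a := e5.resolve_right fun h => by omega
    exact Finset.mem_filter.2 ⟨Finset.mem_filter.2 ⟨e1,
      ((hopDist_anti (hopBound_le ht v)).trans e4).trans_lt (EReal.coe_lt_coe_iff.2 e6)⟩, e3⟩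

theorem levelsOut (S : Site ψ V₀ V t Δ base) (ht : t + 1 ≤ h) (n : ℕ) :
    ∀ m, 1 ≤ m → ∀ (z : (Vtx α → WithTop ℝ) × State α), LiveOut ψ V t a s₀ 0 z.2 →
      FeasOut ψ V₀ a z.1 → NearOut base t (Δ a) a z.1 →
      let z' := (List.range' m n).foldr (fun l z =>
        (base.verts.filter fun v => z.1 v ≠ ⊤ ∧ v.level = l).toList.foldl
          (processOut base t a (Δ a)) z) z
      LiveOut ψ V t a s₀ ((nearOut base h (Δ a) a).filter fun v => m ≤ v.level).card z'.2 ∧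
        FeasOut ψ V₀ a z'.1 ∧ NearOut base t (Δ a) a z'.1 := by
  induction n with
  | zero => exact fun m _ z h1 h2 h3 => ⟨h1.mono (Nat.zero_le _), h2, h3⟩
  | succ n ih =>
    intro m hm z h1 h2 h3
    obtain ⟨g1, g2, g3⟩ := ih (m + 1) (by omega) z h1 h2 h3
    rw [List.range'_succ]
    dsimp only [List.foldr_cons] at g1 g2 g3 ⊢
    set z₁ := (List.range' (m + 1) n).foldr (fun l z =>
        (base.verts.filter fun v => z.1 v ≠ ⊤ ∧ v.level = l).toList.foldl
          (processOut base t a (Δ a)) z) z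
    have hmem : ∀ v ∈ (base.verts.filter fun v => z₁.1 v ≠ ⊤ ∧ v.level = m).toList,
        v ∈ base.verts ∧ z₁.1 v ≠ ⊤ ∧ v.level = m := fun v hv =>
      Finset.mem_filter.1 (Finset.mem_toList.1 hv)
    obtain ⟨f1, f2, f3⟩ := foldl_processOut S (NearOut base t (Δ a) a)
      (base.verts.filter fun v => z₁.1 v ≠ ⊤ ∧ v.level = m).toList
      (fun d d' v dv hv hd hF hdv hr => hd.relaxed S.toSetup hF hdv
        (by rw [(hmem v hv).2.2]; exact hm) hr) z₁ _ g1 g2 g3 (fun v hv => (hmem v hv).2.1)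
    refine ⟨f1.mono ?_, f2, f3⟩
    rw [← card_filter_level_succ (nearOut base h (Δ a) a) m, Finset.length_toList]
    refine Nat.add_le_add_left (Finset.card_le_card fun v hv => ?_) _
    obtain ⟨e1, e2, e3⟩ := Finset.mem_filter.1 hv
    obtain ⟨c, hc⟩ := exists_coe_of_ne_top e2
    obtain ⟨e4, e6⟩ := g3 v c hc
    exact Finset.mem_filter.2 ⟨Finset.mem_filter.2 ⟨e1,
      ((hopDist_anti (hopBound_le ht v)).trans e4).trans_lt (EReal.coe_lt_coe_iff.2 e6)⟩, e3⟩

/-- The vertices processed are near, except for parents r̄ of near in-Steiner vertices at level 0.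
There are at most as many parents as near vertices, whence the factor 2. -/
theorem shortcutIn_spec (S : Site ψ V₀ V t Δ base) (ht : t + 1 ≤ h) (hs : Mid ψ V V t s) (a : α) :
    LiveIn ψ V t a s (2 * (nearIn base h (Δ a) a).card) (shortcutIn base t Δ s a) := by
  unfold shortcutIn
  dsimp only
  rw [range_reverse_foldl]
  set d₀ : Vtx α → WithTop ℝ := fun v =>
    if v ∈ base.uIn a (Δ a) then ((base.hopDist 0 v (neg a)).toReal : WithTop ℝ) else ⊤ with hd₀
  have hmem : ∀ v (c : ℝ), d₀ v = c → v ∈ V₀ ∧ ψ (neg a) - ψ v ≤ c ∧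
      base.hopDist 0 v (neg a) = c ∧ c < Δ a := by
    intro v c hc
    simp only [hd₀] at hc
    split_ifs at hc with hv
    · have hc' : (base.hopDist 0 v (neg a)).toReal = c := by exact_mod_cast hc
      obtain ⟨h1, h2⟩ := Finset.mem_filter.1 hv
      obtain ⟨h3, h4⟩ := Frame.le_toReal (S.core.toFrame.le_hopDist (h := 0)) h2
      rw [hc'] at h3 h4
      rw [h4] at h2
      rw [S.verts] at h1
      exact ⟨h1, h3, h4, EReal.coe_lt_coe_iff.1 h2⟩
    · exact absurd hc (WithTop.top_ne_coe)
  have hF : FeasIn ψ V₀ a d₀ := fun v c hc => ⟨(hmem v c hc).1, (hmem v c hc).2.1⟩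
  have hN : NearIn base t h (Δ a) a d₀ := fun v c hc =>
    ⟨(hopDist_anti (Nat.zero_le _)).trans (hmem v c hc).2.2.1.le, Or.inl (hmem v c hc).2.2.2⟩
  have h0 : LiveIn ψ V t a s 0 s := ⟨hs, fun b => Nat.le_add_right _ _, fun b => le_rfl⟩
  obtain ⟨g1, g2, g3⟩ := levelsIn S ht t 1 le_rfl (d₀, s) h0 hF hN
  set z₁ := (List.range' 1 t).foldr (fun l z =>
        (base.verts.filter fun v => z.1 v ≠ ⊤ ∧ v.level = l).toList.foldl
          (processIn base t a (Δ a)) z) (d₀, s)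
  -- Relaxations made at level 0 need no control: the list of vertices to process is fixed by then
  -- and no level follows.
  obtain ⟨f1, -, -⟩ := foldl_processIn S (fun _ => True)
    (base.verts.filter fun v => z₁.1 v ≠ ⊤ ∧ v.level = 0).toList
    (fun _ _ _ _ _ _ _ _ _ => trivial) z₁ _ g1 g2 trivial
    (fun v hv => (Finset.mem_filter.1 (Finset.mem_toList.1 hv)).2.1)
  refine f1.mono ?_
  rw [Finset.length_toList]
  have hsub : (base.verts.filter fun v => z₁.1 v ≠ ⊤ ∧ v.level = 0) ⊆
      (nearIn base h (Δ a) a).filter (fun v => v.level = 0) ∪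
        (nearIn base h (Δ a) a).image Vtx.par := by
    intro v hv
    obtain ⟨e1, e2, e3⟩ := Finset.mem_filter.1 hv
    obtain ⟨c, hc⟩ := exists_coe_of_ne_top e2
    obtain ⟨e4, e5 | ⟨-, u, hu, hp⟩⟩ := g3 v c hc
    · exact Finset.mem_union_left _ (Finset.mem_filter.2 ⟨Finset.mem_filter.2 ⟨e1,
        ((hopDist_anti (hopBound_le ht v)).trans e4).trans_lt (EReal.coe_lt_coe_iff.2 e5)⟩, e3⟩)
    · exact Finset.mem_union_right _ (Finset.mem_image.2 ⟨u, hu, hp⟩)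
  have h1 := (Finset.card_le_card hsub).trans (Finset.card_union_le _ _)
  have h2 := card_filter_level_succ (nearIn base h (Δ a) a) 0
  have h3 : ((nearIn base h (Δ a) a).image Vtx.par).card ≤ (nearIn base h (Δ a) a).card :=
    Finset.card_image_le
  have h4 : ((nearIn base h (Δ a) a).filter fun v => 0 ≤ v.level).card ≤
      (nearIn base h (Δ a) a).card := Finset.card_filter_le _ _
  rw [zero_add] at h2
  omega

/-- Since `NearOut` has no exception at level 0, no factor 2 arises. -/
theorem shortcutOut_spec (S : Site ψ V₀ V t Δ base) (ht : t + 1 ≤ h) (hs : Mid ψ V V t s) (a : α) :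
    LiveOut ψ V t a s (nearOut base h (Δ a) a).card (shortcutOut base t Δ s a) := by
  unfold shortcutOut
  dsimp only
  rw [range_reverse_foldl]
  set d₀ : Vtx α → WithTop ℝ := fun v =>
    if v ∈ base.uOut a (Δ a) then ((base.hopDist 1 (neg a) v).toReal : WithTop ℝ) else ⊤ with hd₀
  have hmem : ∀ v (c : ℝ), d₀ v = c → v ∈ V₀ ∧ ψ v - ψ (neg a) ≤ c ∧
      base.hopDist 1 (neg a) v = c ∧ c < -Δ a := by
    intro v c hc
    simp only [hd₀] at hc
    split_ifs at hc with hv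
    · have hc' : (base.hopDist 1 (neg a) v).toReal = c := by exact_mod_cast hc
      obtain ⟨h1, h2⟩ := Finset.mem_filter.1 hv
      obtain ⟨h3, h4⟩ := Frame.le_toReal (S.core.toFrame.le_hopDist (h := 1)) h2
      rw [hc'] at h3 h4
      rw [h4] at h2
      rw [S.verts] at h1
      exact ⟨h1, h3, h4, EReal.coe_lt_coe_iff.1 h2⟩
    · exact absurd hc (WithTop.top_ne_coe)
  have hF : FeasOut ψ V₀ a d₀ := fun v c hc => ⟨(hmem v c hc).1, (hmem v c hc).2.1⟩
  have hN : NearOut base t (Δ a) a d₀ := by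
    intro v c hc
    obtain ⟨h1, -, h2, h3⟩ := hmem v c hc
    -- The initial distances use one hop. Old vertices have a level below `t`, so `hopBound` is at
    -- least 1.
    refine ⟨(hopDist_anti ?_).trans h2.le, h3⟩
    have := S.lvl v h1
    unfold hopBound
    split_ifs <;> omega
  have h0 : LiveOut ψ V t a s 0 s := ⟨hs, fun b => le_rfl, fun b => Nat.le_add_right _ _⟩
  obtain ⟨g1, g2, g3⟩ := levelsOut S ht t 1 le_rfl (d₀, s) h0 hF hN
  set z₁ := (List.range' 1 t).foldr (fun l z =>
        (base.verts.filter fun v => z.1 v ≠ ⊤ ∧ v.level = l).toList.foldl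
          (processOut base t a (Δ a)) z) (d₀, s)
  obtain ⟨f1, -, -⟩ := foldl_processOut S (fun _ => True)
    (base.verts.filter fun v => z₁.1 v ≠ ⊤ ∧ v.level = 0).toList
    (fun _ _ _ _ _ _ _ _ _ => trivial) z₁ _ g1 g2 trivial
    (fun v hv => (Finset.mem_filter.1 (Finset.mem_toList.1 hv)).2.1)
  refine f1.mono ?_
  rw [Finset.length_toList]
  have hsub : (base.verts.filter fun v => z₁.1 v ≠ ⊤ ∧ v.level = 0) ⊆
      (nearOut base h (Δ a) a).filter (fun v => v.level = 0) := by
    intro v hv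
    obtain ⟨e1, e2, e3⟩ := Finset.mem_filter.1 hv
    obtain ⟨c, hc⟩ := exists_coe_of_ne_top e2
    obtain ⟨e4, e5⟩ := g3 v c hc
    exact Finset.mem_filter.2 ⟨Finset.mem_filter.2 ⟨e1,
        ((hopDist_anti (hopBound_le ht v)).trans e4).trans_lt (EReal.coe_lt_coe_iff.2 e5)⟩, e3⟩
  have h1 := Finset.card_le_card hsub
  have h2 := card_filter_level_succ (nearOut base h (Δ a) a) 0
  have h4 : ((nearOut base h (Δ a) a).filter fun v => 0 ≤ v.level).card ≤
      (nearOut base h (Δ a) a).card := Finset.card_filter_le _ _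
  rw [zero_add] at h2
  omega

/-- The invariant of the generation of shortcuts for the negative vertices of a list. -/
structure Live (ψ : Vtx α → ℝ) (V : Finset (Vtx α)) (t : ℕ) (s₀ : State α) (f g : α → ℕ)
    (s : State α) : Prop where
  mid : Mid ψ V V t s
  cIn : ∀ b, (hubIn t V s b).card ≤ (hubIn t V s₀ b).card + f b
  cOut : ∀ b, (hubOut t V s b).card ≤ (hubOut t V s₀ b).card + g b

theorem shortcutAt_spec (S : Site ψ V₀ V t Δ base) (ht : t + 1 ≤ h) (hs : Mid ψ V V t s) (a : α) :
    Live ψ V t s (fun b => if b = a then 2 * (nearIn base h (Δ a) a).card else 0)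
      (fun b => if b = a then (nearOut base h (Δ a) a).card else 0) (shortcutAt base t Δ s a) := by
  have h1 := shortcutIn_spec S ht hs a
  have h2 := shortcutOut_spec S ht h1.mid a
  have hhub := S.pot_hub a
  have e1 := S.core.toFrame.wt_eq (S.core.tight_bar a)
  set s₁ := shortcutOut base t Δ (shortcutIn base t Δ s a) a with hs₁
  let P : State α → Prop := Live ψ V t s
    (fun b => if b = a then 2 * (nearIn base h (Δ a) a).card else 0)
    (fun b => if b = a then (nearOut base h (Δ a) a).card else 0)
  have h3 : P s₁ := ⟨h2.mid, fun b => (h2.cIn b).trans (h1.cIn b),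
    fun b => (h2.cOut b).trans (Nat.add_le_add_right (h1.cOut b) _)⟩
  unfold shortcutAt
  rw [← hs₁]
  have h4 : P (if Δ a ≤ 0 then (base.aIn (neg a)).foldl
      (fun s v => addEdgeIn v (hub a t) (base.wt v (neg a) - Δ a) s) s₁ else s₁) := by
    split_ifs with hD
    · refine foldl_inv (P := P) _ (fun s' hs' v hv => ?_) _ h3
      obtain ⟨hvV, -, hf⟩ := S.toSetup.of_mem_aIn hv
      -- Together with `Δ a ≤ 0` this makes the actual weight of the new edge nonnegative, which is
      -- required besides feasibility.
      have h0 := wt_nonneg (mem_aIn.1 hv).2.2.1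
      have hW : 0 ≤ base.wt v (neg a) - Δ a + ψ v - ψ (hub a t) := by rw [hhub]; linarith
      refine ⟨hs'.mid.addEdgeIn (S.subset hvV) (S.hub_in a) hW (Or.inl (by linarith)),
        fun b => ?_, fun b => ?_⟩
      · exact (Finset.card_le_card (hubIn_addEdgeIn S hs'.mid hvV hW b).1).trans (hs'.cIn b)
      · exact (Finset.card_le_card (hubIn_addEdgeIn S hs'.mid hvV hW b).2).trans (hs'.cOut b)
    · exact h3
  dsimp only
  split_ifs at h4 ⊢ with hD
  all_goals first
    | exact h4
    | refine foldl_inv (P := P) _ (fun s' hs' v hv => ?_) _ h4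
      obtain ⟨hvV, -, hf⟩ := S.toSetup.of_mem_aOut hv
      have hW : 0 ≤ base.wt (neg a) (bar a) + Δ a + base.wt (bar a) v + ψ (hub a t) - ψ v := by
        rw [hhub, e1]; linarith
      refine ⟨hs'.mid.addEdgeOut (S.subset hvV) (S.hub_in a) hW, fun b => ?_, fun b => ?_⟩
      · exact (Finset.card_le_card (hubOut_addEdgeOut S hs'.mid hvV hW b).1).trans (hs'.cIn b)
      · exact (Finset.card_le_card (hubOut_addEdgeOut S hs'.mid hvV hW b).2).trans (hs'.cOut b)

/-- The list has no repetitions, so each N-Steiner vertex is charged only in the step of its own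
negative vertex. -/
theorem foldl_shortcutAt (S : Site ψ V₀ V t Δ base) (ht : t + 1 ≤ h) (L : List α) (hL : L.Nodup)
    (hs : Mid ψ V V t s) :
    Live ψ V t s (fun b => if b ∈ L then 2 * (nearIn base h (Δ b) b).card else 0)
      (fun b => if b ∈ L then (nearOut base h (Δ b) b).card else 0)
      (L.foldl (shortcutAt base t Δ) s) := by
  induction L generalizing s with
  | nil => exact ⟨hs, fun b => Nat.le_add_right _ _, fun b => Nat.le_add_right _ _⟩
  | cons a L ih =>
    rw [List.nodup_cons] at hL
    have h1 := shortcutAt_spec S ht hs a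
    have h2 := ih hL.2 h1.mid
    rw [List.foldl_cons]
    refine ⟨h2.mid, fun b => ?_, fun b => ?_⟩
    · have e1 := h1.cIn b
      have e2 := h2.cIn b
      by_cases hb : b = a
      · subst hb
        simp only [hL.1, if_false, if_true, List.mem_cons, true_or] at e1 e2 ⊢
        omega
      · simp only [hb, if_false, List.mem_cons, false_or] at e1 e2 ⊢
        omega
    · have e1 := h1.cOut b
      have e2 := h2.cOut b
      by_cases hb : b = a
      · subst hb
        simp only [hL.1, if_false, if_true, List.mem_cons, true_or] at e1 e2 ⊢
        omega
      · simp only [hb, if_false, List.mem_cons, false_or] at e1 e2 ⊢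
        omega

end

/-! ### Restoring the negative vertices -/

section

variable {s s' s₀ base : State α} {ψ φ : Vtx α → ℝ} {V V' V₀ : Finset (Vtx α)} {t h k l : ℕ}
  {Δ : α → ℝ} {D : ℝ} {a b : α} {x y p q u v : Vtx α} {X Y W dv : ℝ}

theorem coe_untopD {e : WithTop ℝ} (h : e ≠ ⊤) : ((e.untopD 0 : ℝ) : WithTop ℝ) = e := by
  lift e to ℝ using h with c
  rfl

/-- The potential that `restore` applies. -/
def restorePot (a : α) (i W o : ℝ) : Vtx α → ℝ := fun x =>
  if x = neg a then i else if x = bar a then W - o else 0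

/-- The minima defining the potential are finite, since the edge into r̄ exists and 0 is included in
the other one; so `untopD` loses nothing. Because edges join vertices of the graph, these numbers
bound all weights out of and into r. -/
theorem restore_eq (hC : Core ψ V s) (hE : Ends ψ V s) (hV : s.verts = V) (a : α) :
    ∃ W o i : ℝ, s.wt (neg a) (bar a) = W ∧ o ≤ W ∧ i ≤ 0 ∧
      (∀ y, (o : WithTop ℝ) ≤ s.w (neg a) y) ∧ (∀ x, (i : WithTop ℝ) ≤ s.w x (neg a)) ∧
      restore s a = (s.redirect a).reweight (restorePot a i W o) := by
  have hbar : s.w (neg a) (bar a) ≠ ⊤ := (hC.tight_bar a).ne_top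
  have h1 : s.verts.inf (fun v => s.w (neg a) v) ≤ s.w (neg a) (bar a) :=
    Finset.inf_le (by rw [hV]; exact hC.bar_mem a)
  have h2 := coe_untopD (ne_top_of_le_ne_top hbar h1)
  have h3 := coe_untopD (e := min 0 (s.verts.inf fun v => s.w v (neg a)))
    (ne_top_of_le_ne_top WithTop.zero_ne_top (min_le_left _ _))
  refine ⟨_, (s.verts.inf fun v => s.w (neg a) v).untopD 0,
    (min 0 (s.verts.inf fun v => s.w v (neg a))).untopD 0, rfl, ?_, ?_, ?_, ?_, rfl⟩
  · rw [← h2, ← State.coe_wt hbar] at h1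
    exact WithTop.coe_le_coe.1 h1
  · have := min_le_left 0 (s.verts.inf fun v => s.w v (neg a))
    rw [← h3] at this
    exact_mod_cast this
  · intro y
    rw [h2]
    by_cases hy : s.w (neg a) y = ⊤
    · rw [hy]; exact le_top
    · exact Finset.inf_le (by rw [hV]; exact (hE _ _ _ (State.link_wt ψ hy)).2)
  · intro x
    rw [h3]
    by_cases hx : s.w x (neg a) = ⊤
    · rw [hx]; exact le_top
    · exact (min_le_right _ _).trans
        (Finset.inf_le (f := fun v => s.w v (neg a))
          (by rw [hV]; exact (hE _ _ _ (State.link_wt ψ hx)).1))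

theorem restore_w_ne_top (hx : x ≠ neg a) (hx' : x ≠ bar a) :
    (restore s a).w x y ≠ ⊤ ↔ s.w x y ≠ ⊤ := by
  simp [restore, State.reweight, State.redirect, hx, hx']

theorem restore_w_neg : (restore s a).w (neg a) y ≠ ⊤ → y = bar a := by
  intro h
  by_contra hy
  simp [restore, State.reweight, State.redirect, hy] at h

theorem restore_w_bar : (restore s a).w (bar a) y ≠ ⊤ → s.w (bar a) y ≠ ⊤ ∨ s.w (neg a) y ≠ ⊤ := by
  intro h
  by_contra hc
  push Not at hc
  obtain ⟨h1, h2⟩ := hc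
  refine h ?_
  simp [restore, State.reweight, State.redirect, h1, h2]

theorem restore_w_of_ne (hx : x ≠ neg a) (hx' : x ≠ bar a) (hy : y ≠ neg a) (hy' : y ≠ bar a) :
    (restore s a).w x y = s.w x y := by
  simp [restore, State.reweight, State.redirect, hx, hx', hy, hy']

theorem restore_nonneg_neg {W o i : ℝ} (hi : ∀ x, (i : WithTop ℝ) ≤ s.w x (neg a))
    (hx : x ≠ neg a) (hx' : x ≠ bar a)
    (he : restore s a = (s.redirect a).reweight (restorePot a i W o)) :
    0 ≤ (restore s a).w x (neg a) := by
  rw [he]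
  simp only [State.reweight, State.redirect, restorePot, hx, hx', if_false, if_true, false_and]
  have := hi x
  generalize s.w x (neg a) = e at this ⊢
  induction e using WithTop.recTopCoe with
  | top => simp
  | coe c =>
    have h1 : i ≤ c := by exact_mod_cast this
    exact_mod_cast (by linarith : 0 ≤ c + (0 - i))

/-- An edge moved from r to r̄ changes by `-W` and then by `W - o`, and `o` is at most its weight.
An edge already at r̄ gains `W - o ≥ 0`. The potential at the other end is never positive. -/
theorem restore_nonneg_bar {W o i : ℝ} (hw : s.wt (neg a) (bar a) = W) (hoW : o ≤ W) (hi0 : i ≤ 0)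
    (ho : ∀ y, (o : WithTop ℝ) ≤ s.w (neg a) y)
    (he : restore s a = (s.redirect a).reweight (restorePot a i W o)) (hy : y ≠ bar a)
    (h : ((if y = neg a then i else 0 : ℝ) : WithTop ℝ) ≤ s.w (bar a) y) :
    0 ≤ (restore s a).w (bar a) y := by
  rw [he]
  simp only [State.reweight, State.redirect, restorePot, reduceCtorEq, if_false, if_true, true_and,
    hw, hy, ne_eq, not_false_eq_true]
  have h2 := ho y
  set j : ℝ := if y = neg a then i else 0 with hj
  have hj0 : j ≤ 0 := by rw [hj]; split_ifs <;> linarith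
  rcases min_choice (s.w (bar a) y) (s.w (neg a) y + ((-W : ℝ) : WithTop ℝ)) with h3 | h3
  · rw [h3]
    generalize s.w (bar a) y = e at h ⊢
    induction e using WithTop.recTopCoe with
    | top => simp
    | coe c =>
      have h1 : j ≤ c := by exact_mod_cast h
      exact_mod_cast (by linarith : 0 ≤ c + (W - o - j))
  · rw [h3]
    generalize s.w (neg a) y = e at h2 ⊢
    induction e using WithTop.recTopCoe with
    | top => simp
    | coe c =>
      have h1 : o ≤ c := by exact_mod_cast h2
      exact_mod_cast (by linarith : 0 ≤ c + -W + (W - o - j))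

/-- The invariant while the negative vertices are restored; `D` are those already treated, and
`s₁` is the graph before. -/
structure Restored (V : Finset (Vtx α)) (t : ℕ) (s₁ : State α) (D : α → Prop) (s : State α) :
    Prop where
  pot : ∃ ψ, Core ψ V s ∧ Ends ψ V s
  verts : s.verts = V
  neg_out : ∀ c, D c → ∀ y, s.w (neg c) y ≠ ⊤ → y = bar c
  neg_nn : ∀ c, D c → ∀ x, 0 ≤ s.w x (neg c)
  bar_nn : ∀ c y, (∀ a, y ≠ neg a) → (∀ a, y ≠ bar a) → 0 ≤ s.w (bar c) y
  inS_nn : ∀ p t l, inS p t l ∈ V → (∀ a, p ≠ neg a) → (∀ a, p ≠ bar a) → 0 ≤ s.w (inS p t l) p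
  outS_nn : ∀ p t l, outS p t l ∈ V → (∀ a, p ≠ neg a) → (∀ a, p ≠ bar a) →
    0 ≤ s.w p (outS p t l)
  new_in : ∀ p l y, s.w (inS p t l) y ≠ ⊤ → s₁.w (inS p t l) y ≠ ⊤
  new_out : ∀ p l y, s.w y (outS p t l) ≠ ⊤ → y = p ∨ ∃ a, y = hub a t
  hub_out : ∀ a y, s.w (hub a t) y ≠ ⊤ → s₁.w (hub a t) y ≠ ⊤

/-- Restoring `a` does not undo what was achieved for other negative vertices: the only new edges
into them start in r̄ of `a` and are nonnegative by `restore_nonneg_bar`. -/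
theorem Restored.step {s₁ : State α} {P : α → Prop} (R : Restored V t s₁ P s) (a : α) :
    Restored V t s₁ (fun c => c = a ∨ P c) (restore s a) := by
  obtain ⟨ψ, hC, hE⟩ := R.pot
  obtain ⟨W, o, i, hW, hoW, hi0, ho, hi, he⟩ := restore_eq hC hE R.verts a
  refine ⟨⟨fun v => ψ v - restorePot a i W o v, ?_, ?_⟩, R.verts, ?_, ?_, ?_, ?_, ?_, ?_, ?_, ?_⟩
  · rw [he]; exact (hC.redirect a).reweight _
  · rw [he]; exact (hE.redirect hC.toFrame a).reweight _
  · intro c hc y hy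
    by_cases hca : c = a
    · subst hca; exact restore_w_neg hy
    · exact R.neg_out c (hc.resolve_left hca) y ((restore_w_ne_top (by simpa using hca)
        (by simp)).1 hy)
  · intro c hc x
    by_cases hxn : x = neg a
    · subst hxn
      by_contra hlt
      have := restore_w_neg (s := s) (a := a) (y := neg c) fun e => by
        rw [e] at hlt; exact hlt le_top
      simp at this
    by_cases hxb : x = bar a
    · subst hxb
      refine restore_nonneg_bar hW hoW hi0 ho he (by simp) ?_
      split_ifs with hca
      · rw [hca]; exact hi _
      · exact R.neg_nn c (hc.resolve_left fun h => hca (by rw [h])) _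
    by_cases hca : c = a
    · subst hca; exact restore_nonneg_neg hi hxn hxb he
    · rw [restore_w_of_ne hxn hxb (by simpa using hca) (by simp)]
      exact R.neg_nn c (hc.resolve_left hca) x
  · intro c y hy hy'
    by_cases hca : c = a
    · subst hca
      refine restore_nonneg_bar hW hoW hi0 ho he (hy' c) ?_
      rw [if_neg (hy c)]
      exact R.bar_nn c y hy hy'
    · rw [restore_w_of_ne (by simp) (by simpa using hca) (hy a) (hy' a)]
      exact R.bar_nn c y hy hy'
  · intro p t' l h hp hp'
    rw [restore_w_of_ne (by simp) (by simp) (hp a) (hp' a)]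
    exact R.inS_nn p t' l h hp hp'
  · intro p t' l h hp hp'
    rw [restore_w_of_ne (hp a) (hp' a) (by simp) (by simp)]
    exact R.outS_nn p t' l h hp hp'
  · intro p l y hy
    exact R.new_in p l y ((restore_w_ne_top (by simp) (by simp)).1 hy)
  · intro p l y hy
    by_cases hyn : y = neg a
    · subst hyn
      have := restore_w_neg hy
      simp at this
    by_cases hyb : y = bar a
    · subst hyb
      rcases restore_w_bar hy with h1 | h1
      · exact R.new_out p l _ h1
      -- A redirected edge into a new out-Steiner vertex would come from a negative vertex, which is
      -- neither an out-parent nor an N-Steiner vertex. So no in-neighbour is gained.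
      · rcases R.new_out p l _ h1 with h2 | ⟨b, h2⟩
        · subst h2
          exact absurd rfl ((hC.outS_mem (hE _ _ _ (State.link_wt ψ h1)).2).2.2.2 a)
        · simp at h2
    · exact R.new_out p l y ((restore_w_ne_top hyn hyb).1 hy)
  · intro b y hy
    exact R.hub_out b y ((restore_w_ne_top (by simp) (by simp)).1 hy)

theorem Restored.foldl {s₁ : State α} {P : α → Prop} (L : List α) (R : Restored V t s₁ P s) :
    Restored V t s₁ (fun c => c ∈ L ∨ P c) (L.foldl restore s) := by
  induction L generalizing s P with
  | nil => simpa using R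
  | cons a L ih =>
    have := ih (R.step a)
    rw [List.foldl_cons]
    convert this using 2 with c
    rw [List.mem_cons]; tauto

theorem Mid.restored (M : Mid ψ V V t s) : Restored V t s (fun _ => False) s where
  pot := ⟨ψ, M.core, M.ends⟩
  verts := M.verts
  neg_out _ h := h.elim
  neg_nn _ h := h.elim
  bar_nn c y h1 h2 := State.nonneg_iff.2 fun X hX => M.bar_nn c y X hX h1 h2
  inS_nn p t l h _ hp := by
    rw [M.core.toFrame.w_eq (M.core.tight_inS h)]
    exact_mod_cast M.sgn.inS p t l h hp
  outS_nn p t l h _ _ := by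
    rw [M.core.toFrame.w_eq (M.core.tight_outS h)]
    exact_mod_cast M.sgn.outS p t l h
  new_in _ _ _ h := h
  new_out p l y h := M.new_out p l y _ (State.link_wt ψ h)
  hub_out _ _ h := h

theorem Restored.stable {s₁ : State α} (R : Restored V t s₁ (fun _ => True) s) : Stable V s where
  neg_out a := R.neg_out a trivial
  nn_neg x a := R.neg_nn a trivial x
  nn_bar c y hy := by
    by_cases hn : ∃ a, y = neg a
    · obtain ⟨a, rfl⟩ := hn
      exact R.neg_nn a trivial _
    · exact R.bar_nn c y (fun a ha => hn ⟨a, ha⟩) hy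
  nn_inS p t l h hp := by
    by_cases hn : ∃ a, p = neg a
    · obtain ⟨a, rfl⟩ := hn
      exact R.neg_nn a trivial _
    · exact R.inS_nn p t l h (fun a ha => hn ⟨a, ha⟩) hp
  nn_outS p t l h := by
    obtain ⟨ψ, hC, hE⟩ := R.pot
    have hn := (hC.outS_mem h).2.2.2
    by_cases hb : ∃ a, p = bar a
    · obtain ⟨a, rfl⟩ := hb
      exact R.bar_nn a _ (by simp) (by simp)
    · exact R.outS_nn p t l h hn fun a ha => hb ⟨a, ha⟩

/-! ### The graph after an iteration -/

/-- The invariant of the graphs between iterations; all levels are at most `t`. -/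
structure Between (t : ℕ) (s : State α) : Prop where
  pot : ∃ ψ, Core ψ s.verts s ∧ Ends ψ s.verts s
  stable : Stable s.verts s
  heavy : s.heavy ⊆ s.verts
  lvl : ∀ v ∈ s.verts, v.level ≤ t

/-- Counts the pairs of a vertex `x` in `F` and an index `b` with `x ∈ c b` in both orders. -/
theorem double_count [Fintype α] {F : Finset (Vtx α)} {c : α → Finset (Vtx α)} {lam : ℝ}
    (h : ∀ x ∈ F, lam ≤ ((Finset.univ.filter fun b => x ∈ c b).card : ℝ)) :
    lam * F.card ≤ ∑ b, ((c b).card : ℝ) := by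
  calc lam * F.card = ∑ x ∈ F, lam := by rw [Finset.sum_const, nsmul_eq_mul, mul_comm]
    _ ≤ ∑ x ∈ F, ((Finset.univ.filter fun b => x ∈ c b).card : ℝ) := Finset.sum_le_sum h
    _ = ∑ x ∈ F, ∑ b, if x ∈ c b then (1 : ℝ) else 0 := by
        refine Finset.sum_congr rfl fun x _ => ?_
        rw [Finset.card_filter]; push_cast; rfl
    _ = ∑ b, ∑ x ∈ F, if x ∈ c b then (1 : ℝ) else 0 := Finset.sum_comm
    _ ≤ ∑ b, ((c b).card : ℝ) := by
        refine Finset.sum_le_sum fun b _ => ?_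
        rw [← Finset.sum_filter, Finset.sum_const, nsmul_eq_mul, mul_one]
        exact_mod_cast Finset.card_le_card fun x hx => (Finset.mem_filter.1 hx).2

/-- A new heavy vertex is an N-Steiner vertex or a Steiner vertex with at least `lam` edges to or
from new N-Steiner vertices. The number of these edges is bounded by the number of processed
vertices. -/
theorem finish_spec [Fintype α] (hC : Core ψ base.verts base) (hE : Ends ψ base.verts base)
    (hst : Stable base.verts base) (hh : base.heavy ⊆ base.verts)
    (hl : ∀ v ∈ base.verts, v.level < t) (h1t : 1 ≤ t) (hth : t + 1 ≤ h) {lam : ℝ} (hlam : 0 ≤ lam)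
    (Δ : α → ℝ) :
    Between t (finish t lam Δ base) ∧
      lam * (((finish t lam Δ base).heavy.card : ℝ) - base.heavy.card - Fintype.card α) ≤
        ∑ a, (2 * ((nearIn base h (Δ a) a).card : ℝ) + (nearOut base h (Δ a) a).card) := by
  have S := Setup.of_core (Δ := Δ) hC hE hst rfl hh hl
  set ψ₀ := newPot base ψ t Δ
  obtain ⟨⟨V, M, hV, -⟩, g1, g2⟩ := prepared_spec S h1t
  have hVeq : V = base.verts ∪ newSteiner base t ∪ Finset.univ.image fun a => hub a t := by
    rw [← M.verts, prepared_verts]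
  have T : Site ψ₀ base.verts V t Δ base := by
    refine ⟨S, hV, fun a => ?_, fun v hv l hl => ?_, fun v hv l hl => ?_⟩
    · rw [hVeq]; simp
    · rw [hVeq]
      refine Finset.mem_union_left _ (Finset.mem_union_right _ (Finset.mem_union_left _ ?_))
      exact Finset.mem_biUnion.2 ⟨v, hv, Finset.mem_image.2 ⟨l, Finset.mem_range.2 hl, rfl⟩⟩
    · rw [hVeq]
      refine Finset.mem_union_left _ (Finset.mem_union_right _ (Finset.mem_union_right _ ?_))
      exact Finset.mem_biUnion.2 ⟨v, hv, Finset.mem_image.2 ⟨l, Finset.mem_range.2 hl, rfl⟩⟩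
  have L := foldl_shortcutAt T hth (Finset.univ : Finset α).toList (Finset.nodup_toList _) M
  set s₁ := (Finset.univ : Finset α).toList.foldl (shortcutAt base t Δ) (prepared t Δ base) with hs₁
  have hin : ∀ b, (hubIn t V s₁ b).card ≤ 2 * (nearIn base h (Δ b) b).card := by
    intro b
    have e : hubIn t V (prepared t Δ base) b = ∅ := by
      rw [hubIn, Finset.filter_eq_empty_iff]
      rintro x - ⟨-, h2, h3⟩
      rw [g1 x b h3] at h2
      exact h2 rfl
    simpa [e] using L.cIn b
  have hout : ∀ b, (hubOut t V s₁ b).card ≤ (nearOut base h (Δ b) b).card := by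
    intro b
    have e : hubOut t V (prepared t Δ base) b = ∅ := by
      rw [hubOut, Finset.filter_eq_empty_iff]
      rintro x - ⟨-, h2, h3⟩
      rw [g2 x b h3] at h2
      exact h2 rfl
    simpa [e] using L.cOut b
  have R0 := L.mid.restored.foldl (Finset.univ : Finset α).toList
  set s₂ := (Finset.univ : Finset α).toList.foldl restore s₁ with hs₂
  have R : Restored V t s₁ (fun _ => True) s₂ := by
    convert R0 using 2 with c
    simp
  have hs₁h : s₂.heavy = base.heavy ∪ Finset.univ.image fun a => hub a t := by
    rw [hs₂, foldl_eq (F := State.heavy) restore_heavy, hs₁, foldl_eq (F := State.heavy)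
      (shortcutAt_eq State.heavy addEdgeIn_heavy addEdgeOut_heavy _ _ _), prepared_heavy]
  have hfin : finish t lam Δ base = classify t lam s₂ := finish_eq t lam Δ base
  have hfv : (finish t lam Δ base).verts = V := by rw [hfin]; exact R.verts
  constructor
  · obtain ⟨ψ', hC', hE'⟩ := R.pot
    refine ⟨⟨ψ', ?_, ?_⟩, ?_, finish_heavy_subset t lam Δ base hh, ?_⟩
    · rw [hfv, hfin]; exact hC'.of_w_eq rfl rfl rfl
    · rw [hfv, hfin]; exact hE'
    · rw [hfv, hfin]
      have := R.stable
      exact ⟨this.neg_out, this.nn_neg, this.nn_bar, this.nn_inS, this.nn_outS⟩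
    · rw [hfv]; exact M.lvl
  set FI := s₂.verts.filter fun v => v.level = t ∧ v.inParent ≠ none ∧
    lam ≤ ((s₂.verts.filter fun u => s₂.w v u ≠ ⊤).card : ℝ) - 1 with hFI
  set FO := s₂.verts.filter fun v => v.level = t ∧ v.outParent ≠ none ∧
    lam ≤ ((s₂.verts.filter fun u => s₂.w u v ≠ ⊤).card : ℝ) - 1 with hFO
  have hheavy : (finish t lam Δ base).heavy ⊆
      base.heavy ∪ (Finset.univ.image fun a => hub a t) ∪ FI ∪ FO := by
    rw [hfin]
    intro x hx
    rcases Finset.mem_union.1 hx with hx | hx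
    · rw [hs₁h] at hx
      exact Finset.mem_union_left _ (Finset.mem_union_left _ hx)
    · obtain ⟨e1, e2, e3 | e3⟩ := Finset.mem_filter.1 hx
      · exact Finset.mem_union_left _ (Finset.mem_union_right _ (Finset.mem_filter.2 ⟨e1, e2, e3⟩))
      · exact Finset.mem_union_right _ (Finset.mem_filter.2 ⟨e1, e2, e3⟩)
  have hFIc : lam * FI.card ≤ ∑ b, ((hubIn t V s₁ b).card : ℝ) := by
    refine double_count fun x hx => ?_
    obtain ⟨e1, e2, e3, e4⟩ := Finset.mem_filter.1 hx
    rw [R.verts] at e1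
    obtain ⟨p, hp⟩ := Option.ne_none_iff_exists'.1 e3
    obtain ⟨t', l, rfl⟩ := eq_of_inParent hp
    obtain rfl : t' = t := e2
    -- The parent is the only out-neighbour that is not a new N-Steiner vertex; the classification
    -- subtracts one from the degree for it.
    have hsub : (s₂.verts.filter fun u => s₂.w (inS p t' l) u ≠ ⊤) ⊆ insert p
        ((Finset.univ.filter fun b => inS p t' l ∈ hubIn t' V s₁ b).image fun b => hub b t') := by
      intro y hy
      have hy' := R.new_in p l y (Finset.mem_filter.1 hy).2
      rcases L.mid.new_in p l y _ (State.link_wt ψ₀ hy') with rfl | ⟨b, rfl⟩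
      · exact Finset.mem_insert_self _ _
      · refine Finset.mem_insert_of_mem (Finset.mem_image.2 ⟨b, Finset.mem_filter.2
          ⟨Finset.mem_univ _, Finset.mem_filter.2 ⟨e1, rfl, e3, hy'⟩⟩, rfl⟩)
    have h1 := (Finset.card_le_card hsub).trans (Finset.card_insert_le _ _)
    have h2 := h1.trans (Nat.add_le_add_right Finset.card_image_le 1)
    have h3 : ((s₂.verts.filter fun u => s₂.w (inS p t' l) u ≠ ⊤).card : ℝ) ≤
      ((Finset.univ.filter fun b => inS p t' l ∈ hubIn t' V s₁ b).card : ℝ) + 1 := by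
      exact_mod_cast h2
    linarith
  have hFOc : lam * FO.card ≤ ∑ b, ((hubOut t V s₁ b).card : ℝ) := by
    refine double_count fun x hx => ?_
    obtain ⟨e1, e2, e3, e4⟩ := Finset.mem_filter.1 hx
    rw [R.verts] at e1
    obtain ⟨p, hp⟩ := Option.ne_none_iff_exists'.1 e3
    obtain ⟨t', l, rfl⟩ := eq_of_outParent hp
    obtain rfl : t' = t := e2
    have hsub : (s₂.verts.filter fun u => s₂.w u (outS p t' l) ≠ ⊤) ⊆ insert p
        ((Finset.univ.filter fun b => outS p t' l ∈ hubOut t' V s₁ b).image fun b => hub b t') := by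
      intro y hy
      have hy0 := (Finset.mem_filter.1 hy).2
      rcases R.new_out p l y hy0 with rfl | ⟨b, rfl⟩
      · exact Finset.mem_insert_self _ _
      · refine Finset.mem_insert_of_mem (Finset.mem_image.2 ⟨b, Finset.mem_filter.2
          ⟨Finset.mem_univ _, Finset.mem_filter.2 ⟨e1, rfl, e3, R.hub_out b _ hy0⟩⟩, rfl⟩)
    have h1 := (Finset.card_le_card hsub).trans (Finset.card_insert_le _ _)
    have h2 := h1.trans (Nat.add_le_add_right Finset.card_image_le 1)
    have h3 : ((s₂.verts.filter fun u => s₂.w u (outS p t' l) ≠ ⊤).card : ℝ) ≤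
      ((Finset.univ.filter fun b => outS p t' l ∈ hubOut t' V s₁ b).card : ℝ) + 1 := by
      exact_mod_cast h2
    linarith
  have c1 := Finset.card_le_card hheavy
  have c2 := Finset.card_union_le
    (base.heavy ∪ (Finset.univ.image fun a : α => hub a t) ∪ FI) FO
  have c3 := Finset.card_union_le (base.heavy ∪ (Finset.univ.image fun a : α => hub a t)) FI
  have c4 := Finset.card_union_le base.heavy (Finset.univ.image fun a : α => hub a t)
  have c5 : (Finset.univ.image fun a : α => hub a t).card ≤ Fintype.card α := Finset.card_image_le
  have c6 : ((finish t lam Δ base).heavy.card : ℝ) ≤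
      base.heavy.card + Fintype.card α + FI.card + FO.card := by
    exact_mod_cast by omega
  have c7 : ∑ b, ((hubIn t V s₁ b).card : ℝ) ≤
      ∑ b, 2 * ((nearIn base h (Δ b) b).card : ℝ) :=
    Finset.sum_le_sum fun b _ => by exact_mod_cast hin b
  have c8 : ∑ b, ((hubOut t V s₁ b).card : ℝ) ≤ ∑ b, ((nearOut base h (Δ b) b).card : ℝ) :=
    Finset.sum_le_sum fun b _ => by exact_mod_cast hout b
  rw [Finset.sum_add_distrib]
  have c9 : lam * (((finish t lam Δ base).heavy.card : ℝ) - base.heavy.card - Fintype.card α) ≤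
      lam * (FI.card + FO.card) := mul_le_mul_of_nonneg_left (by linarith) hlam
  linarith [mul_add lam (FI.card : ℝ) FO.card]

end

/-! ### The initial potential -/

/-- The weight of the walk that ends in `c` and visits, from its end to its start, the vertices of
the list. -/
def backWeight (H : α → α → WithTop ℝ) : α → List α → WithTop ℝ
  | _, [] => 0
  | c, b :: l => H b c + backWeight H b l

theorem backWeight_append (H : α → α → WithTop ℝ) (x c : α) (l₁ l₂ : List α) :
    backWeight H x (l₁ ++ c :: l₂) = backWeight H x (l₁ ++ [c]) + backWeight H c l₂ := by
  induction l₁ generalizing x with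
  | nil => simp [backWeight]
  | cons b l ih => simp only [List.cons_append, backWeight]; rw [ih, add_assoc]

/-- Brings a closed walk into the form in which `NoNegCycle` speaks about it. -/
theorem backWeight_eq_sum (H : α → α → WithTop ℝ) (x c : α) (l : List α) :
    backWeight H x (l ++ [c]) =
      (List.zipWith H (c :: l.reverse) (l.reverse ++ [x])).sum := by
  induction l generalizing x with
  | nil => simp [backWeight]
  | cons b l ih =>
    simp only [List.cons_append, backWeight]
    rw [ih, List.reverse_cons, ← List.cons_append, List.zipWith_append (by simp)]
    simp [add_comm]

/-- A graph without negative cycle has a feasible potential. -/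
theorem NoNegCycle.exists_potential [Fintype α] {H : α → α → WithTop ℝ} (hH : NoNegCycle H) :
    ∃ ψ : α → ℝ, ∀ a c, ((ψ c - ψ a : ℝ) : WithTop ℝ) ≤ H a c := by
  -- The potential of `c` is the least weight of a simple walk that ends in `c` and may start
  -- anywhere. There are finitely many simple walks, so the minimum is attained.
  have hex : ∀ c, ∃ l : List α, (c :: l).Nodup ∧
      ∀ l' : List α, (c :: l').Nodup → backWeight H c l ≤ backWeight H c l' := by
    intro c
    have hfin : {l : List α | (c :: l).Nodup}.Finite :=
      (List.finite_length_le α (Fintype.card α)).subset fun l hl =>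
        (List.nodup_cons.1 hl).2.length_le_card
    obtain ⟨l, h1, h2⟩ := Set.exists_min_image _ (backWeight H c) hfin ⟨[], by simp⟩
    exact ⟨l, h1, h2⟩
  choose L hL hmin using hex
  have hne : ∀ c, backWeight H c (L c) ≠ ⊤ := fun c =>
    ne_top_of_le_ne_top (by simp [backWeight]) (hmin c [] (by simp))
  have key : ∀ a c, backWeight H c (L c) ≤ H a c + backWeight H a (L a) := by
    intro a c
    -- If prolonging the optimal walk of `a` to `c` closes a cycle, the cycle is cut off; its weight
    -- is nonnegative.
    by_cases hc : c ∈ a :: L a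
    · obtain ⟨l₁, l₂, hl⟩ := List.append_of_mem hc
      have e : H a c + backWeight H a (L a) = backWeight H c (a :: L a) := rfl
      rw [e, hl, backWeight_append, backWeight_eq_sum]
      have h1 := hH c l₁.reverse
      have h2 : (c :: l₂).Nodup := by
        have := hL a
        rw [hl] at this
        exact this.of_append_right
      exact (hmin c l₂ h2).trans (le_add_of_nonneg_left h1)
    · exact hmin c (a :: L a) (List.nodup_cons.2 ⟨hc, hL a⟩)
  refine ⟨fun c => (backWeight H c (L c)).untopD 0, fun a c => ?_⟩
  dsimp only
  have h := key a c
  rw [← coe_untopD (hne a), ← coe_untopD (hne c)] at h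
  generalize (backWeight H c (L c)).untopD 0 = x at h ⊢
  generalize (backWeight H a (L a)).untopD 0 = y at h ⊢
  generalize H a c = e at h ⊢
  induction e using WithTop.recTopCoe with
  | top => exact le_top
  | coe r =>
    rw [← WithTop.coe_add, WithTop.coe_le_coe] at h
    exact WithTop.coe_le_coe.2 (by linarith)

theorem wMin_spec [Fintype α] (H : α → α → WithTop ℝ) (a : α) :
    wMin H a ≤ 0 ∧ ∀ c, ((wMin H a : ℝ) : WithTop ℝ) ≤ H a c := by
  have h1 := min_le_left 0 (Finset.univ.inf (H a))
  have h2 := coe_untopD (ne_top_of_le_ne_top WithTop.zero_ne_top h1)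
  constructor
  · rw [← h2] at h1
    exact_mod_cast h1
  · intro c
    rw [wMin, h2]
    exact (min_le_right _ _).trans (Finset.inf_le (Finset.mem_univ c))

theorem initState_card [Fintype α] (H : α → α → WithTop ℝ) :
    (initState H).verts.card = 2 * Fintype.card α := by
  unfold initState
  rw [Finset.card_union_of_disjoint, Finset.card_image_of_injective, Finset.card_image_of_injective,
    Finset.card_univ, two_mul]
  · exact fun a b h => by cases h; rfl
  · exact fun a b h => by cases h; rfl
  · rw [Finset.disjoint_left]
    intro x h1 h2
    obtain ⟨a, -, rfl⟩ := Finset.mem_image.1 h1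
    simp at h2

theorem initState_link_cases [Fintype α] {H : α → α → WithTop ℝ} {x y : Vtx α}
    (h : (initState H).w x y ≠ ⊤) :
    (∃ a, x = neg a ∧ y = bar a) ∨ ∃ a c, x = bar a ∧ y = neg c := by
  cases x <;> cases y <;> simp [initState] at h <;> aesop

/-- A feasible potential of `H`, taken at r and shifted by `wMin` at r̄, makes the edges between r
and r̄ tight in both directions, and the reduced weights of the edges of `H` are kept. -/
theorem initState_between [Fintype α] {H : α → α → WithTop ℝ} (hH : NoNegCycle H) :
    Between 0 (initState H) := by
  obtain ⟨ψ₀, hψ⟩ := hH.exists_potential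
  let ψ : Vtx α → ℝ := fun v => match v with
    | neg a => ψ₀ a
    | bar a => ψ₀ a + wMin H a
    | _ => 0
  have hn : ∀ a, neg a ∈ (initState H).verts := fun a => by simp [initState]
  have hb : ∀ a, bar a ∈ (initState H).verts := fun a => by simp [initState]
  have hmem : ∀ v ∈ (initState H).verts, (∃ a, v = neg a) ∨ ∃ a, v = bar a := by
    intro v hv
    simp only [initState, Finset.mem_union, Finset.mem_image, Finset.mem_univ, true_and] at hv
    rcases hv with ⟨a, rfl⟩ | ⟨a, rfl⟩
    · exact Or.inl ⟨a, rfl⟩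
    · exact Or.inr ⟨a, rfl⟩
  have w1 : ∀ a, (initState H).w (neg a) (bar a) = ((wMin H a : ℝ) : WithTop ℝ) := fun a => by
    simp [initState]
  have w2 : ∀ a c (X : ℝ), (initState H).w (bar a) (neg c) ≤ (X : WithTop ℝ) ↔
      ((a = c ∧ -wMin H a ≤ X) ∨ H a c ≤ ((X + wMin H a : ℝ) : WithTop ℝ)) := by
    intro a c X
    have e : H a c + ((-wMin H a : ℝ) : WithTop ℝ) ≤ (X : WithTop ℝ) ↔
        H a c ≤ ((X + wMin H a : ℝ) : WithTop ℝ) := by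
      generalize H a c = e
      induction e using WithTop.recTopCoe with
      | top => simp
      | coe r =>
        rw [← WithTop.coe_add, WithTop.coe_le_coe, WithTop.coe_le_coe]
        constructor <;> intro h <;> linarith
    simp only [initState, min_le_iff, e]
    refine or_congr ?_ Iff.rfl
    split_ifs with h
    · rw [WithTop.coe_le_coe]; simp [h]
    · simp [h]
  have w2' : ∀ a c, ∀ m : ℝ, m ≤ -wMin H a → ((m + wMin H a : ℝ) : WithTop ℝ) ≤ H a c →
      (m : WithTop ℝ) ≤ (initState H).w (bar a) (neg c) := by
    intro a c m h1 h2
    simp only [initState]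
    refine le_min ?_ ?_
    · split_ifs
      · exact_mod_cast h1
      · exact le_top
    · generalize H a c = e at h2 ⊢
      induction e using WithTop.recTopCoe with
      | top => simp
      | coe r =>
        rw [WithTop.coe_le_coe] at h2
        rw [← WithTop.coe_add, WithTop.coe_le_coe]
        linarith
  have hends : Ends ψ (initState H).verts (initState H) := by
    intro x y X hX
    rcases initState_link_cases hX.ne_top with ⟨a, rfl, rfl⟩ | ⟨a, c, rfl, rfl⟩
    · exact ⟨hn a, hb a⟩
    · exact ⟨hb a, hn c⟩
  have tneg : ∀ a, (initState H).Link ψ (bar a) (neg a) 0 := by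
    intro a
    rw [State.Link, w2]
    left
    refine ⟨rfl, ?_⟩
    simp only [ψ]; linarith
  have hfr : Frame ψ (initState H).verts (initState H) := by
    refine ⟨hn, hb, ?_, ?_, ?_, ?_, ?_, ?_, ?_, tneg, ?_, ?_⟩
    · intro p t l h; rcases hmem _ h with ⟨a, h⟩ | ⟨a, h⟩ <;> simp at h
    · intro p t l h; rcases hmem _ h with ⟨a, h⟩ | ⟨a, h⟩ <;> simp at h
    · intro p t h; rcases hmem _ h with ⟨a, h⟩ | ⟨a, h⟩ <;> simp at h
    · intro x y X hX
      rcases initState_link_cases hX.ne_top with ⟨a, rfl, rfl⟩ | ⟨a, c, rfl, rfl⟩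
      · rw [State.Link, w1, WithTop.coe_le_coe] at hX
        simp only [ψ] at hX; linarith
      · rw [State.Link, w2] at hX
        rcases hX with ⟨rfl, hX⟩ | hX
        · simp only [ψ] at hX; linarith
        · have := (hψ a c).trans hX
          rw [WithTop.coe_le_coe] at this
          simp only [ψ] at this; linarith
    · intro p t l h; rcases hmem _ h with ⟨a, h⟩ | ⟨a, h⟩ <;> simp at h
    · intro p t l h; rcases hmem _ h with ⟨a, h⟩ | ⟨a, h⟩ <;> simp at h
    · intro a
      rw [State.Link, w1, WithTop.coe_le_coe]
      simp only [ψ]; linarith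
    · intro y a hy ha
      rcases hmem _ hy with ⟨c, rfl⟩ | ⟨c, rfl⟩
      · simp only [rootIn, Option.some.injEq] at ha
        subst ha
        exact Or.inr ⟨c, rfl, tneg c⟩
      · simp [rootIn] at ha
    · intro y a hy ha
      rcases hmem _ hy with ⟨c, rfl⟩ | ⟨c, rfl⟩
      · simp only [rootOut, Option.some.injEq] at ha
        exact Or.inl (by rw [ha])
      · simp only [rootOut, Option.some.injEq] at ha
        subst ha
        exact Or.inr (tneg c)
  refine ⟨⟨ψ, ⟨hfr, ?_, by simp [initState], by simp [initState]⟩, hends⟩, ?_, subset_rfl, ?_⟩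
  · intro x y X hX
    rcases initState_link_cases hX.ne_top with ⟨a, rfl, rfl⟩ | ⟨a, c, rfl, rfl⟩ <;>
      exact EdgeOK.of_none rfl rfl rfl rfl
  · have hnn : ∀ a c, 0 ≤ (initState H).w (bar a) (neg c) := by
      intro a c
      have := wMin_spec H a
      exact_mod_cast w2' a c 0 (by linarith [this.1]) (by rw [zero_add]; exact this.2 c)
    have hz : ∀ x y, (∀ a, x = neg a → y ≠ bar a) → 0 ≤ (initState H).w x y := by
      intro x y hxy
      by_cases h : (initState H).w x y = ⊤
      · rw [h]; exact le_top
      · rcases initState_link_cases h with ⟨a, rfl, rfl⟩ | ⟨a, c, rfl, rfl⟩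
        · exact absurd rfl (hxy a rfl)
        · exact hnn a c
    refine ⟨fun a y h => ?_, fun x a => hz _ _ (by simp), fun c y _ => hz _ _ (by simp),
      fun p t l _ _ => hz _ _ (by simp), fun p t l _ => hz _ _ (by simp)⟩
    rcases initState_link_cases h with ⟨b, h1, rfl⟩ | ⟨b, c, h1, rfl⟩
    · cases h1; rfl
    · simp at h1
  · intro v hv
    rcases hmem _ hv with ⟨a, rfl⟩ | ⟨a, rfl⟩ <;> exact le_rfl

/-- The invariant provides a potential that makes all weights nonnegative. -/
theorem Between.exists_reduces [Fintype α] {t h : ℕ} {s : State α} {b : ℝ} (hs : Between t s)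
    (hb : 0 ≤ (Fintype.card α : ℝ) / b) : ∃ φ, Reduces h b s φ := by
  obtain ⟨ψ, hC, hE⟩ := hs.pot
  have hv : s.Valid ψ := by
    intro x y _
    rw [State.nonneg_iff (ψ := fun v => ψ v - ψ v)]
    intro X hX
    have := hC.feas (State.link_reweight.1 hX)
    simpa using this
  refine ⟨ψ, hv, fun x _ y _ => ?_⟩
  -- After reweighting by `ψ` the zero potential is feasible, also with the deferred edges put back.
  -- So no walk has negative weight and no pair has positive betweenness.
  have hF := (base_spec hC hE hs.stable hv).1.toFrame
  have h0 : ∀ x y, 0 ≤ (insertDeferred (s.reweight ψ)).hopDist h x y := by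
    intro x y
    have := hF.le_hopDist (x := x) (y := y) (h := h)
    simpa using this
  have : betweenness (insertDeferred (s.reweight ψ)) h x y = 0 := by
    rw [betweenness, Finset.card_eq_zero, Finset.filter_eq_empty_iff]
    intro a _ hlt
    exact absurd (add_nonneg (h0 x (neg a)) (h0 (neg a) y)) (not_le.2 hlt)
  rw [this]
  simpa using hb

/-! ### Events of random samples -/

/-- The union bound for a two-stage experiment: either the first stage is bad, or the second one
fails with probability at most `y`. The term `x` allows for a better bound than 1 when the first
stage is bad. -/
theorem toOuterMeasure_bind_le {β γ : Type*} (p : PMF β) (f : β → PMF γ) (s : Set γ)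
    (bad : Set β) (x y : ENNReal) (hx : ∀ a ∈ bad, (f a).toOuterMeasure s ≤ x + y)
    (hy : ∀ a ∉ bad, (f a).toOuterMeasure s ≤ y) :
    (p.bind f).toOuterMeasure s ≤ p.toOuterMeasure bad * x + y := by
  rw [PMF.toOuterMeasure_bind_apply, PMF.toOuterMeasure_apply]
  calc ∑' a, p a * (f a).toOuterMeasure s
      ≤ ∑' a, (bad.indicator p a * x + p a * y) := by
        refine ENNReal.tsum_le_tsum fun a => ?_
        by_cases h : a ∈ bad
        · rw [Set.indicator_of_mem h, ← mul_add]
          exact mul_le_mul_right (hx a h) _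
        · rw [Set.indicator_of_notMem h, zero_mul, zero_add]
          exact mul_le_mul_right (hy a h) _
    _ = _ := by
        rw [ENNReal.tsum_add, ENNReal.tsum_mul_right, ENNReal.tsum_mul_right, PMF.tsum_coe, one_mul]

theorem toOuterMeasure_le_one {β : Type*} (p : PMF β) (s : Set β) : p.toOuterMeasure s ≤ 1 := by
  rw [PMF.toOuterMeasure_apply, ← p.tsum_coe]
  exact ENNReal.tsum_le_tsum fun a => Set.indicator_le_self _ _ a

theorem coin_apply_singleton (l : ℕ) (c : Bool) : (coin l).toOuterMeasure {c} = coin l c :=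
  PMF.toOuterMeasure_apply_singleton _ _

/-- The probability that a random subset misses all elements of `T`. -/
theorem sampleSubset_miss (l : ℕ) (vs : List (Vtx α)) (T : Set (Vtx α)) :
    (sampleSubset l vs).toOuterMeasure {S | ∀ u ∈ S, u ∉ T} ≤
      (1 - (2⁻¹ : ENNReal) ^ l) ^ vs.countP (fun u => decide (u ∈ T)) := by
  induction vs with
  | nil => simpa using toOuterMeasure_le_one _ _
  | cons v vs ih =>
    rw [sampleSubset]
    by_cases hv : v ∈ T
    · have h := toOuterMeasure_bind_le (coin l) (fun c =>
        (sampleSubset l vs).map fun S => if c then insert v S else S) {S | ∀ u ∈ S, u ∉ T} {false}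
        ((1 - (2⁻¹ : ENNReal) ^ l) ^ vs.countP (fun u => decide (u ∈ T))) 0 ?_ ?_
      · refine h.trans ?_
        rw [add_zero, coin_apply_singleton, List.countP_cons_of_pos (by simpa using hv), pow_succ',
          coin, PMF.ofFintype_apply]
        exact le_rfl
      · rintro c rfl
        rw [add_zero, PMF.toOuterMeasure_map_apply]
        simpa using ih
      · rintro (_ | _) hc
        · simp at hc
        · rw [PMF.toOuterMeasure_map_apply]
          have : ((fun S : Finset (Vtx α) => if true = true then insert v S else S) ⁻¹'
              {S | ∀ u ∈ S, u ∉ T}) = ∅ := by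
            ext S
            simp [hv]
          rw [this]; simp
    · have h := toOuterMeasure_bind_le (coin l) (fun c =>
        (sampleSubset l vs).map fun S => if c then insert v S else S) {S | ∀ u ∈ S, u ∉ T} ∅
        0 ((1 - (2⁻¹ : ENNReal) ^ l) ^ vs.countP (fun u => decide (u ∈ T))) (by simp) ?_
      · refine h.trans ?_
        rw [mul_zero, zero_add, List.countP_cons_of_neg (by simpa using hv)]
      · intro c _
        rw [PMF.toOuterMeasure_map_apply]
        refine le_trans (MeasureTheory.measure_mono ?_) ih
        intro S hS u hu
        refine hS u ?_
        split_ifs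
        · exact Finset.mem_insert_of_mem hu
        · exact hu

/-- The probability that a random subset hits `T`. -/
theorem sampleSubset_hit (l : ℕ) (vs : List (Vtx α)) (T : Set (Vtx α)) :
    (sampleSubset l vs).toOuterMeasure {S | ∃ u ∈ S, u ∈ T} ≤
      vs.countP (fun u => decide (u ∈ T)) * (2⁻¹ : ENNReal) ^ l := by
  induction vs with
  | nil => simp [sampleSubset, PMF.toOuterMeasure_pure_apply]
  | cons v vs ih =>
    rw [sampleSubset]
    by_cases hv : v ∈ T
    · have h := toOuterMeasure_bind_le (coin l) (fun c =>
        (sampleSubset l vs).map fun S => if c then insert v S else S) {S | ∃ u ∈ S, u ∈ T} {true}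
        1 (vs.countP (fun u => decide (u ∈ T)) * (2⁻¹ : ENNReal) ^ l) ?_ ?_
      · refine h.trans ?_
        rw [mul_one, coin_apply_singleton, List.countP_cons_of_pos (by simpa using hv), coin,
          PMF.ofFintype_apply, Nat.cast_add, add_mul, Nat.cast_one, one_mul, add_comm]
        exact le_rfl
      · rintro c -
        exact (toOuterMeasure_le_one _ _).trans le_self_add
      · rintro (_ | _) hc
        · rw [PMF.toOuterMeasure_map_apply]
          simpa using ih
        · simp at hc
    · have h := toOuterMeasure_bind_le (coin l) (fun c =>
        (sampleSubset l vs).map fun S => if c then insert v S else S) {S | ∃ u ∈ S, u ∈ T} ∅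
        0 (vs.countP (fun u => decide (u ∈ T)) * (2⁻¹ : ENNReal) ^ l) (by simp) ?_
      · refine h.trans ?_
        rw [mul_zero, zero_add, List.countP_cons_of_neg (by simpa using hv)]
      · intro c _
        rw [PMF.toOuterMeasure_map_apply]
        refine le_trans (MeasureTheory.measure_mono ?_) ih
        rintro S ⟨u, hu, hT⟩
        refine ⟨u, ?_, hT⟩
        dsimp only at hu
        split_ifs at hu
        · rcases Finset.mem_insert.1 hu with rfl | hu
          · exact absurd hT hv
          · exact hu
        · exact hu

/-- With `p = 2 ^ (-l)` and at least `4 / p` trials the probability is at most `exp (-4)`, which is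
below 1/16. -/
theorem one_sub_half_pow_le (l N : ℕ) (hN : 4 * 2 ^ l ≤ N) :
    (1 - (2⁻¹ : ENNReal) ^ l) ^ N ≤ 16⁻¹ := by
  have h0 : (0 : ℝ) ≤ 1 - (2⁻¹ : ℝ) ^ l := sub_nonneg.2 (pow_le_one₀ (by norm_num) (by norm_num))
  have e : (1 - (2⁻¹ : ENNReal) ^ l) = ENNReal.ofReal (1 - (2⁻¹ : ℝ) ^ l) := by
    rw [ENNReal.ofReal_sub _ (by positivity), ENNReal.ofReal_one, ENNReal.ofReal_pow (by norm_num),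
      ENNReal.ofReal_inv_of_pos (by norm_num)]
    norm_num
  have h16 : (16⁻¹ : ENNReal) = ENNReal.ofReal (16⁻¹ : ℝ) := by
    rw [ENNReal.ofReal_inv_of_pos (by norm_num)]; norm_num
  rw [e, ← ENNReal.ofReal_pow h0, h16]
  refine ENNReal.ofReal_le_ofReal ?_
  have h1 : (1 - (2⁻¹ : ℝ) ^ l) ^ (4 * 2 ^ l) ≤ 16⁻¹ := by
    have h2 : (1 - (2⁻¹ : ℝ) ^ l) ≤ Real.exp (-(2⁻¹ : ℝ) ^ l) := Real.one_sub_le_exp_neg _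
    calc (1 - (2⁻¹ : ℝ) ^ l) ^ (4 * 2 ^ l) ≤ Real.exp (-(2⁻¹ : ℝ) ^ l) ^ (4 * 2 ^ l) :=
          pow_le_pow_left₀ h0 h2 _
      _ = Real.exp (-4) := by
          rw [← Real.exp_nat_mul]
          congr 1
          push_cast
          rw [inv_pow]
          field_simp
      _ ≤ 16⁻¹ := by
          rw [Real.exp_neg]
          refine inv_anti₀ (by norm_num) ?_
          have := Real.add_one_le_exp (1 : ℝ)
          calc (16 : ℝ) = (1 + 1) ^ 4 := by norm_num
            _ ≤ Real.exp 1 ^ 4 := pow_le_pow_left₀ (by norm_num) this _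
            _ = Real.exp 4 := by rw [← Real.exp_nat_mul]; norm_num
  exact (pow_le_pow_of_le_one h0 (by have : (0:ℝ) ≤ 2⁻¹ ^ l := by positivity
                                     linarith) hN).trans h1

/-- Many of `k` independent trials are bad with small probability only. -/
theorem sampleTrials_countP (l : ℕ) (vs : List (Vtx α)) (bad : Finset (Vtx α) → Prop)
    (hbad : (sampleSubset l vs).toOuterMeasure {S | bad S} ≤ 16⁻¹) (k j : ℕ) :
    (sampleTrials l vs k).toOuterMeasure
      {Ss | Ss.length ≠ k ∨ j ≤ Ss.countP fun S => decide (bad S)} ≤ 2 ^ k * (16⁻¹) ^ j := by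
  induction k generalizing j with
  | zero =>
    rw [sampleTrials, PMF.toOuterMeasure_pure_apply]
    rcases j with _ | j <;> simp
  | succ k ih =>
    rcases j with _ | j
    · refine (toOuterMeasure_le_one _ _).trans ?_
      rw [pow_zero, mul_one]
      exact one_le_pow₀ (by norm_num)
    · rw [sampleTrials]
      -- A bad first trial, of probability at most 1/16, leaves `j` bad ones to be found, a good one
      -- leaves `j + 1`. Both contributions are at most half of the claimed bound.
      refine (toOuterMeasure_bind_le _ _ _ {S | bad S} (2 ^ k * 16⁻¹ ^ j)
        (2 ^ k * 16⁻¹ ^ (j + 1)) ?_ ?_).trans ?_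
      · intro S hS
        rw [PMF.toOuterMeasure_map_apply]
        refine le_trans ?_ le_self_add
        refine le_trans (MeasureTheory.measure_mono ?_) (ih j)
        intro Ss hSs
        have hb : bad S := hS
        simpa [List.countP_cons, hb] using hSs
      · intro S hS
        rw [PMF.toOuterMeasure_map_apply]
        refine le_trans (MeasureTheory.measure_mono ?_) (ih (j + 1))
        intro Ss hSs
        have hb : ¬ bad S := hS
        simpa [List.countP_cons, hb] using hSs
      · refine (add_le_add_left (mul_le_mul_left hbad _) _).trans ?_
        rw [pow_succ, pow_succ]
        apply le_of_eq
        ring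

/-- With `j` at least half of the trials, the factor `2 ^ k` is outweighed by `16 ^ (-j) ≤ 4 ^
(-k)`. This is the reason for the probability 1/16 per trial. -/
theorem two_pow_mul_inv_pow_le (k j : ℕ) (h : k ≤ 2 * j) :
    (2 : ENNReal) ^ k * (16⁻¹) ^ j ≤ 2⁻¹ ^ k := by
  have h16 : (16⁻¹ : ENNReal) = (2⁻¹) ^ 4 := by
    rw [← ENNReal.inv_pow]; norm_num
  have h1 : (16⁻¹ : ENNReal) ^ j ≤ 2⁻¹ ^ (k + k) := by
    rw [h16, ← pow_mul]
    exact pow_le_pow_of_le_one zero_le (by simp) (by omega)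
  calc (2 : ENNReal) ^ k * (16⁻¹) ^ j ≤ 2 ^ k * 2⁻¹ ^ (k + k) := mul_le_mul_right h1 _
    _ = (2 * 2⁻¹) ^ k * 2⁻¹ ^ k := by rw [mul_pow, pow_add, mul_assoc]
    _ = 2⁻¹ ^ k := by rw [ENNReal.mul_inv_cancel (by norm_num) (by norm_num)]; simp

/-! ### Medians -/

/-- In the sorted list the entry at position `length / 2` has at least half of the entries on either
side, itself included. -/
theorem median_countP (L : List ExtDist) (hL : L ≠ []) :
    L.length ≤ 2 * L.countP (fun x => decide (x ≤ median L)) ∧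
      L.length ≤ 2 * L.countP (fun x => decide (median L ≤ x)) := by
  set M := L.mergeSort fun x y => decide (x ≤ y) with hM
  have hp : M.Perm L := List.mergeSort_perm _ _
  have hs : M.Pairwise (· ≤ ·) := by
    have := List.pairwise_mergeSort (le := fun x y : ExtDist => decide (x ≤ y))
      (fun a b c h1 h2 => by simp only [decide_eq_true_eq] at *; exact h1.trans h2)
      (fun a b => by simpa using le_total a b) L
    simpa using this
  have hlen : M.length = L.length := hp.length_eq
  have hpos : 0 < L.length := List.length_pos_iff.2 hL
  have hlt : L.length / 2 < M.length := by rw [hlen]; omega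
  have hmed : median L = M[L.length / 2] := by
    rw [median, ← hM, List.getD_eq_getElem _ _ hlt]
  have hmono : ∀ i j (hi : i < M.length) (hj : j < M.length), i ≤ j → M[i] ≤ M[j] := by
    intro i j hi hj hij
    rcases hij.eq_or_lt with rfl | hij
    · exact le_rfl
    · exact List.pairwise_iff_getElem.1 hs i j hi hj hij
  constructor
  · have h1 : (M.take (L.length / 2 + 1)).countP (fun x => decide (x ≤ median L)) =
        (M.take (L.length / 2 + 1)).length := by
      rw [List.countP_eq_length]
      intro x hx
      obtain ⟨i, hi, rfl⟩ := List.getElem_of_mem hx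
      rw [List.length_take] at hi
      rw [List.getElem_take, hmed]
      exact decide_eq_true (hmono _ _ _ _ (by omega))
    have h2 := (List.take_sublist (L.length / 2 + 1) M).countP_le (p := fun x => decide (x ≤ median L))
    rw [h1, hp.countP_eq, List.length_take] at h2
    omega
  · have h1 : (M.drop (L.length / 2)).countP (fun x => decide (median L ≤ x)) =
        (M.drop (L.length / 2)).length := by
      rw [List.countP_eq_length]
      intro x hx
      obtain ⟨i, hi, rfl⟩ := List.getElem_of_mem hx
      rw [List.length_drop] at hi
      rw [List.getElem_drop, hmed]
      exact decide_eq_true (hmono _ _ _ _ (by omega))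
    have h2 := (List.drop_sublist (L.length / 2) M).countP_le (p := fun x => decide (median L ≤ x))
    rw [h1, hp.countP_eq, List.length_drop] at h2
    omega

/-- An extended distance `D` separates about `2 ^ l` of the vertices. -/
def Splits (vs : List (Vtx α)) (e : Vtx α → ExtDist) (l : ℕ) (D : ExtDist) : Prop :=
  vs.countP (fun u => decide (e u < D)) < 4 * 2 ^ l ∧
    2 ^ l < 16 * vs.countP (fun u => decide (e u ≤ D))

/-- `T` is an initial segment in the order given by `e`, so the condition at its largest element
already bounds the size of `T`. -/
theorem countP_low (vs : List (Vtx α)) (e : Vtx α → ExtDist) (M : ℕ)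
    {T : Set (Vtx α)} (hT : T = {u | 16 * vs.countP (fun x => decide (e x ≤ e u)) ≤ M}) :
    16 * vs.countP (fun u => decide (u ∈ T)) ≤ M := by
  by_cases h : ∃ u ∈ vs, u ∈ T
  · obtain ⟨u, hu, hmax⟩ := Finset.exists_max_image (vs.toFinset.filter (· ∈ T)) e
      (by obtain ⟨u, h1, h2⟩ := h; exact ⟨u, by simp [h1, h2]⟩)
    simp only [Finset.mem_filter, List.mem_toFinset] at hu hmax
    have h2 := hu.2
    rw [hT] at h2
    refine le_trans ?_ h2
    gcongr
    refine List.countP_mono_left fun x hx hxT => ?_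
    simp only [decide_eq_true_eq] at hxT ⊢
    exact hmax x ⟨hx, hxT⟩
  · push Not at h
    rw [List.countP_eq_zero.2 fun u hu => by simpa only [decide_eq_true_eq] using h u hu]
    simp

/-- Unless `T` contains everything, take the smallest element outside: at least `M` elements lie
strictly below it, and all of them belong to `T`. -/
theorem countP_high (vs : List (Vtx α)) (e : Vtx α → ExtDist) (M : ℕ) (hM : M ≤ vs.length)
    {T : Set (Vtx α)} (hT : T = {u | vs.countP (fun x => decide (e x < e u)) < M}) :
    M ≤ vs.countP (fun u => decide (u ∈ T)) := by
  by_cases h : ∃ u ∈ vs, u ∉ T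
  · obtain ⟨u, hu, hmin⟩ := Finset.exists_min_image (vs.toFinset.filter (· ∉ T)) e
      (by obtain ⟨u, h1, h2⟩ := h; exact ⟨u, by simp [h1, h2]⟩)
    simp only [Finset.mem_filter, List.mem_toFinset] at hu hmin
    have h2 := hu.2
    rw [hT] at h2
    refine (not_lt.1 h2).trans ?_
    refine List.countP_mono_left fun x hx hxu => ?_
    simp only [decide_eq_true_eq] at hxu ⊢
    by_contra hxT
    exact absurd (hmin x ⟨hx, hxT⟩) (not_le.2 hxu)
  · push Not at h
    rw [List.countP_eq_length.2 fun u hu => by simpa only [decide_eq_true_eq] using h u hu]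
    exact hM

/-- The median over `k` samples of the extended distance to the sample separates about `2 ^ l`
vertices with probability at least `1 - 2 * 2 ^ (-k)`. -/
theorem sampleTrials_splits (l : ℕ) (vs : List (Vtx α)) (e : Vtx α → ExtDist) {k : ℕ} (hk : 1 ≤ k)
    (hl : 2 ^ l ≤ vs.length) :
    (sampleTrials l vs k).toOuterMeasure
      {Ss | ¬ Splits vs e l (median (Ss.map fun S => S.inf e))} ≤ 2 * 2⁻¹ ^ k := by
  have hone : 1 ≤ 2 ^ l := Nat.one_le_two_pow
  set T₁ : Set (Vtx α) := {u | vs.countP (fun x => decide (e x < e u)) < 4 * 2 ^ l} with hT₁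
  set T₂ : Set (Vtx α) := {u | 16 * vs.countP (fun x => decide (e x ≤ e u)) ≤ 2 ^ l} with hT₂
  set j := (k + 1) / 2
  have hj : k ≤ 2 * j := by omega
  obtain ⟨bad₁, hb₁⟩ : ∃ b : Finset (Vtx α) → Prop, ∀ S, b S ↔ ∀ u ∈ S, u ∉ T₁ :=
    ⟨_, fun _ => Iff.rfl⟩
  obtain ⟨bad₂, hb₂⟩ : ∃ b : Finset (Vtx α) → Prop, ∀ S, b S ↔ ∃ u ∈ S, u ∈ T₂ :=
    ⟨_, fun _ => Iff.rfl⟩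
  -- With fewer than `4 * 2 ^ l` vertices the first half of `Splits` cannot fail, and the estimate
  -- for missing `T₁` would not be available.
  set E₁ : Set (List (Finset (Vtx α))) := if 4 * 2 ^ l ≤ vs.length then
    {Ss | Ss.length ≠ k ∨ j ≤ Ss.countP fun S => decide (bad₁ S)} else ∅ with hE₁
  set E₂ : Set (List (Finset (Vtx α))) :=
    {Ss | Ss.length ≠ k ∨ j ≤ Ss.countP fun S => decide (bad₂ S)} with hE₂
  have h1 : (sampleTrials l vs k).toOuterMeasure E₁ ≤ 2⁻¹ ^ k := by
    rw [hE₁]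
    split_ifs with hn
    · refine (sampleTrials_countP l vs bad₁ ?_ k j).trans (two_pow_mul_inv_pow_le k j hj)
      simp only [hb₁]
      exact (sampleSubset_miss l vs T₁).trans (one_sub_half_pow_le l _ (countP_high vs e _ hn hT₁))
    · simp
  have h2 : (sampleTrials l vs k).toOuterMeasure E₂ ≤ 2⁻¹ ^ k := by
    refine (sampleTrials_countP l vs bad₂ ?_ k j).trans (two_pow_mul_inv_pow_le k j hj)
    simp only [hb₂]
    refine (sampleSubset_hit l vs T₂).trans ?_
    -- `T₂` has at most `2 ^ l / 16` elements, so a sample of density `2 ^ (-l)` meets it with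
    -- probability at most 1/16.
    have h3 := countP_low vs e (2 ^ l) hT₂
    rw [← ENNReal.inv_pow, ← div_eq_mul_inv]
    refine ENNReal.div_le_of_le_mul ?_
    rw [mul_comm, ← div_eq_mul_inv, ENNReal.le_div_iff_mul_le (by norm_num) (by norm_num), mul_comm]
    exact_mod_cast h3
  have hsub : {Ss | ¬ Splits vs e l (median (Ss.map fun S => S.inf e))} ⊆
      {Ss | Ss.length ≠ k} ∪ (E₁ ∪ E₂) := by
    intro Ss hSs
    by_cases hlen : Ss.length = k
    swap
    · exact Or.inl hlen
    right
    set D := median (Ss.map fun S => S.inf e) with hD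
    obtain ⟨c1, c2⟩ := median_countP (Ss.map fun S => S.inf e) (by
      rw [Ne, ← List.length_eq_zero_iff, List.length_map]; omega)
    rw [List.length_map, List.countP_map, hlen, ← hD] at c1 c2
    simp only [Set.mem_ofPred_eq, Splits, not_and_or, not_lt] at hSs
    rcases hSs with hSs | hSs
    -- If the median is too large, every sample at distance at least the median, and thus half of
    -- them, misses `T₁`.
    · left
      have hn : 4 * 2 ^ l ≤ vs.length := hSs.trans List.countP_le_length
      rw [hE₁, if_pos hn]
      right
      refine le_trans (by omega : j ≤ Ss.countP ((fun x => decide (D ≤ x)) ∘ fun S => S.inf e)) ?_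
      refine List.countP_mono_left fun S _ hS => ?_
      simp only [Function.comp, decide_eq_true_eq] at hS ⊢
      refine (hb₁ S).2 ?_
      intro u hu hT
      have h3 : D ≤ e u := hS.trans (Finset.inf_le hu)
      have h4 : vs.countP (fun x => decide (e x < D)) ≤ vs.countP (fun x => decide (e x < e u)) := by
        refine List.countP_mono_left fun x _ hx => ?_
        simp only [decide_eq_true_eq] at hx ⊢
        exact hx.trans_le h3
      exact absurd (hSs.trans h4) (not_le.2 hT)
    · right
      right
      -- At distance `⊤` all vertices would be counted, and there are at least `2 ^ l` of them.
      -- Finiteness makes the infimum over a sample attained, which yields an element of `T₂`.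
      have hD' : D < ⊤ := by
        rw [lt_top_iff_ne_top]
        intro hD'
        rw [← hD, hD'] at hSs
        simp at hSs
        omega
      refine le_trans (by omega : j ≤ Ss.countP ((fun x => decide (x ≤ D)) ∘ fun S => S.inf e)) ?_
      refine List.countP_mono_left fun S _ hS => ?_
      simp only [Function.comp, decide_eq_true_eq] at hS ⊢
      obtain ⟨u, hu, hS⟩ := (Finset.inf_le_iff hD').1 hS
      refine (hb₂ S).2 ⟨u, hu, le_trans ?_ hSs⟩
      gcongr
      refine List.countP_mono_left fun x _ hx => ?_
      simp only [decide_eq_true_eq] at hx ⊢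
      exact hx.trans hS
  have h2' : (sampleTrials l vs k).toOuterMeasure ({Ss | Ss.length ≠ k} ∪ E₂) ≤ 2⁻¹ ^ k := by
    refine le_trans (MeasureTheory.measure_mono ?_) h2
    rintro Ss (h | h)
    · exact Or.inl h
    · exact h
  calc _ ≤ (sampleTrials l vs k).toOuterMeasure (E₁ ∪ ({Ss | Ss.length ≠ k} ∪ E₂)) := by
        refine MeasureTheory.measure_mono (hsub.trans ?_)
        rintro Ss (h | h | h)
        · exact Or.inr (Or.inl h)
        · exact Or.inl h
        · exact Or.inr (Or.inr h)
    _ ≤ 2⁻¹ ^ k + 2⁻¹ ^ k := (MeasureTheory.measure_union_le _ _).trans (add_le_add h1 h2')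
    _ = _ := (two_mul _).symm

theorem sampleLevels_union (vs : List (Vtx α)) (k : ℕ) (E : ℕ → Set (List (Finset (Vtx α))))
    (x : ENNReal) (m : ℕ)
    (hE : ∀ l, 1 ≤ l → l ≤ m → (sampleTrials l vs k).toOuterMeasure (E l) ≤ x) :
    (sampleLevels vs k m).toOuterMeasure {f | ∃ l, 1 ≤ l ∧ l ≤ m ∧ f l ∈ E l} ≤ m * x := by
  induction m with
  | zero =>
    have : {f : ℕ → List (Finset (Vtx α)) | ∃ l, 1 ≤ l ∧ l ≤ 0 ∧ f l ∈ E l} = ∅ := by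
      ext f
      simp only [Set.mem_ofPred_eq, Set.mem_empty_iff_false, iff_false]
      rintro ⟨l, h1, h2, -⟩
      omega
    rw [this]
    simp
  | succ m ih =>
    rw [sampleLevels]
    refine (toOuterMeasure_bind_le _ _ _ {f | ∃ l, 1 ≤ l ∧ l ≤ m ∧ f l ∈ E l} 1 x ?_ ?_).trans ?_
    · exact fun f _ => (toOuterMeasure_le_one _ _).trans le_self_add
    · intro f hf
      rw [PMF.toOuterMeasure_map_apply]
      refine le_trans (MeasureTheory.measure_mono ?_) (hE (m + 1) (by omega) le_rfl)
      rintro Ss ⟨l, h1, h2, h3⟩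
      rcases h2.eq_or_lt with rfl | h2
      · simpa using h3
      · dsimp only at h3
        rw [Function.update_of_ne (by omega)] at h3
        exact absurd ⟨l, h1, by omega, h3⟩ hf
    · rw [mul_one, Nat.cast_succ, add_mul, one_mul]
      exact add_le_add_left (ih fun l h1 h2 => hE l h1 (by omega)) _

/-! ### The choice of the threshold -/

/-- In every branch the threshold lies between `-dO l` and `dI l` for the least scale `l` with
nonnegative sum; by monotonicity this also holds for values taken from scale `l - 1`. The scale
before has a negative sum by minimality. -/
theorem chooseThreshold_spec {m : ℕ} {dI dO : ℕ → EReal} (hm : 1 ≤ m)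
    (hI : ∀ l, 1 ≤ l → l ≤ m → dI l ≠ ⊥) (hO : ∀ l, 1 ≤ l → l ≤ m → dO l ≠ ⊥)
    (mI : Monotone dI) (mO : Monotone dO) :
    dI m + dO m < 0 ∨ ∃ l, 1 ≤ l ∧ l ≤ m ∧ ((chooseThreshold m dI dO : ℝ) : EReal) ≤ dI l ∧
      ((-chooseThreshold m dI dO : ℝ) : EReal) ≤ dO l ∧
      (l = 1 ∨ dI (l - 1) + dO (l - 1) < 0) := by
  have neg_le : ∀ x y : EReal, x ≠ ⊥ → y ≠ ⊥ → 0 ≤ x + y → -y ≤ x := by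
    intro x y hx hy h
    induction x with
    | bot => exact absurd rfl hx
    | top => exact le_top
    | coe x =>
      induction y with
      | bot => exact absurd rfl hy
      | top => simp
      | coe y =>
        rw [← EReal.coe_add, ← EReal.coe_zero, EReal.coe_le_coe_iff] at h
        rw [← EReal.coe_neg, EReal.coe_le_coe_iff]
        linarith
  have ne_top : ∀ x y : EReal, x ≠ ⊥ → y ≠ ⊥ → x + y < 0 → x ≠ ⊤ ∧ y ≠ ⊤ := by
    intro x y hx hy h
    constructor <;> rintro rfl
    · rw [EReal.top_add_of_ne_bot hy] at h; simp at h
    · rw [EReal.add_top_of_ne_bot hx] at h; simp at h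
  rcases hf : (List.range' 1 m).find? (fun l => decide (0 ≤ dI l + dO l)) with _ | l
  · left
    rw [List.find?_eq_none] at hf
    have := hf m (by rw [List.mem_range'_1]; omega)
    simpa using this
  · right
    rw [List.find?_range'_eq_some] at hf
    obtain ⟨h0, hmem, hprev⟩ := hf
    rw [List.mem_range'_1] at hmem
    rw [decide_eq_true_eq] at h0
    have hl1 : 1 ≤ l := hmem.1
    have hlm : l ≤ m := by omega
    have hc : chooseThreshold m dI dO = if l = 1 then
        if dI 1 ≠ ⊤ then (dI 1).toReal else if dO 1 ≠ ⊤ then -(dO 1).toReal else 0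
      else if dI (l - 1) < dI l then
        if -dO (l - 1) ≤ dI l then -(dO (l - 1)).toReal else (dI l).toReal
      else
        if -dO l ≤ dI (l - 1) then (dI (l - 1)).toReal else -(dO l).toReal := by
      rw [chooseThreshold, List.find?_range'_eq_some.2
        ⟨decide_eq_true h0, by rw [List.mem_range'_1]; omega, hprev⟩]
    have n1 := neg_le _ _ (hI l hl1 hlm) (hO l hl1 hlm) h0
    have n2 := neg_le _ _ (hO l hl1 hlm) (hI l hl1 hlm) (by rwa [add_comm])
    refine ⟨l, hl1, hlm, ?_⟩
    rw [hc]
    by_cases hl : l = 1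
    · subst hl
      rw [if_pos rfl]
      have b1 := hI 1 le_rfl hlm
      have b2 := hO 1 le_rfl hlm
      generalize dI 1 = x at *
      generalize dO 1 = y at *
      induction x with
      | bot => exact absurd rfl b1
      | top =>
        induction y with
        | bot => exact absurd rfl b2
        | top => simp
        | coe y => simp
      | coe x => simpa using n2
    · rw [if_neg hl]
      have hp : dI (l - 1) + dO (l - 1) < 0 := by
        have := hprev (l - 1) (by omega) (by omega)
        simpa using this
      have hI' := hI (l - 1) (by omega) (by omega)
      have hO' := hO (l - 1) (by omega) (by omega)
      have bI := hI l hl1 hlm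
      have bO := hO l hl1 hlm
      obtain ⟨tI, tO⟩ := ne_top _ _ hI' hO' hp
      have m1 : dI (l - 1) ≤ dI l := mI (by omega)
      have m2 : dO (l - 1) ≤ dO l := mO (by omega)
      generalize dI (l - 1) = x' at *
      generalize dO (l - 1) = y' at *
      generalize dI l = x at *
      generalize dO l = y at *
      lift x' to ℝ using ⟨tI, hI'⟩
      lift y' to ℝ using ⟨tO, hO'⟩
      suffices h : ∀ Δ : ℝ, (Δ : EReal) ≤ x → ((-Δ : ℝ) : EReal) ≤ y →
          (Δ : EReal) ≤ x ∧ ((-Δ : ℝ) : EReal) ≤ y ∧ (l = 1 ∨ (x' : EReal) + y' < 0) by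
        split_ifs with h1 h2 h2
        · exact h _ (by simpa using h2) (by simpa using m2)
        · have tx : x ≠ ⊤ := by rintro rfl; simp at h2
          lift x to ℝ using ⟨tx, bI⟩
          exact h _ (by simp) (by simpa using n2)
        · refine h _ (by simpa using m1) ?_
          have e : x = x' := le_antisymm (not_lt.1 h1) m1
          rw [e] at n2
          simpa using n2
        · have ty : y ≠ ⊤ := by rintro rfl; simp at h2
          lift y to ℝ using ⟨ty, bO⟩
          exact h _ (by simpa using n1) (by simp)
      exact fun Δ h1 h2 => ⟨h1, h2, Or.inr hp⟩

/-! ### Running maxima of medians -/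

theorem ExtDist.dist_mono : Monotone ExtDist.dist := by
  intro D D' h
  induction D' using WithTop.recTopCoe with
  | top => exact le_top
  | coe D' =>
    induction D using WithTop.recTopCoe with
    | top => simp at h
    | coe D => exact Prod.Lex.monotone_fst _ _ (WithTop.coe_le_coe.1 h)

/-- What the sampling guarantees for the distance `D` computed for the scale `l`, where `f` is the
exact distance. -/
structure Approx (V : Finset (Vtx α)) (f : Vtx α → EReal) (m : ℕ) (D : ℕ → EReal) : Prop where
  mono : Monotone D
  lt : ∀ l, 1 ≤ l → l ≤ m → (V.filter fun u => f u < D l).card ≤ 4 * 2 ^ l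
  le : ∀ l, 1 ≤ l → l ≤ m → 2 ^ l ≤ 16 * (V.filter fun u => f u ≤ D l).card

theorem Approx.ne_bot {V : Finset (Vtx α)} {f : Vtx α → EReal} {m : ℕ} {D : ℕ → EReal}
    (h : Approx V f m D) (hf : ∀ u, f u ≠ ⊥) {l : ℕ} (h1 : 1 ≤ l) (hm : l ≤ m) : D l ≠ ⊥ := by
  intro e
  have h2 := h.le l h1 hm
  rw [e, Finset.filter_false_of_mem fun u _ => by simpa using hf u] at h2
  have : 1 ≤ 2 ^ l := Nat.one_le_two_pow
  simp at h2

theorem card_filter_eq_countP {β : Type*} (V : Finset β) (p : β → Prop) [DecidablePred p] :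
    (V.filter p).card = V.toList.countP fun u => decide (p u) := by
  rw [Finset.card_def, Finset.filter_val, ← Multiset.countP_eq_card_filter, ← Finset.coe_toList,
    Multiset.coe_countP]

/-- The running maximum is attained at a scale `i ≤ l`, whose upper bound on the count is even
smaller. The lower bound is inherited from scale `l`, since a larger distance only counts more
vertices. -/
theorem Approx.of_splits {V : Finset (Vtx α)} {f : Vtx α → EReal} {idx : Vtx α → ℕ} {m : ℕ}
    {M : ℕ → ExtDist}
    (h : ∀ l, 1 ≤ l → l ≤ m → Splits V.toList
      (fun u => ((toLex (f u, idx u) : Lex (EReal × ℕ)) : ExtDist)) l (M l)) :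
    Approx V f m fun l => ExtDist.dist ((Finset.Icc 1 l).sup M) := by
  refine ⟨fun i j hij => ExtDist.dist_mono (Finset.sup_mono (Finset.Icc_subset_Icc_right hij)),
    fun l h1 hm => ?_, fun l h1 hm => ?_⟩
  · obtain ⟨i, hi, e⟩ := Finset.exists_mem_eq_sup (Finset.Icc 1 l) ⟨1, by simp [h1]⟩ M
    rw [Finset.mem_Icc] at hi
    rw [e, card_filter_eq_countP]
    refine le_trans (le_trans ?_ (h i hi.1 (hi.2.trans hm)).1.le)
      (Nat.mul_le_mul_left 4 (Nat.pow_le_pow_right two_pos hi.2))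
    refine List.countP_mono_left fun u _ hu => ?_
    simp only [decide_eq_true_eq] at hu ⊢
    generalize M i = D at hu ⊢
    induction D using WithTop.recTopCoe with
    | top => exact WithTop.coe_lt_top _
    | coe D => exact WithTop.coe_lt_coe.2 (Prod.Lex.lt_iff.2 (Or.inl hu))
  · refine le_trans (h l h1 hm).2.le (Nat.mul_le_mul_left 16 ?_)
    rw [card_filter_eq_countP]
    refine List.countP_mono_left fun u _ hu => ?_
    simp only [decide_eq_true_eq] at hu ⊢
    exact ExtDist.dist_mono (hu.trans (Finset.le_sup (f := M) (Finset.mem_Icc.2 ⟨h1, le_rfl⟩)))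

/-! ### Counting near vertices -/

/-- The number of pairs whose shortest path through `r = neg a` has negative length. -/
def negPairs (base : State α) (h : ℕ) (a : α) : ℕ :=
  ((base.verts ×ˢ base.verts).filter fun p =>
    base.hopDist h p.1 (neg a) + base.hopDist h (neg a) p.2 < 0).card

theorem mul_le_negPairs {base : State α} {h : ℕ} {a : α} {D D' : EReal} (hD : D + D' < 0) :
    (base.verts.filter fun u => base.hopDist h u (neg a) ≤ D).card *
      (base.verts.filter fun u => base.hopDist h (neg a) u ≤ D').card ≤ negPairs base h a := by
  rw [← Finset.card_product]
  refine Finset.card_le_card fun p hp => ?_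
  simp only [Finset.mem_product, Finset.mem_filter] at hp ⊢
  exact ⟨⟨hp.1.1, hp.2.1⟩, (add_le_add hp.1.2 hp.2.2).trans_lt hD⟩

/-- At most `4 * 2 ^ l` vertices are near at the chosen scale `l`, and at scale `l - 1`, where the
sum is negative, at least `2 ^ (l - 1) / 16` vertices on each side combine to negative pairs. If no
scale is chosen, the last one plays this role. For `l = 1` there are at most 8 near vertices, whence
the summand 64. -/
theorem near_sq_le {base : State α} {h : ℕ} {a : α} {dI dO : ℕ → EReal}
    (hn : 8 ≤ base.verts.card)
    (bI : ∀ u, base.hopDist h u (neg a) ≠ ⊥) (bO : ∀ u, base.hopDist h (neg a) u ≠ ⊥)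
    (hI : Approx base.verts (fun u => base.hopDist h u (neg a)) (numScales base) dI)
    (hO : Approx base.verts (fun u => base.hopDist h (neg a) u) (numScales base) dO) :
    (nearIn base h (chooseThreshold (numScales base) dI dO) a).card ^ 2 ≤
        2 ^ 14 * negPairs base h a + 64 ∧
      (nearOut base h (chooseThreshold (numScales base) dI dO) a).card ^ 2 ≤
        2 ^ 14 * negPairs base h a + 64 := by
  -- At least 8 vertices guarantee that the truncated subtraction in `numScales` leaves at least one
  -- scale.
  have hlog : 3 ≤ Nat.log 2 base.verts.card :=
    Nat.le_log_of_pow_le (by norm_num) (by simpa using hn)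
  have hm : 1 ≤ numScales base := by unfold numScales; omega
  have hlt : base.verts.card < 8 * 2 ^ numScales base := by
    have h1 := Nat.lt_pow_succ_log_self (b := 2) (by norm_num) base.verts.card
    have e : (Nat.log 2 base.verts.card).succ = numScales base + 3 := by unfold numScales; omega
    rw [e, pow_add] at h1
    omega
  set m := numScales base
  -- The constant: `N ^ 2 ≤ 8 ^ 2 * (2 ^ l) ^ 2`, and each factor `2 ^ l` is at most 16 times a
  -- count, so `8 ^ 2 * 16 ^ 2 = 2 ^ 14`.
  have prod : ∀ l, 1 ≤ l → l ≤ m → dI l + dO l < 0 → ∀ N : ℕ, N ≤ 8 * 2 ^ l →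
      N ^ 2 ≤ 2 ^ 14 * negPairs base h a + 64 := by
    intro l h1 h2 h3 N hN
    have h4 := mul_le_negPairs (h := h) (a := a) (base := base) h3
    have h5 := hI.le l h1 h2
    have h6 := hO.le l h1 h2
    have h7 := Nat.mul_le_mul h5 h6
    have h8 := Nat.mul_le_mul hN hN
    nlinarith
  rcases chooseThreshold_spec hm (fun l h1 h2 => hI.ne_bot bI h1 h2)
    (fun l h1 h2 => hO.ne_bot bO h1 h2) hI.mono hO.mono with h0 | ⟨l, h1, h2, h3, h4, h5⟩
  · exact ⟨prod m hm le_rfl h0 _ ((Finset.card_filter_le _ _).trans hlt.le),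
      prod m hm le_rfl h0 _ ((Finset.card_filter_le _ _).trans hlt.le)⟩
  · set Δ := chooseThreshold m dI dO
    have c1 : (nearIn base h Δ a).card ≤ 4 * 2 ^ l := by
      refine le_trans (Finset.card_le_card ?_) (hI.lt l h1 h2)
      exact Finset.monotone_filter_right _ fun u _ hu => hu.trans_le h3
    have c2 : (nearOut base h Δ a).card ≤ 4 * 2 ^ l := by
      refine le_trans (Finset.card_le_card ?_) (hO.lt l h1 h2)
      exact Finset.monotone_filter_right _ fun u _ hu => hu.trans_le h4
    rcases h5 with rfl | h5
    · constructor <;> nlinarith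
    · by_cases hl : l = 1
      · subst hl
        constructor <;> nlinarith
      · have e : 2 ^ l = 2 * 2 ^ (l - 1) := by
          rw [← pow_succ']; congr 1; omega
        exact ⟨prod (l - 1) (by omega) (by omega) h5 _ (by omega),
          prod (l - 1) (by omega) (by omega) h5 _ (by omega)⟩

/-- Interchanging the sums over negative vertices and pairs turns negative pairs into betweenness.
-/
theorem sum_negPairs_le [Fintype α] {base : State α} {h : ℕ} {β : ℝ}
    (hβ : ∀ x ∈ base.verts, ∀ y ∈ base.verts, (betweenness base h x y : ℝ) ≤ β) :
    ∑ a, (negPairs base h a : ℝ) ≤ (base.verts.card : ℝ) ^ 2 * β := by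
  have e : ∑ a, negPairs base h a =
      ∑ p ∈ base.verts ×ˢ base.verts, betweenness base h p.1 p.2 := by
    unfold negPairs betweenness
    simp only [Finset.card_filter]
    exact Finset.sum_comm
  have e' : ∑ a, (negPairs base h a : ℝ) =
      ∑ p ∈ base.verts ×ˢ base.verts, (betweenness base h p.1 p.2 : ℝ) := by
    exact_mod_cast e
  rw [e']
  refine (Finset.sum_le_card_nsmul _ _ β fun p hp => ?_).trans ?_
  · rw [Finset.mem_product] at hp
    exact hβ _ hp.1 _ hp.2
  · rw [Finset.card_product, nsmul_eq_mul, Nat.cast_mul, sq]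

/-- The number of near vertices, summed over all negative vertices. -/
theorem sum_near_le [Fintype α] {base : State α} {h : ℕ} {b : ℝ} {Δ : α → ℝ} (hb : 0 < b)
    (hbn : b ≤ (base.verts.card : ℝ) ^ 2)
    (hβ : ∀ x ∈ base.verts, ∀ y ∈ base.verts,
      (betweenness base h x y : ℝ) ≤ (Fintype.card α : ℝ) / b)
    (hΔ : ∀ a, (nearIn base h (Δ a) a).card ^ 2 ≤ 2 ^ 14 * negPairs base h a + 64 ∧
      (nearOut base h (Δ a) a).card ^ 2 ≤ 2 ^ 14 * negPairs base h a + 64) :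
    ∑ a, (2 * ((nearIn base h (Δ a) a).card : ℝ) + (nearOut base h (Δ a) a).card) ≤
      (base.verts.card : ℝ) / √b * (399 * Fintype.card α) := by
  set n : ℝ := (base.verts.card : ℝ)
  set η : ℝ := (Fintype.card α : ℝ)
  have hη : 0 ≤ η := Nat.cast_nonneg _
  have hn : 0 ≤ n := Nat.cast_nonneg _
  refine le_of_sq_le_sq ?_ (by positivity)
  -- Cauchy–Schwarz. In `h2` the factor 9 comes from `(2x + y)² ≤ 9 max(x², y²)`.
  have h1 : (∑ a, (2 * ((nearIn base h (Δ a) a).card : ℝ) + (nearOut base h (Δ a) a).card)) ^ 2 ≤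
      η * ∑ a, (2 * ((nearIn base h (Δ a) a).card : ℝ) + (nearOut base h (Δ a) a).card) ^ 2 := by
    simpa [η] using sq_sum_le_card_mul_sum_sq (s := (Finset.univ : Finset α))
      (f := fun a => 2 * ((nearIn base h (Δ a) a).card : ℝ) + (nearOut base h (Δ a) a).card)
  have h2 : ∑ a, (2 * ((nearIn base h (Δ a) a).card : ℝ) + (nearOut base h (Δ a) a).card) ^ 2 ≤
      ∑ a, 9 * (2 ^ 14 * (negPairs base h a : ℝ) + 64) := by
    refine Finset.sum_le_sum fun a _ => ?_
    obtain ⟨c1, c2⟩ := hΔ a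
    have c1' : ((nearIn base h (Δ a) a).card : ℝ) ^ 2 ≤ 2 ^ 14 * negPairs base h a + 64 := by
      exact_mod_cast c1
    have c2' : ((nearOut base h (Δ a) a).card : ℝ) ^ 2 ≤ 2 ^ 14 * negPairs base h a + 64 := by
      exact_mod_cast c2
    nlinarith [sq_nonneg (((nearIn base h (Δ a) a).card : ℝ) - (nearOut base h (Δ a) a).card)]
  have h3 : ∑ a, 9 * (2 ^ 14 * (negPairs base h a : ℝ) + 64) =
      9 * (2 ^ 14 * ∑ a, (negPairs base h a : ℝ) + 64 * η) := by
    rw [← Finset.mul_sum, Finset.sum_add_distrib, ← Finset.mul_sum, Finset.sum_const, nsmul_eq_mul,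
      Finset.card_univ, mul_comm _ (64 : ℝ)]
  have h4 := sum_negPairs_le hβ
  -- The assumption `b ≤ n ^ 2` absorbs the additive constants into the main term.
  have h5 : 64 * η ≤ 64 * (n ^ 2 * (η / b)) := by
    have : 1 ≤ n ^ 2 / b := (one_le_div hb).2 hbn
    have : n ^ 2 * (η / b) = n ^ 2 / b * η := by ring
    nlinarith
  calc _ ≤ η * (9 * (2 ^ 14 * (n ^ 2 * (η / b)) + 64 * (n ^ 2 * (η / b)))) := by
        refine h1.trans (mul_le_mul_of_nonneg_left ((h2.trans h3.le).trans ?_) hη)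
        linarith
    -- Here `148032 = 9 * (2 ^ 14 + 64)`, which is less than `399 ^ 2`.
    _ = n ^ 2 / b * (148032 * η ^ 2) := by ring
    _ ≤ n ^ 2 / b * ((399 * η) ^ 2) := by
        refine mul_le_mul_of_nonneg_left ?_ (by positivity)
        nlinarith [sq_nonneg η]
    _ = _ := by
        rw [mul_pow (n / √b), div_pow, Real.sq_sqrt hb.le]

/-! ### The probability that an iteration fails -/

/-- The distances from and to the samples approximate the exact distances at all scales and for all
negative vertices. -/
def GoodSamples (base : State α) (h : ℕ) (smp : ℕ → List (Finset (Vtx α))) : Prop :=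
  ∀ a, Approx base.verts (fun u => base.hopDist h u (neg a)) (numScales base)
      (fun l => ExtDist.dist
        ((Finset.Icc 1 l).sup fun i => (median ((smp i).map (extDistIn base h a))))) ∧
    Approx base.verts (fun u => base.hopDist h (neg a) u) (numScales base)
      (fun l => ExtDist.dist
        ((Finset.Icc 1 l).sup fun i => (median ((smp i).map (extDistOut base h a)))))

/-- A union bound over scales, negative vertices and the two directions; each event has probability
at most `2 * 2 ^ (-k)`. -/
theorem sampleLevels_good [Fintype α] (base : State α) (h : ℕ) {k : ℕ} (hk : 1 ≤ k) :
    (sampleLevels base.verts.toList k (numScales base)).toOuterMeasure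
      {smp | ¬ GoodSamples base h smp} ≤
      (numScales base : ENNReal) * ((Fintype.card α : ENNReal) * (4 * 2⁻¹ ^ k)) := by
  set eI : α → Vtx α → ExtDist := fun a u =>
    ((toLex (base.hopDist h u (neg a), base.index u) : Lex (EReal × ℕ)) : ExtDist) with heI
  set eO : α → Vtx α → ExtDist := fun a u =>
    ((toLex (base.hopDist h (neg a) u, base.index u) : Lex (EReal × ℕ)) : ExtDist) with heO
  set E : ℕ → Set (List (Finset (Vtx α))) := fun l => ⋃ a : α,
    ({Ss | ¬ Splits base.verts.toList (eI a) l (median (Ss.map fun S => S.inf (eI a)))} ∪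
      {Ss | ¬ Splits base.verts.toList (eO a) l (median (Ss.map fun S => S.inf (eO a)))}) with hE
  refine le_trans (MeasureTheory.measure_mono ?_) (sampleLevels_union base.verts.toList k E
    ((Fintype.card α : ENNReal) * (4 * 2⁻¹ ^ k)) (numScales base) fun l h1 hm => ?_)
  · intro smp hbad
    by_contra hcon
    refine hbad fun a => ⟨Approx.of_splits (idx := base.index) fun l h1 hm => ?_,
      Approx.of_splits (idx := base.index) fun l h1 hm => ?_⟩ <;>
    · by_contra hs
      refine hcon ⟨l, h1, hm, Set.mem_iUnion.2 ⟨a, ?_⟩⟩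
      first
        | exact Or.inl hs
        | exact Or.inr hs
  · have hl : 2 ^ l ≤ base.verts.toList.length := by
      rw [Finset.length_toList]
      unfold numScales at hm
      refine (Nat.pow_le_pow_right two_pos (by omega : l ≤ Nat.log 2 base.verts.card)).trans
        (Nat.pow_log_le_self 2 ?_)
      rintro e
      rw [e] at hm
      simp at hm
      omega
    refine (MeasureTheory.measure_iUnion_fintype_le _ _).trans ?_
    refine (Finset.sum_le_card_nsmul _ _ (4 * 2⁻¹ ^ k) fun a _ => ?_).trans ?_
    · refine (MeasureTheory.measure_union_le _ _).trans ?_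
      refine (add_le_add (sampleTrials_splits l _ (eI a) hk hl)
        (sampleTrials_splits l _ (eO a) hk hl)).trans ?_
      rw [← add_mul]
      norm_num
    · rw [Finset.card_univ, nsmul_eq_mul]

/-- The number of events contributes at most `n ^ 2`, the trials contribute `n ^ (-K)`, and `K ≥ c +
3` leaves the exponent `-(c + 1)`. -/
theorem failure_bound {n m η : ℕ} {c K : ℝ} (hn : 2 ≤ n) (hη : η ≤ n) (hm : m * 4 ≤ n)
    (hK : c + 3 ≤ K) :
    (m : ENNReal) * ((η : ENNReal) * (4 * 2⁻¹ ^ ⌈K * Real.logb 2 n⌉₊)) ≤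
      ENNReal.ofReal ((n : ℝ) ^ (-(c + 1))) := by
  set k := ⌈K * Real.logb 2 n⌉₊
  have hn0 : (0 : ℝ) < n := by exact_mod_cast (by omega : 0 < n)
  have hn1 : (1 : ℝ) ≤ n := by exact_mod_cast (by omega : 1 ≤ n)
  have e : (m : ENNReal) * ((η : ENNReal) * (4 * 2⁻¹ ^ k)) =
      ENNReal.ofReal (m * (η * (4 * (2⁻¹ : ℝ) ^ k))) := by
    rw [ENNReal.ofReal_mul (by positivity), ENNReal.ofReal_mul (by positivity),
      ENNReal.ofReal_mul (by positivity), ENNReal.ofReal_pow (by positivity),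
      ENNReal.ofReal_inv_of_pos (by norm_num), ENNReal.ofReal_natCast, ENNReal.ofReal_natCast]
    norm_num
  rw [e]
  refine ENNReal.ofReal_le_ofReal ?_
  have h1 : (2⁻¹ : ℝ) ^ k ≤ (n : ℝ) ^ (-K) := by
    have e1 : (n : ℝ) ^ (-K) = (2 : ℝ) ^ (-(K * Real.logb 2 n)) := by
      conv_lhs => rw [← Real.rpow_logb (b := 2) (by norm_num) (by norm_num) hn0]
      rw [← Real.rpow_mul (by norm_num)]
      ring_nf
    rw [e1, inv_pow, ← Real.rpow_natCast, ← Real.rpow_neg (by norm_num)]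
    exact Real.rpow_le_rpow_of_exponent_le (by norm_num) (neg_le_neg (Nat.le_ceil _))
  have hm' : (m : ℝ) * 4 ≤ n := by exact_mod_cast hm
  have hη' : (η : ℝ) ≤ n := by exact_mod_cast hη
  calc (m : ℝ) * (η * (4 * (2⁻¹ : ℝ) ^ k)) = (m * 4) * η * (2⁻¹ : ℝ) ^ k := by ring
    _ ≤ n * n * (n : ℝ) ^ (-K) := by gcongr
    _ = (n : ℝ) ^ (2 - K) := by
        rw [sub_eq_add_neg, Real.rpow_add hn0, ← sq, ← Real.rpow_natCast]; norm_num
    _ ≤ _ := Real.rpow_le_rpow_of_exponent_le hn1 (by linarith)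

/-- Bounds on the sizes of the graph after one iteration that hold with certainty. -/
def Grows [Fintype α] (s s' : State α) : Prop :=
  s.verts ⊆ s'.verts ∧ s'.heavy ⊆ s'.verts ∧
    s'.verts.card ≤ s.verts.card + Fintype.card α + 2 * s.heavy.card * Nat.clog 2 s.verts.card

theorem finish_grows [Fintype α] {s : State α} (hs : s.heavy ⊆ s.verts) (t : ℕ) (lam : ℝ)
    (Δ : α → ℝ) (φ : Vtx α → ℝ) :
    Grows s (finish t lam Δ (insertDeferred (s.reweight φ))) := by
  have e1 : (insertDeferred (s.reweight φ)).verts = s.verts := insertDeferred_verts _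
  have e2 : (insertDeferred (s.reweight φ)).heavy = s.heavy := insertDeferred_heavy _
  have h1 := finish_verts_card t lam Δ (insertDeferred (s.reweight φ))
  have h2 := finish_heavy_subset t lam Δ (insertDeferred (s.reweight φ)) (by rwa [e1, e2])
  rw [e1, e2] at h1
  refine ⟨?_, h2, h1⟩
  rw [finish_verts, e1]
  exact Finset.subset_union_left.trans Finset.subset_union_left

theorem shortcut_grows [Fintype α] {h : ℕ} {b K : ℝ} {B : ℕ → State α → PMF (Vtx α → ℝ)}
    {t : ℕ} {s : State α} (hs : s.heavy ⊆ s.verts) :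
    (shortcut h b K B t s).toOuterMeasure {s' | ¬ Grows s s'} = 0 := by
  refine le_antisymm ?_ zero_le
  refine (toOuterMeasure_bind_le _ _ _ ∅ 0 0 (by simp) fun φ _ => ?_).trans (by simp)
  dsimp only
  rw [PMF.toOuterMeasure_map_apply]
  have : ((fun smp => finish t ((s.verts.card : ℝ) / √b)
      (threshold (insertDeferred (s.reweight φ)) h smp) (insertDeferred (s.reweight φ))) ⁻¹'
      {s' | ¬ Grows s s'}) = ∅ :=
    Set.eq_empty_of_forall_notMem fun smp hsmp => hsmp (finish_grows hs _ _ _ _)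
  rw [this]
  simp

/-- An iteration can fail in two ways, through the betweenness reduction and through the samples,
each with probability at most `n ^ (-(c + 1))`. Otherwise all conclusions hold deterministically. -/
theorem shortcut_spec [Fintype α] {h : ℕ} {b c K : ℝ} {B : ℕ → State α → PMF (Vtx α → ℝ)}
    {t : ℕ} {s : State α} (hs : Between t s) (hth : t + 2 ≤ h) (hb : 0 < b)
    (hbn : b ≤ (s.verts.card : ℝ) ^ 2) (hn : 8 ≤ s.verts.card)
    (hη : Fintype.card α ≤ s.verts.card) (hc : 0 < c) (hK : c + 3 ≤ K)
    (hB : IsBetweennessReduction h b (c + 1) B) :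
    (shortcut h b K B (t + 1) s).toOuterMeasure {s' | ¬ (Between (t + 1) s' ∧ Grows s s' ∧
      (s'.heavy.card : ℝ) ≤ s.heavy.card + 400 * Fintype.card α)} ≤
      2 * ENNReal.ofReal ((s.verts.card : ℝ) ^ (-(c + 1))) := by
  have hn0 : (0 : ℝ) < s.verts.card := by exact_mod_cast (by omega : 0 < s.verts.card)
  rw [two_mul]
  refine (toOuterMeasure_bind_le _ _ _ {φ | ¬ Reduces h b s φ} 1
    (ENNReal.ofReal ((s.verts.card : ℝ) ^ (-(c + 1)))) ?_ fun φ hφ => ?_).trans ?_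
  · exact fun φ _ => (toOuterMeasure_le_one _ _).trans le_self_add
  · dsimp only
    rw [PMF.toOuterMeasure_map_apply]
    have hφ : Reduces h b s φ := not_not.1 hφ
    set base := insertDeferred (s.reweight φ) with hbase
    have e1 : base.verts = s.verts := insertDeferred_verts _
    have e2 : base.heavy = s.heavy := insertDeferred_heavy _
    obtain ⟨ψ, hC, hE⟩ := hs.pot
    obtain ⟨g1, g2, g3⟩ := base_spec hC hE hs.stable hφ.1
    rw [← hbase] at g1 g2 g3
    have hk : 1 ≤ ⌈K * Real.logb 2 base.verts.card⌉₊ := by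
      rw [Nat.one_le_ceil_iff]
      refine mul_pos (by linarith) (Real.logb_pos (by norm_num) ?_)
      rw [e1]
      exact_mod_cast (by omega : 1 < s.verts.card)
    have hm : numScales base * 4 ≤ s.verts.card := by
      have h1 : 2 ^ (numScales base + 2) ≤ s.verts.card := by
        have h2 : 3 ≤ Nat.log 2 s.verts.card := Nat.le_log_of_pow_le (by norm_num) (by simpa using hn)
        have h3 : numScales base + 2 = Nat.log 2 s.verts.card := by
          unfold numScales; rw [e1]; omega
        rw [h3]
        exact Nat.pow_log_le_self 2 (by omega)
      have h2 : numScales base < 2 ^ numScales base := Nat.lt_two_pow_self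
      rw [pow_add] at h1
      omega
    refine le_trans (MeasureTheory.measure_mono ?_) ((sampleLevels_good base h hk).trans ?_)
    · intro smp hsmp hgood
      refine hsmp ?_
      dsimp only
      obtain ⟨f1, f2⟩ := finish_spec (t := t + 1) (h := h) (lam := (s.verts.card : ℝ) / √b)
        (ψ := fun v => ψ v - φ v) (base := base) (by rw [e1]; exact g1) (by rw [e1]; exact g2)
        (by rw [e1]; exact g3) (by rw [e1, e2]; exact hs.heavy)
        (by rw [e1]; exact fun v hv => Nat.lt_succ_of_le (hs.lvl v hv)) (by omega) (by omega)
        (by positivity) (threshold base h smp)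
      refine ⟨f1, finish_grows hs.heavy _ _ _ _, ?_⟩
      have hF := g1.toFrame
      have h1 := f2.trans (sum_near_le (b := b) hb (by rw [e1]; exact hbn)
        (by rw [e1]; exact hφ.2) fun a => near_sq_le (by rw [e1]; exact hn)
          (fun u => hF.hopDist_ne_bot) (fun u => hF.hopDist_ne_bot) (hgood a).1 (hgood a).2)
      rw [e1, e2] at h1
      -- The degree threshold cancels the factor `n / √b`: 399η Steiner vertices and η N-Steiner
      -- vertices remain.
      have h2 := le_of_mul_le_mul_left h1 (by positivity)
      linarith
    · rw [e1]
      exact failure_bound (by omega) hη hm hK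
  · rw [mul_one]
    refine add_le_add_left (hB _ _ (hs.exists_reduces (by positivity))) _

/-! ### From one iteration to the whole run -/

/-- A property of histories that each iteration preserves up to a small failure probability. -/
theorem run_le [Fintype α] {H : α → α → WithTop ℝ} {h : ℕ} {b K : ℝ}
    {B : ℕ → State α → PMF (Vtx α → ℝ)} (I : ℕ → State α → Prop) (R : State α → State α → Prop)
    (ε : ENNReal) (T : ℕ) (h0 : I 0 (initState H))
    (hstep : ∀ t < T, ∀ s, I t s →
      (shortcut h b K B (t + 1) s).toOuterMeasure {s' | ¬ (I (t + 1) s' ∧ R s s')} ≤ ε) :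
    (run H h b K B T).toOuterMeasure
      {G | ¬ ((∀ i ≤ T, I i (G i)) ∧ ∀ i < T, R (G i) (G (i + 1)))} ≤ T * ε := by
  induction T with
  | zero =>
    rw [run, PMF.toOuterMeasure_pure_apply, if_neg]
    · simp
    · simpa using h0
  | succ T ih =>
    rw [run]
    refine (toOuterMeasure_bind_le _ _ _
      {G | ¬ ((∀ i ≤ T, I i (G i)) ∧ ∀ i < T, R (G i) (G (i + 1)))} 1 ε
      (fun G _ => (toOuterMeasure_le_one _ _).trans le_self_add) fun G hG => ?_).trans ?_
    · obtain ⟨k1, k2⟩ := not_not.1 hG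
      rw [PMF.toOuterMeasure_map_apply]
      refine le_trans (MeasureTheory.measure_mono ?_) (hstep T (by omega) _ (k1 T le_rfl))
      intro s hs hcon
      refine hs ⟨fun i hi => ?_, fun i hi => ?_⟩
      · dsimp only
        rcases hi.eq_or_lt with rfl | hi
        · rw [Function.update_self]; exact hcon.1
        · rw [Function.update_of_ne (by omega)]; exact k1 i (by omega)
      · dsimp only
        rw [Function.update_of_ne (a := i) (by omega)]
        rcases (Nat.lt_succ_iff.1 hi).eq_or_lt with rfl | hi
        · rw [Function.update_self]; exact hcon.2
        · rw [Function.update_of_ne (by omega)]; exact k2 i hi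
    · rw [mul_one, Nat.cast_succ, add_mul, one_mul]
      exact add_le_add_left (ih fun t ht => hstep t (by omega)) _

/-! ### The number of vertices -/

theorem clog_le_logb_add_one {v : ℕ} (hv : 1 ≤ v) :
    (Nat.clog 2 v : ℝ) ≤ Real.logb 2 v + 1 := by
  rw [← Real.natCeil_logb_natCast]
  exact (Nat.ceil_lt_add_one (Real.logb_nonneg (by norm_num) (by exact_mod_cast hv))).le

theorem one_le_logb {v : ℕ} (hv : 2 ≤ v) : 1 ≤ Real.logb 2 v := by
  rw [Real.le_logb_iff_rpow_le (by norm_num) (by exact_mod_cast (by omega : 0 < v)), Real.rpow_one]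
  exact_mod_cast hv

/-- The three conditions serve to obtain `γ ≥ 1` and hence `b ≤ η`, to bound twice the number of
iterations by `n₀` in the union bound, and to keep the number of vertices below `n₀ ^ 2`. -/
theorem exists_large (c₁ cL D : ℝ) (hc₁ : 0 < c₁) (hcL : 0 < cL) (hD : 0 < D) :
    ∃ N : ℕ, ∀ n : ℕ, N ≤ n → 1 ≤ c₁ * Real.logb 2 n ∧ 2 * (cL * Real.logb 2 n) ≤ n ∧
      1 + cL * D * Real.logb 2 n ^ 3 ≤ n := by
  have key : ∀ (k : ℕ) (c : ℝ), 0 < c →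
      ∀ᶠ x : ℝ in Filter.atTop, c * Real.logb 2 x ^ k ≤ x := by
    intro k c hc
    have h2 : 0 < Real.log 2 := Real.log_pos (by norm_num)
    have h := (Real.isLittleO_pow_log_id_atTop (n := k)).bound
      (show 0 < c⁻¹ * Real.log 2 ^ k by positivity)
    filter_upwards [h, Filter.eventually_ge_atTop (1 : ℝ)] with x hx h1
    have h3 : 0 ≤ Real.log x := Real.log_nonneg h1
    rw [Real.norm_of_nonneg (by positivity), id, Real.norm_of_nonneg (by linarith)] at hx
    rw [Real.logb, div_pow]
    calc c * (Real.log x ^ k / Real.log 2 ^ k)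
        ≤ c * ((c⁻¹ * Real.log 2 ^ k * x) / Real.log 2 ^ k) := by gcongr
      _ = x := by field_simp
  have h1 : ∀ᶠ x : ℝ in Filter.atTop, c₁⁻¹ ≤ Real.logb 2 x :=
    (Real.tendsto_logb_atTop (by norm_num)).eventually_ge_atTop _
  have h := (h1.and ((key 1 (2 * cL) (by positivity)).and ((key 3 (2 * (cL * D)) (by positivity)).and
    (Filter.eventually_ge_atTop (2 : ℝ)))))
  obtain ⟨N, hN⟩ := Filter.eventually_atTop.1 (tendsto_natCast_atTop_atTop.eventually h)
  refine ⟨N, fun n hn => ?_⟩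
  obtain ⟨g1, g2, g3, g4⟩ := hN n hn
  refine ⟨?_, ?_, ?_⟩
  · calc (1 : ℝ) = c₁ * c₁⁻¹ := (mul_inv_cancel₀ hc₁.ne').symm
      _ ≤ _ := mul_le_mul_of_nonneg_left g1 hc₁.le
  · linarith
  · linarith

/-- The induction step for the number of vertices. -/
theorem card_step {n₀ v v' η Hv : ℕ} {ℓ cL t D : ℝ} (hℓ : ℓ = Real.logb 2 n₀) (h2 : 2 ≤ n₀)
    (hD : D = 7 + 1200 * cL) (hcL : 0 < cL) (ht0 : 0 ≤ t) (ht : t ≤ cL * ℓ) (hη : 2 * η = n₀)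
    (hbig : 1 + cL * D * ℓ ^ 3 ≤ n₀) (hv1 : 1 ≤ v)
    (hH : (Hv : ℝ) ≤ n₀ + 400 * η * t) (hv : (v : ℝ) ≤ n₀ * (1 + t * D * ℓ ^ 2))
    (hv' : v' ≤ v + η + 2 * Hv * Nat.clog 2 v) :
    (v' : ℝ) ≤ n₀ * (1 + (t + 1) * D * ℓ ^ 2) := by
  have hℓ1 : 1 ≤ ℓ := hℓ ▸ one_le_logb h2
  have hn0 : (0 : ℝ) < n₀ := by exact_mod_cast (by omega : 0 < n₀)
  have hη' : 2 * (η : ℝ) = n₀ := by exact_mod_cast hη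
  have hD0 : 0 < D := by rw [hD]; positivity
  have hv'' : (v' : ℝ) ≤ v + η + 2 * Hv * Nat.clog 2 v := by exact_mod_cast hv'
  -- A crude bound on `v` suffices, as only its logarithm enters: it is at most `2 * ℓ`.
  have h1 : (v : ℝ) ≤ (n₀ : ℝ) ^ 2 := by
    refine hv.trans ?_
    rw [sq (n₀ : ℝ)]
    refine mul_le_mul_of_nonneg_left (le_trans ?_ hbig) hn0.le
    have : t * (D * ℓ ^ 2) ≤ cL * ℓ * (D * ℓ ^ 2) := mul_le_mul_of_nonneg_right ht (by positivity)
    nlinarith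
  have h3 : (Nat.clog 2 v : ℝ) ≤ 3 * ℓ := by
    refine (clog_le_logb_add_one hv1).trans ?_
    have h4 : Real.logb 2 v ≤ 2 * ℓ := by
      refine (Real.logb_le_logb_of_le (by norm_num) (by exact_mod_cast hv1) h1).trans ?_
      rw [Real.logb_pow, hℓ]
      norm_num
    linarith
  have h5 : (Hv : ℝ) ≤ n₀ * ((1 + 200 * cL) * ℓ) := by
    have : (n₀ : ℝ) * (200 * t) ≤ n₀ * (200 * (cL * ℓ)) := by gcongr
    nlinarith
  have h6 : (Hv : ℝ) * Nat.clog 2 v ≤ n₀ * ((1 + 200 * cL) * ℓ) * (3 * ℓ) :=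
    mul_le_mul h5 h3 (by positivity) (by positivity)
  have h7 : (n₀ : ℝ) ≤ n₀ * ℓ ^ 2 := le_mul_of_one_le_right hn0.le (one_le_pow₀ hℓ1)
  -- The coefficients of `n₀ * ℓ ^ 2` add up to `D`: 1 for the N-Steiner vertices and `2 * 3 * (1 +
  -- 200 * cL)` for the gadgets.
  calc (v' : ℝ) ≤ n₀ * (1 + t * D * ℓ ^ 2) + n₀ * ℓ ^ 2 +
        2 * (n₀ * ((1 + 200 * cL) * ℓ) * (3 * ℓ)) := by linarith
    _ = _ := by rw [hD]; ring

/-- The bounds for large graphs. -/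
theorem run_large [Fintype α] {H : α → α → WithTop ℝ} (hH : NoNegCycle H) {n₀ L : ℕ}
    {c cL b K D ℓ : ℝ} {B : ℕ → State α → PMF (Vtx α → ℝ)}
    (hn₀ : n₀ = (initState H).verts.card) (h8 : 8 ≤ n₀) (hℓ : ℓ = Real.logb 2 n₀)
    (hD : D = 7 + 1200 * cL) (hc : 0 < c) (hcL : 0 < cL) (hL : (L : ℝ) ≤ cL * ℓ) (hb : 0 < b)
    (hbn : b ≤ n₀) (hK : c + 3 ≤ K) (h2 : 2 * (cL * ℓ) ≤ n₀) (hbig : 1 + cL * D * ℓ ^ 3 ≤ n₀)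
    (hB : IsBetweennessReduction (L + 1) b (c + 1) B) :
    (run H (L + 1) b K B L).toOuterMeasure
      {G | ¬ ((∀ t < L, ((G (t + 1)).heavy.card : ℝ) ≤ (G t).heavy.card + 400 * Fintype.card α) ∧
        ∀ t ≤ L, 2 ≤ (G t).verts.card ∧
          ((G t).verts.card : ℝ) ≤ (1 + cL * D) * (n₀ * ℓ ^ 4))} ≤
      ENNReal.ofReal ((n₀ : ℝ) ^ (-c)) := by
  have hℓ1 : 1 ≤ ℓ := hℓ ▸ one_le_logb (by omega)
  have hn0 : (0 : ℝ) < n₀ := by exact_mod_cast (by omega : 0 < n₀)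
  have hD0 : 0 < D := by rw [hD]; positivity
  have hη : 2 * Fintype.card α = n₀ := by rw [hn₀, initState_card]
  -- The size of the graph never drops below `n₀`, so the failure probability of each iteration can
  -- be measured with `n₀`.
  let I : ℕ → State α → Prop := fun t s => Between t s ∧ n₀ ≤ s.verts.card ∧
    (s.heavy.card : ℝ) ≤ n₀ + 400 * Fintype.card α * t ∧
    (s.verts.card : ℝ) ≤ n₀ * (1 + t * D * ℓ ^ 2)
  have hrun := run_le (H := H) (h := L + 1) (b := b) (K := K) (B := B) I
    (fun s s' => (s'.heavy.card : ℝ) ≤ s.heavy.card + 400 * Fintype.card α)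
    (2 * ENNReal.ofReal ((n₀ : ℝ) ^ (-(c + 1)))) L ?_ ?_
  · refine le_trans (MeasureTheory.measure_mono ?_) (hrun.trans ?_)
    · intro G hG hcon
      refine hG ⟨hcon.2, fun t ht => ?_⟩
      obtain ⟨-, i2, -, i4⟩ := hcon.1 t ht
      refine ⟨by omega, i4.trans ?_⟩
      have h3 : (t : ℝ) ≤ cL * ℓ := le_trans (by exact_mod_cast ht) hL
      have h4 : (t : ℝ) * D * ℓ ^ 2 ≤ cL * D * ℓ ^ 4 := by
        calc (t : ℝ) * D * ℓ ^ 2 ≤ cL * ℓ * D * ℓ ^ 2 := by gcongr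
          _ = cL * D * ℓ ^ 3 := by ring
          _ ≤ cL * D * ℓ ^ 4 := by
            refine mul_le_mul_of_nonneg_left (pow_le_pow_right₀ hℓ1 (by norm_num)) (by positivity)
      have h5 : 1 ≤ ℓ ^ 4 := one_le_pow₀ hℓ1
      calc (n₀ : ℝ) * (1 + t * D * ℓ ^ 2) ≤ n₀ * (ℓ ^ 4 + cL * D * ℓ ^ 4) := by gcongr
        _ = _ := by ring
    · have e : (L : ENNReal) * (2 * ENNReal.ofReal ((n₀ : ℝ) ^ (-(c + 1)))) =
          ENNReal.ofReal (L * (2 * (n₀ : ℝ) ^ (-(c + 1)))) := by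
        rw [ENNReal.ofReal_mul (by positivity), ENNReal.ofReal_mul (by positivity),
          ENNReal.ofReal_natCast]
        norm_num
      rw [e]
      refine ENNReal.ofReal_le_ofReal ?_
      -- One power of `n₀` in the failure probability pays for the union over the iterations.
      calc (L : ℝ) * (2 * (n₀ : ℝ) ^ (-(c + 1))) = 2 * L * (n₀ : ℝ) ^ (-(c + 1)) := by ring
        _ ≤ n₀ * (n₀ : ℝ) ^ (-(c + 1)) := by
          refine mul_le_mul_of_nonneg_right (by linarith) (by positivity)
        _ = (n₀ : ℝ) ^ (-c) := by
          rw [← Real.rpow_one_add' hn0.le (by linarith)]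
          congr 1; ring
  · refine ⟨initState_between hH, hn₀.le, ?_, ?_⟩
    · have : (initState H).heavy.card ≤ n₀ := hn₀ ▸ le_rfl
      have : ((initState H).heavy.card : ℝ) ≤ n₀ := by exact_mod_cast this
      simpa using this
    · rw [← hn₀]; simp
  · rintro t ht s ⟨i1, i2, i3, i4⟩
    have hcard : (n₀ : ℝ) ≤ s.verts.card := by exact_mod_cast i2
    have h1 : (1 : ℝ) ≤ s.verts.card := by exact_mod_cast (by omega : 1 ≤ s.verts.card)
    refine le_trans (MeasureTheory.measure_mono ?_) ((shortcut_spec i1 (by omega) hb ?_ (by omega)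
      (by omega) hc hK hB).trans ?_)
    · intro s' hs' hcon
      obtain ⟨k1, k2, k3⟩ := hcon
      refine hs' ⟨⟨k1, i2.trans (Finset.card_le_card k2.1), ?_, ?_⟩, k3⟩
      · push_cast
        linarith
      · have := card_step (t := t) hℓ (by omega) hD hcL (Nat.cast_nonneg t)
          (le_trans (by exact_mod_cast ht.le) hL) hη hbig (by omega) i3 i4 k2.2.2
        push_cast
        exact this
    · nlinarith
    · refine mul_le_mul_right (ENNReal.ofReal_le_ofReal ?_) _
      exact Real.rpow_le_rpow_of_nonpos hn0 hcard (by linarith)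

/-- A bound for the number of vertices after `t` iterations on a graph with at most `N`
vertices. -/
def sizeBound (N : ℕ) : ℕ → ℕ
  | 0 => N
  | t + 1 => sizeBound N t + N + 2 * sizeBound N t * sizeBound N t

theorem sizeBound_mono (N : ℕ) : Monotone (sizeBound N) := by
  refine monotone_nat_of_le_succ fun t => ?_
  rw [sizeBound, add_assoc]
  exact le_self_add

/-- The bounds for small graphs. -/
theorem run_small [Fintype α] {H : α → α → WithTop ℝ} {n₀ N h L : ℕ}
    {b K : ℝ} {B : ℕ → State α → PMF (Vtx α → ℝ)}
    (hn₀ : n₀ = (initState H).verts.card) (hN : n₀ ≤ N) :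
    (run H h b K B L).toOuterMeasure
      {G | ¬ ∀ t ≤ L, n₀ ≤ (G t).verts.card ∧ (G t).heavy.card ≤ sizeBound N t ∧
        (G t).verts.card ≤ sizeBound N t} = 0 := by
  have hη : 2 * Fintype.card α = n₀ := by rw [hn₀, initState_card]
  let I : ℕ → State α → Prop := fun t s => n₀ ≤ s.verts.card ∧ s.heavy ⊆ s.verts ∧
    s.verts.card ≤ sizeBound N t
  have hrun := run_le (H := H) (h := h) (b := b) (K := K) (B := B) I (fun _ _ => True) 0 L
    ⟨hn₀.le, subset_rfl, hn₀ ▸ hN⟩ ?_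
  · rw [mul_zero] at hrun
    refine le_antisymm (le_trans (MeasureTheory.measure_mono ?_) hrun) zero_le
    intro G hG hcon
    refine hG fun t ht => ?_
    obtain ⟨i1, i2, i3⟩ := hcon.1 t ht
    exact ⟨i1, (Finset.card_le_card i2).trans i3, i3⟩
  · rintro t - s ⟨i1, i2, i3⟩
    refine le_trans (MeasureTheory.measure_mono ?_) (shortcut_grows i2).le
    intro s' hs' hcon
    obtain ⟨k1, k2, k3⟩ := hcon
    refine hs' ⟨⟨i1.trans (Finset.card_le_card k1), k2, k3.trans ?_⟩, trivial⟩
    have h1 : Nat.clog 2 s.verts.card ≤ s.verts.card :=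
      Nat.clog_le_of_le_pow Nat.lt_two_pow_self.le
    have h2 : s.heavy.card ≤ s.verts.card := Finset.card_le_card i2
    rw [sizeBound]
    have h3 : 2 * s.heavy.card * Nat.clog 2 s.verts.card ≤ 2 * sizeBound N t * sizeBound N t :=
      Nat.mul_le_mul (by omega) (by omega)
    omega

end

end NegSSSP

/-! ### The main theorem -/

theorem mainTheorem5 (c cL c₁ c₂ : ℝ) (hc : 0 < c) (hcL : 0 < cL) (hc₁ : 0 < c₁) (hc₂ : c₁ ≤ c₂) :
    ∃ K₀ C : ℝ, ∀ (α : Type*) [Fintype α] (H : α → α → WithTop ℝ), NegSSSP.NoNegCycle H →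
      ∀ (η n₀ : ℕ), η = Fintype.card α → n₀ = (NegSSSP.initState H).verts.card →
      ∀ (L : ℕ) (γ K : ℝ), (L : ℝ) ≤ cL * Real.logb 2 n₀ →
        c₁ * (Real.logb 2 n₀ * (2 : ℝ) ^ √(Real.logb 2 n₀)) ≤ γ →
        γ ≤ c₂ * (Real.logb 2 n₀ * (2 : ℝ) ^ √(Real.logb 2 n₀)) →
        K₀ ≤ K →
      ∀ B : ℕ → NegSSSP.State α → PMF (NegSSSP.Vtx α → ℝ),
        NegSSSP.IsBetweennessReduction (L + 1) (η / γ) (c + 1) B →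
        (NegSSSP.run H (L + 1) (η / γ) K B (NegSSSP.numIterations η L)).toOuterMeasure
          {G | ¬ ((∀ t < NegSSSP.numIterations η L,
                    ((G (t + 1)).heavy.card : ℝ) ≤
                      (G t).heavy.card + C * (η * Real.logb 2 (G t).verts.card)) ∧
                  ∀ t ≤ NegSSSP.numIterations η L,
                    ((G t).verts.card : ℝ) ≤ C * (n₀ * Real.logb 2 n₀ ^ 4))}
          ≤ ENNReal.ofReal ((n₀ : ℝ) ^ (-c)) := by
  set D : ℝ := 7 + 1200 * cL with hD
  have hD0 : 0 < D := by rw [hD]; positivity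
  obtain ⟨N, hN⟩ := NegSSSP.exists_large c₁ cL D hc₁ hcL hD0
  set F : ℕ := NegSSSP.sizeBound N ⌊cL * Real.logb 2 N⌋₊ with hF
  -- In `C`, the summand 400 covers the growth of the heavy vertices, `cL * D` together with a
  -- further 1 the number of vertices of large graphs, and `F` everything for graphs with fewer than
  -- `N` initial vertices.
  refine ⟨c + 3, 400 + cL * D + F, ?_⟩
  intro α _ H hH η n₀ hη hn₀ L γ K hL hγ _ hK B hB
  have hF0 : (0 : ℝ) ≤ F := Nat.cast_nonneg F
  have hn₀' : n₀ = 2 * η := by rw [hn₀, hη, NegSSSP.initState_card]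
  by_cases hsmall : η ≤ 100
  · rw [NegSSSP.numIterations, if_pos hsmall, NegSSSP.run, PMF.toOuterMeasure_pure_apply, if_neg]
    · exact zero_le
    · refine not_not.2 ⟨fun t ht => absurd ht (by omega), fun t _ => ?_⟩
      dsimp only
      rw [← hn₀]
      rcases Nat.eq_zero_or_pos η with h0 | h0
      · rw [hn₀', h0]; simp
      · have h1 := NegSSSP.one_le_logb (v := n₀) (by omega)
        have h2 : (n₀ : ℝ) ≤ n₀ * Real.logb 2 n₀ ^ 4 :=
          le_mul_of_one_le_right (Nat.cast_nonneg _) (one_le_pow₀ h1)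
        refine h2.trans (le_mul_of_one_le_left (by positivity) ?_)
        have : 0 < cL * D := by positivity
        linarith
  rw [NegSSSP.numIterations, if_neg hsmall]
  have hℓ := NegSSSP.one_le_logb (v := n₀) (by omega)
  have hη0 : (1 : ℝ) ≤ η := by exact_mod_cast (by omega : 1 ≤ η)
  have hn0 : (1 : ℝ) ≤ n₀ := by exact_mod_cast (by omega : 1 ≤ n₀)
  have hcD : 0 < cL * D := by positivity
  have hsz : (1 : ℝ) ≤ n₀ * Real.logb 2 n₀ ^ 4 :=
    one_le_mul_of_one_le_of_one_le hn0 (one_le_pow₀ hℓ)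
  -- The heavy vertices grow by a constant multiple of η only, so the logarithm in the claim is
  -- merely bounded below by 1.
  have hheavy : ∀ v : ℕ, 2 ≤ v → (η : ℝ) ≤ η * Real.logb 2 v := fun v hv =>
    le_mul_of_one_le_right (by linarith) (NegSSSP.one_le_logb hv)
  by_cases hlarge : N ≤ n₀
  · obtain ⟨g1, g2, g3⟩ := hN n₀ hlarge
    have hγ1 : 1 ≤ γ := by
      refine le_trans ?_ hγ
      rw [← mul_assoc]
      exact one_le_mul_of_one_le_of_one_le g1 (Real.one_le_rpow (by norm_num) (Real.sqrt_nonneg _))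
    have hb : 0 < (η : ℝ) / γ := by positivity
    have hbn : (η : ℝ) / γ ≤ n₀ := by
      refine (div_le_self (by positivity) hγ1).trans ?_
      exact_mod_cast (by omega : η ≤ n₀)
    refine le_trans (MeasureTheory.measure_mono ?_)
      (NegSSSP.run_large hH hn₀ (by omega) rfl hD hc hcL hL hb hbn hK g2 g3 hB)
    intro G hG hcon
    refine hG ⟨fun t ht => ?_, fun t ht => ?_⟩
    · have h1 := hheavy _ (hcon.2 t ht.le).1
      have h2 := hcon.1 t ht
      rw [← hη] at h2
      nlinarith
    · refine (hcon.2 t ht).2.trans (mul_le_mul_of_nonneg_right ?_ (by linarith))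
      linarith
  -- For small graphs the number of iterations is bounded by a constant, so sizes that hold with
  -- certainty are bounded by `F`.
  · have hLT : L ≤ ⌊cL * Real.logb 2 N⌋₊ := by
      refine Nat.le_floor (hL.trans (mul_le_mul_of_nonneg_left ?_ hcL.le))
      exact Real.logb_le_logb_of_le (by norm_num) (by linarith)
        (by exact_mod_cast (not_le.1 hlarge).le)
    refine le_trans (MeasureTheory.measure_mono ?_)
      ((NegSSSP.run_small (h := L + 1) (L := L) (b := η / γ) (K := K) (B := B) hn₀
        (not_le.1 hlarge).le).le.trans zero_le)
    intro G hG hcon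
    have hle : ∀ t ≤ L, (NegSSSP.sizeBound N t : ℝ) ≤ F := fun t ht => by
      exact_mod_cast NegSSSP.sizeBound_mono N (ht.trans hLT)
    refine hG ⟨fun t ht => ?_, fun t ht => ?_⟩
    · have h1 := hheavy (G t).verts.card (by have := (hcon t ht.le).1; omega)
      have h2 : ((G (t + 1)).heavy.card : ℝ) ≤ NegSSSP.sizeBound N (t + 1) := by
        exact_mod_cast (hcon (t + 1) ht).2.1
      have h3 := hle (t + 1) ht
      have h4 : (0 : ℝ) ≤ (G t).heavy.card := Nat.cast_nonneg _
      nlinarith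
    · have h2 : ((G t).verts.card : ℝ) ≤ NegSSSP.sizeBound N t := by
        exact_mod_cast (hcon t ht).2.2
      have h3 := hle t ht
      nlinarith
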